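/- Let $\sigma$ be the round metric on the unit sphere $S^2\subset\mathbb R^3$, $\nabla$ its covariant derivative, $\epsilon_{AB}$ its area form (outward orientation), and $\tilde X^1,\tilde X^2,\tilde X^3$ the restrictions to $S^2$ of the Cartesian coordinates. A function on $S^2$ is of modes $\ell\ge 2$ if it is $L^2$-orthogonal to $1,\tilde X^1,\tilde X^2,\tilde X^3$. A (vacuum) Bondi–Sachs coordinate system $(u,r,x)$, $u\in\mathbb R$, $x\in S^2$, $r$ large, is one in which the spacetime metric is $$-UV\,du^2-2U\,du\,dr+r^2h_{AB}(dx^A+W^Adu)(dx^B+W^Bdu),\qquad \det h=\det\sigma,\quad U>0,$$ satisfies the vacuum Einstein equation $\mathrm{Ric}=0$, and has coefficients that are smooth functions of $(u,1/r,x)$ up to $1/r=0$, with $U\to1$, $V=1-\frac{2m}{r}+O(r^{-2})$, $h_{AB}=\sigma_{AB}+\frac{C_{AB}}{r}+O(r^{-2})$ and $W^A=O(r^{-2})$, the coefficient of $r^{-3}$ in $W^A$ being written $\frac23N^A-\frac1{16}\nabla^A(C_{DE}C^{DE})-\frac12C_B{}^A\nabla^DC_D{}^B$. This defines the mass aspect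 $m(u,x)$, the shear $C_{AB}(u,x)$ and the angular momentum aspect $N_A(u,x)$. The news is $N_{AB}=\partial_uC_{AB}$. The closed potential $c(u,\cdot)$ of $C_{AB}(u,\cdot)$ is the smooth function of modes $\ell\ge2$ for which $$C_{AB}=\nabla_A\nabla_Bc-\tfrac12\sigma_{AB}\Delta c+\tfrac12(\epsilon_A{}^E\nabla_E\nabla_B\underline c+\epsilon_B{}^E\nabla_E\nabla_A\underline c)$$ with some smooth $\underline c$ of modes $\ell\ge2$. For a rotation Killing field $\hat Y$ of $S^2$, and $k=1,2,3$, put $$J(u,Y)=\int_{S^2}\hat Y^A\Big(N_A-\tfrac14C_{AB}\nabla_DC^{DB}-c\,\nabla_Am\Big)(u,\cdot),\qquad P^k(u)=\int_{S^2}2m(u,\cdot)\tilde X^k,$$ where $Y=\hat Y^A\partial_{x^A}$ is the rotation BMS field tangent to the $u$ cuts of null infinity. The total flux of a function $F(u)$ is $\delta F=\lim_{u\to+\infty}F(u)-\lim_{u\to-\infty}F(u)$. Let $(u,r,x)$ and $(\bar u,\bar r,\bar x)$ be two Bondi–Sachs coordinate systems of the same spacetime related by the supertranslation $f\in C^\infty(S^2)$,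 i.e. by a change of coordinates $(\bar u,1/\bar r,\bar x)\mapsto(u,1/r,x)$ that is smooth up to null infinity, where it is $u=\bar u+f(\bar x)$, $x=\bar x$. Assume that for some $\varepsilon>0$ the news $N_{AB}$ of the first system, together with $\partial_uN_{AB}$ and with its first and second derivatives along $S^2$, is $O(|u|^{-1-\varepsilon})$ as $u\to\pm\infty$, uniformly on $S^2$. Let $J(\bar u,\bar Y)$ be the angular momentum formed in the second system with the same $\hat Y$, that is, for $\bar Y=\hat Y^A\partial_{\bar x^A}$ (in the first system, $\bar Y=\hat Y^A\partial_{x^A}+\hat Y(f)\partial_u$). Write $f=\alpha_0+\sum_i\alpha_i\tilde X^i+f_{\ell\ge2}$ with $f_{\ell\ge2}$ of modes $\ell\ge2$. Then the total fluxes $\delta P^j$ ($j=1,2,3$), and $\delta J(Y)$ and $\delta J(\bar Y)$ for every rotation Killing field $\hat Y$, all exist, and for $\hat Y^A=\epsilon^{AB}\nabla_B\tilde X^k$, $k=1,2,3$, $$\delta J(\bar Y)=\delta J(Y)+\sum_{i,j}\alpha_i\,\varepsilon_{ikj}\,\delta P^j ,$$ where $\varepsilon_{ikj}$ is the Levi-Civita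 symbol with $\varepsilon_{123}=1$. Moreover, if $\alpha_1=\alpha_2=\alpha_3=0$ (in particular, if $f$ is of modes $\ell\ge2$), then $\delta J(\bar Y)=\delta J(Y)$ for every rotation Killing field $\hat Y$: the flux is invariant under every $\ell\ge2$ supertranslation. If $f_{\ell\ge2}=0$ (an ordinary translation), the displayed formula is the classical transformation law of angular momentum. -/

import Mathlib

open Filter Topology MeasureTheory
open scoped ContDiff

noncomputable section

namespace BondiSachs

/-! ### Calculus on the unit sphere of `ℝ³`

Functions and tensor fields on `S²` are written as functions on `ℝ³`, of which only the values at
unit vectors matter. A tensor on `S²` is given by its components in the ambient Cartesian frame,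
and is tangential: contracting any slot with the position vector gives `0`. Indices are raised and
lowered with the round metric, that is, with the ambient Euclidean inner product. -/

/-- Euclidean three-space; its unit sphere is `S²`. -/
abbrev E3 : Type := EuclideanSpace ℝ (Fin 3)

/-- Smoothness on `S²`: the degree-zero homogeneous extension is smooth away from the origin. -/
def SphereSmooth (φ : E3 → ℝ) : Prop :=
  ContDiffOn ℝ ∞ (fun y : E3 => φ (‖y‖⁻¹ • y)) {0}ᶜ

/-- The `i`-th Cartesian component of the derivative along `S²` (derivative of the degree-zero
homogeneous extension), at a unit vector `x`. -/
def tderiv (i : Fin 3) (φ : E3 → ℝ) (x : E3) : ℝ :=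
  fderiv ℝ (fun y : E3 => φ (‖y‖⁻¹ • y)) x (EuclideanSpace.single i 1)

/-- The round metric `σ` at the unit vector `x`, which is also the orthogonal projection onto the
tangent plane. -/
def roundMetric (x : E3) (i j : Fin 3) : ℝ :=
  (if i = j then 1 else 0) - x i * x j

/-- The Levi-Civita symbol of `ℝ³`, with `leviCivita 0 1 2 = 1`. -/
def leviCivita (i j k : Fin 3) : ℝ :=
  (((j : ℕ) : ℝ) - ((i : ℕ) : ℝ)) * (((k : ℕ) : ℝ) - ((i : ℕ) : ℝ)) *
    (((k : ℕ) : ℝ) - ((j : ℕ) : ℝ)) / 2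

/-- The area form `ε_{AB}` of `S²`, oriented by the outward normal `x`. -/
def areaForm (x : E3) (i j : Fin 3) : ℝ :=
  ∑ k, leviCivita k i j * x k

/-- The gradient `∇_A φ`. -/
def grad (φ : E3 → ℝ) (x : E3) (i : Fin 3) : ℝ := tderiv i φ x

/-- The covariant derivative `∇_A v_B` of a tangential one-form: tangential projection of the
derivative along the sphere. -/
def covDeriv₁ (v : E3 → Fin 3 → ℝ) (x : E3) (i j : Fin 3) : ℝ :=
  ∑ b, roundMetric x j b * tderiv i (fun z => v z b) x

/-- The covariant derivative `∇_D T_{AB}` of a tangential two-tensor; the first index is the one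
of differentiation. -/
def covDeriv₂ (T : E3 → Fin 3 → Fin 3 → ℝ) (x : E3) (k i j : Fin 3) : ℝ :=
  ∑ a, ∑ b, roundMetric x i a * roundMetric x j b * tderiv k (fun z => T z a b) x

/-- The Hessian `∇_A ∇_B φ`. -/
def hess (φ : E3 → ℝ) (x : E3) (i j : Fin 3) : ℝ := covDeriv₁ (grad φ) x i j

/-- The Laplacian `Δ φ` of the round metric. -/
def lap (φ : E3 → ℝ) (x : E3) : ℝ := ∑ i, hess φ x i i

/-- The divergence `∇^D T_{DB}`. -/
def divT (T : E3 → Fin 3 → Fin 3 → ℝ) (x : E3) (j : Fin 3) : ℝ := ∑ k, covDeriv₂ T x k k j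

/-- The integral over `S²` with respect to the area measure (of total mass `4π`). -/
def sphereIntegral (φ : E3 → ℝ) : ℝ :=
  ∫ x : Metric.sphere (0 : E3) 1, φ x ∂((volume : Measure E3).toSphere)

/-- `φ` is of harmonic modes `ℓ ≥ 2`: it is `L²`-orthogonal to the constants and to the three
coordinate functions. -/
def HighModes (φ : E3 → ℝ) : Prop :=
  sphereIntegral φ = 0 ∧ ∀ i : Fin 3, sphereIntegral (fun x => φ x * x i) = 0

/-- `c` is the closed potential of the symmetric trace-free tensor `T`:
`T_{AB} = ∇_A ∇_B c - ½ σ_{AB} Δ c + ½ (ε_A^E ∇_E ∇_B c' + ε_B^E ∇_E ∇_A c')`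
with smooth `c`, `c'` of harmonic modes `ℓ ≥ 2`. -/
def IsClosedPotential (T : E3 → Fin 3 → Fin 3 → ℝ) (c : E3 → ℝ) : Prop :=
  SphereSmooth c ∧ HighModes c ∧
    ∃ c' : E3 → ℝ, SphereSmooth c' ∧ HighModes c' ∧
      ∀ x : E3, ‖x‖ = 1 → ∀ i j : Fin 3,
        T x i j = hess c x i j - 1 / 2 * roundMetric x i j * lap c x
          + 1 / 2 * (∑ e, areaForm x i e * hess c' x e j + ∑ e, areaForm x j e * hess c' x e i)

/-- A rotation Killing field of `S²`: a smooth tangential field with `∇_A Y_B + ∇_B Y_A = 0`. -/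
def IsRotationKilling (Y : E3 → Fin 3 → ℝ) : Prop :=
  (∀ i, SphereSmooth (fun x => Y x i)) ∧
    ∀ x : E3, ‖x‖ = 1 → (∑ i, x i * Y x i = 0) ∧
      ∀ i j : Fin 3, covDeriv₁ Y x i j + covDeriv₁ Y x j i = 0

/-- The field `Y^A = ε^{AB} ∇_B X^k`, with `X^k` the `k`-th coordinate function on `S²`. -/
def rotationField (k : Fin 3) (x : E3) (i : Fin 3) : ℝ :=
  ∑ b, areaForm x i b * grad (fun z => z k) x b

/-! ### Coordinate Ricci curvature in dimension four -/

/-- Coordinate points of the four-dimensional spacetime. -/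
abbrev Pt : Type := Fin 4 → ℝ

/-- The partial derivative `∂_μ F`. -/
def pd (μ : Fin 4) (F : Pt → ℝ) (p : Pt) : ℝ := fderiv ℝ F p (Pi.single μ 1)

/-- The Christoffel symbol `Γ^l_{μν}` of the metric `g`. -/
def christoffel (g : Pt → Matrix (Fin 4) (Fin 4) ℝ) (l μ ν : Fin 4) (p : Pt) : ℝ :=
  1 / 2 * ∑ s, (g p)⁻¹ l s *
    (pd μ (fun q => g q s ν) p + pd ν (fun q => g q s μ) p - pd s (fun q => g q μ ν) p)

/-- The Ricci tensor `R_{μν}` of the metric `g`. -/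
def ricci (g : Pt → Matrix (Fin 4) (Fin 4) ℝ) (μ ν : Fin 4) (p : Pt) : ℝ :=
  ∑ l, (pd l (christoffel g l μ ν) p - pd ν (christoffel g l μ l) p)
    + ∑ l, ∑ s, (christoffel g l l s p * christoffel g s μ ν p
        - christoffel g l ν s p * christoffel g s μ l p)

/-! ### Bondi–Sachs coordinates

A point with Bondi–Sachs coordinates `(u, r, x)`, `x ∈ S²`, is recorded either as the triple
`(u, ρ, x)` with `ρ = 1/r`, so that future null infinity is `ρ = 0`, or by the four numbers
`(u, y)` with `y = r x ∈ ℝ³`. -/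

/-- The triples `(u, ρ, x)`. -/
abbrev Triple : Type := ℝ × ℝ × E3

/-- The triple `(u, 1/r, x)` of the point `(u, y)`, where `r = |y|` and `x = y/r`. -/
def toTriple (p : Pt) : Triple :=
  let y : E3 := WithLp.toLp 2 fun i => p i.succ
  (p 0, ‖y‖⁻¹, ‖y‖⁻¹ • y)

/-- The point `(u, y)`, `y = r x`, of the triple `(u, 1/r, x)`. -/
def ofTriple (q : Triple) : Pt := Fin.cons q.1 fun i => q.2.1⁻¹ * q.2.2 i

/-- Triples that represent points of the spacetime: `r` is finite and positive, and `x ∈ S²`. -/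
def IsFinite (q : Triple) : Prop := 0 < q.2.1 ∧ ‖q.2.2‖ = 1

/-- The coordinate one-form `du` in the coordinates `(u, y)`. -/
def duForm : Fin 4 → ℝ := Fin.cons 1 fun _ => 0

/-- The one-form `dr = x · dy` at the triple `q`. -/
def drForm (q : Triple) : Fin 4 → ℝ := Fin.cons 0 fun i => q.2.2 i

/-- The one-forms `dx^a = r⁻¹ (δ^a_i - x^a x_i) dy^i`, the Cartesian components of the
differential of `x = y/r`. -/
def dxForm (q : Triple) (a : Fin 3) : Fin 4 → ℝ :=
  Fin.cons 0 fun i => q.2.1 * roundMetric q.2.2 a i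

/-- The metric `-U V du² - 2 U du dr + r² h_{AB} (dx^A + W^A du)(dx^B + W^B du)` in the coordinates
`(u, y)`. -/
def bondiMetric (U V : Triple → ℝ) (W : Triple → Fin 3 → ℝ) (h : Triple → Fin 3 → Fin 3 → ℝ)
    (p : Pt) : Matrix (Fin 4) (Fin 4) ℝ :=
  let q := toTriple p
  fun μ ν =>
    -(U q * V q) * duForm μ * duForm ν - U q * (duForm μ * drForm q ν + drForm q μ * duForm ν)
      + (q.2.1⁻¹) ^ 2 * ∑ a, ∑ b, h q a b *
          (dxForm q a μ + W q a * duForm μ) * (dxForm q b ν + W q b * duForm ν)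

/-- A Bondi–Sachs coordinate system of a vacuum spacetime near its future null infinity
`ℝ × S²`. -/
structure Coords where
  /-- A neighbourhood of null infinity in the space of triples `(u, 1/r, x)`. -/
  dom : Set Triple
  isOpen_dom : IsOpen dom
  scri_mem : ∀ (u : ℝ) (x : E3), ‖x‖ = 1 → (u, 0, x) ∈ dom
  /-- The metric coefficients, as functions of `(u, 1/r, x)`. -/
  U : Triple → ℝ
  V : Triple → ℝ
  W : Triple → Fin 3 → ℝ
  h : Triple → Fin 3 → Fin 3 → ℝ
  /-- Smoothness up to null infinity: the coefficients have expansions in inverse powers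
  of `r`. -/
  smooth_U : ContDiffOn ℝ ∞ U dom
  smooth_V : ContDiffOn ℝ ∞ V dom
  smooth_W : ∀ i, ContDiffOn ℝ ∞ (fun q => W q i) dom
  smooth_h : ∀ i j, ContDiffOn ℝ ∞ (fun q => h q i j) dom
  /-- `W` is a tangent vector of `S²`. -/
  W_tangential : ∀ q ∈ dom, IsFinite q → ∑ i, q.2.2 i * W q i = 0
  /-- `h` is a Riemannian metric on the tangent plane of `S²`; adding `x ⊗ x` turns it into a
  positive definite form on `ℝ³`. -/
  h_tangential : ∀ q ∈ dom, IsFinite q → ∀ i, ∑ j, h q i j * q.2.2 j = 0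
  h_posDef : ∀ q ∈ dom, IsFinite q →
    (Matrix.of fun i j => h q i j + q.2.2 i * q.2.2 j).PosDef
  /-- `r` is the area radius: `det h_{AB} = det σ_{AB}`. -/
  h_det : ∀ q ∈ dom, IsFinite q →
    (Matrix.of fun i j => h q i j + q.2.2 i * q.2.2 j).det = 1
  U_pos : ∀ q ∈ dom, IsFinite q → 0 < U q
  /-- Asymptotic flatness: `U → 1`, `V → 1`, `h → σ` and `W = O(r⁻²)` as `r → ∞`. -/
  U_scri : ∀ (u : ℝ) (x : E3), ‖x‖ = 1 → U (u, 0, x) = 1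
  V_scri : ∀ (u : ℝ) (x : E3), ‖x‖ = 1 → V (u, 0, x) = 1
  h_scri : ∀ (u : ℝ) (x : E3), ‖x‖ = 1 → ∀ i j, h (u, 0, x) i j = roundMetric x i j
  W_scri : ∀ (u : ℝ) (x : E3), ‖x‖ = 1 → ∀ i, W (u, 0, x) i = 0
  W_scri' : ∀ (u : ℝ) (x : E3), ‖x‖ = 1 → ∀ i, deriv (fun ρ => W (u, ρ, x) i) 0 = 0
  /-- The vacuum Einstein equation. -/
  vacuum : ∀ q ∈ dom, IsFinite q →
    ∀ μ ν, ricci (bondiMetric U V W h) μ ν (ofTriple q) = 0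

namespace Coords

variable (B : Coords)

/-- The spacetime metric in the coordinates `(u, y)`. -/
def metric : Pt → Matrix (Fin 4) (Fin 4) ℝ := bondiMetric B.U B.V B.W B.h

/-- The mass aspect `m`: `V = 1 - 2 m / r + O(r⁻²)`. -/
def mass (u : ℝ) (x : E3) : ℝ := -(1 / 2) * deriv (fun ρ => B.V (u, ρ, x)) 0

/-- The shear `C_{AB}`: `h_{AB} = σ_{AB} + C_{AB} / r + O(r⁻²)`. -/
def shear (u : ℝ) (x : E3) (i j : Fin 3) : ℝ := deriv (fun ρ => B.h (u, ρ, x) i j) 0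

/-- The news `N_{AB} = ∂_u C_{AB}`. -/
def news (u : ℝ) (x : E3) (i j : Fin 3) : ℝ := deriv (fun s => B.shear s x i j) u

/-- The angular momentum aspect `N_A`, defined by the coefficient of `r⁻³` in `W^A`, which is
`⅔ N^A - (1/16) ∇^A (C_{DE} C^{DE}) - ½ C_B^A ∇^D C_D^B`. -/
def angularAspect (u : ℝ) (x : E3) (i : Fin 3) : ℝ :=
  3 / 2 * (1 / 6 * iteratedDeriv 3 (fun ρ => B.W (u, ρ, x) i) 0
    + 1 / 16 * grad (fun z => ∑ d, ∑ e, B.shear u z d e * B.shear u z d e) x i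
    + 1 / 2 * ∑ b, B.shear u x i b * divT (B.shear u) x b)

/-- The Bondi–Sachs linear momentum `P^k(u) = ∫ 2 m X^k`. -/
def momentum (k : Fin 3) (u : ℝ) : ℝ := sphereIntegral fun x => 2 * B.mass u x * x k

/-- The angular momentum `J(u, Y) = ∫ Y^A (N_A - ¼ C_{AB} ∇_D C^{DB} - c ∇_A m)` of the cut `u`,
for the rotation BMS field that is tangent to the cuts of constant `u` and has angular part `Y`;
here `c` is the closed potential of the shear. -/
def angularMomentum (c : ℝ → E3 → ℝ) (Y : E3 → Fin 3 → ℝ) (u : ℝ) : ℝ :=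
  sphereIntegral fun x => ∑ i, Y x i *
    (B.angularAspect u x i - 1 / 4 * ∑ b, B.shear u x i b * divT (B.shear u) x b
      - c u x * grad (B.mass u) x i)

/-- Decay of the news: `N_{AB}`, its `u`-derivative, and its first and second derivatives along
`S²` are `O(|u|^{-1-ε})` as `u → ±∞`, uniformly on `S²`, for some `ε > 0`. -/
def NewsDecay : Prop :=
  ∃ ε : ℝ, 0 < ε ∧ ∃ K R : ℝ, ∀ u : ℝ, R ≤ |u| → ∀ x : E3, ‖x‖ = 1 → ∀ i j : Fin 3,
    |B.news u x i j| ≤ K * |u| ^ (-1 - ε) ∧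
    |deriv (fun s => B.news s x i j) u| ≤ K * |u| ^ (-1 - ε) ∧
    (∀ k, |tderiv k (fun z => B.news u z i j) x| ≤ K * |u| ^ (-1 - ε)) ∧
    ∀ k l, |tderiv k (tderiv l fun z => B.news u z i j) x| ≤ K * |u| ^ (-1 - ε)

end Coords

/-- The systems `B` with coordinates `(u, r, x)` and `B'` with coordinates `(ū, r̄, x̄)`, of the same
spacetime, are related by the supertranslation `f`: near null infinity there is a change of
coordinates `(ū, 1/r̄, x̄) ↦ (u, 1/r, x)`, smooth up to null infinity, where it is `u = ū + f(x̄)`,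
`x = x̄`, that carries one expression of the spacetime metric into the other. -/
def SupertranslationRelated (B B' : Coords) (f : E3 → ℝ) : Prop :=
  ∃ (D : Set Triple) (Ψ : Triple → Triple),
    IsOpen D ∧ (∀ (u : ℝ) (x : E3), ‖x‖ = 1 → (u, 0, x) ∈ D) ∧
    ContDiffOn ℝ ∞ Ψ D ∧
    (∀ (u : ℝ) (x : E3), ‖x‖ = 1 → Ψ (u, 0, x) = (u + f x, 0, x)) ∧
    ∀ q ∈ D, IsFinite q → q ∈ B'.dom ∧ Ψ q ∈ B.dom ∧ IsFinite (Ψ q) ∧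
      ∀ μ ν : Fin 4, B'.metric (ofTriple q) μ ν =
        ∑ a, ∑ b, pd μ (fun p => ofTriple (Ψ (toTriple p)) a) (ofTriple q) *
          pd ν (fun p => ofTriple (Ψ (toTriple p)) b) (ofTriple q) *
          B.metric (ofTriple (Ψ q)) a b

/-- The total flux of `F` exists and equals `d`: both limits exist and
`d = lim_{u → +∞} F(u) - lim_{u → -∞} F(u)`. -/
def HasTotalFlux (F : ℝ → ℝ) (d : ℝ) : Prop :=
  ∃ a b : ℝ, Tendsto F atBot (𝓝 a) ∧ Tendsto F atTop (𝓝 b) ∧ d = b - a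

end BondiSachs

end

/-! Let Y be the rotation x ↦ A x with A antisymmetric, N the news, and K(u) the integral of Y^A
(N_A − ¼ C_AB ∇_D C^DB). As Y is divergence-free, J = K + ∫ m Y(c). The Einstein equation gives two
laws on null infinity: K' = −¼ ∫ N · L_Y C (`Fields.Exp.hasDerivAt_charge`), and ∂_u m = −⅛ |N|² + ¼
∇∇N (`Fields.Exp.mass_evolution` combined with `W2_eq`). The change of coordinates gives C'(u) = C(u
+ f) − 2 ∇∇f + σ Δf (`ScriMap.Expansion.shear_eq`), and m'(u) = m(u + f) plus terms that contain a
derivative of C in u (`mass_eq`).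

Hence L_Y C' is L_Y C at the shifted time, plus Y(f) N, minus twice the trace-free Hessian of Y(f).
Shifting each generator of null infinity by f does not change an integral over ℝ × S², so the flux
of K changes by −¼ ∫∫ (Y(f) |N|² − 2 N · ∇∇Y(f)). By the mass loss law tested with Y(f)
(`ScriData.sphereIntegral_news`), this is 2 ∫ Y(f) δm (`ScriData.integral_chargeFlux`). On the other
hand m' − m tends to 0 and Y(c') − Y(c) tends to −2 Y(f₂), so the flux of ∫ m Y(c) changes by −2 ∫
Y(f₂) δm. The modes ℓ ≥ 2 cancel. What remains comes from f − f₂ = α₀ + ∑ α_i x_i; since Y(x_i) = ∑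
A_ij x_j, it is ∑ α_i A_ij δP_j (`ScriData.angularMomentum_flux`).

The asymptotic analysis is made algebraic. Functions smooth at null infinity, modulo equality at
finite radius, form a commutative ring `ScriRing` with commuting-up-to-curvature derivations ∂_u,
∂_ρ and the Cartesian tangential derivatives. In it ρ = 1/r is not a zero divisor, and an element
that vanishes at ρ = 0 is divisible by ρ (`exists_eq_rho_mul`). An expansion in 1/r is thus a
divisibility statement, and the Ricci tensor in the coordinates y = r x is a polynomial expression
whose coefficients are compared by cancelling powers of ρ. The rr equation gives the second
coefficient of U, the rA equation the leading shift, the uu equation the evolution of m, and the uA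
equation, contracted with a rotation, that of the angular momentum aspect.

For the change of coordinates, ρ² times the metric is regular at null infinity, and its pull-back
must again have Bondi–Sachs form (`ScriMap.Pulls`). The vanishing of its ρρ and ρA components, and
the normalization of its angular part, determine the coordinate change to the order that the shear
and the mass need.

The potential c is given separately at each u, so nothing is known about its dependence on u. This
is overcome by the estimate |c| ≤ 36 sup |C| (`IsClosedPotential.abs_le`), which comes from an
explicit approximate identity on the sphere. Since L_Y C has potential Y(c), the estimate applied to
differences of shears transfers their decay and convergence to Y(c). -/

noncomputable section

namespace BondiSachs

/-! ### Points of finite radius near null infinity -/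

/-- `P` holds at the points of finite radius close to null infinity. -/
def NearFin (P : Triple → Prop) : Prop :=
  ∀ (u : ℝ) (x : E3), ‖x‖ = 1 → ∀ᶠ q in 𝓝 ((u, 0, x) : Triple), IsFinite q → P q

theorem NearFin.mono {P Q : Triple → Prop} (h : NearFin P) (hPQ : ∀ q, IsFinite q → P q → Q q) :
    NearFin Q := fun u x hx => (h u x hx).mono fun q hq hf => hPQ q hf (hq hf)

theorem NearFin.and {P Q : Triple → Prop} (h : NearFin P) (h' : NearFin Q) :
    NearFin fun q => P q ∧ Q q := fun u x hx => by
  filter_upwards [h u x hx, h' u x hx] with q hq hq' hf using ⟨hq hf, hq' hf⟩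

/-- Needed to compare derivatives: a relation that holds near null infinity also holds on a
neighbourhood of each nearby point of finite radius. -/
theorem NearFin.eventually {P : Triple → Prop} (h : NearFin P) :
    NearFin fun q => ∀ᶠ q' in 𝓝 q, IsFinite q' → P q' := fun u x hx =>
  (eventually_eventually_nhds.2 (h u x hx)).mono fun _ hq _ => hq

theorem NearFin.of_scri {P : Triple → Prop}
    (h : ∀ (u : ℝ) (x : E3), ‖x‖ = 1 → ∀ᶠ q in 𝓝 ((u, 0, x) : Triple), P q) : NearFin P :=
  fun u x hx => (h u x hx).mono fun _ hq _ => hq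

theorem nearFin_all {ι : Type*} [Finite ι] {P : ι → Triple → Prop} (h : ∀ i, NearFin (P i)) :
    NearFin fun q => ∀ i, P i q := fun u x hx => by
  filter_upwards [eventually_all.2 fun i => h i u x hx] with q hq hf i using hq i hf

theorem NearFin.tendsto {P : Triple → Prop} (h : NearFin P) (u : ℝ) (x : E3) (hx : ‖x‖ = 1) :
    ∀ᶠ ρ in 𝓝[>] (0 : ℝ), P (u, ρ, x) := by
  have hc : Tendsto (fun ρ : ℝ => ((u, ρ, x) : Triple)) (𝓝[>] 0) (𝓝 (u, 0, x)) := by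
    have : ContinuousAt (fun ρ : ℝ => ((u, ρ, x) : Triple)) 0 := by fun_prop
    exact this.tendsto.mono_left nhdsWithin_le_nhds
  filter_upwards [hc.eventually (h u x hx), self_mem_nhdsWithin] with ρ hρ hpos
  exact hρ ⟨hpos, hx⟩

/-! ### Normalization -/

theorem hasFDerivAt_norm_inv {y : E3} (hy : y ≠ 0) :
    HasFDerivAt (fun z : E3 => ‖z‖⁻¹)
      (-(‖y‖⁻¹ ^ 2) • innerSL ℝ (‖y‖⁻¹ • y)) y := by
  have hn : ‖y‖ ≠ 0 := norm_ne_zero_iff.2 hy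
  have h1 : HasFDerivAt (fun z : E3 => ‖z‖) (innerSL ℝ (‖y‖⁻¹ • y)) y := by
    have h := (hasStrictFDerivAt_norm_sq y).hasFDerivAt.sqrt (pow_ne_zero 2 hn)
    have e : (fun z : E3 => Real.sqrt (‖z‖ ^ 2)) = fun z => ‖z‖ := by
      funext z; exact Real.sqrt_sq (norm_nonneg z)
    rw [e] at h
    refine h.congr_fderiv ?_
    ext v
    simp only [Real.sqrt_sq (norm_nonneg y), smul_apply, nsmul_eq_mul, innerSL_apply_apply,
      inner_smul_left, smul_eq_mul, map_inv₀, conj_trivial, Nat.cast_ofNat]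
    field_simp
  refine ((hasDerivAt_inv hn).comp_hasFDerivAt y h1).congr_fderiv ?_
  rw [inv_pow]

theorem hasFDerivAt_normalize {y : E3} (hy : y ≠ 0) :
    HasFDerivAt (fun z : E3 => ‖z‖⁻¹ • z)
      (‖y‖⁻¹ • (ContinuousLinearMap.id ℝ E3
        - (innerSL ℝ (‖y‖⁻¹ • y)).smulRight (‖y‖⁻¹ • y))) y := by
  have h := (hasFDerivAt_norm_inv hy).smul (hasFDerivAt_id y)
  refine h.congr_fderiv ?_
  ext v i
  simp
  ring

theorem normalize_of_unit {x : E3} (hx : ‖x‖ = 1) : ‖x‖⁻¹ • x = x := by simp [hx]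

theorem norm_normalize {y : E3} (hy : y ≠ 0) : ‖‖y‖⁻¹ • y‖ = 1 := by
  rw [norm_smul, norm_inv, norm_norm, inv_mul_cancel₀ (norm_ne_zero_iff.2 hy)]

theorem ne_zero_of_unit {x : E3} (hx : ‖x‖ = 1) : x ≠ 0 := by
  rintro rfl; simp at hx

theorem contDiffAt_normalize {y : E3} (hy : y ≠ 0) :
    ContDiffAt ℝ ∞ (fun z : E3 => ‖z‖⁻¹ • z) y :=
  ((contDiffAt_norm ℝ hy).inv (norm_ne_zero_iff.2 hy)).smul contDiffAt_id

/-! ### Functions that are smooth at null infinity, modulo equality at finite radius -/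

/-- Functions of `(u, ρ, x)` that are smooth at the points of null infinity. -/
def scriSmooth : Subalgebra ℝ (Triple → ℝ) where
  carrier := {F | ∀ (u : ℝ) (x : E3), ‖x‖ = 1 → ContDiffAt ℝ ∞ F (u, 0, x)}
  mul_mem' := fun hF hG u x hx => (hF u x hx).mul (hG u x hx)
  add_mem' := fun hF hG u x hx => (hF u x hx).add (hG u x hx)
  algebraMap_mem' := fun r u x _ => by
    change ContDiffAt ℝ ∞ (fun _ : Triple => r) _
    exact contDiffAt_const

theorem const_mem (c : ℝ) : (fun _ : Triple => c) ∈ scriSmooth := scriSmooth.algebraMap_mem c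

theorem add_mem' {F G : Triple → ℝ} (hF : F ∈ scriSmooth) (hG : G ∈ scriSmooth) :
    (fun q => F q + G q) ∈ scriSmooth := scriSmooth.add_mem hF hG

theorem mul_mem' {F G : Triple → ℝ} (hF : F ∈ scriSmooth) (hG : G ∈ scriSmooth) :
    (fun q => F q * G q) ∈ scriSmooth := scriSmooth.mul_mem hF hG

/-- The ideal of functions that vanish at the points of finite radius. -/
def finIdeal : Ideal scriSmooth where
  carrier := {F | NearFin fun q => F.1 q = 0}
  add_mem' := fun {F G} hF hG => (hF.and hG).mono fun q _ h => by
    change F.1 q + G.1 q = 0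
    rw [h.1, h.2, add_zero]
  zero_mem' := fun u x hx => Eventually.of_forall fun q _ => rfl
  smul_mem' := fun F {G} hG => hG.mono fun q _ h => by
    change F.1 q * G.1 q = 0
    rw [h, mul_zero]

/-- The ring of smooth functions near null infinity. -/
def ScriRing : Type := scriSmooth ⧸ finIdeal

instance : CommRing ScriRing := inferInstanceAs (CommRing (scriSmooth ⧸ finIdeal))

instance : Algebra ℝ ScriRing := inferInstanceAs (Algebra ℝ (scriSmooth ⧸ finIdeal))

/-- The class of a function. -/
def toRing (F : Triple → ℝ) (hF : F ∈ scriSmooth) : ScriRing :=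
  Ideal.Quotient.mk finIdeal ⟨F, hF⟩

theorem toRing_surjective (a : ScriRing) : ∃ F hF, toRing F hF = a := by
  obtain ⟨F, hF⟩ := Ideal.Quotient.mk_surjective (I := finIdeal) a
  exact ⟨F.1, F.2, hF⟩

theorem toRing_eq_iff {F G : Triple → ℝ} {hF : F ∈ scriSmooth} {hG : G ∈ scriSmooth} :
    toRing F hF = toRing G hG ↔ NearFin fun q => F q = G q := by
  refine (Ideal.Quotient.eq (I := finIdeal) (x := ⟨F, hF⟩) (y := ⟨G, hG⟩)).trans ?_
  constructor
  · intro h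
    exact NearFin.mono h fun q _ hq => sub_eq_zero.1 hq
  · intro h
    exact NearFin.mono h fun q _ hq => sub_eq_zero.2 hq

theorem toRing_add {F G : Triple → ℝ} (hF : F ∈ scriSmooth) (hG : G ∈ scriSmooth) :
    toRing F hF + toRing G hG = toRing (fun q => F q + G q) (add_mem' hF hG) := rfl

theorem toRing_mul {F G : Triple → ℝ} (hF : F ∈ scriSmooth) (hG : G ∈ scriSmooth) :
    toRing F hF * toRing G hG = toRing (fun q => F q * G q) (mul_mem' hF hG) := rfl

theorem toRing_smul {F : Triple → ℝ} (c : ℝ) (hF : F ∈ scriSmooth) :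
    c • toRing F hF = toRing (fun q => c * F q) (mul_mem' (const_mem c) hF) := rfl

theorem toRing_one : (1 : ScriRing) = toRing (fun _ => 1) (const_mem 1) := rfl

theorem algebraMap_eq (c : ℝ) : algebraMap ℝ ScriRing c =
    toRing (fun _ => c) (const_mem c) := rfl

theorem nearFin_differentiableAt {F : Triple → ℝ} (hF : F ∈ scriSmooth) :
    NearFin fun q => DifferentiableAt ℝ F q := NearFin.of_scri fun u x hx => by
  have h : ContDiffAt ℝ 1 F (u, 0, x) := (hF u x hx).of_le (by simp)
  filter_upwards [h.eventually (by simp)] with q hq using hq.differentiableAt (by simp)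

/-! ### Tangential derivatives -/

/-- The component of the direction `e` tangent to `ℝ × ℝ × S²`. -/
def tang (e q : Triple) : Triple := (e.1, e.2.1, e.2.2 - inner ℝ q.2.2 e.2.2 • q.2.2)

/-- The derivative in the direction of the tangential component of `e`. -/
def tanD (e : Triple) (F : Triple → ℝ) (q : Triple) : ℝ := fderiv ℝ F q (tang e q)

theorem contDiff_tang (e : Triple) : ContDiff ℝ ∞ (tang e) := by
  unfold tang
  have h : ContDiff ℝ ∞ fun q : Triple => (inner ℝ q.2.2 e.2.2 : ℝ) :=
    ContDiff.inner ℝ (by fun_prop) contDiff_const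
  fun_prop

theorem tanD_mem (e : Triple) {F : Triple → ℝ} (hF : F ∈ scriSmooth) : tanD e F ∈ scriSmooth :=
  fun u x hx => ((hF u x hx).fderiv_right (by simp)).clm_apply (contDiff_tang e).contDiffAt

/-- The projection to unit vectors in the last slot. -/
def unitize (q : Triple) : Triple := (q.1, q.2.1, ‖q.2.2‖⁻¹ • q.2.2)

theorem unitize_of_unit {q : Triple} (hq : ‖q.2.2‖ = 1) : unitize q = q := by
  obtain ⟨u, ρ, x⟩ := q
  simp only at hq
  simp [unitize, hq]

theorem hasFDerivAt_unitize {q : Triple} (hq : ‖q.2.2‖ = 1) :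
    ∃ L : Triple →L[ℝ] Triple, HasFDerivAt unitize L q ∧ ∀ e, L e = tang e q := by
  have hs : HasFDerivAt (fun q : Triple => q.2.2) ((ContinuousLinearMap.snd ℝ ℝ E3).comp
      (ContinuousLinearMap.snd ℝ ℝ (ℝ × E3))) q :=
    ((ContinuousLinearMap.snd ℝ ℝ E3).comp (ContinuousLinearMap.snd ℝ ℝ (ℝ × E3))).hasFDerivAt
  have hr : HasFDerivAt (fun q : Triple => q.2.1) ((ContinuousLinearMap.fst ℝ ℝ E3).comp
      (ContinuousLinearMap.snd ℝ ℝ (ℝ × E3))) q :=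
    ((ContinuousLinearMap.fst ℝ ℝ E3).comp (ContinuousLinearMap.snd ℝ ℝ (ℝ × E3))).hasFDerivAt
  have h := (hasFDerivAt_normalize (ne_zero_of_unit hq)).comp q hs
  have hf : HasFDerivAt (fun q : Triple => q.1) (ContinuousLinearMap.fst ℝ ℝ (ℝ × E3)) q :=
    (ContinuousLinearMap.fst ℝ ℝ (ℝ × E3)).hasFDerivAt
  refine ⟨_, hf.prodMk (hr.prodMk h), fun e => ?_⟩
  simp [tang, hq]

/-- The tangential derivative at a finite point is the derivative of `F ∘ unitize`, which near that
point sees only points of finite radius. Hence tangential derivatives descend to the quotient ring;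
the full derivative would not. -/
theorem tanD_eq_zero_of_eventually {F : Triple → ℝ} {q : Triple} (e : Triple) (hq : IsFinite q)
    (hd : DifferentiableAt ℝ F q) (h : ∀ᶠ q' in 𝓝 q, IsFinite q' → F q' = 0) :
    tanD e F q = 0 := by
  obtain ⟨L, hL, hLe⟩ := hasFDerivAt_unitize hq.2
  have hu := unitize_of_unit hq.2
  have hd' : HasFDerivAt F (fderiv ℝ F q) (unitize q) := by rw [hu]; exact hd.hasFDerivAt
  have hc := hd'.comp q hL
  have hz : F ∘ unitize =ᶠ[𝓝 q] fun _ => 0 := by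
    have ht : Tendsto unitize (𝓝 q) (𝓝 q) := by
      have := hL.continuousAt.tendsto
      rwa [hu] at this
    have hpos : ∀ᶠ q' : Triple in 𝓝 q, 0 < q'.2.1 :=
      (continuous_fst.comp continuous_snd).continuousAt.eventually (lt_mem_nhds hq.1)
    have hne : ∀ᶠ q' : Triple in 𝓝 q, q'.2.2 ≠ 0 :=
      (continuous_snd.comp continuous_snd).continuousAt.eventually_ne (ne_zero_of_unit hq.2)
    filter_upwards [ht.eventually h, hpos, hne] with q' h1 h2 h3
    exact h1 ⟨h2, norm_normalize h3⟩
  have h0 := (hc.congr_of_eventuallyEq hz.symm).unique (hasFDerivAt_const (0 : ℝ) q)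
  have := congrArg (fun T => T e) h0
  simpa [hLe, tanD, hu] using this

theorem nearFin_tanD_congr {F G : Triple → ℝ} (e : Triple) (hF : F ∈ scriSmooth)
    (hG : G ∈ scriSmooth) (h : NearFin fun q => F q = G q) :
    NearFin fun q => tanD e F q = tanD e G q := by
  have h1 := ((nearFin_differentiableAt hF).and (nearFin_differentiableAt hG)).and h.eventually
  refine h1.mono fun q hq hh => ?_
  have := tanD_eq_zero_of_eventually (F := fun q => F q - G q) e hq (hh.1.1.sub hh.1.2)
    (hh.2.mono fun q' h' hf => sub_eq_zero.2 (h' hf))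
  unfold tanD at this ⊢
  rw [fderiv_fun_sub hh.1.1 hh.1.2] at this
  exact sub_eq_zero.1 (by simpa using this)

/-- The representative of a ring element. -/
def rep (a : ScriRing) : Triple → ℝ := (toRing_surjective a).choose

theorem rep_mem (a : ScriRing) : rep a ∈ scriSmooth := (toRing_surjective a).choose_spec.choose

theorem toRing_rep (a : ScriRing) : toRing (rep a) (rep_mem a) = a :=
  (toRing_surjective a).choose_spec.choose_spec

theorem nearFin_rep {F : Triple → ℝ} (hF : F ∈ scriSmooth) :
    NearFin fun q => rep (toRing F hF) q = F q := toRing_eq_iff.1 (toRing_rep (toRing F hF))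

/-- The tangential derivative of a ring element. -/
def tanRing (e : Triple) (a : ScriRing) : ScriRing :=
  toRing (tanD e (rep a)) (tanD_mem e (rep_mem a))

theorem tanRing_toRing (e : Triple) {F : Triple → ℝ} (hF : F ∈ scriSmooth) :
    tanRing e (toRing F hF) = toRing (tanD e F) (tanD_mem e hF) :=
  toRing_eq_iff.2 (nearFin_tanD_congr e (rep_mem _) hF (nearFin_rep hF))

/-- Tangential derivatives are derivations of the ring. -/
def tanDer (e : Triple) : Derivation ℝ ScriRing ScriRing :=
  Derivation.mk'
    { toFun := tanRing e
      map_add' := fun a b => by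
        obtain ⟨F, hF, rfl⟩ := toRing_surjective a
        obtain ⟨G, hG, rfl⟩ := toRing_surjective b
        rw [toRing_add, tanRing_toRing, tanRing_toRing, tanRing_toRing, toRing_add, toRing_eq_iff]
        refine ((nearFin_differentiableAt hF).and (nearFin_differentiableAt hG)).mono
          fun q _ h => ?_
        simp only [tanD, fderiv_fun_add h.1 h.2, add_apply]
      map_smul' := fun c a => by
        obtain ⟨F, hF, rfl⟩ := toRing_surjective a
        rw [toRing_smul, tanRing_toRing, tanRing_toRing, RingHom.id_apply, toRing_smul,
          toRing_eq_iff]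
        refine (nearFin_differentiableAt hF).mono fun q _ h => ?_
        simp only [tanD, fderiv_const_mul h, smul_apply, smul_eq_mul] }
    (fun a b => by
        obtain ⟨F, hF, rfl⟩ := toRing_surjective a
        obtain ⟨G, hG, rfl⟩ := toRing_surjective b
        change tanRing e _ = toRing F hF * tanRing e _ + toRing G hG * tanRing e _
        rw [toRing_mul, tanRing_toRing, tanRing_toRing, tanRing_toRing, toRing_mul, toRing_mul,
          toRing_add, toRing_eq_iff]
        refine ((nearFin_differentiableAt hF).and (nearFin_differentiableAt hG)).mono
          fun q _ h => ?_
        simp only [tanD, fderiv_fun_mul h.1 h.2, add_apply,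
          smul_apply, smul_eq_mul])

theorem tanDer_toRing (e : Triple) {F : Triple → ℝ} (hF : F ∈ scriSmooth) :
    tanDer e (toRing F hF) = toRing (tanD e F) (tanD_mem e hF) := tanRing_toRing e hF

/-- `∂_u`. -/
def dU : Derivation ℝ ScriRing ScriRing := tanDer (1, 0, 0)

/-- `∂_ρ`. -/
def dR : Derivation ℝ ScriRing ScriRing := tanDer (0, 1, 0)

/-- The Cartesian components of the derivative along `S²`. -/
def dT (i : Fin 3) : Derivation ℝ ScriRing ScriRing := tanDer (0, 0, EuclideanSpace.single i 1)

theorem rho_mem : (fun q : Triple => q.2.1) ∈ scriSmooth := fun _ _ _ => by fun_prop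

theorem coord_mem (i : Fin 3) : (fun q : Triple => q.2.2 i) ∈ scriSmooth := fun _ _ _ => by
  fun_prop

theorem time_mem : (fun q : Triple => q.1) ∈ scriSmooth := fun _ _ _ => by fun_prop

/-- The function `ρ = 1/r`. -/
def rho : ScriRing := toRing _ rho_mem

/-- The functions `x_i`. -/
def xc (i : Fin 3) : ScriRing := toRing _ (coord_mem i)

/-- The function `u`. -/
def uc : ScriRing := toRing _ time_mem

theorem fderiv_rho (q e : Triple) : fderiv ℝ (fun q : Triple => q.2.1) q e = e.2.1 := by
  have : HasFDerivAt (fun q : Triple => q.2.1) ((ContinuousLinearMap.fst ℝ ℝ E3).comp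
      (ContinuousLinearMap.snd ℝ ℝ (ℝ × E3))) q :=
    ((ContinuousLinearMap.fst ℝ ℝ E3).comp (ContinuousLinearMap.snd ℝ ℝ (ℝ × E3))).hasFDerivAt
  rw [this.fderiv]; rfl

theorem fderiv_time (q e : Triple) : fderiv ℝ (fun q : Triple => q.1) q e = e.1 := by
  have : HasFDerivAt (fun q : Triple => q.1) (ContinuousLinearMap.fst ℝ ℝ (ℝ × E3)) q :=
    (ContinuousLinearMap.fst ℝ ℝ (ℝ × E3)).hasFDerivAt
  rw [this.fderiv]; rfl

theorem fderiv_coord (i : Fin 3) (q e : Triple) :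
    fderiv ℝ (fun q : Triple => q.2.2 i) q e = e.2.2 i := by
  have : HasFDerivAt (fun q : Triple => q.2.2 i) ((EuclideanSpace.proj i : E3 →L[ℝ] ℝ).comp
      ((ContinuousLinearMap.snd ℝ ℝ E3).comp (ContinuousLinearMap.snd ℝ ℝ (ℝ × E3)))) q :=
    ((EuclideanSpace.proj i : E3 →L[ℝ] ℝ).comp ((ContinuousLinearMap.snd ℝ ℝ E3).comp
      (ContinuousLinearMap.snd ℝ ℝ (ℝ × E3)))).hasFDerivAt
  rw [this.fderiv]; rfl

theorem tanDer_rho (e : Triple) : tanDer e rho = algebraMap ℝ ScriRing e.2.1 := by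
  unfold rho
  rw [tanDer_toRing, algebraMap_eq, toRing_eq_iff]
  exact NearFin.of_scri fun u x hx => Eventually.of_forall fun q => by
    simp [tanD, fderiv_rho, tang]

theorem tanDer_uc (e : Triple) : tanDer e uc = algebraMap ℝ ScriRing e.1 := by
  unfold uc
  rw [tanDer_toRing, algebraMap_eq, toRing_eq_iff]
  exact NearFin.of_scri fun u x hx => Eventually.of_forall fun q => by
    simp [tanD, fderiv_time, tang]

@[simp] theorem dU_rho : dU rho = 0 := by simp [dU, tanDer_rho]
@[simp] theorem dR_rho : dR rho = 1 := by simp [dR, tanDer_rho]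
@[simp] theorem dT_rho (i : Fin 3) : dT i rho = 0 := by simp [dT, tanDer_rho]
@[simp] theorem dU_uc : dU uc = 1 := by simp [dU, tanDer_uc]
@[simp] theorem dR_uc : dR uc = 0 := by simp [dR, tanDer_uc]
@[simp] theorem dT_uc (i : Fin 3) : dT i uc = 0 := by simp [dT, tanDer_uc]

theorem tanDer_xc (e : Triple) (he : e.2.2 = 0) (i : Fin 3) : tanDer e (xc i) = 0 := by
  unfold xc
  rw [tanDer_toRing, ← map_zero (algebraMap ℝ ScriRing), algebraMap_eq, toRing_eq_iff]
  exact NearFin.of_scri fun u x hx => Eventually.of_forall fun q => by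
    simp [tanD, fderiv_coord, tang, he]

@[simp] theorem dU_xc (i : Fin 3) : dU (xc i) = 0 := tanDer_xc _ rfl i
@[simp] theorem dR_xc (i : Fin 3) : dR (xc i) = 0 := tanDer_xc _ rfl i

@[simp] theorem dT_xc (i j : Fin 3) :
    dT i (xc j) = (if i = j then 1 else 0) - xc i * xc j := by
  have h : ((if i = j then 1 else 0 : ScriRing)) - xc i * xc j
      = toRing (fun q => (if i = j then 1 else 0) + (-1) * (q.2.2 i * q.2.2 j)) (add_mem'
          (const_mem (if i = j then 1 else 0))
          (mul_mem' (const_mem (-1)) (mul_mem' (coord_mem i) (coord_mem j)))) := by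
    have h1 : (if i = j then 1 else 0 : ScriRing) = algebraMap ℝ ScriRing (if i = j then 1 else 0)
        := by split_ifs <;> simp
    rw [h1, algebraMap_eq, sub_eq_add_neg, ← neg_one_smul ℝ]
    rfl
  rw [h]
  unfold dT xc
  rw [tanDer_toRing, toRing_eq_iff]
  exact NearFin.of_scri fun u x hx => Eventually.of_forall fun q => by
    by_cases hij : i = j
    · subst hij
      simp [tanD, fderiv_coord, tang, EuclideanSpace.inner_single_right]
      ring
    · have hij' : ¬ j = i := fun h => hij h.symm
      simp [tanD, fderiv_coord, tang, EuclideanSpace.inner_single_right, hij, hij']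

theorem sum_xc_mul_xc : ∑ i, xc i * xc i = 1 := by
  have : ∑ i, xc i * xc i = toRing (fun q => q.2.2 0 * q.2.2 0 + q.2.2 1 * q.2.2 1
      + q.2.2 2 * q.2.2 2) (add_mem' (add_mem' (mul_mem' (coord_mem 0) (coord_mem 0))
        (mul_mem' (coord_mem 1) (coord_mem 1))) (mul_mem' (coord_mem 2) (coord_mem 2))) := by
    rw [Fin.sum_univ_three]; rfl
  rw [this, toRing_one, toRing_eq_iff]
  refine fun u x hx => Eventually.of_forall fun q hq => ?_
  have := hq.2
  rw [EuclideanSpace.norm_eq, Real.sqrt_eq_one, Fin.sum_univ_three] at this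
  simp only [Real.norm_eq_abs, sq_abs] at this
  linarith

/-- Although ρ vanishes at null infinity, it is positive at finite radius, where equality in the
ring is tested. All comparisons of coefficients rest on this cancellation. -/
theorem rho_mul_cancel {a b : ScriRing} (h : rho * a = rho * b) : a = b := by
  obtain ⟨F, hF, rfl⟩ := toRing_surjective a
  obtain ⟨G, hG, rfl⟩ := toRing_surjective b
  unfold rho at h
  rw [toRing_mul, toRing_mul, toRing_eq_iff] at h
  exact toRing_eq_iff.2 (h.mono fun q hq hh => mul_left_cancel₀ hq.1.ne' hh)

theorem rho_pow_mul_cancel (n : ℕ) {a b : ScriRing} (h : rho ^ n * a = rho ^ n * b) : a = b := by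
  induction n with
  | zero => simpa using h
  | succ n ih => exact ih (rho_mul_cancel (by rw [← mul_assoc, ← mul_assoc, ← pow_succ', h]))

/-- The component derivative `∂_μ` in the coordinates `(u, y)`, `y = r x`. -/
def dC (μ : Fin 4) : Derivation ℝ ScriRing ScriRing :=
  Fin.cases dU (fun i => rho • dT i - (rho ^ 2 * xc i) • dR) μ

theorem dC_zero : dC 0 = dU := rfl

theorem dC_succ (i : Fin 3) (a : ScriRing) :
    dC i.succ a = rho * dT i a - rho ^ 2 * xc i * dR a := by
  change (rho • dT i - (rho ^ 2 * xc i) • dR) a = _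
  simp

/-! ### Coordinate derivatives -/

/-- The spatial part `y` of `(u, y)`. -/
def spatial (p : Pt) : E3 := WithLp.toLp 2 fun i => p i.succ

theorem toTriple_eq (p : Pt) :
    toTriple p = (p 0, ‖spatial p‖⁻¹, ‖spatial p‖⁻¹ • spatial p) := rfl

/-- `spatial` as a continuous linear map. -/
def spatialL : Pt →L[ℝ] E3 :=
  LinearMap.toContinuousLinearMap
    { toFun := spatial
      map_add' := fun p q => by ext i; simp [spatial]
      map_smul' := fun c p => by ext i; simp [spatial] }

theorem spatialL_apply (p : Pt) : spatialL p = spatial p := rfl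

theorem spatial_ofTriple (q : Triple) : spatial (ofTriple q) = q.2.1⁻¹ • q.2.2 := by
  ext i; simp [spatial, ofTriple]

theorem spatial_ofTriple_ne {q : Triple} (hq : IsFinite q) : spatial (ofTriple q) ≠ 0 := by
  rw [spatial_ofTriple]
  exact smul_ne_zero (inv_ne_zero hq.1.ne') (ne_zero_of_unit hq.2)

theorem toTriple_ofTriple {q : Triple} (hq : IsFinite q) : toTriple (ofTriple q) = q := by
  obtain ⟨u, ρ, x⟩ := q
  obtain ⟨hρ, hx⟩ := hq
  simp only at hρ hx
  have h1 : ‖ρ⁻¹ • x‖ = ρ⁻¹ := by rw [norm_smul, hx, mul_one, norm_inv, Real.norm_of_nonneg hρ.le]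
  rw [toTriple_eq, spatial_ofTriple]
  simp only [h1, inv_inv, smul_smul, mul_inv_cancel₀ hρ.ne', one_smul]
  simp [ofTriple]

theorem ofTriple_toTriple {p : Pt} (hp : spatial p ≠ 0) : ofTriple (toTriple p) = p := by
  have hn : ‖spatial p‖ ≠ 0 := norm_ne_zero_iff.2 hp
  rw [toTriple_eq]
  funext μ
  refine Fin.cases ?_ (fun i => ?_) μ
  · simp [ofTriple]
  · simp only [ofTriple, Fin.cons_succ, inv_inv, PiLp.smul_apply, smul_eq_mul]
    rw [← mul_assoc, mul_inv_cancel₀ hn, one_mul]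
    simp [spatial]

theorem isFinite_toTriple {p : Pt} (hp : spatial p ≠ 0) : IsFinite (toTriple p) :=
  ⟨inv_pos.2 (norm_pos_iff.2 hp), norm_normalize hp⟩

/-- Since ρ = 1/|y| and x = ρ y, the derivative in y_i is ρ times the tangential derivative minus ρ²
x_i ∂_ρ. Each spatial derivative therefore gains a power of ρ, whereas ∂_u gains none. -/
theorem hasFDerivAt_toTriple {p : Pt} (hp : spatial p ≠ 0) :
    ∃ L : Pt →L[ℝ] Triple, HasFDerivAt toTriple L p ∧
      L (Pi.single 0 1) = tang (1, 0, 0) (toTriple p) ∧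
      ∀ i : Fin 3, L (Pi.single i.succ 1) =
        (toTriple p).2.1 • tang (0, 0, EuclideanSpace.single i 1) (toTriple p)
          - ((toTriple p).2.1 ^ 2 * (toTriple p).2.2 i) • tang (0, 1, 0) (toTriple p) := by
  have hs : HasFDerivAt spatial spatialL p := spatialL.hasFDerivAt
  have h0 : HasFDerivAt (fun p : Pt => p 0) (ContinuousLinearMap.proj 0 : Pt →L[ℝ] ℝ) p :=
    (ContinuousLinearMap.proj 0 : Pt →L[ℝ] ℝ).hasFDerivAt
  have h1 := (hasFDerivAt_norm_inv hp).comp p hs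
  have h2 := (hasFDerivAt_normalize hp).comp p hs
  have e0 : spatial (Pi.single 0 1) = 0 := by ext i; simp [spatial]
  have ei : ∀ i : Fin 3, spatial (Pi.single i.succ 1) = EuclideanSpace.single i 1 := by
    intro i; ext j; simp [spatial, Pi.single_apply]
  refine ⟨_, h0.prodMk (h1.prodMk h2), ?_, fun i => ?_⟩
  · simp [spatialL_apply, e0, tang]
  · simp only [ContinuousLinearMap.prod_apply, ContinuousLinearMap.comp_apply, spatialL_apply, ei,
      toTriple_eq, tang]
    refine Prod.ext ?_ (Prod.ext ?_ ?_)
    · simp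
    · simp [EuclideanSpace.inner_single_right]
    · simp [EuclideanSpace.inner_single_right]

theorem continuousAt_toTriple {p : Pt} (hp : spatial p ≠ 0) : ContinuousAt toTriple p :=
  (hasFDerivAt_toTriple hp).choose_spec.1.continuousAt

theorem eventually_spatial_ne {p : Pt} (hp : spatial p ≠ 0) : ∀ᶠ p' in 𝓝 p, spatial p' ≠ 0 :=
  spatialL.continuous.continuousAt.eventually_ne hp

/-- The coordinate derivative of a function of `(u, ρ, x)`. -/
def coordD (μ : Fin 4) (F : Triple → ℝ) (q : Triple) : ℝ :=
  Fin.cases (tanD (1, 0, 0) F q) (fun i => q.2.1 * tanD (0, 0, EuclideanSpace.single i 1) F q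
    - q.2.1 ^ 2 * q.2.2 i * tanD (0, 1, 0) F q) μ

theorem pd_comp_toTriple {F : Triple → ℝ} {p : Pt} (hp : spatial p ≠ 0)
    (hF : DifferentiableAt ℝ F (toTriple p)) (μ : Fin 4) :
    pd μ (fun p => F (toTriple p)) p = coordD μ F (toTriple p) := by
  obtain ⟨L, hL, h0, hi⟩ := hasFDerivAt_toTriple hp
  have h := (hF.hasFDerivAt.comp p hL).fderiv
  have h' : fderiv ℝ (fun p => F (toTriple p)) p = (fderiv ℝ F (toTriple p)).comp L := h
  unfold pd
  rw [h', ContinuousLinearMap.comp_apply]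
  refine Fin.cases ?_ (fun i => ?_) μ
  · rw [h0]; rfl
  · rw [hi, map_sub, map_smul, map_smul]; rfl

theorem coordD_mem (μ : Fin 4) {F : Triple → ℝ} (hF : F ∈ scriSmooth) :
    coordD μ F ∈ scriSmooth := by
  refine Fin.cases (tanD_mem _ hF) (fun i => ?_) μ
  intro u x hx
  have h1 := tanD_mem (0, 0, EuclideanSpace.single i 1) hF u x hx
  have h2 := tanD_mem (0, 1, 0) hF u x hx
  have h3 := rho_mem u x hx
  have h4 := coord_mem i u x hx
  exact (h3.mul h1).sub (((h3.pow 2).mul h4).mul h2)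

theorem dC_toRing (μ : Fin 4) {F : Triple → ℝ} (hF : F ∈ scriSmooth) :
    dC μ (toRing F hF) = toRing (coordD μ F) (coordD_mem μ hF) := by
  refine Fin.cases ?_ (fun i => ?_) μ
  · exact tanDer_toRing _ hF
  · rw [dC_succ, dT, dR, tanDer_toRing, tanDer_toRing, rho, xc, pow_two, toRing_mul, toRing_mul,
      toRing_mul, toRing_mul, sub_eq_add_neg, ← neg_one_smul ℝ, toRing_smul, toRing_add]
    refine toRing_eq_iff.2 (NearFin.of_scri fun u x hx => Eventually.of_forall fun q => ?_)
    change _ = q.2.1 * tanD (0, 0, EuclideanSpace.single i 1) F q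
      - q.2.1 ^ 2 * q.2.2 i * tanD (0, 1, 0) F q
    ring

/-! ### Values at null infinity -/

/-- The value at null infinity is the limit along ρ ↓ 0 of values at finite radius. This makes
evaluation at null infinity well defined on the quotient ring. -/
theorem eq_zero_of_nearFin {F : Triple → ℝ} (hF : F ∈ scriSmooth) (h : NearFin fun q => F q = 0)
    (u : ℝ) (x : E3) (hx : ‖x‖ = 1) : F (u, 0, x) = 0 := by
  have hc : Tendsto (fun ρ : ℝ => F (u, ρ, x)) (𝓝[>] 0) (𝓝 (F (u, 0, x))) := by
    have h1 : ContinuousAt (fun ρ : ℝ => F (u, ρ, x)) 0 :=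
      ContinuousAt.comp (g := F) (f := fun ρ : ℝ => ((u, ρ, x) : Triple))
        (hF u x hx).continuousAt (by fun_prop)
    exact h1.tendsto.mono_left nhdsWithin_le_nhds
  have hz : Tendsto (fun ρ : ℝ => F (u, ρ, x)) (𝓝[>] 0) (𝓝 0) :=
    tendsto_const_nhds.congr' ((h.tendsto u x hx).mono fun ρ hρ => hρ.symm)
  exact tendsto_nhds_unique hc hz

/-- The value at the point `(u, x)` of null infinity. -/
def ev (u : ℝ) (x : E3) (hx : ‖x‖ = 1) : ScriRing →+* ℝ :=
  Ideal.Quotient.lift finIdeal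
    ((Pi.evalRingHom (fun _ : Triple => ℝ) (u, 0, x)).comp scriSmooth.val.toRingHom)
    (fun F hF => eq_zero_of_nearFin F.2 hF u x hx)

theorem ev_toRing {F : Triple → ℝ} (hF : F ∈ scriSmooth) (u : ℝ) (x : E3) (hx : ‖x‖ = 1) :
    ev u x hx (toRing F hF) = F (u, 0, x) := rfl

@[simp] theorem ev_rho (u : ℝ) (x : E3) (hx : ‖x‖ = 1) : ev u x hx rho = 0 := rfl
@[simp] theorem ev_xc (u : ℝ) (x : E3) (hx : ‖x‖ = 1) (i : Fin 3) : ev u x hx (xc i) = x i := rfl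
@[simp] theorem ev_uc (u : ℝ) (x : E3) (hx : ‖x‖ = 1) : ev u x hx uc = u := rfl
@[simp] theorem ev_algebraMap (u : ℝ) (x : E3) (hx : ‖x‖ = 1) (c : ℝ) :
    ev u x hx (algebraMap ℝ ScriRing c) = c := rfl
@[simp] theorem ev_smul (u : ℝ) (x : E3) (hx : ‖x‖ = 1) (c : ℝ) (a : ScriRing) :
    ev u x hx (c • a) = c * ev u x hx a := by
  rw [Algebra.smul_def, map_mul, ev_algebraMap]

/-- `v` is the value of `a` at null infinity. -/
def Val (a : ScriRing) (v : ℝ → E3 → ℝ) : Prop := ∀ u x hx, ev u x hx a = v u x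

/-- Smoothness of a function on null infinity. -/
def ScriFun (v : ℝ → E3 → ℝ) : Prop :=
  ∀ (u : ℝ) (y : E3), y ≠ 0 → ContDiffAt ℝ ∞ (fun p : ℝ × E3 => v p.1 (‖p.2‖⁻¹ • p.2)) (u, y)

theorem Val.scriFun {a : ScriRing} {v : ℝ → E3 → ℝ} (h : Val a v) : ScriFun v := by
  obtain ⟨F, hF, rfl⟩ := toRing_surjective a
  intro u y hy
  have hn : ContDiffAt ℝ ∞ (fun p : ℝ × E3 => ((p.1, 0, ‖p.2‖⁻¹ • p.2) : Triple)) (u, y) := by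
    have : ContDiffAt ℝ ∞ (fun p : ℝ × E3 => ‖p.2‖⁻¹ • p.2) (u, y) :=
      ContDiffAt.comp (g := fun z : E3 => ‖z‖⁻¹ • z) (f := fun q : ℝ × E3 => q.2) (u, y)
        (contDiffAt_normalize hy) (by fun_prop)
    exact contDiffAt_fst.prodMk (contDiffAt_const.prodMk this)
  have hc : ContDiffAt ℝ ∞ (fun p : ℝ × E3 => F (p.1, 0, ‖p.2‖⁻¹ • p.2)) (u, y) :=
    ContDiffAt.comp (g := F) (u, y) (hF u _ (norm_normalize hy)) hn
  refine hc.congr_of_eventuallyEq ?_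
  have hne : ∀ᶠ p : ℝ × E3 in 𝓝 (u, y), p.2 ≠ 0 := continuous_snd.continuousAt.eventually_ne hy
  filter_upwards [hne] with p hp
  rw [← h p.1 _ (norm_normalize hp), ev_toRing]

theorem Val.dU {a : ScriRing} {v : ℝ → E3 → ℝ} (h : Val a v) :
    Val (dU a) fun u x => deriv (fun s => v s x) u := by
  obtain ⟨F, hF, rfl⟩ := toRing_surjective a
  intro u x hx
  rw [BondiSachs.dU, tanDer_toRing, ev_toRing]
  have hd : DifferentiableAt ℝ F (u, 0, x) := (hF u x hx).differentiableAt (by simp)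
  have hl : HasDerivAt (fun s : ℝ => ((s, 0, x) : Triple)) (1, 0, 0) u :=
    (hasDerivAt_id u).prodMk (hasDerivAt_const u _)
  have hc : HasDerivAt (fun s : ℝ => F (s, 0, x)) (fderiv ℝ F (u, 0, x) (1, 0, 0)) u :=
    HasFDerivAt.comp_hasDerivAt (l := F) u hd.hasFDerivAt hl
  have he : (fun s => v s x) = fun s => F (s, 0, x) := by
    funext s; rw [← h s x hx, ev_toRing]
  change tanD (1, 0, 0) F (u, 0, x) = deriv (fun s => v s x) u
  rw [he, hc.deriv]
  simp [tanD, tang]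

theorem Val.dT {a : ScriRing} {v : ℝ → E3 → ℝ} (h : Val a v) (i : Fin 3) :
    Val (dT i a) fun u x => tderiv i (v u) x := by
  obtain ⟨F, hF, rfl⟩ := toRing_surjective a
  intro u x hx
  rw [BondiSachs.dT, tanDer_toRing, ev_toRing]
  have hd : DifferentiableAt ℝ F (u, 0, x) := (hF u x hx).differentiableAt (by simp)
  have hl : HasFDerivAt (fun y : E3 => ((u, 0, ‖y‖⁻¹ • y) : Triple)) _ x :=
    (hasFDerivAt_const u x).prodMk ((hasFDerivAt_const (0 : ℝ) x).prodMk
      (hasFDerivAt_normalize (ne_zero_of_unit hx)))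
  have hd' : HasFDerivAt F (fderiv ℝ F (u, 0, x)) ((u, 0, ‖x‖⁻¹ • x) : Triple) := by
    rw [normalize_of_unit hx]; exact hd.hasFDerivAt
  have hc := (HasFDerivAt.comp x hd' hl).fderiv
  have he : (fun y : E3 => v u (‖y‖⁻¹ • y)) =ᶠ[𝓝 x] F ∘ fun y : E3 => ((u, 0, ‖y‖⁻¹ • y) : Triple)
      := by
    filter_upwards [isOpen_ne.mem_nhds (ne_zero_of_unit hx)] with y hy
    rw [← h u _ (norm_normalize hy), ev_toRing]; rfl
  change _ = fderiv ℝ (fun y : E3 => v u (‖y‖⁻¹ • y)) x _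
  rw [he.fderiv_eq, hc]
  simp [tanD, tang, hx]

theorem Val.smul {a : ScriRing} {v : ℝ → E3 → ℝ} (c : ℝ) (h : Val a v) :
    Val (c • a) fun u x => c * v u x := fun u x hx => by rw [ev_smul, h u x hx]

/-- Second derivatives commute if one direction is not angular. -/
theorem tanDer_comm (d e : Triple) (hd0 : d.2.2 = 0) (a : ScriRing) :
    tanDer d (tanDer e a) = tanDer e (tanDer d a) := by
  obtain ⟨F, hF, rfl⟩ := toRing_surjective a
  rw [tanDer_toRing, tanDer_toRing, tanDer_toRing, tanDer_toRing]
  refine toRing_eq_iff.2 (NearFin.of_scri fun u x hx => ?_)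
  have h2 : ContDiffAt ℝ 2 F (u, 0, x) := (hF u x hx).of_le (by norm_cast)
  filter_upwards [h2.eventually (by simp)] with q hq
  have hs := hq.isSymmSndFDerivAt (by simp)
  have hd : DifferentiableAt ℝ (fderiv ℝ F) q :=
    (hq.fderiv_right (m := 1) (by norm_num)).differentiableAt (by simp)
  have hconst : ∀ q, tang d q = d := fun q => Prod.ext rfl (Prod.ext rfl (by simp [tang, hd0]))
  have ht : DifferentiableAt ℝ (tang e) q := (contDiff_tang e).contDiffAt.differentiableAt (by simp)
  -- The projection depends only on the angular slot, which the direction `d` leaves fixed; so the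
  -- one term that could spoil the symmetry of the second derivative is absent.
  have ht0 : fderiv ℝ (tang e) q d = 0 := by
    have hl : HasDerivAt (fun s : ℝ => q + s • d) d 0 := by
      simpa using ((hasDerivAt_id (0 : ℝ)).smul_const d).const_add q
    have ht' : HasFDerivAt (tang e) (fderiv ℝ (tang e) q) (q + (0 : ℝ) • d) := by
      simpa using ht.hasFDerivAt
    have h1 := HasFDerivAt.comp_hasDerivAt (l := tang e) 0 ht' hl
    have h2 : (tang e ∘ fun s : ℝ => q + s • d) = fun _ => tang e q := by
      funext s; simp [tang, hd0]
    rw [h2] at h1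
    exact h1.unique (hasDerivAt_const _ _)
  have e1 : fderiv ℝ (tanD e F) q d
      = fderiv ℝ (fderiv ℝ F) q d (tang e q) := by
    unfold tanD
    rw [fderiv_clm_apply hd ht]
    simp [ht0]
  have e2 : fderiv ℝ (tanD d F) q (tang e q)
      = fderiv ℝ (fderiv ℝ F) q (tang e q) d := by
    unfold tanD
    simp only [hconst]
    rw [fderiv_clm_apply hd (differentiableAt_const _)]
    simp
  change fderiv ℝ (tanD e F) q (tang d q) = fderiv ℝ (tanD d F) q (tang e q)
  rw [hconst, e1, e2, hs]

theorem dR_tanDer (e : Triple) (a : ScriRing) : dR (tanDer e a) = tanDer e (dR a) :=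
  tanDer_comm _ e rfl a

theorem dU_tanDer (e : Triple) (a : ScriRing) : dU (tanDer e a) = tanDer e (dU a) :=
  tanDer_comm _ e rfl a

/-! ### Division by `ρ` -/

/-- Compactness provides the constant dominating function for differentiation under the integral.
The interval (−2, 2) is an open neighbourhood of [0, 1], so that smoothness at the end points is
two-sided. -/
theorem exists_bound_parametric {E F : Type} [NormedAddCommGroup E] [ProperSpace E]
    [NormedAddCommGroup F] {S : Set E} (hS : IsOpen S)
    {G : ℝ → E → F} (hG : ContinuousOn (Function.uncurry G) (Set.Ioo (-2) 2 ×ˢ S)) {q : E}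
    (hq : q ∈ S) : ∃ ε > 0, ∃ M, Metric.ball q ε ⊆ S ∧
      ∀ t ∈ Set.Icc (0 : ℝ) 1, ∀ q' ∈ Metric.ball q ε, ‖G t q'‖ ≤ M := by
  obtain ⟨ε, hε, hb⟩ := Metric.nhds_basis_closedBall.mem_iff.1 (hS.mem_nhds hq)
  have hK : IsCompact (Set.Icc (0 : ℝ) 1 ×ˢ Metric.closedBall q ε) :=
    isCompact_Icc.prod (isCompact_closedBall q ε)
  have hsub : Set.Icc (0 : ℝ) 1 ×ˢ Metric.closedBall q ε ⊆ Set.Ioo (-2) 2 ×ˢ S :=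
    Set.prod_mono (fun t ht => ⟨by linarith [ht.1], by linarith [ht.2]⟩) hb
  obtain ⟨M, hM⟩ := hK.exists_bound_of_continuousOn (hG.mono hsub)
  exact ⟨ε, hε, M, Metric.ball_subset_closedBall.trans hb, fun t ht q' hq' =>
    hM (t, q') ⟨ht, Metric.ball_subset_closedBall hq'⟩⟩

theorem continuousOn_slice {E F : Type} [NormedAddCommGroup E] [NormedAddCommGroup F] {S : Set E}
    {G : ℝ → E → F} (hG : ContinuousOn (Function.uncurry G) (Set.Ioo (-2) 2 ×ˢ S)) {q : E}
    (hq : q ∈ S) : ContinuousOn (fun t => G t q) (Set.Icc 0 1) := by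
  have h : ContinuousOn (fun t : ℝ => (t, q)) (Set.Icc 0 1) := by fun_prop
  exact hG.comp h fun t ht => ⟨⟨by linarith [ht.1], by linarith [ht.2]⟩, hq⟩

theorem aestronglyMeasurable_slice {E F : Type} [NormedAddCommGroup E]
    [NormedAddCommGroup F] {S : Set E}
    {G : ℝ → E → F} (hG : ContinuousOn (Function.uncurry G) (Set.Ioo (-2) 2 ×ˢ S)) {q : E}
    (hq : q ∈ S) :
    AEStronglyMeasurable (fun t => G t q) (volume.restrict (Set.uIoc (0 : ℝ) 1)) := by
  rw [Set.uIoc_of_le zero_le_one]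
  exact ((continuousOn_slice hG hq).mono Set.Ioc_subset_Icc_self).aestronglyMeasurable
    measurableSet_Ioc

/-- Smooth dependence on a parameter of an integral over `[0, 1]`. -/
theorem contDiffOn_parametric {E : Type} [NormedAddCommGroup E] [NormedSpace ℝ E] [ProperSpace E]
    (n : ℕ) : ∀ {F : Type} [NormedAddCommGroup F] [NormedSpace ℝ F] [CompleteSpace F]
    {S : Set E}, IsOpen S → ∀ {G : ℝ → E → F},
    ContDiffOn ℝ n (Function.uncurry G) (Set.Ioo (-2) 2 ×ˢ S) →
    ContDiffOn ℝ n (fun q => ∫ t in (0 : ℝ)..1, G t q) S := by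
  induction n with
  | zero =>
    intro F _ _ _ S hS G hG
    simp only [Nat.cast_zero, contDiffOn_zero] at hG ⊢
    intro q hq
    obtain ⟨ε, hε, M, hb, hM⟩ := exists_bound_parametric hS hG hq
    refine ContinuousAt.continuousWithinAt ?_
    refine intervalIntegral.continuousAt_of_dominated_interval (bound := fun _ => M) ?_ ?_ ?_ ?_
    · filter_upwards [Metric.ball_mem_nhds q hε] with q' hq'
      exact aestronglyMeasurable_slice hG (hb hq')
    · filter_upwards [Metric.ball_mem_nhds q hε] with q' hq'
      refine Eventually.of_forall fun t ht => ?_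
      rw [Set.uIoc_of_le zero_le_one] at ht
      exact hM t (Set.Ioc_subset_Icc_self ht) q' hq'
    · exact intervalIntegrable_const
    · refine Eventually.of_forall fun t ht => ?_
      rw [Set.uIoc_of_le zero_le_one] at ht
      have h1 : ContinuousAt (Function.uncurry G) (t, q) :=
        hG.continuousAt ((isOpen_Ioo.prod hS).mem_nhds
          ⟨⟨by linarith [ht.1], by linarith [ht.2]⟩, hq⟩)
      exact ContinuousAt.comp (g := Function.uncurry G) (f := fun q' => (t, q')) h1 (by fun_prop)
  -- The derivative of the integral is the integral of the partial derivative, which takes values in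
  -- another space; for this reason the target space is quantified inside the induction.
  | succ n ih =>
    intro F _ _ _ S hS G hG
    have hO : IsOpen (Set.Ioo (-2 : ℝ) 2 ×ˢ S) := isOpen_Ioo.prod hS
    set G' : ℝ → E → E →L[ℝ] F := fun t q =>
      (fderiv ℝ (Function.uncurry G) (t, q)).comp (ContinuousLinearMap.inr ℝ ℝ E) with hG'
    have hfd : ContDiffOn ℝ n (fderiv ℝ (Function.uncurry G)) (Set.Ioo (-2 : ℝ) 2 ×ˢ S) :=
      hG.fderiv_of_isOpen hO (by norm_cast)
    have hcG' : ContDiffOn ℝ n (Function.uncurry G') (Set.Ioo (-2 : ℝ) 2 ×ˢ S) :=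
      hfd.clm_comp contDiffOn_const
    have hd : ∀ t ∈ Set.Icc (0 : ℝ) 1, ∀ q ∈ S, HasFDerivAt (fun q => G t q) (G' t q) q := by
      intro t ht q hq
      have hmem : ((t, q) : ℝ × E) ∈ Set.Ioo (-2 : ℝ) 2 ×ˢ S :=
        ⟨⟨by linarith [ht.1], by linarith [ht.2]⟩, hq⟩
      have h1 : HasFDerivAt (Function.uncurry G) (fderiv ℝ (Function.uncurry G) (t, q)) (t, q) :=
        ((hG.contDiffAt (hO.mem_nhds hmem)).differentiableAt (by simp)).hasFDerivAt
      have h2 : HasFDerivAt (fun q' : E => (t, q')) (ContinuousLinearMap.inr ℝ ℝ E) q :=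
        hasFDerivAt_prodMk_right t q
      exact h1.comp q h2
    have hint : ∀ q ∈ S, HasFDerivAt (fun q => ∫ t in (0 : ℝ)..1, G t q)
        (∫ t in (0 : ℝ)..1, G' t q) q := by
      intro q hq
      obtain ⟨ε, hε, M, hb, hM⟩ := exists_bound_parametric hS hcG'.continuousOn hq
      refine intervalIntegral.hasFDerivAt_integral_of_dominated_of_fderiv_le (𝕜 := ℝ)
        (F := fun q t => G t q) (F' := fun q t => G' t q)
        (bound := fun _ => M) (s := Metric.ball q ε) (Metric.ball_mem_nhds q hε)
        ?_ ?_ ?_ ?_ ?_ ?_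
      · filter_upwards [Metric.ball_mem_nhds q hε] with q' hq'
        exact aestronglyMeasurable_slice hG.continuousOn (hb hq')
      · refine ContinuousOn.intervalIntegrable ?_
        rw [Set.uIcc_of_le zero_le_one]
        exact continuousOn_slice hG.continuousOn hq
      · exact aestronglyMeasurable_slice hcG'.continuousOn hq
      · refine Eventually.of_forall fun t ht q' hq' => ?_
        rw [Set.uIoc_of_le zero_le_one] at ht
        exact hM t (Set.Ioc_subset_Icc_self ht) q' hq'
      · exact intervalIntegrable_const
      · refine Eventually.of_forall fun t ht q' hq' => ?_
        rw [Set.uIoc_of_le zero_le_one] at ht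
        exact hd t (Set.Ioc_subset_Icc_self ht) q' (hb hq')
    have := contDiffOn_succ_iff_fderiv_of_isOpen (𝕜 := ℝ) (n := n)
      (f := fun q => ∫ t in (0 : ℝ)..1, G t q) hS
    rw [Nat.cast_succ, this]
    refine ⟨fun q hq => (hint q hq).differentiableAt.differentiableWithinAt, by simp, ?_⟩
    exact (ih hS hcG').congr fun q hq => (hint q hq).fderiv

/-- A function that vanishes at null infinity is divisible by `ρ`. -/
theorem exists_eq_rho_mul {a : ScriRing} (h : Val a fun _ _ => 0) : ∃ b, a = rho * b := by
  obtain ⟨F, hF, rfl⟩ := toRing_surjective a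
  -- Hadamard's quotient: F(ρ) = ρ ∫₀¹ F_ρ(tρ) dt when F vanishes at ρ = 0.
  set G : Triple → ℝ := fun q =>
    ∫ t in (0 : ℝ)..1, fderiv ℝ F (q.1, t * q.2.1, q.2.2) (0, 1, 0) with hGdef
  -- Half the radius suffices because |t| ≤ 2 at most doubles the radial coordinate.
  have hball : ∀ (u : ℝ) (x : E3) (δ : ℝ), ∀ t ∈ Set.Ioo (-2 : ℝ) 2,
      ∀ q ∈ Metric.ball ((u, 0, x) : Triple) (δ / 2),
      ((q.1, t * q.2.1, q.2.2) : Triple) ∈ Metric.ball ((u, 0, x) : Triple) δ := by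
    intro u x δ t ht q hq
    obtain ⟨v, ρ, y⟩ := q
    simp only [Metric.mem_ball, Prod.dist_eq, max_lt_iff, Real.dist_eq, sub_zero] at hq ⊢
    have hδ : 0 < δ := by linarith [abs_nonneg ρ, hq.2.1]
    refine ⟨by linarith [hq.1], ?_, by linarith [hq.2.2]⟩
    rw [abs_mul]
    have : |t| ≤ 2 := abs_le.2 ⟨ht.1.le, ht.2.le⟩
    nlinarith [abs_nonneg ρ, abs_nonneg t, hq.2.1]
  have hG : G ∈ scriSmooth := by
    intro u x hx
    rw [contDiffAt_infty]
    intro n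
    obtain ⟨s, hs, hFs⟩ := ((hF u x hx).of_le (m := ((n + 1 : ℕ) : WithTop ℕ∞))
      (by norm_cast; exact le_top)).contDiffOn le_rfl (by simp)
    obtain ⟨δ, hδ, hδs⟩ := Metric.mem_nhds_iff.1 hs
    have hF1 : ContDiffOn ℝ n (fderiv ℝ F) (Metric.ball ((u, 0, x) : Triple) δ) :=
      (hFs.mono hδs).fderiv_of_isOpen Metric.isOpen_ball (by norm_cast)
    have hm : ContDiff ℝ n fun p : ℝ × Triple => ((p.2.1, p.1 * p.2.2.1, p.2.2.2) : Triple) := by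
      fun_prop
    have hF2 : ContDiffOn ℝ n (Function.uncurry fun (t : ℝ) (q : Triple) =>
        fderiv ℝ F (q.1, t * q.2.1, q.2.2) (0, 1, 0))
        (Set.Ioo (-2) 2 ×ˢ Metric.ball ((u, 0, x) : Triple) (δ / 2)) := by
      have h1 := hF1.comp hm.contDiffOn (s := Set.Ioo (-2) 2 ×ˢ
        Metric.ball ((u, 0, x) : Triple) (δ / 2)) fun p hp => hball u x δ p.1 hp.1 p.2 hp.2
      exact h1.clm_apply contDiffOn_const
    exact (contDiffOn_parametric n Metric.isOpen_ball hF2).contDiffAt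
      (Metric.ball_mem_nhds _ (by positivity))
  refine ⟨toRing G hG, ?_⟩
  unfold rho
  rw [toRing_mul]
  refine toRing_eq_iff.2 fun u x hx => ?_
  obtain ⟨s, hs, hFs⟩ := ((hF u x hx).of_le (m := ((1 : ℕ) : WithTop ℕ∞))
    (by norm_cast)).contDiffOn le_rfl (by simp)
  obtain ⟨δ, hδ, hδs⟩ := Metric.mem_nhds_iff.1 hs
  have hFb := hFs.mono hδs
  have hF1 : ContinuousOn (fderiv ℝ F) (Metric.ball ((u, 0, x) : Triple) δ) :=
    hFb.continuousOn_fderiv_of_isOpen Metric.isOpen_ball (by norm_cast)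
  filter_upwards [Metric.ball_mem_nhds ((u, 0, x) : Triple) (half_pos hδ)] with q hq hfin
  have hder : ∀ t ∈ Set.uIcc (0 : ℝ) 1, HasDerivAt (fun t : ℝ => F (q.1, t * q.2.1, q.2.2))
      (q.2.1 * fderiv ℝ F (q.1, t * q.2.1, q.2.2) (0, 1, 0)) t := by
    intro t ht
    rw [Set.uIcc_of_le zero_le_one] at ht
    have hmem := hball u x δ t ⟨by linarith [ht.1], by linarith [ht.2]⟩ q hq
    have hd : HasFDerivAt F (fderiv ℝ F (q.1, t * q.2.1, q.2.2)) (q.1, t * q.2.1, q.2.2) :=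
      ((hFb.contDiffAt (Metric.isOpen_ball.mem_nhds hmem)).differentiableAt
        (by simp)).hasFDerivAt
    have hl : HasDerivAt (fun t : ℝ => ((q.1, t * q.2.1, q.2.2) : Triple)) (0, q.2.1, 0) t := by
      refine (hasDerivAt_const t _).prodMk (HasDerivAt.prodMk ?_ (hasDerivAt_const t _))
      simpa using (hasDerivAt_id t).mul_const q.2.1
    have := HasFDerivAt.comp_hasDerivAt (l := F) t hd hl
    have e : ((0, q.2.1, 0) : Triple) = q.2.1 • ((0, 1, 0) : Triple) := by simp
    rw [e, map_smul] at this
    exact this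
  have hci : IntervalIntegrable (fun t => q.2.1 * fderiv ℝ F (q.1, t * q.2.1, q.2.2) (0, 1, 0))
      volume 0 1 := by
    refine ContinuousOn.intervalIntegrable ?_
    rw [Set.uIcc_of_le zero_le_one]
    have hl : ContinuousOn (fun t : ℝ => ((q.1, t * q.2.1, q.2.2) : Triple)) (Set.Icc 0 1) := by
      fun_prop
    have := hF1.comp hl fun t ht =>
      hball u x δ t ⟨by linarith [ht.1], by linarith [ht.2]⟩ q hq
    exact continuousOn_const.mul (this.clm_apply continuousOn_const)
  have hI := intervalIntegral.integral_eq_sub_of_hasDerivAt hder hci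
  have h0 : F (q.1, 0, q.2.2) = 0 := by
    have := h q.1 q.2.2 hfin.2
    rwa [ev_toRing] at this
  simp only [one_mul, zero_mul, h0, sub_zero] at hI
  change F q = q.2.1 * G q
  rw [hGdef, ← intervalIntegral.integral_const_mul, hI]

/-! ### Orders of vanishing -/

/-- Equality on null infinity. -/
def ScriEq (v w : ℝ → E3 → ℝ) : Prop := ∀ (u : ℝ) (x : E3), ‖x‖ = 1 → v u x = w u x

theorem dU_rho_pow_mul (n : ℕ) (b : ScriRing) : dU (rho ^ n * b) = rho ^ n * dU b := by
  simp [Derivation.leibniz, Derivation.leibniz_pow]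

theorem dT_rho_pow_mul (i : Fin 3) (n : ℕ) (b : ScriRing) :
    dT i (rho ^ n * b) = rho ^ n * dT i b := by
  simp [Derivation.leibniz, Derivation.leibniz_pow]

/-- The derivative appears with the factor ρ² of the coordinate derivatives, which also avoids the
exponent n − 1 at n = 0. -/
theorem sq_mul_dR_rho_pow_mul (n : ℕ) (b : ScriRing) :
    rho ^ 2 * dR (rho ^ n * b) = rho ^ (n + 1) * (n * b + rho * dR b) := by
  simp only [Derivation.leibniz, Derivation.leibniz_pow, dR_rho, smul_eq_mul, nsmul_eq_mul, mul_one]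
  cases n with
  | zero => simp; ring
  | succ n => rw [Nat.add_sub_cancel]; push_cast; ring

theorem dC_succ_rho_pow_mul (i : Fin 3) (n : ℕ) (b : ScriRing) :
    dC i.succ (rho ^ n * b)
      = rho ^ (n + 1) * (dT i b - xc i * (n * b + rho * dR b)) := by
  rw [dC_succ, dT_rho_pow_mul, mul_right_comm, sq_mul_dR_rho_pow_mul]; ring

/-! ### Smooth functions on the sphere, tangential derivatives and integration by parts. -/

section

theorem sphereSmooth_iff {φ : E3 → ℝ} :
    SphereSmooth φ ↔ ∀ y : E3, y ≠ 0 → ContDiffAt ℝ ∞ (fun y : E3 => φ (‖y‖⁻¹ • y)) y :=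
  ⟨fun h y hy => (h y hy).contDiffAt (isOpen_ne.mem_nhds hy), fun h y hy => (h y hy).contDiffWithinAt⟩

theorem SphereSmooth.contDiffAt {φ : E3 → ℝ} (h : SphereSmooth φ) {y : E3} (hy : y ≠ 0) :
    ContDiffAt ℝ ∞ (fun y : E3 => φ (‖y‖⁻¹ • y)) y := sphereSmooth_iff.1 h y hy

theorem SphereSmooth.differentiableAt {φ : E3 → ℝ} (h : SphereSmooth φ) {y : E3} (hy : y ≠ 0) :
    DifferentiableAt ℝ (fun y : E3 => φ (‖y‖⁻¹ • y)) y := (h.contDiffAt hy).differentiableAt (by simp)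

attribute [fun_prop] SphereSmooth

theorem SphereSmooth.congr {φ ψ : E3 → ℝ} (h : SphereSmooth φ) (e : ∀ x : E3, ‖x‖ = 1 → ψ x = φ x) :
    SphereSmooth ψ :=
  ContDiffOn.congr h fun _ hy => e _ (norm_normalize hy)

@[fun_prop]
theorem sphereSmooth_const (c : ℝ) : SphereSmooth fun _ => c := contDiffOn_const

@[fun_prop]
theorem SphereSmooth.add {φ ψ : E3 → ℝ} (h : SphereSmooth φ) (h' : SphereSmooth ψ) :
    SphereSmooth fun x => φ x + ψ x := ContDiffOn.add h h'

@[fun_prop]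
theorem SphereSmooth.sub {φ ψ : E3 → ℝ} (h : SphereSmooth φ) (h' : SphereSmooth ψ) :
    SphereSmooth fun x => φ x - ψ x := ContDiffOn.sub h h'

@[fun_prop]
theorem SphereSmooth.mul {φ ψ : E3 → ℝ} (h : SphereSmooth φ) (h' : SphereSmooth ψ) :
    SphereSmooth fun x => φ x * ψ x := ContDiffOn.mul h h'

@[fun_prop]
theorem SphereSmooth.pow {φ : E3 → ℝ} (h : SphereSmooth φ) (n : ℕ) : SphereSmooth fun x => φ x ^ n :=
  ContDiffOn.pow h n

@[fun_prop]
theorem SphereSmooth.sum {ι : Type*} {s : Finset ι} {φ : ι → E3 → ℝ} (h : ∀ i, SphereSmooth (φ i)) :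
    SphereSmooth fun x => ∑ i ∈ s, φ i x := ContDiffOn.sum fun i _ => h i

theorem SphereSmooth.div {φ ψ : E3 → ℝ} (h : SphereSmooth φ) (h' : SphereSmooth ψ)
    (h0 : ∀ x : E3, ‖x‖ = 1 → ψ x ≠ 0) : SphereSmooth fun x => φ x / ψ x :=
  ContDiffOn.div h h' fun _ hy => h0 _ (norm_normalize hy)

@[fun_prop]
theorem sphereSmooth_coord (i : Fin 3) : SphereSmooth fun x : E3 => x i :=
  sphereSmooth_iff.2 fun y hy =>
    ContDiffAt.comp (g := fun x : E3 => x i) (f := fun y : E3 => ‖y‖⁻¹ • y) y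
      (EuclideanSpace.proj (𝕜 := ℝ) i).contDiff.contDiffAt (contDiffAt_normalize hy)

@[fun_prop]
theorem sphereSmooth_roundMetric (i j : Fin 3) : SphereSmooth fun x => roundMetric x i j := by
  unfold roundMetric; fun_prop

theorem tderiv_congr {φ ψ : E3 → ℝ} (e : ∀ x : E3, ‖x‖ = 1 → φ x = ψ x) (i : Fin 3) {x : E3}
    (hx : ‖x‖ = 1) : tderiv i φ x = tderiv i ψ x := by
  have : (fun y : E3 => φ (‖y‖⁻¹ • y)) =ᶠ[𝓝 x] fun y : E3 => ψ (‖y‖⁻¹ • y) := by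
    filter_upwards [isOpen_ne.mem_nhds (ne_zero_of_unit hx)] with y hy using e _ (norm_normalize hy)
  unfold tderiv
  rw [this.fderiv_eq]

/-- The homogeneous extension of degree zero has a homogeneous derivative. -/
theorem tderiv_normalize (i : Fin 3) (φ : E3 → ℝ) {y : E3} (hy : y ≠ 0) :
    tderiv i φ (‖y‖⁻¹ • y) =
      ‖y‖ * fderiv ℝ (fun y : E3 => φ (‖y‖⁻¹ • y)) y (EuclideanSpace.single i 1) := by
  set G := fun y : E3 => φ (‖y‖⁻¹ • y)
  have hn : 0 < ‖y‖ := norm_pos_iff.2 hy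
  have h := fderiv_comp_smul (f := G) (x := y) ‖y‖⁻¹
  have hG : (fun z => G (‖y‖⁻¹ • z)) = G := by
    funext z
    simp only [G, norm_smul, norm_inv, norm_norm, smul_smul]
    congr 2
    field_simp
  rw [hG] at h
  change fderiv ℝ G (‖y‖⁻¹ • y) _ = _
  rw [h]
  simp [hn.ne']

@[fun_prop]
theorem SphereSmooth.tderiv {φ : E3 → ℝ} (h : SphereSmooth φ) (i : Fin 3) :
    SphereSmooth fun x => BondiSachs.tderiv i φ x := by
  refine sphereSmooth_iff.2 fun y hy => ?_
  have h1 : ContDiffAt ℝ ∞ (fun y : E3 => ‖y‖ * fderiv ℝ (fun y : E3 => φ (‖y‖⁻¹ • y)) y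
      (EuclideanSpace.single i 1)) y :=
    (contDiffAt_norm ℝ hy).mul (((h.contDiffAt hy).fderiv_right (m := ∞) (by simp)).clm_apply
      contDiffAt_const)
  refine h1.congr_of_eventuallyEq ?_
  filter_upwards [isOpen_ne.mem_nhds hy] with z hz using tderiv_normalize i φ hz

theorem ScriFun.sphereSmooth {v : ℝ → E3 → ℝ} (h : ScriFun v) (u : ℝ) : SphereSmooth (v u) :=
  sphereSmooth_iff.2 fun y hy => ContDiffAt.comp
    (g := fun p : ℝ × E3 => v p.1 (‖p.2‖⁻¹ • p.2)) (f := fun y : E3 => (u, y)) y (h u y hy)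
    (contDiffAt_const.prodMk contDiffAt_id)

variable {φ ψ : E3 → ℝ} {x : E3}

theorem tderiv_add (i : Fin 3) (h : SphereSmooth φ) (h' : SphereSmooth ψ) (hx : ‖x‖ = 1) :
    tderiv i (fun x => φ x + ψ x) x = tderiv i φ x + tderiv i ψ x := by
  unfold tderiv
  rw [fderiv_fun_add (h.differentiableAt (ne_zero_of_unit hx)) (h'.differentiableAt
    (ne_zero_of_unit hx))]; rfl

theorem tderiv_sub (i : Fin 3) (h : SphereSmooth φ) (h' : SphereSmooth ψ) (hx : ‖x‖ = 1) :
    tderiv i (fun x => φ x - ψ x) x = tderiv i φ x - tderiv i ψ x := by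
  unfold tderiv
  rw [fderiv_fun_sub (h.differentiableAt (ne_zero_of_unit hx)) (h'.differentiableAt
    (ne_zero_of_unit hx))]; rfl

theorem tderiv_mul (i : Fin 3) (h : SphereSmooth φ) (h' : SphereSmooth ψ) (hx : ‖x‖ = 1) :
    tderiv i (fun x => φ x * ψ x) x = φ x * tderiv i ψ x + ψ x * tderiv i φ x := by
  unfold tderiv
  rw [fderiv_fun_mul (h.differentiableAt (ne_zero_of_unit hx)) (h'.differentiableAt
    (ne_zero_of_unit hx))]
  simp [normalize_of_unit hx]

theorem tderiv_const (i : Fin 3) (c : ℝ) : tderiv i (fun _ => c) x = 0 := by simp [tderiv]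

theorem tderiv_const_mul (i : Fin 3) (c : ℝ) (h : SphereSmooth φ) (hx : ‖x‖ = 1) :
    tderiv i (fun x => c * φ x) x = c * tderiv i φ x := by
  rw [tderiv_mul i (sphereSmooth_const c) h hx, tderiv_const]; ring

theorem tderiv_neg (i : Fin 3) : tderiv i (fun x => -φ x) x = -tderiv i φ x := by
  unfold tderiv
  rw [fderiv_fun_neg]; rfl

theorem tderiv_sum {ι : Type*} (i : Fin 3) {s : Finset ι} {φ : ι → E3 → ℝ}
    (h : ∀ k, SphereSmooth (φ k)) (hx : ‖x‖ = 1) :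
    tderiv i (fun x => ∑ k ∈ s, φ k x) x = ∑ k ∈ s, tderiv i (φ k) x := by
  unfold tderiv
  rw [fderiv_fun_sum fun k _ => (h k).differentiableAt (ne_zero_of_unit hx)]
  simp

/-- The derivative along the sphere of a function differentiable on a neighbourhood. -/
theorem tderiv_of_hasFDerivAt (i : Fin 3) {L : E3 →L[ℝ] ℝ} (h : HasFDerivAt φ L x) (hx : ‖x‖ = 1) :
    tderiv i φ x = L (EuclideanSpace.single i 1) - x i * L x := by
  have h' : HasFDerivAt φ L (‖x‖⁻¹ • x) := by rwa [normalize_of_unit hx]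
  have := (HasFDerivAt.comp (g := φ) (f := fun y : E3 => ‖y‖⁻¹ • y) x h'
    (hasFDerivAt_normalize (ne_zero_of_unit hx))).fderiv
  unfold tderiv
  change fderiv ℝ (φ ∘ fun y : E3 => ‖y‖⁻¹ • y) x _ = _
  rw [this]
  have hi : inner ℝ x (EuclideanSpace.single i (1 : ℝ)) = x i := by
    rw [EuclideanSpace.inner_single_right]; simp
  simp [hx, hi]

theorem tderiv_coord (i j : Fin 3) (hx : ‖x‖ = 1) :
    tderiv i (fun x : E3 => x j) x = roundMetric x i j := by
  have h : HasFDerivAt (fun x : E3 => x j) (EuclideanSpace.proj (𝕜 := ℝ) j : E3 →L[ℝ] ℝ) x :=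
    (EuclideanSpace.proj (𝕜 := ℝ) j : E3 →L[ℝ] ℝ).hasFDerivAt
  rw [tderiv_of_hasFDerivAt i h hx]
  simp [roundMetric, eq_comm]

theorem sum_x_sq (hx : ‖x‖ = 1) : x 0 * x 0 + x 1 * x 1 + x 2 * x 2 = 1 := by
  have := EuclideanSpace.norm_sq_eq x
  rw [hx, Fin.sum_univ_three] at this
  simp only [Real.norm_eq_abs, sq_abs] at this
  linarith

/-- The homogeneous extension of degree zero is constant along rays. -/
theorem sum_x_tderiv (h : SphereSmooth φ) (hx : ‖x‖ = 1) : ∑ i, x i * tderiv i φ x = 0 := by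
  have hd := (h.differentiableAt (ne_zero_of_unit hx)).hasFDerivAt
  have hl : HasDerivAt (fun s : ℝ => s • x) x 1 := by
    simpa using (hasDerivAt_id (1 : ℝ)).smul_const x
  have hd' : HasFDerivAt (fun y : E3 => φ (‖y‖⁻¹ • y))
      (fderiv ℝ (fun y : E3 => φ (‖y‖⁻¹ • y)) x) ((1 : ℝ) • x) := by
    rw [one_smul]; exact hd
  have h1 := HasFDerivAt.comp_hasDerivAt (1 : ℝ) hd' hl
  have h2 : ((fun y : E3 => φ (‖y‖⁻¹ • y)) ∘ fun s : ℝ => s • x) =ᶠ[𝓝 1] fun _ => φ x := by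
    filter_upwards [isOpen_Ioi.mem_nhds (show (0 : ℝ) < 1 by norm_num)] with s hs
    have hs' : (0 : ℝ) < s := hs
    simp [norm_smul, hx, abs_of_pos hs', smul_smul, hs'.ne']
  have h3 := (h1.congr_of_eventuallyEq h2.symm).unique (hasDerivAt_const _ _)
  have hb : x = ∑ i, x i • EuclideanSpace.single i (1 : ℝ) := by
    ext j; fin_cases j <;> simp [Fin.sum_univ_three]
  unfold tderiv
  have h4 : fderiv ℝ (fun y : E3 => φ (‖y‖⁻¹ • y)) x (∑ i, x i • EuclideanSpace.single i (1 : ℝ))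
      = 0 := by rw [← hb]; exact h3
  rw [map_sum] at h4
  simpa using h4

/-! ### Integration over the sphere -/

theorem SphereSmooth.continuous_coe (h : SphereSmooth φ) :
    Continuous fun x : Metric.sphere (0 : E3) 1 => φ x := by
  rw [continuous_iff_continuousAt]
  intro x
  have hx : ‖(x : E3)‖ = 1 := by simp
  have h1 : ContinuousAt ((fun y : E3 => φ (‖y‖⁻¹ • y)) ∘ fun x : Metric.sphere (0 : E3) 1 => (x : E3)) x :=
    ContinuousAt.comp (h.contDiffAt (ne_zero_of_unit hx)).continuousAt
      continuous_subtype_val.continuousAt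
  refine h1.congr (Filter.Eventually.of_forall fun z => ?_)
  have hz : ‖(z : E3)‖ = 1 := by simp
  simp [hz]

theorem SphereSmooth.integrable (h : SphereSmooth φ) :
    Integrable (fun x : Metric.sphere (0 : E3) 1 => φ x) ((volume : Measure E3).toSphere) :=
  h.continuous_coe.integrable_of_hasCompactSupport (HasCompactSupport.of_compactSpace _)

theorem sphereIntegral_congr (e : ∀ x : E3, ‖x‖ = 1 → φ x = ψ x) :
    sphereIntegral φ = sphereIntegral ψ :=
  integral_congr_ae (Eventually.of_forall fun x => e x (by simp))

theorem sphereIntegral_add (h : SphereSmooth φ) (h' : SphereSmooth ψ) :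
    sphereIntegral (fun x => φ x + ψ x) = sphereIntegral φ + sphereIntegral ψ :=
  integral_add h.integrable h'.integrable

theorem sphereIntegral_sub (h : SphereSmooth φ) (h' : SphereSmooth ψ) :
    sphereIntegral (fun x => φ x - ψ x) = sphereIntegral φ - sphereIntegral ψ :=
  integral_sub h.integrable h'.integrable

theorem sphereIntegral_const_mul (c : ℝ) (φ : E3 → ℝ) :
    sphereIntegral (fun x => c * φ x) = c * sphereIntegral φ := integral_const_mul _ _

theorem sphereIntegral_sum {ι : Type*} {s : Finset ι} {φ : ι → E3 → ℝ} (h : ∀ i, SphereSmooth (φ i)) :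
    sphereIntegral (fun x => ∑ i ∈ s, φ i x) = ∑ i ∈ s, sphereIntegral (φ i) :=
  integral_finsetSum _ fun i _ => (h i).integrable

theorem sphereIntegral_one_pos : 0 < sphereIntegral fun _ => 1 := by
  unfold sphereIntegral
  simp only [integral_const, smul_eq_mul, mul_one]
  rw [Measure.toSphere_real_apply_univ]
  have : 0 < (volume : Measure E3).real (Metric.ball 0 1) :=
    ENNReal.toReal_pos (Metric.measure_ball_pos _ _ one_pos).ne' measure_ball_lt_top.ne
  simp only [finrank_euclideanSpace_fin]
  positivity

/-- Integration in polar coordinates of a product of a radial and an angular function. -/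
theorem integral_radial_mul (a : ℝ → ℝ) (φ : E3 → ℝ) :
    ∫ y : E3, a ‖y‖ * φ (‖y‖⁻¹ • y) = (∫ r in Set.Ioi (0 : ℝ), r ^ 2 * a r) * sphereIntegral φ := by
  have hf : Module.finrank ℝ E3 = 3 := by simp
  calc ∫ y : E3, a ‖y‖ * φ (‖y‖⁻¹ • y)
      = ∫ y : ({(0 : E3)}ᶜ : Set E3), a ‖y.1‖ * φ (‖y.1‖⁻¹ • y.1) ∂(Measure.comap Subtype.val (volume : Measure E3)) := by
        rw [integral_subtype_comap (measurableSet_singleton _).compl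
          fun y : E3 => a ‖y‖ * φ (‖y‖⁻¹ • y), restrict_compl_singleton]
    _ = ∫ p : Metric.sphere (0 : E3) 1 × Set.Ioi (0 : ℝ), φ p.1 * a p.2 ∂(volume : Measure E3).toSphere.prod
          (.volumeIoiPow (Module.finrank ℝ E3 - 1)) := by
        rw [← (volume : Measure E3).measurePreserving_homeomorphUnitSphereProd.integral_comp
          (Homeomorph.measurableEmbedding _)]
        exact integral_congr_ae (Eventually.of_forall fun y => by
          simp [homeomorphUnitSphereProd, mul_comm])
    _ = sphereIntegral φ * ∫ r : Set.Ioi (0 : ℝ), a r ∂.volumeIoiPow (Module.finrank ℝ E3 - 1) :=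
        integral_prod_mul (fun x : Metric.sphere (0 : E3) 1 => φ x) fun r : Set.Ioi (0 : ℝ) => a r
    _ = _ := by
        rw [mul_comm, hf]
        congr 1
        simp only [Measure.volumeIoiPow, ENNReal.ofReal]
        rw [integral_withDensity_eq_integral_smul,
          integral_subtype_comap measurableSet_Ioi fun r : ℝ => Real.toNNReal (r ^ (3 - 1)) • a r,
          setIntegral_congr_fun measurableSet_Ioi fun r hr => ?_]
        · rw [NNReal.smul_def, Real.coe_toNNReal _ (pow_nonneg (le_of_lt hr) _)]; rfl
        · exact (measurable_subtype_coe.pow_const _).real_toNNReal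

theorem continuous_radial_mul {a : ℝ → ℝ} (ha : ContinuousOn a (Set.Ioi 0))
    (h1 : ∀ r ∉ Set.Icc (1 : ℝ) 3, a r = 0) (h : SphereSmooth φ) :
    Continuous fun y : E3 => a ‖y‖ * φ (‖y‖⁻¹ • y) := by
  rw [continuous_iff_continuousAt]
  intro y
  by_cases hy : y = 0
  · have : (fun y : E3 => a ‖y‖ * φ (‖y‖⁻¹ • y)) =ᶠ[𝓝 y] fun _ => 0 := by
      filter_upwards [continuous_norm.continuousAt.eventually_lt_const
        (show ‖y‖ < 1 by simp [hy])] with z hz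
      rw [h1 _ fun hz' => absurd hz'.1 (not_le.2 hz), zero_mul]
    exact continuousAt_const.congr this.symm
  · exact ((ha.continuousAt (isOpen_Ioi.mem_nhds (norm_pos_iff.2 hy))).comp
      continuous_norm.continuousAt).mul (h.contDiffAt hy).continuousAt

theorem integrable_radial_mul {a : ℝ → ℝ} (ha : ContinuousOn a (Set.Ioi 0))
    (h1 : ∀ r ∉ Set.Icc (1 : ℝ) 3, a r = 0) (h : SphereSmooth φ) :
    Integrable (fun y : E3 => a ‖y‖ * φ (‖y‖⁻¹ • y)) := by
  refine (continuous_radial_mul ha h1 h).integrable_of_hasCompactSupport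
    (HasCompactSupport.intro (isCompact_closedBall (0 : E3) 3) fun y hy => ?_)
  rw [h1 _ fun hz' => hy (by simpa using hz'.2), zero_mul]

/-- The support lies in a shell away from the origin, where the degree-zero extension of a function
on the sphere is smooth. The positive integral is the constant divided by in the divergence theorem.
-/
theorem exists_bump : ∃ χ : ℝ → ℝ, ContDiff ℝ ∞ χ ∧ (∀ r ∉ Set.Icc (1 : ℝ) 3, χ r = 0) ∧
    (∀ r ∉ Set.Icc (1 : ℝ) 3, deriv χ r = 0) ∧ 0 < ∫ r in Set.Ioi (0 : ℝ), r ^ 2 * (χ r / r) := by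
  let b : ContDiffBump (2 : ℝ) := ⟨1 / 2, 1, by norm_num, by norm_num⟩
  have h0 : ∀ r ∉ Set.Icc (1 : ℝ) 3, b r = 0 := fun r hr =>
    b.zero_of_le_dist (by
      rw [Real.dist_eq]; by_contra! h
      rw [abs_lt] at h
      change -1 < r - 2 ∧ r - 2 < 1 at h
      exact hr ⟨by linarith [h.1], by linarith [h.2]⟩)
  refine ⟨b, b.contDiff, h0, fun r hr => ?_, ?_⟩
  · have : (b : ℝ → ℝ) =ᶠ[𝓝 r] fun _ => 0 := by
      filter_upwards [isClosed_Icc.isOpen_compl.mem_nhds hr] with s hs using h0 s hs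
    rw [this.deriv_eq]; simp
  · have e : ∀ r ∈ Set.Ioi (0 : ℝ), r ^ 2 * (b r / r) = r * b r := fun r hr => by
      have : r ≠ 0 := ne_of_gt hr
      field_simp
    rw [setIntegral_congr_fun measurableSet_Ioi e]
    have hc : Continuous fun r : ℝ => r * b r := continuous_id.mul b.continuous
    have hi : Integrable fun r : ℝ => r * b r :=
      hc.integrable_of_hasCompactSupport (HasCompactSupport.intro isCompact_Icc fun r hr => by
        rw [h0 r hr, mul_zero])
    rw [setIntegral_pos_iff_support_of_nonneg_ae
      ((ae_restrict_iff' measurableSet_Ioi).2 (Eventually.of_forall fun r hr =>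
        mul_nonneg (le_of_lt hr) b.nonneg)) hi.integrableOn]
    refine lt_of_lt_of_le ?_ (measure_mono (show Set.Ioo (1 : ℝ) 3 ⊆ _ from fun r hr =>
      ⟨?_, show (0 : ℝ) < r by linarith [hr.1]⟩))
    · simp
    · have : 0 < b r := b.pos_of_mem_ball (by
        rw [Metric.mem_ball, Real.dist_eq, abs_lt]
        change -1 < r - 2 ∧ r - 2 < 1
        exact ⟨by linarith [hr.1], by linarith [hr.2]⟩)
      have h2 : 0 < r := by linarith [hr.1]
      exact (mul_pos h2 this).ne'

/-- The divergence theorem on the unit sphere of `ℝ³`. -/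
theorem sphereIntegral_tderiv (h : SphereSmooth φ) (i : Fin 3) :
    sphereIntegral (fun x => tderiv i φ x) = 2 * sphereIntegral fun x => x i * φ x := by
  obtain ⟨χ, hχ, h0, h0', hB⟩ := exists_bump
  set A := ∫ r in Set.Ioi (0 : ℝ), r ^ 2 * deriv χ r
  set B := ∫ r in Set.Ioi (0 : ℝ), r ^ 2 * (χ r / r)
  have hcd : ContinuousOn (deriv χ) (Set.Ioi 0) := (hχ.continuous_deriv (by simp)).continuousOn
  have hcq : ContinuousOn (fun r => χ r / r) (Set.Ioi 0) :=
    hχ.continuous.continuousOn.div continuousOn_id fun r hr => ne_of_gt hr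
  -- The integral over ℝ³ of a partial derivative of χ(|y|) φ(y/|y|) is zero; polar coordinates
  -- split it into a radial and a tangential contribution.
  have key : ∀ {φ : E3 → ℝ}, SphereSmooth φ → ∀ i,
      A * sphereIntegral (fun x => x i * φ x) + B * sphereIntegral (fun x => tderiv i φ x) = 0 := by
    intro φ h i
    set F := fun y : E3 => χ ‖y‖ * φ (‖y‖⁻¹ • y)
    have hF : ∀ y, HasFDerivAt F (fderiv ℝ F y) y ∧ fderiv ℝ F y (EuclideanSpace.single i 1) =
        deriv χ ‖y‖ * ((‖y‖⁻¹ • y) i * φ (‖y‖⁻¹ • y))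
          + χ ‖y‖ / ‖y‖ * tderiv i φ (‖y‖⁻¹ • y) := by
      intro y
      by_cases hy : y = 0
      · have : F =ᶠ[𝓝 y] fun _ => 0 := by
          filter_upwards [continuous_norm.continuousAt.eventually_lt_const
            (show ‖y‖ < 1 by simp [hy])] with z hz
          simp only [F]
          rw [h0 _ fun hz' => absurd hz'.1 (not_le.2 hz), zero_mul]
        have h1 : HasFDerivAt F (0 : E3 →L[ℝ] ℝ) y :=
          (hasFDerivAt_const (0 : ℝ) y).congr_of_eventuallyEq this
        refine ⟨h1.differentiableAt.hasFDerivAt, ?_⟩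
        rw [h1.fderiv]
        have e0 : χ 0 = 0 := h0 _ (by simp)
        have e1 : deriv χ 0 = 0 := h0' _ (by simp)
        simp [hy, e1]
      · have h1 : HasFDerivAt (fun z : E3 => ‖z‖) (innerSL ℝ (‖y‖⁻¹ • y)) y := by
          have h2 := (hasFDerivAt_norm_inv hy)
          have hn : ‖y‖⁻¹ ≠ 0 := inv_ne_zero (norm_ne_zero_iff.2 hy)
          have h3 := (hasDerivAt_inv hn).comp_hasFDerivAt y h2
          have e : (Inv.inv ∘ fun z : E3 => ‖z‖⁻¹) = fun z => ‖z‖ := by funext z; simp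
          rw [e] at h3
          refine h3.congr_fderiv ?_
          ext v
          simp
          field_simp
        have h2 : HasDerivAt χ (deriv χ ‖y‖) ‖y‖ :=
          (hχ.differentiable (by simp)).differentiableAt.hasDerivAt
        have h3 := (h2.comp_hasFDerivAt y h1).mul (h.differentiableAt hy).hasFDerivAt
        have h4 : HasFDerivAt F _ y := h3
        refine ⟨h4.differentiableAt.hasFDerivAt, ?_⟩
        rw [h4.fderiv, tderiv_normalize i φ hy]
        have hi : inner ℝ y (EuclideanSpace.single i (1 : ℝ)) = y i := by
          rw [EuclideanSpace.inner_single_right]; simp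
        have hn : ‖y‖ ≠ 0 := norm_ne_zero_iff.2 hy
        simp [hi]
        field_simp
        ring
    have hi1 := integrable_radial_mul hcd h0' ((sphereSmooth_coord i).mul h)
    have hi2 := integrable_radial_mul hcq (fun r hr => by simp [h0 r hr]) (h.tderiv i)
    have hiF : Integrable F := integrable_radial_mul hχ.continuous.continuousOn h0 h
    have hid : Integrable fun y => fderiv ℝ F y (EuclideanSpace.single i 1) := by
      refine (hi1.add hi2).congr (Eventually.of_forall fun y => ?_)
      exact (hF y).2.symm
    have hz := integral_mul_fderiv_eq_neg_fderiv_mul_of_integrable (μ := (volume : Measure E3))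
      (f := fun _ : E3 => (1 : ℝ)) (g := F) (v := EuclideanSpace.single i 1) (by simp)
      (by simpa using hid) (by simpa using hiF) (by fun_prop)
      (fun y _ => (hF y).1.differentiableAt)
    simp only [one_mul, fderiv_fun_const, Pi.zero_apply, zero_apply, zero_mul,
      integral_zero, neg_zero] at hz
    rw [integral_congr_ae (Eventually.of_forall fun y => (hF y).2)] at hz
    rw [integral_add hi1 hi2] at hz
    rw [integral_radial_mul (deriv χ) fun x => x i * φ x,
      integral_radial_mul (fun r => χ r / r) fun x => tderiv i φ x] at hz
    exact hz
  -- The ratio of the two radial constants is read off from the relation itself, tested with the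
  -- coordinate functions: ∑ x_i² = 1 and ∑ ∂_i x_i = 2. No integration by parts in r is needed.
  have hA : A = -2 * B := by
    have h3 := fun i => key (sphereSmooth_coord i) i
    have e1 : ∑ i : Fin 3, sphereIntegral (fun x => x i * x i) = sphereIntegral fun _ => 1 := by
      rw [← sphereIntegral_sum fun i => by fun_prop]
      exact sphereIntegral_congr fun x hx => by rw [Fin.sum_univ_three]; exact sum_x_sq hx
    have e2 : ∑ i : Fin 3, sphereIntegral (fun x => tderiv i (fun x : E3 => x i) x)
        = 2 * sphereIntegral fun _ => 1 := by
      rw [← sphereIntegral_const_mul, ← sphereIntegral_sum fun i => by fun_prop]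
      refine sphereIntegral_congr fun x hx => ?_
      simp only [tderiv_coord _ _ hx, Fin.sum_univ_three, roundMetric]
      have := sum_x_sq hx
      norm_num
      linarith
    have h4 : A * (sphereIntegral fun _ => 1) + B * (2 * sphereIntegral fun _ => 1) = 0 := by
      rw [← e2, ← e1, Finset.mul_sum, Finset.mul_sum, ← Finset.sum_add_distrib]
      exact Finset.sum_eq_zero fun i _ => h3 i
    have h5 := sphereIntegral_one_pos
    have : (A + 2 * B) * (sphereIntegral fun _ => 1) = 0 := by linarith
    rcases mul_eq_zero.1 this with h | h <;> linarith
  have := key h i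
  rw [hA] at this
  have hBne : B ≠ 0 := hB.ne'
  have h6 : B * (sphereIntegral (fun x => tderiv i φ x) - 2 * sphereIntegral fun x => x i * φ x) = 0 := by
    linarith
  rcases mul_eq_zero.1 h6 with h | h
  · exact absurd h hBne
  · linarith

/-- Integration by parts on the sphere. -/
theorem sphereIntegral_mul_tderiv (h : SphereSmooth φ) (h' : SphereSmooth ψ) (i : Fin 3) :
    sphereIntegral (fun x => φ x * tderiv i ψ x) =
      2 * sphereIntegral (fun x => x i * (φ x * ψ x)) - sphereIntegral fun x => ψ x * tderiv i φ x := by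
  rw [← sphereIntegral_tderiv (h.mul h') i, ← sphereIntegral_sub (by fun_prop) (by fun_prop)]
  exact sphereIntegral_congr fun x hx => by rw [tderiv_mul i h h' hx]; ring

/-- The commutator of derivatives along the sphere. -/
theorem tderiv_comm (h : SphereSmooth φ) (hx : ‖x‖ = 1) (i j : Fin 3) :
    tderiv i (tderiv j φ) x - tderiv j (tderiv i φ) x = x i * tderiv j φ x - x j * tderiv i φ x := by
  have hx0 := ne_zero_of_unit hx
  set G := fun y : E3 => φ (‖y‖⁻¹ • y) with hG
  have h2 : ContDiffAt ℝ 2 G x := (h.contDiffAt hx0).of_le (by norm_cast)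
  have hs := h2.isSymmSndFDerivAt (by simp)
  have hd : DifferentiableAt ℝ (fderiv ℝ G) x :=
    (h2.fderiv_right (m := 1) (by norm_num)).differentiableAt (by simp)
  have hn : HasFDerivAt (fun z : E3 => ‖z‖) (innerSL ℝ (‖x‖⁻¹ • x)) x := by
    have hnx : ‖x‖⁻¹ ≠ 0 := by simp [hx]
    have h3 := (hasDerivAt_inv hnx).comp_hasFDerivAt x (hasFDerivAt_norm_inv hx0)
    have e : (Inv.inv ∘ fun z : E3 => ‖z‖⁻¹) = fun z => ‖z‖ := by funext z; simp
    rw [e] at h3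
    refine h3.congr_fderiv ?_
    ext v
    simp [hx]
  -- A tangential derivative extends to the ambient derivative times ‖y‖, which restores degree
  -- zero. Differentiating this factor is the only source of the commutator.
  have key : ∀ i j, tderiv i (tderiv j φ) x = x i * tderiv j φ x
      + fderiv ℝ (fderiv ℝ G) x (EuclideanSpace.single i 1) (EuclideanSpace.single j 1) := by
    intro i j
    have e : (fun y : E3 => tderiv j φ (‖y‖⁻¹ • y)) =ᶠ[𝓝 x]
        fun y => ‖y‖ * fderiv ℝ G y (EuclideanSpace.single j 1) := by
      filter_upwards [isOpen_ne.mem_nhds hx0] with z hz using tderiv_normalize j φ hz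
    conv_lhs => unfold tderiv
    change fderiv ℝ (fun y : E3 => tderiv j φ (‖y‖⁻¹ • y)) x _ = _
    have hi : inner ℝ x (EuclideanSpace.single i (1 : ℝ)) = x i := by
      rw [EuclideanSpace.inner_single_right]; simp
    have h3 : HasFDerivAt (fun y => ‖y‖ * fderiv ℝ G y (EuclideanSpace.single j 1)) _ x :=
      hn.mul (hd.hasFDerivAt.clm_apply (hasFDerivAt_const (EuclideanSpace.single j 1) x))
    rw [e.fderiv_eq, h3.fderiv]
    simp [hx, hi, BondiSachs.tderiv]
    ring
  rw [key, key, hs]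
  ring

end

section

/-! ### Exact identities in the ring -/

/-- The radial derivative `∂_r`. -/
def Dr (a : ScriRing) : ScriRing := -(rho ^ 2 * dR a)

@[simp] theorem dC_zero_rho : dC 0 rho = 0 := dU_rho
@[simp] theorem dC_zero_xc (i : Fin 3) : dC 0 (xc i) = 0 := dU_xc i
theorem dC_succ_rho (i : Fin 3) : dC i.succ rho = -(rho ^ 2 * xc i) := by simp [dC_succ]
theorem dC_succ_xc (i j : Fin 3) :
    dC i.succ (xc j) = rho * ((if i = j then 1 else 0) - xc i * xc j) := by simp [dC_succ]

theorem sum_xc_dT (a : ScriRing) : ∑ i, xc i * dT i a = 0 := by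
  obtain ⟨F, hF, rfl⟩ := toRing_surjective a
  unfold dT xc
  simp only [Fin.sum_univ_three, tanDer_toRing, toRing_mul, toRing_add]
  rw [← map_zero (algebraMap ℝ ScriRing), algebraMap_eq]
  refine toRing_eq_iff.2 fun u x hx => Eventually.of_forall fun q hq => ?_
  have hx2 : q.2.2 0 * q.2.2 0 + q.2.2 1 * q.2.2 1 + q.2.2 2 * q.2.2 2 = 1 := by
    have := hq.2
    rw [EuclideanSpace.norm_eq, Real.sqrt_eq_one, Fin.sum_univ_three] at this
    simp only [Real.norm_eq_abs, sq_abs] at this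
    linarith
  have h : ∀ i, q.2.2 i * tanD (0, 0, EuclideanSpace.single i 1) F q
      = fderiv ℝ F q (q.2.2 i • tang (0, 0, EuclideanSpace.single i 1) q) := fun i => by
    rw [map_smul]; rfl
  change q.2.2 0 * tanD (0, 0, EuclideanSpace.single 0 1) F q
    + q.2.2 1 * tanD (0, 0, EuclideanSpace.single 1 1) F q
    + q.2.2 2 * tanD (0, 0, EuclideanSpace.single 2 1) F q = 0
  rw [h, h, h, ← map_add, ← map_add]
  have : q.2.2 0 • tang (0, 0, EuclideanSpace.single 0 1) q
      + q.2.2 1 • tang (0, 0, EuclideanSpace.single 1 1) q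
      + q.2.2 2 • tang (0, 0, EuclideanSpace.single 2 1) q = 0 := by
    refine Prod.ext (by simp [tang]) (Prod.ext (by simp [tang]) ?_)
    ext i
    simp only [tang, EuclideanSpace.inner_single_right, conj_trivial, one_mul]
    fin_cases i <;> simp
    · linear_combination (-(q.2.2 0)) * hx2
    · linear_combination (-(q.2.2 1)) * hx2
    · linear_combination (-(q.2.2 2)) * hx2
  rw [this, map_zero]

theorem sum_sq : xc 0 * xc 0 + xc 1 * xc 1 + xc 2 * xc 2 = 1 := by
  have := sum_xc_mul_xc
  rwa [Fin.sum_univ_three] at this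

theorem sum_xc_dC (a : ScriRing) : ∑ i : Fin 3, xc i * dC i.succ a = Dr a := by
  have h1 := sum_xc_dT a
  have h2 := sum_sq
  simp only [Fin.sum_univ_three, dC_succ, Dr] at h1 ⊢
  linear_combination rho * h1 - rho ^ 2 * dR a * h2

/-- The coefficients of a Bondi–Sachs metric as elements of the ring; `Ui = U⁻¹`, and the angular
shift is `ρ² W`. -/
structure Fields where
  U : ScriRing
  Ui : ScriRing
  V : ScriRing
  W : Fin 3 → ScriRing
  h : Fin 3 → Fin 3 → ScriRing
  U_mul : U * Ui = 1
  x_W : ∑ i, xc i * W i = 0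
  h_symm : ∀ i j, h i j = h j i
  h_x : ∀ i, ∑ j, h i j * xc j = 0
  h_det : (Matrix.of fun i j => h i j + xc i * xc j).det = 1

namespace Fields

variable (B : Fields)

/-- The inverse of `h` on the tangent plane. -/
def k (i j : Fin 3) : ScriRing :=
  (Matrix.of fun i j => B.h i j + xc i * xc j).adjugate i j - xc i * xc j

/-- `w_i = r (h W)_i / ρ`. -/
def w (i : Fin 3) : ScriRing := ∑ j, B.h i j * B.W j

/-- The component `g_{0i}`. -/
def b (i : Fin 3) : ScriRing := -(B.U * xc i) + rho * B.w i

/-- The component `g_{00}`. -/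
def φ : ScriRing := -(B.U * B.V) + rho ^ 2 * ∑ i, B.W i * B.w i

/-- The metric in the coordinates `(u, y)`. -/
def g : Fin 4 → Fin 4 → ScriRing :=
  fun μ ν => Fin.cases (Fin.cases B.φ B.b ν) (fun i => Fin.cases (B.b i) (fun j => B.h i j) ν) μ

/-- The inverse metric. -/
def gi : Fin 4 → Fin 4 → ScriRing :=
  fun μ ν => Fin.cases (Fin.cases 0 (fun i => -(B.Ui * xc i)) ν)
    (fun i => Fin.cases (-(B.Ui * xc i)) (fun j => B.Ui * B.V * (xc i * xc j)
      + B.Ui * rho * (B.W i * xc j + xc i * B.W j) + B.k i j) ν) μ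

/-- Twice the Christoffel symbols. -/
def G (l μ ν : Fin 4) : ScriRing :=
  ∑ s, B.gi l s * (dC μ (B.g s ν) + dC ν (B.g s μ) - dC s (B.g μ ν))

/-- Four times the Ricci tensor. -/
def ric (μ ν : Fin 4) : ScriRing :=
  ∑ l, 2 * (dC l (B.G l μ ν) - dC ν (B.G l μ l))
    + ∑ l, ∑ s, (B.G l l s * B.G s μ ν - B.G l ν s * B.G s μ l)

@[simp] theorem g_zero_zero : B.g 0 0 = B.φ := rfl
@[simp] theorem g_zero_succ (i : Fin 3) : B.g 0 i.succ = B.b i := rfl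
@[simp] theorem g_succ_zero (i : Fin 3) : B.g i.succ 0 = B.b i := rfl
@[simp] theorem g_succ_succ (i j : Fin 3) : B.g i.succ j.succ = B.h i j := rfl
@[simp] theorem gi_zero_zero : B.gi 0 0 = 0 := rfl
@[simp] theorem gi_zero_succ (i : Fin 3) : B.gi 0 i.succ = -(B.Ui * xc i) := rfl
@[simp] theorem gi_succ_zero (i : Fin 3) : B.gi i.succ 0 = -(B.Ui * xc i) := rfl
@[simp] theorem gi_succ_succ (i j : Fin 3) : B.gi i.succ j.succ = B.Ui * B.V * (xc i * xc j)
      + B.Ui * rho * (B.W i * xc j + xc i * B.W j) + B.k i j := rfl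

theorem x_h (i : Fin 3) : ∑ j, xc j * B.h j i = 0 := by
  rw [← B.h_x i]
  exact Finset.sum_congr rfl fun j _ => by rw [B.h_symm i j, mul_comm]

theorem g_symm (μ ν : Fin 4) : B.g μ ν = B.g ν μ := by
  refine Fin.cases ?_ (fun i => ?_) μ <;> refine Fin.cases ?_ (fun j => ?_) ν <;>
    simp [B.h_symm]

theorem G_symm (l μ ν : Fin 4) : B.G l μ ν = B.G l ν μ := by
  unfold G
  refine Finset.sum_congr rfl fun s _ => ?_
  rw [B.g_symm μ ν]; ring

/-- Differentiating h x = 0 moves the derivative onto x, whose spatial derivative is ρ times the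
tangential projection. The analogous identities for ∂_u and ∂_r, and for w in place of h, arise in
the same way. -/
theorem x_dC_h (i k : Fin 3) : ∑ j, xc j * dC k.succ (B.h i j) = -(rho * B.h i k) := by
  have h := congrArg (dC k.succ) (B.h_x i)
  have h2 := B.h_x i
  simp only [Fin.sum_univ_three, map_add, Derivation.leibniz, map_zero, dC_succ_xc,
    smul_eq_mul] at h h2 ⊢
  fin_cases k <;> simp at h ⊢
  · linear_combination h + rho * xc 0 * h2
  · linear_combination h + rho * xc 1 * h2
  · linear_combination h + rho * xc 2 * h2

theorem x_dU_h (i : Fin 3) : ∑ j, xc j * dU (B.h i j) = 0 := by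
  have h := congrArg dU (B.h_x i)
  simpa [Derivation.leibniz] using h

theorem x_Dr_h (i : Fin 3) : ∑ j, xc j * Dr (B.h i j) = 0 := by
  have h := congrArg dR (B.h_x i)
  simp only [map_sum, Derivation.leibniz, map_zero, dR_xc, smul_eq_mul, mul_zero,
    zero_add] at h
  simp only [Dr, Fin.sum_univ_three] at h ⊢
  linear_combination -rho ^ 2 * h

theorem x_w : ∑ i, xc i * B.w i = 0 := by
  have h0 := B.x_h 0
  have h1 := B.x_h 1
  have h2 := B.x_h 2
  simp only [w, Fin.sum_univ_three] at *
  linear_combination B.W 0 * h0 + B.W 1 * h1 + B.W 2 * h2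

theorem x_dC_w (k : Fin 3) : ∑ j, xc j * dC k.succ (B.w j) = -(rho * B.w k) := by
  have h := congrArg (dC k.succ) B.x_w
  have h2 := B.x_w
  simp only [Fin.sum_univ_three, map_add, Derivation.leibniz, map_zero, dC_succ_xc,
    smul_eq_mul] at h h2 ⊢
  fin_cases k <;> simp at h ⊢
  · linear_combination h + rho * xc 0 * h2
  · linear_combination h + rho * xc 1 * h2
  · linear_combination h + rho * xc 2 * h2

theorem x_dU_w : ∑ j, xc j * dU (B.w j) = 0 := by
  have h := congrArg dU B.x_w
  simpa [Derivation.leibniz] using h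

theorem x_Dr_w : ∑ j, xc j * Dr (B.w j) = 0 := by
  have h := congrArg dR B.x_w
  simp only [map_sum, Derivation.leibniz, map_zero, dR_xc, smul_eq_mul, mul_zero,
    add_zero] at h
  simp only [Dr, Fin.sum_univ_three] at h ⊢
  linear_combination -rho ^ 2 * h

/-- The matrix h + x ⊗ x has determinant one, so its adjugate is its inverse. Both fix x, and
removing x ⊗ x from the inverse leaves the inverse of h on the tangent plane. -/
theorem k_mul_h (i j : Fin 3) :
    ∑ l, B.k i l * B.h l j = (if i = j then 1 else 0) - xc i * xc j := by
  set M : Matrix (Fin 3) (Fin 3) ScriRing := Matrix.of fun i j => B.h i j + xc i * xc j with hM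
  have h1 : M.adjugate * M = 1 := by rw [Matrix.adjugate_mul, B.h_det, one_smul]
  have hMx : M.mulVec xc = xc := by
    funext a
    have ha := B.h_x a
    have hs := sum_sq
    simp only [Matrix.mulVec, dotProduct, hM, Matrix.of_apply, Fin.sum_univ_three] at ha ⊢
    linear_combination ha + xc a * hs
  have h2 : M.adjugate.mulVec xc = xc := by
    conv_lhs => rw [← hMx]
    rw [Matrix.mulVec_mulVec, h1, Matrix.one_mulVec]
  have e1 := congrFun (congrFun h1 i) j
  have e2 := congrFun h2 i
  have e3 := B.x_h j
  rw [Matrix.mul_apply, Matrix.one_apply] at e1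
  simp only [Matrix.mulVec, dotProduct] at e2
  have hM' : ∀ l j, M l j = B.h l j + xc l * xc j := fun _ _ => rfl
  simp only [hM', Fin.sum_univ_three, k, ← hM] at e1 e2 e3 ⊢
  linear_combination e1 - xc j * e2 - xc i * e3

theorem k_x (i : Fin 3) : ∑ l, B.k i l * xc l = 0 := by
  set M : Matrix (Fin 3) (Fin 3) ScriRing := Matrix.of fun i j => B.h i j + xc i * xc j with hM
  have h1 : M.adjugate * M = 1 := by rw [Matrix.adjugate_mul, B.h_det, one_smul]
  have hMx : M.mulVec xc = xc := by
    funext a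
    have ha := B.h_x a
    have hs := sum_sq
    simp only [Matrix.mulVec, dotProduct, hM, Matrix.of_apply, Fin.sum_univ_three] at ha ⊢
    linear_combination ha + xc a * hs
  have h2 : M.adjugate.mulVec xc = xc := by
    conv_lhs => rw [← hMx]
    rw [Matrix.mulVec_mulVec, h1, Matrix.one_mulVec]
  have e2 := congrFun h2 i
  have e3 := sum_sq
  simp only [Matrix.mulVec, dotProduct] at e2
  simp only [Fin.sum_univ_three, k, ← hM] at e2 ⊢
  linear_combination e2 - xc i * e3

theorem k_symm (i j : Fin 3) : B.k i j = B.k j i := by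
  have h : (Matrix.of fun i j => B.h i j + xc i * xc j).transpose
      = Matrix.of fun i j => B.h i j + xc i * xc j := by
    ext a c; simp [B.h_symm c a, mul_comm]
  have h' := congrFun (congrFun (Matrix.adjugate_transpose
    (Matrix.of fun i j => B.h i j + xc i * xc j)) i) j
  rw [h, Matrix.transpose_apply] at h'
  unfold k
  rw [h', mul_comm (xc i)]

theorem x_k (i : Fin 3) : ∑ l, xc l * B.k l i = 0 := by
  rw [← B.k_x i]
  exact Finset.sum_congr rfl fun j _ => by rw [B.k_symm i j, mul_comm]

/-- Jacobi's formula for the constant determinant of h + x ⊗ x. The contributions of x ⊗ x cancel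
because x is a unit vector and k and h are tangential. -/
theorem k_der_h (D : Derivation ℝ ScriRing ScriRing) :
    ∑ i, ∑ j, B.k i j * D (B.h i j) = 0 := by
  have hd := congrArg D B.h_det
  have hx : xc 0 * D (xc 0) + xc 1 * D (xc 1) + xc 2 * D (xc 2) = 0 := by
    have h := congrArg D sum_sq
    simp only [map_add, Derivation.leibniz, smul_eq_mul, Derivation.map_one_eq_zero] at h
    have h2 : (2 : ℝ) • (xc 0 * D (xc 0) + xc 1 * D (xc 1) + xc 2 * D (xc 2)) = 0 := by
      rw [two_smul, ← h]; ring
    have h3 := congrArg (fun z => (1 / 2 : ℝ) • z) h2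
    simpa [smul_smul] using h3
  have hk0 := B.k_x 0
  have hk1 := B.k_x 1
  have hk2 := B.k_x 2
  have hk0' := B.x_k 0
  have hk1' := B.x_k 1
  have hk2' := B.x_k 2
  simp only [Fin.sum_univ_three] at hk0 hk1 hk2 hk0' hk1' hk2' ⊢
  have e : ∀ i j, B.k i j = (Matrix.of fun i j => B.h i j + xc i * xc j).adjugate i j
    - xc i * xc j := fun _ _ => rfl
  have hD0 := congrArg D (B.h_x 0)
  have hD1 := congrArg D (B.h_x 1)
  have hD2 := congrArg D (B.h_x 2)
  have h0 := B.x_h 0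
  have h1 := B.x_h 1
  have h2 := B.x_h 2
  have s01 := B.h_symm 1 0
  have s02 := B.h_symm 2 0
  have s12 := B.h_symm 2 1
  have hkey : ∑ i, ∑ j, (B.k i j + xc i * xc j) * D (B.h i j + xc i * xc j) = 0 := by
    have e' : ∀ i j, B.k i j + xc i * xc j
      = (Matrix.of fun i j => B.h i j + xc i * xc j).adjugate i j := fun i j => by rw [e]; ring
    simp only [e', Fin.sum_univ_three]
    rw [Matrix.det_fin_three] at hd
    simp only [Matrix.adjugate_fin_three, Matrix.of_apply, Matrix.cons_val', Matrix.cons_val_zero,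
      Matrix.cons_val_one, Matrix.cons_val, s01, s02, s12] at hd ⊢
    simp only [map_add, map_sub, Derivation.leibniz, smul_eq_mul, Derivation.map_one_eq_zero]
      at hd ⊢
    linear_combination hd
  simp only [Fin.sum_univ_three, map_add, map_zero, Derivation.leibniz, smul_eq_mul] at *
  linear_combination hkey
    - (D (xc 0) * hk0' + D (xc 1) * hk1' + D (xc 2) * hk2')
    - (D (xc 0) * hk0 + D (xc 1) * hk1 + D (xc 2) * hk2)
    - 2 * (xc 0 * xc 0 + xc 1 * xc 1 + xc 2 * xc 2) * hx
    - (xc 0 * hD0 + xc 1 * hD1 + xc 2 * hD2)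
    + (D (xc 0) * h0 + D (xc 1) * h1 + D (xc 2) * h2)

end Fields

end

section

namespace Fields

variable (B : Fields)

/-! ### Christoffel symbols -/

/-- The lower-index Christoffel bracket `∂_μ g_{sν} + ∂_ν g_{sμ} - ∂_s g_{μν}`. -/
def br (s μ ν : Fin 4) : ScriRing := dC μ (B.g s ν) + dC ν (B.g s μ) - dC s (B.g μ ν)

theorem G_zero (μ ν : Fin 4) : B.G 0 μ ν = -(B.Ui * ∑ k : Fin 3, xc k * B.br k.succ μ ν) := by
  unfold G br
  rw [Fin.sum_univ_succ]
  simp only [gi_zero_zero, gi_zero_succ, zero_mul, zero_add, Finset.mul_sum, ← Finset.sum_neg_distrib]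
  exact Finset.sum_congr rfl fun k _ => by ring

theorem G_succ (i : Fin 3) (μ ν : Fin 4) : B.G i.succ μ ν = -(B.Ui * xc i * B.br 0 μ ν)
    - (B.V * xc i + rho * B.W i) * B.G 0 μ ν
    + B.Ui * rho * xc i * ∑ j : Fin 3, B.W j * B.br j.succ μ ν
    + ∑ j : Fin 3, B.k i j * B.br j.succ μ ν := by
  rw [G_zero]
  unfold G
  rw [Fin.sum_univ_succ]
  simp only [gi_succ_zero, gi_succ_succ, Fin.sum_univ_three]
  unfold br
  ring

theorem x_dC_h' (i k : Fin 3) : ∑ j, xc j * dC k.succ (B.h j i) = -(rho * B.h i k) := by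
  rw [← x_dC_h]
  exact Finset.sum_congr rfl fun j _ => by rw [B.h_symm]

theorem x_dU_h' (i : Fin 3) : ∑ j, xc j * dU (B.h j i) = 0 := by
  rw [← B.x_dU_h i]
  exact Finset.sum_congr rfl fun j _ => by rw [B.h_symm]

theorem x_dC_b (i : Fin 3) :
    ∑ k : Fin 3, xc k * dC i.succ (B.b k) = -dC i.succ B.U - rho ^ 2 * B.w i := by
  have h1 := B.x_dC_w i
  have h2 := B.x_w
  have hs := sum_sq
  simp only [b, Fin.sum_univ_three, map_add, map_neg, Derivation.leibniz, smul_eq_mul,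
    dC_succ_xc, dC_succ_rho] at h1 h2 ⊢
  fin_cases i <;> simp at h1 ⊢
  · linear_combination rho * h1 - (dC 1 B.U - B.U * rho * xc 0) * hs - rho ^ 2 * xc 0 * h2
  · linear_combination rho * h1 - (dC 2 B.U - B.U * rho * xc 1) * hs - rho ^ 2 * xc 1 * h2
  · linear_combination rho * h1 - (dC 3 B.U - B.U * rho * xc 2) * hs - rho ^ 2 * xc 2 * h2

theorem x_dU_b : ∑ k : Fin 3, xc k * dU (B.b k) = -dU B.U := by
  have h1 := B.x_dU_w
  have hs := sum_sq
  simp only [b, Fin.sum_univ_three, map_add, map_neg, Derivation.leibniz, smul_eq_mul,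
    dU_rho, dU_xc] at h1 ⊢
  linear_combination rho * h1 - dU B.U * hs

theorem Dr_b (i : Fin 3) :
    Dr (B.b i) = -(Dr B.U * xc i) + rho * Dr (B.w i) - rho ^ 2 * B.w i := by
  simp only [b, Dr, map_add, map_neg, Derivation.leibniz, smul_eq_mul, dR_xc, dR_rho]
  ring

theorem br_zero_zero (s : Fin 3) : B.br s.succ 0 0 = 2 * dU (B.b s) - dC s.succ B.φ := by
  simp only [br, g_succ_zero, g_zero_zero, dC_zero]; ring

theorem br_zero_succ (s i : Fin 3) :
    B.br s.succ 0 i.succ = dU (B.h s i) + dC i.succ (B.b s) - dC s.succ (B.b i) := by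
  simp only [br, g_succ_zero, g_succ_succ, g_zero_succ, dC_zero]

theorem br_succ_succ (s i j : Fin 3) : B.br s.succ i.succ j.succ
    = dC i.succ (B.h s j) + dC j.succ (B.h s i) - dC s.succ (B.h i j) := by
  simp only [br, g_succ_succ]

theorem br0_zero_zero : B.br 0 0 0 = dU B.φ := by
  simp only [br, g_zero_zero, dC_zero]; ring

theorem br0_zero_succ (i : Fin 3) : B.br 0 0 i.succ = dC i.succ B.φ := by
  simp only [br, g_zero_zero, g_zero_succ, dC_zero]; ring

theorem br0_succ_succ (i j : Fin 3) :
    B.br 0 i.succ j.succ = dC i.succ (B.b j) + dC j.succ (B.b i) - dU (B.h i j) := by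
  simp only [br, g_succ_succ, g_zero_succ, dC_zero]

theorem G_zero_zero_zero : B.G 0 0 0 = B.Ui * (2 * dU B.U + Dr B.φ) := by
  rw [G_zero]
  have h1 := B.x_dU_b
  have h2 := sum_xc_dC B.φ
  simp only [br_zero_zero, Fin.sum_univ_three] at *
  linear_combination -2 * B.Ui * h1 + B.Ui * h2

theorem G_zero_zero_succ (i : Fin 3) : B.G 0 0 i.succ
    = B.Ui * (dC i.succ B.U - xc i * Dr B.U + rho * Dr (B.w i)) := by
  rw [G_zero]
  have h1 := B.x_dU_h' i
  have h2 := B.x_dC_b i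
  have h3 := sum_xc_dC (B.b i)
  rw [Dr_b] at h3
  simp only [br_zero_succ, Fin.sum_univ_three] at *
  linear_combination -B.Ui * (h1 + h2 - h3)

theorem G_zero_succ_succ (i j : Fin 3) : B.G 0 i.succ j.succ
    = B.Ui * (2 * rho * B.h i j + Dr (B.h i j)) := by
  rw [G_zero]
  have h1 := B.x_dC_h' i j
  have h2 := B.x_dC_h' j i
  have h3 := sum_xc_dC (B.h i j)
  have e := B.h_symm j i
  simp only [br_succ_succ, Fin.sum_univ_three] at *
  linear_combination -B.Ui * (h1 + h2 - h3) + B.Ui * rho * e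

/-- Twice the contraction `Γ^0_{0r}`. -/
theorem x_G_zero_zero : ∑ j : Fin 3, xc j * B.G 0 0 j.succ = 0 := by
  have h1 := sum_xc_dC B.U
  have h2 := B.x_Dr_w
  have hs := sum_sq
  simp only [G_zero_zero_succ, Fin.sum_univ_three] at *
  linear_combination B.Ui * h1 + B.Ui * rho * h2 - B.Ui * Dr B.U * hs

/-- Twice the contraction `Γ^0_{ir}`. -/
theorem x_G_zero_succ (i : Fin 3) : ∑ j : Fin 3, xc j * B.G 0 i.succ j.succ = 0 := by
  have h1 := B.h_x i
  have h2 := B.x_Dr_h i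
  simp only [G_zero_succ_succ, Fin.sum_univ_three] at *
  linear_combination 2 * B.Ui * rho * h1 + B.Ui * h2

/-- Twice the contraction `Γ^k_{ir}`. -/
def Q (k i : Fin 3) : ScriRing := ∑ j : Fin 3, xc j * B.G k.succ i.succ j.succ

/-- The coefficient of `x_k` in `Q`. -/
def lam (i : Fin 3) : ScriRing :=
  -(B.Ui * (rho * Dr (B.w i) - 2 * rho ^ 2 * B.w i - dC i.succ B.U - xc i * Dr B.U))
    + B.Ui * rho * ∑ l, B.W l * Dr (B.h l i)

/-- The remaining part of `Q`. -/
def Nr (k i : Fin 3) : ScriRing := ∑ l, B.k k l * Dr (B.h l i)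

theorem x_br_succ_succ (s i : Fin 3) :
    ∑ j : Fin 3, xc j * B.br s.succ i.succ j.succ = Dr (B.h s i) := by
  have h1 := B.x_dC_h s i
  have h2 := B.x_dC_h i s
  have h3 := sum_xc_dC (B.h s i)
  have e := B.h_symm s i
  simp only [br_succ_succ, Fin.sum_univ_three] at *
  linear_combination h1 - h2 + h3 - rho * e

theorem x_br0_succ_succ (i : Fin 3) : ∑ j : Fin 3, xc j * B.br 0 i.succ j.succ
    = rho * Dr (B.w i) - 2 * rho ^ 2 * B.w i - dC i.succ B.U - xc i * Dr B.U := by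
  have h1 := B.x_dC_b i
  have h2 := sum_xc_dC (B.b i)
  have h3 := B.x_dU_h i
  rw [Dr_b] at h2
  simp only [br0_succ_succ, Fin.sum_univ_three] at *
  linear_combination h1 + h2 - h3

theorem Q_eq (k i : Fin 3) : B.Q k i = xc k * B.lam i + B.Nr k i := by
  have h0 := B.x_G_zero_succ i
  have hb := B.x_br0_succ_succ i
  have h1 := B.x_br_succ_succ 0 i
  have h2 := B.x_br_succ_succ 1 i
  have h3 := B.x_br_succ_succ 2 i
  unfold Q lam Nr
  simp only [G_succ B k, Fin.sum_univ_three] at *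
  linear_combination -(B.V * xc k + rho * B.W k) * h0 - B.Ui * xc k * hb
    + (B.Ui * rho * xc k * B.W 0 + B.k k 0) * h1
    + (B.Ui * rho * xc k * B.W 1 + B.k k 1) * h2
    + (B.Ui * rho * xc k * B.W 2 + B.k k 2) * h3

/-- The contraction Γ^l_{μl} is the derivative of log √|det g|. In the coordinates (u, y) the
determinant is −U², because the determinant of h is normalized; hence only U enters. -/
theorem trace_G (μ : Fin 4) : ∑ l, B.G l μ l = 2 * B.Ui * dC μ B.U := by
  have hgi : ∀ μ ν, B.gi μ ν = B.gi ν μ := by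
    intro μ ν
    refine Fin.cases ?_ (fun i => ?_) μ <;> refine Fin.cases ?_ (fun j => ?_) ν <;>
      simp only [gi_zero_zero, gi_zero_succ, gi_succ_zero, gi_succ_succ]
    rw [B.k_symm i j]; ring
  have e : ∑ l, B.G l μ l = ∑ l, ∑ s, B.gi l s * dC μ (B.g l s) := by
    have h1 : ∑ l, B.G l μ l = ∑ l, ∑ s, B.gi l s * dC μ (B.g s l)
        + (∑ l, ∑ s, B.gi l s * dC l (B.g s μ) - ∑ l, ∑ s, B.gi l s * dC s (B.g μ l)) := by
      rw [← Finset.sum_sub_distrib, ← Finset.sum_add_distrib]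
      refine Finset.sum_congr rfl fun l _ => ?_
      unfold G
      rw [← Finset.sum_sub_distrib, ← Finset.sum_add_distrib]
      exact Finset.sum_congr rfl fun s _ => by ring
    have h2 : ∑ l, ∑ s, B.gi l s * dC s (B.g μ l) = ∑ l, ∑ s, B.gi l s * dC l (B.g s μ) := by
      rw [Finset.sum_comm]
      refine Finset.sum_congr rfl fun l _ => Finset.sum_congr rfl fun s _ => ?_
      rw [hgi, B.g_symm]
    rw [h1, h2, sub_self, add_zero]
    refine Finset.sum_congr rfl fun l _ => Finset.sum_congr rfl fun s _ => ?_
    rw [B.g_symm]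
  have hk := B.k_der_h (dC μ)
  have hW := B.x_W
  have hw := B.x_w
  have hs := sum_sq
  have d1 := congrArg (dC μ) hw
  have d2 := congrArg (dC μ) hs
  have dx0 := congrArg (dC μ) (B.h_x 0)
  have dx1 := congrArg (dC μ) (B.h_x 1)
  have dx2 := congrArg (dC μ) (B.h_x 2)
  have h0 := B.x_h 0
  have h1 := B.x_h 1
  have h2 := B.x_h 2
  have s01 := B.h_symm 1 0
  have s02 := B.h_symm 2 0
  have s12 := B.h_symm 2 1
  have dd2 : xc 0 * dC μ (xc 0) + xc 1 * dC μ (xc 1) + xc 2 * dC μ (xc 2) = 0 := by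
    simp only [map_add, Derivation.leibniz, smul_eq_mul, Derivation.map_one_eq_zero] at d2
    have h2 : (2 : ℝ) • (xc 0 * dC μ (xc 0) + xc 1 * dC μ (xc 1) + xc 2 * dC μ (xc 2)) = 0 := by
      rw [two_smul, ← d2]; ring
    have h3 := congrArg (fun z => (1 / 2 : ℝ) • z) h2
    simpa [smul_smul] using h3
  have hww : ∀ i, B.w i = B.h i 0 * B.W 0 + B.h i 1 * B.W 1 + B.h i 2 * B.W 2 := fun i => by
    rw [w, Fin.sum_univ_three]
  have hw0 := hww 0
  have hw1 := hww 1
  have hw2 := hww 2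
  clear hww
  have hrx : xc 0 * dC μ (B.b 0) + xc 1 * dC μ (B.b 1) + xc 2 * dC μ (B.b 2)
      = -dC μ B.U - rho * (B.w 0 * dC μ (xc 0) + B.w 1 * dC μ (xc 1) + B.w 2 * dC μ (xc 2)) := by
    simp only [b, Fin.sum_univ_three, map_add, map_neg, Derivation.leibniz, smul_eq_mul,
      map_zero] at *
    linear_combination (dC μ rho) * hw + rho * d1 - dC μ B.U * hs - B.U * dd2
  rw [e, Fin.sum_univ_succ, Fin.sum_univ_succ]
  simp only [gi_zero_zero, gi_zero_succ, gi_succ_zero, gi_succ_succ, g_zero_succ, g_succ_zero,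
    g_succ_succ, Fin.sum_univ_succ (n := 3), zero_mul, zero_add]
  simp only [Fin.sum_univ_three, map_add, map_zero, Derivation.leibniz, smul_eq_mul] at *
  rw [s01, s02, s12] at *
  linear_combination hk - 2 * B.Ui * hrx
    + B.Ui * B.V * (xc 0 * dx0 + xc 1 * dx1 + xc 2 * dx2
      - (dC μ (xc 0) * h0 + dC μ (xc 1) * h1 + dC μ (xc 2) * h2))
    + 2 * B.Ui * rho * (B.W 0 * dx0 + B.W 1 * dx1 + B.W 2 * dx2)
    + 2 * B.Ui * rho * (dC μ (xc 0) * hw0 + dC μ (xc 1) * hw1 + dC μ (xc 2) * hw2)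

end Fields

end

/-! ### The Ricci tensor contracted with the radial direction. -/

section

/-- The projection onto the tangent plane, as an element of the ring. -/
def Pr (i j : Fin 3) : ScriRing := (if i = j then 1 else 0) - xc i * xc j

theorem Pr_symm (i j : Fin 3) : Pr i j = Pr j i := by
  simp only [Pr, mul_comm, eq_comm]

theorem x_Pr (i : Fin 3) : ∑ j, xc j * Pr j i = 0 := by
  have := sum_sq
  fin_cases i <;> simp [Pr, Fin.sum_univ_three]
  · linear_combination -xc 0 * this
  · linear_combination -xc 1 * this
  · linear_combination -xc 2 * this

theorem Pr_x (i : Fin 3) : ∑ j, Pr i j * xc j = 0 := by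
  rw [← x_Pr i]; exact Finset.sum_congr rfl fun j _ => by rw [Pr_symm, mul_comm]

theorem Pr_mul (v : Fin 3 → ScriRing) (hv : ∑ j, xc j * v j = 0) (i : Fin 3) :
    ∑ j, Pr i j * v j = v i := by
  rw [Fin.sum_univ_three] at hv ⊢
  fin_cases i <;> simp [Pr]
  · linear_combination -xc 0 * hv
  · linear_combination -xc 1 * hv
  · linear_combination -xc 2 * hv

theorem dC_xc (i j : Fin 3) : dC i.succ (xc j) = rho * Pr i j := dC_succ_xc i j

theorem trace_Pr : Pr 0 0 + Pr 1 1 + Pr 2 2 = 2 := by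
  simp [Pr]; linear_combination -sum_sq

theorem dC_three (a : ScriRing) : xc 0 * dC 1 a + xc 1 * dC 2 a + xc 2 * dC 3 a = Dr a := by
  rw [← sum_xc_dC a, Fin.sum_univ_three]; rfl

theorem succ_zero3 : Fin.succ (0 : Fin 3) = 1 := rfl
theorem succ_one3 : Fin.succ (1 : Fin 3) = 2 := rfl
theorem succ_two3 : Fin.succ (2 : Fin 3) = 3 := rfl

namespace Fields
variable (B : Fields)

/-- Twice the contracted Christoffel symbols `∂_μ log √|g|`. -/
def t (μ : Fin 4) : ScriRing := 2 * B.Ui * dC μ B.U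

/-- The radial component of `t`. -/
def τ : ScriRing := 2 * B.Ui * Dr B.U

/-- The contraction `x^j G^k_{0j}`. -/
def Z (k : Fin 3) : ScriRing := ∑ j : Fin 3, xc j * B.G k.succ 0 j.succ

theorem ric_eq (μ ν : Fin 4) : B.ric μ ν = 2 * ∑ l, dC l (B.G l μ ν) - 2 * dC ν (B.t μ)
    + ∑ s, B.t s * B.G s μ ν - ∑ l, ∑ s, B.G l ν s * B.G s μ l := by
  have h1 : ∑ l, dC ν (B.G l μ l) = dC ν (B.t μ) := by rw [← map_sum, trace_G, t]
  have h2 : ∀ s, ∑ l, B.G l l s * B.G s μ ν = B.t s * B.G s μ ν := fun s => by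
    rw [t, ← trace_G, Finset.sum_mul]
    exact Finset.sum_congr rfl fun l _ => by rw [B.G_symm l l s]
  unfold ric
  rw [← Finset.mul_sum, Finset.sum_sub_distrib, h1]
  simp only [Finset.sum_sub_distrib]
  rw [Finset.sum_comm (f := fun l s => B.G l l s * B.G s μ ν), Finset.sum_congr rfl fun s _ => h2 s]
  ring

theorem x_t : ∑ j : Fin 3, xc j * B.t j.succ = B.τ := by
  have := dC_three B.U
  simp only [t, τ, Fin.sum_univ_three, succ_zero3, succ_one3, succ_two3]
  linear_combination 2 * B.Ui * this

/-- The tangential trace of the spatial Christoffel symbols. -/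
theorem Pr_G (i : Fin 3) : ∑ k, ∑ j, Pr k j * B.G k.succ i.succ j.succ
    = -(rho * ∑ j, B.W j * B.G 0 i.succ j.succ) := by
  have hk := B.k_der_h (dC i.succ)
  have hkx : ∀ j, B.k 0 j * xc 0 + B.k 1 j * xc 1 + B.k 2 j * xc 2 = 0 := fun j => by
    have := B.x_k j
    rw [Fin.sum_univ_three] at this
    linear_combination this
  have hW := B.x_W
  have hs := sum_sq
  have h := B.x_G_zero_succ i
  have k01 := B.k_symm 1 0
  have k02 := B.k_symm 2 0
  have k12 := B.k_symm 2 1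
  have kx0 := hkx 0
  have kx1 := hkx 1
  have kx2 := hkx 2
  have px : ∀ j, xc 0 * Pr 0 j + xc 1 * Pr 1 j + xc 2 * Pr 2 j = 0 := fun j => by
    rw [← x_Pr j, Fin.sum_univ_three]
  have pW : ∀ j, B.W 0 * Pr 0 j + B.W 1 * Pr 1 j + B.W 2 * Pr 2 j = B.W j := fun j => by
    have := Pr_mul B.W hW j
    rw [Fin.sum_univ_three, Pr_symm j 0, Pr_symm j 1, Pr_symm j 2] at this
    linear_combination this
  have pk : ∀ j l, B.k 0 l * Pr 0 j + B.k 1 l * Pr 1 j + B.k 2 l * Pr 2 j = B.k j l := fun j l => by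
    have := Pr_mul (fun i => B.k i l) (B.x_k l) j
    rw [Fin.sum_univ_three, Pr_symm j 0, Pr_symm j 1, Pr_symm j 2] at this
    linear_combination this
  have e : ∀ j, ∑ k, Pr k j * B.G k.succ i.succ j.succ = -(rho * (B.W j * B.G 0 i.succ j.succ))
      + ∑ l, B.k j l * B.br l.succ i.succ j.succ := fun j => by
    simp only [G_succ, Fin.sum_univ_three]
    linear_combination (-(B.Ui * B.br 0 i.succ j.succ) - B.V * B.G 0 i.succ j.succ
      + B.Ui * rho * (B.W 0 * B.br (Fin.succ 0) i.succ j.succ + B.W 1 * B.br (Fin.succ 1) i.succ j.succ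
        + B.W 2 * B.br (Fin.succ 2) i.succ j.succ)) * px j
      - rho * B.G 0 i.succ j.succ * pW j + B.br (Fin.succ 0) i.succ j.succ * pk j 0
      + B.br (Fin.succ 1) i.succ j.succ * pk j 1 + B.br (Fin.succ 2) i.succ j.succ * pk j 2
  have e2 : ∑ j, ∑ l, B.k j l * B.br l.succ i.succ j.succ = 0 := by
    rw [← hk]
    simp only [br_succ_succ, Fin.sum_univ_three]
    rw [k01, k02, k12, B.h_symm 1 0, B.h_symm 2 0, B.h_symm 2 1, B.h_symm i 0, B.h_symm i 1, B.h_symm i 2]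
    ring
  rw [Finset.sum_comm, Finset.sum_congr rfl fun j _ => e j, Finset.sum_add_distrib, e2,
    Finset.sum_neg_distrib, Finset.mul_sum]
  ring

/-- The contraction of the Ricci tensor with the radial direction. -/
theorem ric_radial (i : Fin 3) : ∑ j : Fin 3, xc j * B.ric j.succ i.succ
    = 2 * ∑ k : Fin 3, dC k.succ (B.Q k i) + 2 * rho ^ 2 * ∑ j, B.W j * B.G 0 i.succ j.succ
      - 2 * dC i.succ B.τ + 2 * rho * ∑ j, Pr i j * B.t j.succ + ∑ k, B.t k.succ * B.Q k i
      - ∑ k, B.G 0 i.succ k.succ * B.Z k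
      - ∑ l, ∑ k, B.G l.succ i.succ k.succ * B.Q k l := by
  have h1 : ∑ j : Fin 3, xc j * dU (B.G 0 i.succ j.succ) = 0 := by
    have := congrArg dU (B.x_G_zero_succ i)
    simpa [Derivation.leibniz] using this
  have h2 : ∀ k : Fin 3, dC k.succ (B.Q k i) = ∑ j : Fin 3, xc j * dC k.succ (B.G k.succ i.succ j.succ)
      + rho * ∑ j, Pr k j * B.G k.succ i.succ j.succ := fun k => by
    unfold Q
    simp only [Fin.sum_univ_three, map_add, Derivation.leibniz, smul_eq_mul, dC_xc]
    ring
  have h3 := B.Pr_G i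
  have h4 : dC i.succ B.τ = ∑ j : Fin 3, xc j * dC i.succ (B.t j.succ)
      + rho * ∑ j, Pr i j * B.t j.succ := by
    rw [← x_t]
    simp only [Fin.sum_univ_three, map_add, Derivation.leibniz, smul_eq_mul, dC_xc]
    ring
  have h5 := B.x_G_zero_succ i
  have h6 := B.x_G_zero_zero
  have h7 := fun k : Fin 3 => B.x_G_zero_succ k
  have g1 := fun l a b : Fin 4 => B.G_symm l a b
  have e1 : ∑ j : Fin 3, xc j * ∑ l, dC l (B.G l j.succ i.succ)
      = ∑ k : Fin 3, ∑ j : Fin 3, xc j * dC k.succ (B.G k.succ i.succ j.succ) := by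
    simp only [Fin.sum_univ_succ (n := 3), dC_zero]
    rw [Finset.sum_comm, Finset.sum_congr rfl fun j _ => by rw [mul_add, g1 0 j.succ i.succ],
      Finset.sum_add_distrib, h1, zero_add]
    exact Finset.sum_congr rfl fun j _ => by
      rw [Finset.mul_sum]; exact Finset.sum_congr rfl fun k _ => by rw [g1 k.succ j.succ]
  have e2 : ∑ j : Fin 3, xc j * ∑ s, B.t s * B.G s j.succ i.succ = ∑ k, B.t k.succ * B.Q k i := by
    unfold Q
    simp only [Fin.sum_univ_succ (n := 3), g1 _ _ i.succ, Fin.sum_univ_three] at h5 ⊢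
    linear_combination B.t 0 * h5
  -- All products with an upper time index on the radial factor drop, since Γ^0_{rμ} = 0.
  have e3 : ∑ j : Fin 3, xc j * ∑ l, ∑ s, B.G l i.succ s * B.G s j.succ l
      = ∑ k, B.G 0 i.succ k.succ * B.Z k + ∑ l, ∑ k, B.G l.succ i.succ k.succ * B.Q k l := by
    have a0 := h7 0
    have a1 := h7 1
    have a2 := h7 2
    unfold Q Z
    simp only [Fin.sum_univ_succ (n := 3), g1 _ (Fin.succ 0) 0, g1 _ (Fin.succ 1) 0,
      g1 _ (Fin.succ 2) 0, g1 _ (Fin.succ 1) (Fin.succ 0), g1 _ (Fin.succ 2) (Fin.succ 0),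
      g1 _ (Fin.succ 2) (Fin.succ 1), Fin.sum_univ_three] at h6 a0 a1 a2 ⊢
    linear_combination B.G 0 i.succ 0 * h6 + B.G (Fin.succ 0) i.succ 0 * a0
      + B.G (Fin.succ 1) i.succ 0 * a1 + B.G (Fin.succ 2) i.succ 0 * a2
  have e4 : ∑ j : Fin 3, xc j * B.ric j.succ i.succ
      = 2 * ∑ j : Fin 3, xc j * ∑ l, dC l (B.G l j.succ i.succ)
        - 2 * ∑ j : Fin 3, xc j * dC i.succ (B.t j.succ)
        + ∑ j : Fin 3, xc j * ∑ s, B.t s * B.G s j.succ i.succ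
        - ∑ j : Fin 3, xc j * ∑ l, ∑ s, B.G l i.succ s * B.G s j.succ l := by
    rw [Fin.sum_univ_three, ric_eq, ric_eq, ric_eq]
    simp only [Fin.sum_univ_three (M := ScriRing)]
    ring
  have e5 : ∑ k : Fin 3, dC k.succ (B.Q k i)
      = ∑ k : Fin 3, ∑ j : Fin 3, xc j * dC k.succ (B.G k.succ i.succ j.succ)
        - rho ^ 2 * ∑ j, B.W j * B.G 0 i.succ j.succ := by
    rw [Finset.sum_congr rfl fun k _ => h2 k, Finset.sum_add_distrib, ← Finset.mul_sum, h3]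
    ring
  rw [e4, e1, e2, e3, e5, h4]
  ring

theorem x_Nr (i : Fin 3) : ∑ k, xc k * B.Nr k i = 0 := by
  have h0 := B.x_k 0
  have h1 := B.x_k 1
  have h2 := B.x_k 2
  simp only [Nr, Fin.sum_univ_three] at *
  linear_combination Dr (B.h 0 i) * h0 + Dr (B.h 1 i) * h1 + Dr (B.h 2 i) * h2

theorem Nr_x (k : Fin 3) : ∑ i, xc i * B.Nr k i = 0 := by
  have h0 := B.x_Dr_h 0
  have h1 := B.x_Dr_h 1
  have h2 := B.x_Dr_h 2
  simp only [Nr, Fin.sum_univ_three] at *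
  linear_combination B.k k 0 * h0 + B.k k 1 * h1 + B.k k 2 * h2

theorem trace_Nr : ∑ k, B.Nr k k = 0 := by
  have h := B.k_der_h dR
  simp only [Nr, Dr, Fin.sum_univ_three] at *
  rw [B.k_symm 1 0, B.k_symm 2 0, B.k_symm 2 1] at *
  rw [B.h_symm 1 0, B.h_symm 2 0, B.h_symm 2 1] at *
  linear_combination -rho ^ 2 * h

theorem x_lam : ∑ i, xc i * B.lam i = B.τ := by
  have h1 := B.x_Dr_w
  have h2 := B.x_w
  have h3 := dC_three B.U
  have hs := sum_sq
  have d0 := B.x_Dr_h 0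
  have d1 := B.x_Dr_h 1
  have d2 := B.x_Dr_h 2
  simp only [lam, τ, Fin.sum_univ_three, succ_zero3, succ_one3, succ_two3] at *
  linear_combination -B.Ui * (rho * h1 - 2 * rho ^ 2 * h2 - h3 - Dr B.U * hs)
    + B.Ui * rho * (B.W 0 * d0 + B.W 1 * d1 + B.W 2 * d2)

theorem x_Q (k : Fin 3) : ∑ i, xc i * B.Q k i = xc k * B.τ := by
  have h1 := B.x_lam
  have h2 := B.Nr_x k
  simp only [Q_eq, Fin.sum_univ_three] at *
  linear_combination xc k * h1 + h2

/-- The `rr` component of the Einstein equation. -/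
theorem ric_rr : ∑ i : Fin 3, xc i * ∑ j : Fin 3, xc j * B.ric j.succ i.succ
    = 4 * rho * B.τ - ∑ l, ∑ k, B.Nr l k * B.Nr k l := by
  have hs := sum_sq
  have hP := trace_Pr
  have e1 : ∑ i : Fin 3, xc i * ∑ k : Fin 3, dC k.succ (B.Q k i) = 2 * rho * B.τ + Dr B.τ := by
    have h1 : ∀ k : Fin 3, dC k.succ (∑ i, xc i * B.Q k i)
        = ∑ i, xc i * dC k.succ (B.Q k i) + rho * ∑ i, Pr k i * B.Q k i := fun k => by
      simp only [Fin.sum_univ_three, map_add, Derivation.leibniz, smul_eq_mul, dC_xc]; ring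
    have h2 : ∀ k : Fin 3, dC k.succ (∑ i, xc i * B.Q k i)
        = xc k * dC k.succ B.τ + rho * Pr k k * B.τ := fun k => by
      rw [x_Q]; simp only [Derivation.leibniz, smul_eq_mul, dC_xc]; ring
    have h3 : ∑ k, ∑ i, Pr k i * B.Q k i = 0 := by
      have a := B.trace_Nr
      have a0 := B.x_Nr 0
      have a1 := B.x_Nr 1
      have a2 := B.x_Nr 2
      have p := fun j : Fin 3 => x_Pr j
      have p0 := x_Pr 0
      have p1 := x_Pr 1
      have p2 := x_Pr 2
      simp only [Q_eq, Fin.sum_univ_three] at *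
      have q : ∀ i j, Pr i j * B.Nr i j = (if i = j then 1 else 0) * B.Nr i j - xc i * xc j * B.Nr i j :=
        fun i j => by unfold Pr; ring
      have q00 := q 0 0
      have q11 := q 1 1
      have q22 := q 2 2
      have q01 := q 0 1
      have q02 := q 0 2
      have q12 := q 1 2
      have q10 := q 1 0
      have q20 := q 2 0
      have q21 := q 2 1
      simp only [Fin.reduceEq, if_true, if_false] at q00 q11 q22 q01 q02 q12 q10 q20 q21
      linear_combination (exp := 1) B.lam 0 * p0 + B.lam 1 * p1 + B.lam 2 * p2 + a
        - xc 0 * a0 - xc 1 * a1 - xc 2 * a2 + q00 + q01 + q02 + q10 + q11 + q12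
        + q20 + q21 + q22
    have h4 := dC_three B.τ
    have g := fun k => (h1 k).symm.trans (h2 k)
    have g0 := g 0
    have g1 := g 1
    have g2 := g 2
    simp only [Fin.sum_univ_three, succ_zero3, succ_one3, succ_two3] at *
    linear_combination g0 + g1 + g2 + h4 - rho * h3 + rho * B.τ * hP
  have e2 : ∑ i : Fin 3, xc i * ∑ j, B.W j * B.G 0 i.succ j.succ = 0 := by
    have h := fun j : Fin 3 => B.x_G_zero_succ j
    have h0 := h 0
    have h1 := h 1
    have h2 := h 2
    simp only [Fin.sum_univ_three, B.G_symm 0 _ (Fin.succ 0), B.G_symm 0 (Fin.succ 2) (Fin.succ 1)]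
      at *
    linear_combination B.W 0 * h0 + B.W 1 * h1 + B.W 2 * h2
  have e3 : ∑ i : Fin 3, xc i * dC i.succ B.τ = Dr B.τ := sum_xc_dC _
  have e4 : ∑ i, xc i * ∑ j, Pr i j * B.t j.succ = 0 := by
    have p0 := x_Pr 0
    have p1 := x_Pr 1
    have p2 := x_Pr 2
    simp only [Fin.sum_univ_three] at *
    linear_combination B.t (Fin.succ 0) * p0 + B.t (Fin.succ 1) * p1 + B.t (Fin.succ 2) * p2
  have e5 : ∑ i, xc i * ∑ k, B.t k.succ * B.Q k i = B.τ * B.τ := by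
    have h := B.x_t
    have q0 := B.x_Q 0
    have q1 := B.x_Q 1
    have q2 := B.x_Q 2
    simp only [Fin.sum_univ_three] at *
    linear_combination B.τ * h + B.t (Fin.succ 0) * q0 + B.t (Fin.succ 1) * q1
      + B.t (Fin.succ 2) * q2
  have e6 : ∑ i : Fin 3, xc i * ∑ k, B.G 0 i.succ k.succ * B.Z k = 0 := by
    have h := fun j : Fin 3 => B.x_G_zero_succ j
    have h0 := h 0
    have h1 := h 1
    have h2 := h 2
    simp only [Fin.sum_univ_three, B.G_symm 0 _ (Fin.succ 0), B.G_symm 0 (Fin.succ 2) (Fin.succ 1)]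
      at *
    linear_combination B.Z 0 * h0 + B.Z 1 * h1 + B.Z 2 * h2
  -- The radial part of Q produces τ², which cancels the one in `e5`. Only the square of `Nr`, the
  -- shear of the null rays, survives, as in the Raychaudhuri equation.
  have e7 : ∑ i : Fin 3, xc i * ∑ l, ∑ k, B.G l.succ i.succ k.succ * B.Q k l
      = B.τ * B.τ + ∑ l, ∑ k, B.Nr l k * B.Nr k l := by
    have h1 : ∑ i : Fin 3, xc i * ∑ l, ∑ k, B.G l.succ i.succ k.succ * B.Q k l
        = ∑ l, ∑ k, B.Q l k * B.Q k l := by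
      have e : ∀ l k, B.Q l k = ∑ i : Fin 3, xc i * B.G l.succ i.succ k.succ := fun l k => by
        unfold Q; exact Finset.sum_congr rfl fun i _ => by rw [B.G_symm l.succ]
      simp only [Finset.mul_sum]
      rw [Finset.sum_comm]
      refine Finset.sum_congr rfl fun l _ => ?_
      rw [Finset.sum_comm]
      refine Finset.sum_congr rfl fun k _ => ?_
      rw [e l k, Finset.sum_mul]
      exact Finset.sum_congr rfl fun i _ => by ring
    rw [h1]
    have hl := B.x_lam
    have a0 := B.Nr_x 0
    have a1 := B.Nr_x 1
    have a2 := B.Nr_x 2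
    simp only [Q_eq, Fin.sum_univ_three] at *
    linear_combination (B.τ + xc 0 * B.lam 0 + xc 1 * B.lam 1 + xc 2 * B.lam 2) * hl
      + 2 * B.lam 0 * a0 + 2 * B.lam 1 * a1 + 2 * B.lam 2 * a2
  have e : ∑ i : Fin 3, xc i * ∑ j : Fin 3, xc j * B.ric j.succ i.succ
      = 2 * ∑ i : Fin 3, xc i * ∑ k : Fin 3, dC k.succ (B.Q k i)
      + 2 * rho ^ 2 * ∑ i : Fin 3, xc i * ∑ j, B.W j * B.G 0 i.succ j.succ
      - 2 * ∑ i : Fin 3, xc i * dC i.succ B.τ + 2 * rho * ∑ i, xc i * ∑ j, Pr i j * B.t j.succ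
      + ∑ i, xc i * ∑ k, B.t k.succ * B.Q k i
      - ∑ i : Fin 3, xc i * ∑ k, B.G 0 i.succ k.succ * B.Z k
      - ∑ i : Fin 3, xc i * ∑ l, ∑ k, B.G l.succ i.succ k.succ * B.Q k l := by
    rw [Finset.sum_congr rfl fun i _ => by rw [ric_radial]]
    simp only [Fin.sum_univ_three (M := ScriRing)]
    ring
  rw [e, e1, e2, e3, e4, e5, e6, e7]
  ring

end Fields

end

section

/-! ### Expansions in powers of `ρ` -/

theorem dvd_dU {n : ℕ} {a : ScriRing} (h : rho ^ n ∣ a) : rho ^ n ∣ dU a := by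
  obtain ⟨b, rfl⟩ := h
  exact ⟨_, dU_rho_pow_mul n b⟩

theorem dvd_dC {n : ℕ} {a : ScriRing} (h : rho ^ n ∣ a) (i : Fin 3) :
    rho ^ (n + 1) ∣ dC i.succ a := by
  obtain ⟨b, rfl⟩ := h
  exact ⟨_, dC_succ_rho_pow_mul i n b⟩

theorem rho_dvd_dC (a : ScriRing) (i : Fin 3) : rho ∣ dC i.succ a := by
  have := dvd_dC (n := 0) (a := a) (by simp) i
  simpa using this

theorem dvd_Dr {n : ℕ} {a : ScriRing} (h : rho ^ n ∣ a) : rho ^ (n + 1) ∣ Dr a := by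
  rw [← sum_xc_dC]
  exact Finset.dvd_sum fun i _ => (dvd_dC h i).mul_left _

theorem sq_dvd_Dr (a : ScriRing) : rho ^ 2 ∣ Dr a := ⟨-dR a, by unfold Dr; ring⟩

/-- Comparison of coefficients: an expression whose ρⁿ coefficient is `a`, but which is divisible by
ρⁿ⁺¹, forces `a` to vanish at null infinity. -/
theorem eq_of_dvd_sub {n : ℕ} {a : ScriRing} {v : ℝ → E3 → ℝ} (ha : Val a v)
    (h : rho ^ (n + 1) ∣ rho ^ n * a) : ScriEq v fun _ _ => 0 := by
  obtain ⟨b, hb⟩ := h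
  have : a = rho * b := rho_pow_mul_cancel n (by rw [hb]; ring)
  intro u x hx
  rw [← ha u x hx, this]
  simp

@[simp] theorem ev_Pr (u : ℝ) (x : E3) (hx : ‖x‖ = 1) (i j : Fin 3) :
    ev u x hx (Pr i j) = roundMetric x i j := by
  unfold Pr roundMetric
  split_ifs <;> simp

@[simp] theorem dR_Pr (i j : Fin 3) : dR (Pr i j) = 0 := by
  unfold Pr
  split_ifs <;> simp [Derivation.leibniz]

@[simp] theorem dU_Pr (i j : Fin 3) : dU (Pr i j) = 0 := by
  unfold Pr
  split_ifs <;> simp [Derivation.leibniz]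

theorem dC_Pr (k i j : Fin 3) : dC k.succ (Pr i j) = -(rho * (Pr k i * xc j + xc i * Pr k j)) := by
  have h : Pr i j = (if i = j then 1 else 0) - xc i * xc j := rfl
  rw [h]
  split_ifs <;> simp only [map_sub, Derivation.leibniz, dC_xc, smul_eq_mul, map_zero,
    Derivation.map_one_eq_zero] <;> ring

namespace Fields
variable (B : Fields)

/-- The coefficient of `x_i` in `G^i_{μν}`. -/
def γ (μ ν : Fin 4) : ScriRing := -(B.Ui * B.br 0 μ ν) - B.V * B.G 0 μ ν
  + B.Ui * rho * ∑ j : Fin 3, B.W j * B.br j.succ μ ν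

/-- The tangential part of `G^i_{μν}`. -/
def δ (i : Fin 3) (μ ν : Fin 4) : ScriRing :=
  -(rho * B.W i * B.G 0 μ ν) + ∑ j : Fin 3, B.k i j * B.br j.succ μ ν

/-- The radial and tangential parts of the Christoffel symbols have different orders in ρ, and
tangential tensors annihilate the radial one; so the two are estimated separately. -/
theorem G_succ_eq (i : Fin 3) (μ ν : Fin 4) : B.G i.succ μ ν = xc i * B.γ μ ν + B.δ i μ ν := by
  rw [G_succ, γ, δ]; ring

theorem x_δ (μ ν : Fin 4) : ∑ i, xc i * B.δ i μ ν = 0 := by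
  have h := B.x_W
  have h0 := B.x_k 0
  have h1 := B.x_k 1
  have h2 := B.x_k 2
  simp only [δ, Fin.sum_univ_three] at *
  linear_combination -(rho * B.G 0 μ ν) * h + B.br (Fin.succ 0) μ ν * h0
    + B.br (Fin.succ 1) μ ν * h1 + B.br (Fin.succ 2) μ ν * h2

theorem x_br_zero_succ (s : Fin 3) : ∑ j : Fin 3, xc j * B.br s.succ 0 j.succ
    = -(Dr B.U * xc s) + rho * Dr (B.w s) + dC s.succ B.U := by
  have h1 := B.x_dU_h s
  have h2 := sum_xc_dC (B.b s)
  have h3 := B.x_dC_b s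
  rw [Dr_b] at h2
  simp only [br_zero_succ, Fin.sum_univ_three] at *
  linear_combination h1 + h2 - h3

theorem x_δ_zero (k : Fin 3) : ∑ j : Fin 3, xc j * B.δ k 0 j.succ
    = ∑ s : Fin 3, B.k k s * (rho * Dr (B.w s) + dC s.succ B.U) := by
  have h := B.x_G_zero_zero
  have h0 := B.x_br_zero_succ 0
  have h1 := B.x_br_zero_succ 1
  have h2 := B.x_br_zero_succ 2
  have hk := B.k_x k
  simp only [δ, Fin.sum_univ_three] at *
  linear_combination -(rho * B.W k) * h + B.k k 0 * h0 + B.k k 1 * h1 + B.k k 2 * h2 - Dr B.U * hk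

/-- Leading coefficients of a Bondi–Sachs metric at null infinity. -/
structure Asym (m : ℝ → E3 → ℝ) (C : ℝ → E3 → Fin 3 → Fin 3 → ℝ) (W2 W3 : ℝ → E3 → Fin 3 → ℝ) :
    Prop where
  U : Val B.U fun _ _ => 1
  V : Val B.V fun _ _ => 1
  V' : Val (dR B.V) fun u x => -2 * m u x
  h : ∀ i j, Val (B.h i j) fun _ x => roundMetric x i j
  h' : ∀ i j, Val (dR (B.h i j)) fun u x => C u x i j
  W : ∀ i, Val (B.W i) fun u x => W2 u x i
  W' : ∀ i, Val (dR (B.W i)) fun u x => W3 u x i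

/-- Expansion of the coefficients of a vacuum Bondi–Sachs metric. -/
structure Exp (m : ℝ → E3 → ℝ) (C : ℝ → E3 → Fin 3 → Fin 3 → ℝ) (W2 W3 : ℝ → E3 → Fin 3 → ℝ) where
  u2 : ScriRing
  y2 : ScriRing
  v1 : ScriRing
  c : Fin 3 → Fin 3 → ScriRing
  k1 : Fin 3 → Fin 3 → ScriRing
  hU : B.U = 1 + rho ^ 2 * u2
  hUi : B.Ui = 1 + rho ^ 2 * y2
  hV : B.V = 1 + rho * v1
  hh : ∀ i j, B.h i j = Pr i j + rho * c i j
  hk : ∀ i j, B.k i j = Pr i j + rho * k1 i j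
  c_symm : ∀ i j, c i j = c j i
  c_x : ∀ i, ∑ j, c i j * xc j = 0
  k1_x : ∀ i, ∑ j, k1 i j * xc j = 0
  val_u2 : Val u2 fun u x => -(1 / 16) * ∑ i, ∑ j, C u x i j * C u x i j
  val_v1 : Val v1 fun u x => -2 * m u x
  val_c : ∀ i j, Val (c i j) fun u x => C u x i j
  val_k1 : ∀ i j, Val (k1 i j) fun u x => -C u x i j
  val_W : ∀ i, Val (B.W i) fun u x => W2 u x i
  val_W' : ∀ i, Val (dR (B.W i)) fun u x => W3 u x i

variable {B} {m : ℝ → E3 → ℝ} {C : ℝ → E3 → Fin 3 → Fin 3 → ℝ} {W2 W3 : ℝ → E3 → Fin 3 → ℝ}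

/-- Division by ρ produces the coefficients of h and V. In the rr equation the source is quadratic
in ∂_ρ h and carries a spare power of ρ, so U has no term of order ρ; the next coefficient of the
same equation gives −|C|²/16. -/
theorem Asym.exp (H : B.Asym m C W2 W3) (hR : ∀ μ ν, B.ric μ ν = 0) :
    Nonempty (B.Exp m C W2 W3) := by
  have hc : ∀ i j, ∃ c, B.h i j - Pr i j = rho * c := fun i j => exists_eq_rho_mul fun u x hx => by
    simp [H.h i j u x hx]
  choose c hc using hc
  have hh : ∀ i j, B.h i j = Pr i j + rho * c i j := fun i j => by rw [← hc]; ring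
  have c_symm : ∀ i j, c i j = c j i := fun i j => rho_mul_cancel (by
    rw [← hc, ← hc, B.h_symm, Pr_symm])
  have c_x : ∀ i, ∑ j, c i j * xc j = 0 := fun i => rho_mul_cancel (by
    have h1 := B.h_x i
    have h2 := Pr_x i
    simp only [hh, Fin.sum_univ_three] at *
    linear_combination h1 - h2)
  have val_c : ∀ i j, Val (c i j) fun u x => C u x i j := fun i j u x hx => by
    rw [← H.h' i j u x hx, hh]
    simp [Derivation.leibniz]
  have hPP : ∀ i j, ∑ l, B.k i l * Pr l j = B.k i j := fun i j => by
    have := Pr_mul (fun l => B.k l i) (B.x_k i) j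
    rw [← B.k_symm, ← this]
    exact Finset.sum_congr rfl fun l _ => by rw [B.k_symm, Pr_symm, mul_comm]
  have hkk : ∀ i j, B.k i j - Pr i j = rho * -∑ l, B.k i l * c l j := fun i j => by
    have h1 := B.k_mul_h i j
    have h2 := hPP i j
    have h3 : Pr i j = (if i = j then 1 else 0) - xc i * xc j := rfl
    simp only [hh, Fin.sum_univ_three] at *
    linear_combination h1 - h2 - h3
  have val_k : ∀ i j, Val (B.k i j) fun _ x => roundMetric x i j := fun i j u x hx => by
    have : B.k i j = Pr i j + rho * -∑ l, B.k i l * c l j := by rw [← hkk]; ring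
    rw [this]; simp
  have Cx : ∀ i j u (x : E3), ‖x‖ = 1 → ∑ l, roundMetric x i l * C u x l j = C u x i j := by
    intro i j u x hx
    have h := Pr_mul (fun l => c l j) (by
      rw [← c_x j]; exact Finset.sum_congr rfl fun l _ => by rw [c_symm, mul_comm]) i
    have := congrArg (ev u x hx) h
    simpa only [map_sum, map_mul, ev_Pr, val_c _ _ u x hx] using this
  have val_k1 : ∀ i j, Val (-∑ l, B.k i l * c l j) fun u x => -C u x i j := fun i j u x hx => by
    simp [val_k _ _ u x hx, val_c _ _ u x hx, Cx i j u x hx]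
  -- the `rr` equation
  obtain ⟨b, hb⟩ := exists_eq_rho_mul (a := B.U - 1) fun u x hx => by simp [H.U u x hx]
  set n : Fin 3 → Fin 3 → ScriRing := fun k i => ∑ l, B.k k l * dR (B.h l i) with hn
  have hNr : ∀ k i, B.Nr k i = -(rho ^ 2 * n k i) := fun k i => by
    simp only [Nr, hn, Dr, Fin.sum_univ_three]; ring
  have hrr := B.ric_rr
  simp only [hR, mul_zero, Finset.sum_const_zero, hNr] at hrr
  -- The rr equation with Dr = −ρ² ∂_ρ written out; the power ρ³ is common to both sides and one
  -- more power remains on the right.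
  have hrr2 : rho ^ 3 * (-(8 * B.Ui * dR B.U)) = rho ^ 3 * (rho * ∑ l, ∑ k, n l k * n k l) := by
    simp only [τ, Dr, Fin.sum_univ_three] at hrr ⊢
    linear_combination -hrr
  have hrr3 := rho_pow_mul_cancel 3 hrr2
  have hdU : -(8 * dR B.U) = rho * (B.U * ∑ l, ∑ k, n l k * n k l) := by
    have := B.U_mul
    linear_combination B.U * hrr3 + 8 * dR B.U * this
  have hU1 : B.U = 1 + rho * b := by rw [← hb]; ring
  have hb0 : Val b fun _ _ => 0 := fun u x hx => by
    have := congrArg (ev u x hx) hdU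
    rw [hU1] at this
    simpa [Derivation.leibniz, map_ofNat] using this
  obtain ⟨u2, rfl⟩ := exists_eq_rho_mul hb0
  have hU : B.U = 1 + rho ^ 2 * u2 := by rw [hU1]; ring
  have val_u2 : Val u2 fun u x => -(1 / 16) * ∑ i, ∑ j, C u x i j * C u x i j := by
    have h1 : rho * (-(16 * u2 + 8 * rho * dR u2)) = rho * (B.U * ∑ l, ∑ k, n l k * n k l) := by
      rw [← hdU, hU]
      simp [Derivation.leibniz]
      ring
    have h2 := rho_mul_cancel h1
    intro u x hx
    have h3 := congrArg (ev u x hx) h2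
    have hsymm : ∀ i j, C u x i j = C u x j i := fun i j => by
      have h4 := val_c i j u x hx
      rw [c_symm, val_c j i u x hx] at h4
      exact h4.symm
    simp only [map_neg, map_add, map_mul, ev_rho, map_sum, H.U u x hx, hn, val_k _ _ u x hx,
      H.h' _ _ u x hx, Cx _ _ u x hx, map_ofNat] at h3
    simp only [Fin.sum_univ_three] at h3 ⊢
    rw [hsymm 1 0, hsymm 2 0, hsymm 2 1] at *
    linarith
  obtain ⟨v1, hv1⟩ := exists_eq_rho_mul (a := B.V - 1) fun u x hx => by simp [H.V u x hx]
  have hV : B.V = 1 + rho * v1 := by rw [← hv1]; ring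
  exact ⟨{
    u2 := u2
    y2 := -(B.Ui * u2)
    v1 := v1
    c := c
    k1 := fun i j => -∑ l, B.k i l * c l j
    hU := hU
    hUi := by
      have := B.U_mul
      rw [hU] at this
      linear_combination this
    hV := hV
    hh := hh
    hk := fun i j => by rw [← hkk]; ring
    c_symm := c_symm
    c_x := c_x
    k1_x := fun i => by
      have h0 := c_x 0
      have h1 := c_x 1
      have h2 := c_x 2
      simp only [Fin.sum_univ_three] at *
      linear_combination -(B.k i 0) * h0 - B.k i 1 * h1 - B.k i 2 * h2
    val_u2 := val_u2
    val_v1 := fun u x hx => by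
      rw [← H.V' u x hx, hV]; simp [Derivation.leibniz]
    val_c := val_c
    val_k1 := val_k1
    val_W := H.W
    val_W' := H.W' }⟩

namespace Exp
variable (X : B.Exp m C W2 W3)
include X

theorem C_symm {x : E3} (u : ℝ) (hx : ‖x‖ = 1) (i j : Fin 3) : C u x i j = C u x j i := by
  have h := X.val_c i j u x hx
  rw [X.c_symm, X.val_c j i u x hx] at h
  exact h.symm

theorem C_x {x : E3} (u : ℝ) (hx : ‖x‖ = 1) (i : Fin 3) : ∑ j, C u x i j * x j = 0 := by
  have := congrArg (ev u x hx) (X.c_x i)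
  simpa [X.val_c _ _ u x hx] using this

theorem val_U : Val B.U fun _ _ => 1 := fun u x hx => by rw [X.hU]; simp
theorem val_Ui : Val B.Ui fun _ _ => 1 := fun u x hx => by rw [X.hUi]; simp
theorem val_k (i j : Fin 3) : Val (B.k i j) fun _ x => roundMetric x i j := fun u x hx => by
  rw [X.hk]; simp
theorem val_h (i j : Fin 3) : Val (B.h i j) fun _ x => roundMetric x i j := fun u x hx => by
  rw [X.hh]; simp
theorem dR_h (i j : Fin 3) : dR (B.h i j) = X.c i j + rho * dR (X.c i j) := by
  rw [X.hh]; simp [Derivation.leibniz]; ring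

/-- The ρ-derivative at null infinity of the determinant condition on h. -/
theorem C_trace {x : E3} (u : ℝ) (hx : ‖x‖ = 1) : ∑ i, C u x i i = 0 := by
  have h := congrArg (ev u x hx) (B.k_der_h dR)
  have h0 := X.C_x u hx 0
  have h1 := X.C_x u hx 1
  have h2 := X.C_x u hx 2
  simp only [X.dR_h, map_sum, map_mul, map_add, X.val_k _ _ u x hx, X.val_c _ _ u x hx, ev_rho,
    zero_mul, add_zero, map_zero] at h
  simp only [Fin.sum_univ_three, roundMetric, if_true, Fin.reduceEq, if_false] at *
  have e1 := X.C_symm u hx 1 0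
  have e2 := X.C_symm u hx 2 0
  have e3 := X.C_symm u hx 2 1
  rw [e1, e2, e3] at *
  linear_combination h + x 0 * h0 + x 1 * h1 + x 2 * h2

theorem W2_x {x : E3} (u : ℝ) (hx : ‖x‖ = 1) : ∑ i, x i * W2 u x i = 0 := by
  have := congrArg (ev u x hx) B.x_W
  simpa [X.val_W _ u x hx] using this

theorem P_W2 {x : E3} (u : ℝ) (hx : ‖x‖ = 1) (i : Fin 3) :
    ∑ j, roundMetric x i j * W2 u x j = W2 u x i := by
  have := congrArg (ev u x hx) (Pr_mul B.W B.x_W i)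
  simpa [X.val_W _ u x hx] using this

theorem P_C {x : E3} (u : ℝ) (hx : ‖x‖ = 1) (i l : Fin 3) :
    ∑ j, roundMetric x i j * C u x j l = C u x i l := by
  have h := Pr_mul (fun j => X.c j l) (by
    rw [← X.c_x l]; exact Finset.sum_congr rfl fun j _ => by rw [X.c_symm, mul_comm]) i
  have := congrArg (ev u x hx) h
  simpa [X.val_c _ _ u x hx] using this

theorem val_w (i : Fin 3) : Val (B.w i) fun u x => W2 u x i := fun u x hx => by
  refine Eq.trans ?_ (X.P_W2 u hx i)
  simp [w, X.val_h _ _ u x hx, X.val_W _ u x hx]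

theorem val_dR_w (i : Fin 3) :
    Val (dR (B.w i)) fun u x => W3 u x i + ∑ j, C u x i j * W2 u x j := fun u x hx => by
  have h := congrArg dR B.x_W
  simp only [map_sum, Derivation.leibniz, dR_xc, map_zero, smul_eq_mul, mul_zero, add_zero] at h
  have h' := congrArg (ev u x hx) (Pr_mul (fun j => dR (B.W j)) (by simpa using h) i)
  simp only [map_sum, map_mul, ev_Pr, X.val_W' _ u x hx] at h'
  simp only [w, map_sum, Derivation.leibniz, X.dR_h, smul_eq_mul, map_add, map_mul,
    X.val_h _ _ u x hx, X.val_W _ u x hx, X.val_W' _ u x hx, ev_rho, zero_mul, add_zero,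
    X.val_c _ _ u x hx, Finset.sum_add_distrib, h', mul_comm (W2 u x _)]

theorem dvd_dC_U (i : Fin 3) : rho ^ 3 ∣ dC i.succ B.U := by
  rw [X.hU, map_add, Derivation.map_one_eq_zero, zero_add]
  exact dvd_dC ⟨_, rfl⟩ i

theorem dvd_Dr_U : rho ^ 3 ∣ Dr B.U := by
  have h : Dr B.U = Dr (rho ^ 2 * X.u2) := by rw [X.hU]; simp [Dr]
  rw [h]
  exact dvd_Dr ⟨_, rfl⟩

theorem dvd_dU_U : rho ^ 2 ∣ dU B.U := by
  rw [X.hU, map_add, Derivation.map_one_eq_zero, zero_add]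
  exact dvd_dU ⟨_, rfl⟩

/-- The angular derivative of `h` at second order. -/
def dh (i s k : Fin 3) : ScriRing :=
  dT i (X.c s k) - rho * xc i * dR (X.c s k) - xc i * X.c s k

theorem dC_h (i s k : Fin 3) : dC i.succ (B.h s k)
    = -(rho * (Pr i s * xc k + xc s * Pr i k)) + rho ^ 2 * X.dh i s k := by
  rw [X.hh, map_add, dC_Pr, Derivation.leibniz, dC_succ_rho, dC_succ, dh, smul_eq_mul, smul_eq_mul]
  ring

theorem val_dh (i s k : Fin 3) : Val (X.dh i s k) fun u x =>
    tderiv i (fun z => C u z s k) x - x i * C u x s k := fun u x hx => by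
  simp [dh, (X.val_c s k).dT i u x hx, X.val_c s k u x hx]

theorem br_angular (s i k : Fin 3) : B.br s.succ i.succ k.succ = -(2 * rho * xc s * Pr i k)
    + rho ^ 2 * (X.dh i s k + X.dh k s i - X.dh s i k) := by
  rw [br_succ_succ, X.dC_h, X.dC_h, X.dC_h, Pr_symm k i, Pr_symm s i, Pr_symm s k]
  ring

omit X in
theorem G_zero_angular (i j : Fin 3) : B.G 0 i.succ j.succ
    = B.Ui * (2 * rho * B.h i j - rho ^ 2 * dR (B.h i j)) := by
  rw [G_zero_succ_succ, Dr]; ring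

omit X in
theorem G_zero_angular_dvd (i j : Fin 3) : rho ∣ B.G 0 i.succ j.succ :=
  ⟨B.Ui * (2 * B.h i j - rho * dR (B.h i j)), by rw [G_zero_angular]; ring⟩

omit X in
theorem sq_dvd_Nr (k i : Fin 3) : rho ^ 2 ∣ B.Nr k i :=
  Finset.dvd_sum fun l _ => (sq_dvd_Dr _).mul_left _

theorem dvd_lam_sub (i : Fin 3) : rho ^ 3 ∣ B.lam i - 2 * rho ^ 2 * B.Ui * B.w i := by
  have h1 : rho ^ 3 ∣ rho * Dr (B.w i) := by
    obtain ⟨b, hb⟩ := sq_dvd_Dr (B.w i)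
    exact ⟨b, by rw [hb]; ring⟩
  have h2 : rho ^ 3 ∣ B.Ui * rho * ∑ l, B.W l * Dr (B.h l i) := by
    obtain ⟨b, hb⟩ : rho ^ 2 ∣ ∑ l, B.W l * Dr (B.h l i) :=
      Finset.dvd_sum fun l _ => (sq_dvd_Dr _).mul_left _
    exact ⟨B.Ui * b, by rw [hb]; ring⟩
  have : B.lam i - 2 * rho ^ 2 * B.Ui * B.w i = -(B.Ui * (rho * Dr (B.w i) - dC i.succ B.U
      - xc i * Dr B.U)) + B.Ui * rho * ∑ l, B.W l * Dr (B.h l i) := by rw [lam]; ring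
  rw [this]
  exact dvd_add ((dvd_neg).2 (((h1.sub (X.dvd_dC_U i)).sub (X.dvd_Dr_U.mul_left _)).mul_left _)) h2

/-- The radial part of Z is a multiple of x_k and is annihilated by Γ^0_{ik}; the tangential part is
of order ρ³, and Γ^0_{ik} supplies the fourth power. -/
theorem dvd_Z (i : Fin 3) : rho ^ 4 ∣ ∑ k, B.G 0 i.succ k.succ * B.Z k := by
  have h : ∑ k : Fin 3, B.G 0 i.succ k.succ * B.Z k
      = ∑ k : Fin 3, B.G 0 i.succ k.succ *
        ∑ s : Fin 3, B.k k s * (rho * Dr (B.w s) + dC s.succ B.U) := by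
    have hx := B.x_G_zero_succ i
    have h0 := B.x_δ_zero 0
    have h1 := B.x_δ_zero 1
    have h2 := B.x_δ_zero 2
    simp only [Z, G_succ_eq, Fin.sum_univ_three] at *
    linear_combination (xc 0 * B.γ 0 (Fin.succ 0) + xc 1 * B.γ 0 (Fin.succ 1)
      + xc 2 * B.γ 0 (Fin.succ 2)) * hx + B.G 0 i.succ (Fin.succ 0) * h0
      + B.G 0 i.succ (Fin.succ 1) * h1 + B.G 0 i.succ (Fin.succ 2) * h2
  rw [h]
  refine Finset.dvd_sum fun k _ => ?_
  rw [show rho ^ 4 = rho * rho ^ 3 by ring]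
  refine mul_dvd_mul (G_zero_angular_dvd i k) (Finset.dvd_sum fun s _ => Dvd.dvd.mul_left ?_ _)
  refine dvd_add ?_ (X.dvd_dC_U s)
  rw [show rho ^ 3 = rho * rho ^ 2 by ring]
  exact mul_dvd_mul_left _ (sq_dvd_Dr _)

/-- One order better than the product of the separate orders. The radial part of the Christoffel
symbol and the term −2ρ x_s P_ik of its bracket both contract to zero with the tangential `Nr`. -/
theorem dvd_G_Nr (i k : Fin 3) : rho ^ 4 ∣ ∑ l, B.G l.succ i.succ k.succ * B.Nr k l := by
  have hN := B.Nr_x k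
  have hP : ∀ s, ∑ l, Pr l s * B.Nr k l = B.Nr k s := fun s => by
    rw [← Pr_mul (fun l => B.Nr k l) hN s]
    exact Finset.sum_congr rfl fun l _ => by rw [Pr_symm]
  have e : ∑ l, B.G l.succ i.succ k.succ * B.Nr k l
      = -(rho * B.G 0 i.succ k.succ * ∑ l, B.W l * B.Nr k l)
        + (rho ^ 2 * ∑ s, (X.dh i s k + X.dh k s i - X.dh s i k) * B.Nr k s
        + rho * ∑ l, ∑ s, X.k1 l s * B.br s.succ i.succ k.succ * B.Nr k l) := by
    have P0 := hP 0
    have P1 := hP 1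
    have P2 := hP 2
    have b0 := X.br_angular 0 i k
    have b1 := X.br_angular 1 i k
    have b2 := X.br_angular 2 i k
    simp only [G_succ_eq, δ, X.hk, Fin.sum_univ_three] at *
    linear_combination (B.γ i.succ k.succ - 2 * rho * Pr i k) * hN
      + B.br (Fin.succ 0) i.succ k.succ * P0
      + B.br (Fin.succ 1) i.succ k.succ * P1 + B.br (Fin.succ 2) i.succ k.succ * P2
      + B.Nr k 0 * b0 + B.Nr k 1 * b1 + B.Nr k 2 * b2
  rw [e]
  have hb : ∀ s : Fin 3, rho ∣ B.br s.succ i.succ k.succ := fun s => by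
    rw [br_succ_succ]
    exact dvd_sub (dvd_add (rho_dvd_dC _ _) (rho_dvd_dC _ _)) (rho_dvd_dC _ _)
  refine dvd_add ((dvd_neg).2 ?_) (dvd_add ?_ ?_)
  · rw [show rho ^ 4 = rho * rho * rho ^ 2 by ring]
    exact mul_dvd_mul (mul_dvd_mul_left _ (G_zero_angular_dvd i k))
      (Finset.dvd_sum fun l _ => (sq_dvd_Nr k l).mul_left _)
  · rw [show rho ^ 4 = rho ^ 2 * rho ^ 2 by ring]
    exact mul_dvd_mul_left _ (Finset.dvd_sum fun l _ => (sq_dvd_Nr k l).mul_left _)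
  · rw [show rho ^ 4 = rho * (rho * rho ^ 2) by ring]
    exact mul_dvd_mul_left _ (Finset.dvd_sum fun l _ => Finset.dvd_sum fun s _ =>
      mul_dvd_mul ((hb s).mul_left _) (sq_dvd_Nr k l))

/-- The `rA` component of the Einstein equation determines the leading shift. -/
theorem W2_eq (hR : ∀ μ ν, B.ric μ ν = 0) {x : E3} (u : ℝ) (hx : ‖x‖ = 1) (i : Fin 3) :
    W2 u x i = 1 / 2 * ∑ k, tderiv k (fun z => C u z k i) x := by
  have h := B.ric_radial i
  simp only [hR, mul_zero, Finset.sum_const_zero] at h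
  -- The value of q combines the radial part 2 x_k W_i with the leading part −C_ki of `Nr`.
  have hQ : ∀ k, ∃ q, B.Q k i = rho ^ 2 * q ∧ Val q fun u x => 2 * x k * W2 u x i - C u x k i := by
    intro k
    obtain ⟨l, hl⟩ := X.dvd_lam_sub i
    refine ⟨xc k * (2 * B.Ui * B.w i + rho * l) - ∑ s, B.k k s * dR (B.h s i), ?_, ?_⟩
    · have hl' : B.lam i = rho ^ 3 * l + 2 * rho ^ 2 * B.Ui * B.w i := by rw [← hl]; ring
      rw [Q_eq, hl', Nr]
      simp only [Dr, Fin.sum_univ_three]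
      ring
    · intro u x hx
      simp only [map_sub, map_mul, map_add, map_sum, ev_xc, ev_rho, map_ofNat, X.val_Ui u x hx,
        X.val_w i u x hx, X.val_k _ _ u x hx, X.dR_h, X.val_c _ _ u x hx, zero_mul, add_zero,
        X.P_C u hx]
      ring
  choose q hq hqv using hQ
  have hQd : ∀ k : Fin 3, dC k.succ (B.Q k i)
      = rho ^ 3 * (dT k (q k) - xc k * (2 * q k + rho * dR (q k))) := fun k => by
    rw [hq, dC_succ_rho_pow_mul]; push_cast; ring
  have hlast : ∑ l, ∑ k, B.G l.succ i.succ k.succ * B.Q k l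
      = ∑ l, B.Q l i * B.lam l + ∑ k, ∑ l, B.G l.succ i.succ k.succ * B.Nr k l := by
    have e : ∀ l, B.Q l i = ∑ j : Fin 3, xc j * B.G l.succ i.succ j.succ := fun _ => rfl
    simp only [Q_eq B _ 0, Q_eq B _ 1, Q_eq B _ 2, Fin.sum_univ_three]
    rw [e, e, e]
    simp only [Fin.sum_univ_three]
    ring
  have hd1 : rho ^ 4 ∣ 2 * dC i.succ B.τ := by
    refine Dvd.dvd.mul_left (dvd_dC (n := 3) ?_ i) _
    exact X.dvd_Dr_U.mul_left _
  have ht : ∀ j : Fin 3, rho ^ 3 ∣ B.t j.succ := fun j => (X.dvd_dC_U j).mul_left _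
  have hd2 : rho ^ 4 ∣ 2 * rho * ∑ j, Pr i j * B.t j.succ := by
    rw [show rho ^ 4 = rho * rho ^ 3 by ring]
    exact mul_dvd_mul (Dvd.intro_left 2 rfl) (Finset.dvd_sum fun j _ => (ht j).mul_left _)
  have hd3 : rho ^ 4 ∣ ∑ k : Fin 3, B.t k.succ * B.Q k i := by
    refine Finset.dvd_sum fun k _ => ?_
    rw [hq]
    obtain ⟨b, hb⟩ := ht k
    exact ⟨rho * b * q k, by rw [hb]; ring⟩
  have hd5 : rho ^ 4 ∣ ∑ l, ∑ k, B.G l.succ i.succ k.succ * B.Q k l := by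
    rw [hlast]
    refine dvd_add (Finset.dvd_sum fun l _ => ?_) (Finset.dvd_sum fun k _ => X.dvd_G_Nr i k)
    have hl : rho ^ 2 ∣ B.lam l := by
      obtain ⟨b, hb⟩ := X.dvd_lam_sub l
      exact ⟨rho * b + 2 * B.Ui * B.w l, by linear_combination hb⟩
    rw [hq, show rho ^ 4 = rho ^ 2 * rho ^ 2 by ring]
    exact mul_dvd_mul (Dvd.intro _ rfl) hl
  -- M is the ρ³ coefficient of the contracted equation; all remaining terms are of order ρ⁴, so M
  -- vanishes at null infinity.
  set M : ScriRing := 2 * ∑ k, (dT k (q k) - xc k * (2 * q k + rho * dR (q k)))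
    + 2 * ∑ j, B.W j * (B.Ui * (2 * B.h i j - rho * dR (B.h i j))) with hM
  have hmain : rho ^ 3 * M = 2 * dC i.succ B.τ - 2 * rho * ∑ j, Pr i j * B.t j.succ
      - ∑ k, B.t k.succ * B.Q k i + ∑ k, B.G 0 i.succ k.succ * B.Z k
      + ∑ l, ∑ k, B.G l.succ i.succ k.succ * B.Q k l := by
    have hG : rho * ∑ j, B.W j * (B.Ui * (2 * B.h i j - rho * dR (B.h i j)))
        = ∑ j, B.W j * B.G 0 i.succ j.succ := by
      rw [Finset.mul_sum]
      exact Finset.sum_congr rfl fun j _ => by rw [G_zero_angular]; ring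
    have hQ' : rho ^ 3 * ∑ k, (dT k (q k) - xc k * (2 * q k + rho * dR (q k)))
        = ∑ k : Fin 3, dC k.succ (B.Q k i) := by
      rw [Finset.mul_sum]
      exact Finset.sum_congr rfl fun k _ => (hQd k).symm
    rw [hM]
    linear_combination -h + 2 * hQ' + 2 * rho ^ 2 * hG
  have hdiv : rho ^ 4 ∣ rho ^ 3 * M := by
    rw [hmain]
    exact dvd_add (dvd_add (dvd_sub (dvd_sub hd1 hd2) hd3) (X.dvd_Z i)) hd5
  have hval : Val M fun u x => 2 * ∑ k, (tderiv k (fun z => 2 * z k * W2 u z i - C u z k i) x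
      - x k * (2 * (2 * x k * W2 u x i - C u x k i))) + 2 * ∑ j, W2 u x j * (2 * roundMetric x i j) :=
    fun u x hx => by
      simp [hM, (hqv _).dT _ u x hx, hqv _ u x hx, X.val_W _ u x hx, X.val_Ui u x hx,
        X.val_h _ _ u x hx, map_ofNat]
  have h0 := eq_of_dvd_sub hval hdiv u x hx
  have sW : ∀ i, SphereSmooth fun z => W2 u z i := fun i => (X.val_W i).scriFun.sphereSmooth u
  have sC : ∀ i j, SphereSmooth fun z => C u z i j := fun i j => (X.val_c i j).scriFun.sphereSmooth u
  have hd : ∀ k, tderiv k (fun z => 2 * z k * W2 u z i - C u z k i) x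
      = 2 * (x k * tderiv k (fun z => W2 u z i) x + W2 u x i * roundMetric x k k)
        - tderiv k (fun z => C u z k i) x := fun k => by
    rw [tderiv_sub k (by fun_prop) (sC k i) hx, tderiv_mul k (by fun_prop) (sW i) hx,
      tderiv_const_mul k 2 (by fun_prop) hx, tderiv_coord k k hx]
    ring
  have hs := sum_x_tderiv (sW i) hx
  have hCx := X.C_x u hx i
  have hPW := X.P_W2 u hx i
  have hxx := sum_x_sq hx
  simp only [hd, Fin.sum_univ_three] at *
  rw [X.C_symm u hx i 0, X.C_symm u hx i 1, X.C_symm u hx i 2] at hCx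
  have hP : roundMetric x 0 0 + roundMetric x 1 1 + roundMetric x 2 2 = 2 := by
    simp only [roundMetric, if_true]; linarith
  linear_combination (1 / 4) * h0 - hs - W2 u x i * hP - hCx + (2 * W2 u x i) * hxx / 1 - hPW

end Exp
end Fields

end

/-! ### Evolution of the mass aspect, and estimates for the uA equation. -/

section

theorem exists_val (a : ScriRing) : ∃ v, Val a v :=
  ⟨fun u x => if hx : ‖x‖ = 1 then ev u x hx a else 0, fun u x hx => by simp [hx]⟩

theorem ev_eq_zero_of_dvd {n : ℕ} {a : ScriRing} (h : rho ^ (n + 1) ∣ rho ^ n * a) (u : ℝ) (x : E3)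
    (hx : ‖x‖ = 1) : ev u x hx a = 0 := by
  obtain ⟨b, hb⟩ := h
  have : a = rho * b := rho_pow_mul_cancel n (by rw [hb]; ring)
  simp [this]

theorem dC_rho_mul (i : Fin 3) (a : ScriRing) : dC i.succ (rho * a)
    = rho ^ 2 * (dT i a - xc i * (a + rho * dR a)) := by
  have h := dC_succ_rho_pow_mul i 1 a
  rw [pow_one] at h
  rw [h]; push_cast; ring

theorem sum_dC_xc_mul (a : ScriRing) : ∑ i : Fin 3, dC i.succ (xc i * a) = 2 * rho * a + Dr a := by
  have h1 := dC_three a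
  have h2 := trace_Pr
  simp only [Fin.sum_univ_three, Derivation.leibniz, dC_xc, smul_eq_mul, succ_zero3, succ_one3,
    succ_two3] at *
  linear_combination h1 + rho * a * h2

/-- The rotation generator `Y_j = A_{jl} x_l`. -/
def rot (A : Fin 3 → Fin 3 → ℝ) (j : Fin 3) : ScriRing := ∑ l, algebraMap ℝ ScriRing (A j l) * xc l

theorem rot_x {A : Fin 3 → Fin 3 → ℝ} (hA : ∀ i j, A i j = -A j i) : ∑ j, rot A j * xc j = 0 := by
  have h00 : A 0 0 = 0 := by linarith [hA 0 0]
  have h11 : A 1 1 = 0 := by linarith [hA 1 1]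
  have h22 : A 2 2 = 0 := by linarith [hA 2 2]
  simp only [rot, Fin.sum_univ_three, h00, h11, h22, hA 1 0, hA 2 0, hA 2 1, map_zero, map_neg]
  ring

theorem dC_rot (A : Fin 3 → Fin 3 → ℝ) (i j : Fin 3) :
    dC i.succ (rot A j) = rho * ∑ l, algebraMap ℝ ScriRing (A j l) * Pr i l := by
  simp only [rot, map_sum, Derivation.leibniz, Derivation.map_algebraMap, dC_xc, smul_eq_mul,
    mul_zero, add_zero, Finset.mul_sum]
  exact Finset.sum_congr rfl fun l _ => by ring

theorem dR_rot (A : Fin 3 → Fin 3 → ℝ) (j : Fin 3) : dR (rot A j) = 0 := by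
  simp [rot, Derivation.leibniz]

theorem dU_rot (A : Fin 3 → Fin 3 → ℝ) (j : Fin 3) : dU (rot A j) = 0 := by
  simp [rot, Derivation.leibniz]

/-- The rotation field `A x`. -/
def rotVec (A : Fin 3 → Fin 3 → ℝ) (x : E3) (j : Fin 3) : ℝ := ∑ l, A j l * x l

@[simp] theorem ev_rot (A : Fin 3 → Fin 3 → ℝ) (j : Fin 3) (u : ℝ) (x : E3) (hx : ‖x‖ = 1) :
    ev u x hx (rot A j) = rotVec A x j := by
  simp [rot, rotVec]

namespace Fields
variable {B : Fields} {m : ℝ → E3 → ℝ} {C : ℝ → E3 → Fin 3 → Fin 3 → ℝ}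
  {W2 W3 : ℝ → E3 → Fin 3 → ℝ}

namespace Exp
variable (X : B.Exp m C W2 W3)

/-- The coefficient of `ρ` in `g_{00}`. -/
def φ1 : ScriRing := -(rho * X.u2 + X.v1 + rho ^ 2 * X.u2 * X.v1) + rho * ∑ i, B.W i * B.w i

theorem φ_eq : B.φ = -1 + rho * X.φ1 := by
  rw [φ, X.hU, X.hV, φ1]; ring

theorem val_φ1 : Val X.φ1 fun u x => 2 * m u x := fun u x hx => by
  simp [φ1, X.val_v1 u x hx]

theorem dU_φ : dU B.φ = rho * dU X.φ1 := by
  rw [X.φ_eq]; simp [Derivation.leibniz]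

theorem Dr_φ : Dr B.φ = rho ^ 2 * -(X.φ1 + rho * dR X.φ1) := by
  rw [X.φ_eq]; simp [Dr, Derivation.leibniz]; ring

theorem dC_φ (i : Fin 3) :
    dC i.succ B.φ = rho ^ 2 * (dT i X.φ1 - xc i * (X.φ1 + rho * dR X.φ1)) := by
  rw [X.φ_eq, map_add, dC_rho_mul]; simp

/-- The coefficient of `ρ³` in `∂_i U`. -/
def aU (i : Fin 3) : ScriRing := dT i X.u2 - xc i * (2 * X.u2 + rho * dR X.u2)

theorem dC_U (i : Fin 3) : dC i.succ B.U = rho ^ 3 * X.aU i := by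
  rw [X.hU, map_add, dC_succ_rho_pow_mul, aU]; push_cast; simp

theorem dU_U : dU B.U = rho ^ 2 * dU X.u2 := by
  rw [X.hU, map_add, dU_rho_pow_mul]; simp

theorem Dr_U : Dr B.U = rho ^ 3 * -(2 * X.u2 + rho * dR X.u2) := by
  rw [X.hU]; simp [Dr, Derivation.leibniz]; ring

theorem dU_h (i j : Fin 3) : dU (B.h i j) = rho * dU (X.c i j) := by
  rw [X.hh]; simp [Derivation.leibniz]

/-- The coefficient of `ρ²` in `∂_i (ρ w_j)`. -/
def dw (_ : B.Exp m C W2 W3) (i j : Fin 3) : ScriRing :=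
  dT i (B.w j) - xc i * (B.w j + rho * dR (B.w j))

include X

theorem dC_b (i j : Fin 3) : dC i.succ (B.b j)
    = -(rho ^ 3 * X.aU i * xc j) - B.U * rho * Pr i j + rho ^ 2 * X.dw i j := by
  rw [b, map_add, dC_rho_mul, map_neg, Derivation.leibniz, dC_xc, X.dC_U, dw, smul_eq_mul,
    smul_eq_mul]
  ring

theorem dU_b (j : Fin 3) : dU (B.b j) = -(rho ^ 2 * dU X.u2 * xc j) + rho * dU (B.w j) := by
  rw [b, map_add, map_neg, Derivation.leibniz, Derivation.leibniz, X.dU_U]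
  simp; ring

theorem br_zero_zero_eq (s : Fin 3) : B.br s.succ 0 0 = rho * (2 * dU (B.w s)
    - rho * (2 * dU X.u2 * xc s + dT s X.φ1 - xc s * (X.φ1 + rho * dR X.φ1))) := by
  rw [br_zero_zero, X.dU_b, X.dC_φ]; ring

theorem br_zero_succ_eq (s j : Fin 3) : B.br s.succ 0 j.succ = rho * (dU (X.c s j)
    + rho * (X.dw j s - X.dw s j) + rho ^ 2 * (xc j * X.aU s - xc s * X.aU j)) := by
  rw [br_zero_succ, X.dC_b, X.dC_b, X.dU_h, Pr_symm s j]; ring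

theorem G_zero_zero_zero_eq : B.G 0 0 0
    = rho ^ 2 * (B.Ui * (2 * dU X.u2 - (X.φ1 + rho * dR X.φ1))) := by
  rw [G_zero_zero_zero, X.dU_U, X.Dr_φ]; ring

theorem G_zero_zero_succ_eq (i : Fin 3) : B.G 0 0 i.succ
    = rho ^ 3 * (B.Ui * (dT i X.u2 - dR (B.w i))) := by
  rw [G_zero_zero_succ, X.dC_U, X.Dr_U, aU, Dr]; ring

/-- `δ^i_{00} / ρ`. -/
def d0 (i : Fin 3) : ScriRing := -(B.W i * B.G 0 0 0) + ∑ s, B.k i s * (2 * dU (B.w s)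
    - rho * (2 * dU X.u2 * xc s + dT s X.φ1 - xc s * (X.φ1 + rho * dR X.φ1)))

theorem δ_zero_zero (i : Fin 3) : B.δ i 0 0 = rho * X.d0 i := by
  simp only [δ, d0, X.br_zero_zero_eq, Fin.sum_univ_three]; ring

/-- `δ^i_{0j} / ρ`. -/
def d1 (i j : Fin 3) : ScriRing := -(B.W i * B.G 0 0 j.succ) + ∑ s, B.k i s * (dU (X.c s j)
    + rho * (X.dw j s - X.dw s j) + rho ^ 2 * (xc j * X.aU s - xc s * X.aU j))

theorem δ_zero_succ (i j : Fin 3) : B.δ i 0 j.succ = rho * X.d1 i j := by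
  simp only [δ, d1, X.br_zero_succ_eq, Fin.sum_univ_three]; ring

theorem x_d1 (j : Fin 3) : ∑ i, xc i * X.d1 i j = 0 := rho_mul_cancel (by
  have h := B.x_δ 0 j.succ
  simp only [X.δ_zero_succ, Fin.sum_univ_three] at *
  linear_combination h)

theorem val_G_zero_zero : Val (B.G 0 0 0) fun _ _ => 0 := fun u x hx => by
  rw [X.G_zero_zero_zero_eq]; simp

theorem val_G_zero_succ (i : Fin 3) : Val (B.G 0 0 i.succ) fun _ _ => 0 := fun u x hx => by
  rw [X.G_zero_zero_succ_eq]; simp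

theorem P_dU_W2 {x : E3} (u : ℝ) (hx : ‖x‖ = 1) (i : Fin 3) :
    ∑ s, roundMetric x i s * deriv (fun v => W2 v x s) u = deriv (fun v => W2 v x i) u := by
  have h := congrArg dU B.x_w
  simp only [map_sum, Derivation.leibniz, dU_xc, map_zero, smul_eq_mul, mul_zero, add_zero] at h
  have := congrArg (ev u x hx) (Pr_mul (fun j => dU (B.w j)) (by simpa using h) i)
  simpa [(X.val_w _).dU u x hx] using this

theorem dU_W2_x {x : E3} (u : ℝ) (hx : ‖x‖ = 1) :
    ∑ i, x i * deriv (fun v => W2 v x i) u = 0 := by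
  have h := congrArg dU B.x_w
  simp only [map_sum, Derivation.leibniz, dU_xc, map_zero, smul_eq_mul, mul_zero, add_zero] at h
  have := congrArg (ev u x hx) h
  simpa [(X.val_w _).dU u x hx] using this

theorem P_news {x : E3} (u : ℝ) (hx : ‖x‖ = 1) (i j : Fin 3) :
    ∑ s, roundMetric x i s * deriv (fun v => C v x s j) u = deriv (fun v => C v x i j) u := by
  have h := congrArg dU (X.c_x j)
  simp only [map_sum, Derivation.leibniz, dU_xc, map_zero, smul_eq_mul, mul_zero, zero_add] at h
  have := congrArg (ev u x hx) (Pr_mul (fun s => dU (X.c s j)) (by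
    rw [← h]; exact Finset.sum_congr rfl fun l _ => by rw [X.c_symm]) i)
  simpa [(X.val_c _ _).dU u x hx] using this

theorem val_d0 (i : Fin 3) : Val (X.d0 i) fun u x => 2 * deriv (fun v => W2 v x i) u :=
  fun u x hx => by
  simp only [d0, map_add, map_neg, map_mul, map_sum, map_sub, X.val_G_zero_zero u x hx, ev_rho,
    zero_mul, sub_zero, mul_zero, neg_zero, zero_add, X.val_k _ _ u x hx, (X.val_w _).dU u x hx,
    map_ofNat]
  rw [← X.P_dU_W2 u hx i, Finset.mul_sum]
  exact Finset.sum_congr rfl fun s _ => by ring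

theorem val_d1 (i j : Fin 3) : Val (X.d1 i j) fun u x => deriv (fun v => C v x i j) u :=
  fun u x hx => by
  simp only [d1, map_add, map_neg, map_mul, map_sum, map_pow, X.val_G_zero_succ j u x hx, ev_rho,
    zero_mul, mul_zero, neg_zero, zero_add, add_zero, X.val_k _ _ u x hx,
    (X.val_c _ _).dU u x hx, ne_eq, OfNat.ofNat_ne_zero, not_false_eq_true, zero_pow]
  exact X.P_news u hx i j

theorem sq_dvd_γ (j : Fin 3) : rho ^ 2 ∣ B.γ 0 j.succ := by
  rw [γ, br0_zero_succ, X.dC_φ, X.G_zero_zero_succ_eq]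
  simp only [X.br_zero_succ_eq]
  refine dvd_add (dvd_sub ((dvd_neg).2 (Dvd.dvd.mul_left (Dvd.intro _ rfl) _)) ?_) ?_
  · exact ⟨B.V * (rho * (B.Ui * (dT j X.u2 - dR (B.w j)))), by ring⟩
  · rw [pow_two]
    exact mul_dvd_mul (Dvd.intro_left _ rfl) (Finset.dvd_sum fun s _ =>
      Dvd.dvd.mul_left (Dvd.intro _ rfl) _)

theorem dvd_G_succ_zero (i j : Fin 3) : rho ∣ B.G i.succ 0 j.succ := by
  rw [G_succ_eq, X.δ_zero_succ]
  exact dvd_add ((dvd_trans (Dvd.intro _ (by ring)) (X.sq_dvd_γ j)).mul_left _) (Dvd.intro _ rfl)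

/-- The evolution equation of the mass aspect. -/
theorem mass_evolution (hR : ∀ μ ν, B.ric μ ν = 0) {x : E3} (u : ℝ) (hx : ‖x‖ = 1) :
    deriv (fun v => m v x) u = -(1 / 8) * ∑ i, ∑ j,
        deriv (fun v => C v x i j) u * deriv (fun v => C v x i j) u
      + 1 / 2 * ∑ i, tderiv i (fun z => deriv (fun v => W2 v z i) u) x := by
  have h := B.ric_eq 0 0
  rw [hR] at h
  -- The quotient of the radial part of Γ^i_{00} by ρ (doubled). Its value −2 ∂_u m is how the time
  -- derivative of the mass enters through the spatial divergence.
  set g := -(B.Ui * dU X.φ1) - B.V * (rho * (B.Ui * (2 * dU X.u2 - (X.φ1 + rho * dR X.φ1))))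
    + rho * (B.Ui * ∑ s, B.W s * (2 * dU (B.w s)
    - rho * (2 * dU X.u2 * xc s + dT s X.φ1 - xc s * (X.φ1 + rho * dR X.φ1)))) with hg
  have hγ : B.γ 0 0 = rho * g := by
    rw [γ, br0_zero_zero, X.dU_φ, X.G_zero_zero_zero_eq, hg]
    simp only [X.br_zero_zero_eq, Fin.sum_univ_three]
    ring
  have valg : Val g fun u x => -2 * deriv (fun v => m v x) u := fun u x hx => by
    have h1 : ev u x hx (dU X.φ1) = deriv (fun s => 2 * m s x) u := X.val_φ1.dU u x hx
    have h2 : deriv (fun s => 2 * m s x) u = 2 * deriv (fun s => m s x) u := by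
      rw [deriv_const_mul_field]
    rw [h2] at h1
    simp [hg, X.val_Ui u x hx, h1]
  have e1 : ∑ i : Fin 3, dC i.succ (B.G i.succ 0 0) = rho ^ 2 * (g - rho * dR g
      + ∑ i, (dT i (X.d0 i) - xc i * (X.d0 i + rho * dR (X.d0 i)))) := by
    simp only [G_succ_eq, map_add, Finset.sum_add_distrib, X.δ_zero_zero, dC_rho_mul]
    rw [sum_dC_xc_mul, hγ, ← Finset.mul_sum]
    simp only [Dr, Derivation.leibniz, dR_rho, smul_eq_mul]
    ring
  set p := B.Ui * -(X.φ1 + rho * dR X.φ1) with hp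
  -- The terms in ∂_u u₂ cancel between Γ^0_{00} and the contracted symbol. No second time
  -- derivative of |C|² is left, and p has the value −2m.
  have e0 : B.G 0 0 0 - B.t 0 = rho ^ 2 * p := by
    rw [t, dC_zero, X.dU_U, X.G_zero_zero_zero_eq, hp]; ring
  have e0' : dU (B.G 0 0 0) - dU (B.t 0) = rho ^ 2 * dU p := by
    rw [← map_sub, e0, dU_rho_pow_mul]
  have ht : ∀ s, rho ^ 2 ∣ B.t s := by
    intro s
    refine Fin.cases ?_ (fun i => ?_) s
    · exact X.dvd_dU_U.mul_left _
    · exact (dvd_trans (Dvd.intro _ (by ring : rho ^ 2 * rho = rho ^ 3)) (X.dvd_dC_U i)).mul_left _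
  have hG00 : ∀ s, rho ∣ B.G s 0 0 := by
    intro s
    refine Fin.cases ?_ (fun i => ?_) s
    · rw [X.G_zero_zero_zero_eq, pow_two, mul_assoc]; exact Dvd.intro _ rfl
    · rw [G_succ_eq, hγ, X.δ_zero_zero]
      exact dvd_add ((Dvd.intro _ rfl).mul_left _) (Dvd.intro _ rfl)
  have hd1 : rho ^ 3 ∣ ∑ s, B.t s * B.G s 0 0 := Finset.dvd_sum fun s _ => by
    rw [show rho ^ 3 = rho ^ 2 * rho by ring]
    exact mul_dvd_mul (ht s) (hG00 s)
  choose γ' hγ' using fun j => X.sq_dvd_γ j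
  set n : Fin 3 → Fin 3 → ScriRing := fun i j => rho * xc i * γ' j + X.d1 i j with hn
  have hGn : ∀ i j : Fin 3, B.G i.succ 0 j.succ = rho * n i j := fun i j => by
    rw [G_succ_eq, hγ', X.δ_zero_succ, hn]; ring
  have valn : ∀ i j, Val (n i j) fun u x => deriv (fun v => C v x i j) u := fun i j u x hx => by
    simp [hn, X.val_d1 i j u x hx]
  have e2 : ∑ l, ∑ s, B.G l 0 s * B.G s 0 l = B.G 0 0 0 * B.G 0 0 0
      + 2 * ∑ i : Fin 3, B.G 0 0 i.succ * B.G i.succ 0 0 + rho ^ 2 * ∑ i, ∑ j, n i j * n j i := by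
    simp only [Fin.sum_univ_succ (n := 3), hGn, Fin.sum_univ_three, B.G_symm _ (Fin.succ 0) 0]
    ring
  have hd2 : rho ^ 3 ∣ B.G 0 0 0 * B.G 0 0 0
      + 2 * ∑ i : Fin 3, B.G 0 0 i.succ * B.G i.succ 0 0 := by
    refine dvd_add ?_ (Dvd.dvd.mul_left (Finset.dvd_sum fun i _ => ?_) _)
    · rw [X.G_zero_zero_zero_eq]
      exact ⟨rho * (B.Ui * (2 * dU X.u2 - (X.φ1 + rho * dR X.φ1))) ^ 2, by ring⟩
    · rw [X.G_zero_zero_succ_eq, mul_assoc]; exact Dvd.intro _ rfl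
  -- The right-hand side is of order ρ³, so the bracket on the left vanishes at null infinity; that
  -- is the evolution law.
  have e3 : rho ^ 2 * (2 * dU p + 2 * (g - rho * dR g
      + ∑ i, (dT i (X.d0 i) - xc i * (X.d0 i + rho * dR (X.d0 i))))
      - ∑ i, ∑ j, n i j * n j i) = B.G 0 0 0 * B.G 0 0 0
      + 2 * ∑ i : Fin 3, B.G 0 0 i.succ * B.G i.succ 0 0 - ∑ s, B.t s * B.G s 0 0 := by
    rw [Fin.sum_univ_succ, dC_zero, e1] at h
    linear_combination -h + e2 - 2 * e0'
  have valp : Val p fun u x => -(2 * m u x) := fun u x hx => by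
    simp [hp, X.val_Ui u x hx, X.val_φ1 u x hx]
  have h1 : ev u x hx (dU p) = deriv (fun s => -(2 * m s x)) u := valp.dU u x hx
  have h2 : deriv (fun s => -(2 * m s x)) u = -2 * deriv (fun s => m s x) u := by
    rw [← deriv_const_mul_field]; congr 1; funext s; ring
  rw [h2] at h1
  have hz := ev_eq_zero_of_dvd (n := 2) (by rw [e3]; exact dvd_sub hd2 hd1) u x hx
  have hs : ∀ i, deriv (fun v => C v x i 0) u = deriv (fun v => C v x 0 i) u := fun i => by
    congr 1; funext v; exact X.C_symm v hx i 0
  have hs' : deriv (fun v => C v x 2 1) u = deriv (fun v => C v x 1 2) u := by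
    congr 1; funext v; exact X.C_symm v hx 2 1
  have hW := X.dU_W2_x u hx
  have sW : ∀ i, SphereSmooth fun z => deriv (fun v => W2 v z i) u := fun i =>
    (X.val_W i).dU.scriFun.sphereSmooth u
  simp only [map_sub, map_add, map_mul, map_sum, map_ofNat, h1, valg u x hx, ev_rho, zero_mul,
    sub_zero, add_zero, (X.val_d0 _).dT _ u x hx, X.val_d0 _ u x hx, ev_xc, valn _ _ u x hx,
    tderiv_const_mul _ 2 (sW _) hx] at hz
  simp only [Fin.sum_univ_three, hs, hs'] at hz hW ⊢
  linear_combination (-1 / 8) * hz - (1 / 2) * hW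

theorem x_γ : rho ^ 2 ∣ ∑ i : Fin 3, xc i * B.γ 0 i.succ :=
  Finset.dvd_sum fun i _ => (X.sq_dvd_γ i).mul_left _

theorem rho_dvd_γ_angular (j k : Fin 3) : rho ∣ B.γ j.succ k.succ := by
  rw [γ, br0_succ_succ, X.dU_h]
  refine dvd_add (dvd_sub ((dvd_neg).2 (Dvd.dvd.mul_left (dvd_sub (dvd_add (rho_dvd_dC _ _)
    (rho_dvd_dC _ _)) (Dvd.intro _ rfl)) _)) ((G_zero_angular_dvd j k).mul_left _)) ?_
  exact Dvd.dvd.mul_right (Dvd.intro_left _ rfl) _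

/-- The radial contraction gains an order over `rho_dvd_γ_angular`: Γ^0 drops out, and brackets with
a radial slot reduce to radial derivatives or to ρ² terms. -/
theorem x_γ_angular (j : Fin 3) : rho ^ 2 ∣ ∑ k : Fin 3, xc k * B.γ j.succ k.succ := by
  have h1 := B.x_br0_succ_succ j
  have h2 := B.x_G_zero_succ j
  have b0 := B.x_br_succ_succ 0 j
  have b1 := B.x_br_succ_succ 1 j
  have b2 := B.x_br_succ_succ 2 j
  have e : ∑ k : Fin 3, xc k * B.γ j.succ k.succ = -(B.Ui * (rho * Dr (B.w j) - 2 * rho ^ 2 * B.w j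
      - dC j.succ B.U - xc j * Dr B.U)) + B.Ui * rho * ∑ s, B.W s * Dr (B.h s j) := by
    simp only [γ, Fin.sum_univ_three] at *
    linear_combination -B.Ui * h1 - B.V * h2 + B.Ui * rho * (B.W 0 * b0 + B.W 1 * b1 + B.W 2 * b2)
  have h23 : ∀ {a : ScriRing}, rho ^ 3 ∣ a → rho ^ 2 ∣ a := fun h =>
    dvd_trans (Dvd.intro rho (by ring)) h
  rw [e]
  refine dvd_add ((dvd_neg).2 (Dvd.dvd.mul_left (dvd_sub (dvd_sub (dvd_sub ?_ ?_)
    (h23 (X.dvd_dC_U j))) ((h23 X.dvd_Dr_U).mul_left _)) _)) ?_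
  · exact (sq_dvd_Dr _).mul_left _
  · exact ⟨2 * B.w j, by ring⟩
  · exact Dvd.dvd.mul_left (Finset.dvd_sum fun s _ => (sq_dvd_Dr _).mul_left _) _

/-- `δ^i_{jk} / ρ²`. -/
def d2 (i j k : Fin 3) : ScriRing := -(B.W i * (B.Ui * (2 * B.h j k - rho * dR (B.h j k))))
  + ∑ s, B.k i s * (X.dh j s k + X.dh k s j - X.dh s j k)

theorem δ_succ_succ (i j k : Fin 3) : B.δ i j.succ k.succ = rho ^ 2 * X.d2 i j k := by
  have h := B.k_x i
  rw [δ, G_zero_angular, d2]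
  simp only [X.br_angular, Fin.sum_univ_three] at *
  linear_combination -2 * rho * Pr j k * h

theorem val_d2 (i j k : Fin 3) : Val (X.d2 i j k) fun u x => -(2 * W2 u x i * roundMetric x j k)
    + ∑ s, roundMetric x i s * ((tderiv j (fun z => C u z s k) x - x j * C u x s k)
      + (tderiv k (fun z => C u z s j) x - x k * C u x s j)
      - (tderiv s (fun z => C u z j k) x - x s * C u x j k)) := fun u x hx => by
  simp only [d2, map_add, map_sub, map_neg, map_mul, map_sum, X.val_W _ u x hx, X.val_Ui u x hx,
    X.val_h _ _ u x hx, map_ofNat, ev_rho, zero_mul, sub_zero, X.val_k _ _ u x hx,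
    X.val_dh _ _ _ u x hx]
  ring

/-- The quadratic Christoffel terms in the angular components of the Einstein equation. -/
theorem quadratic_terms (j : Fin 3) : rho ^ 4 ∣ ∑ l, ∑ s, B.G l j.succ s * B.G s 0 l
    - (∑ i : Fin 3, B.G 0 j.succ i.succ * (rho * X.d0 i)
      + rho ^ 3 * ∑ i, ∑ k, X.d2 i j k * X.d1 k i) := by
  -- Each Christoffel symbol is split into radial and tangential parts. Radial parts enter the
  -- product only through contractions with x, each of which is small.
  have e : ∑ l, ∑ s, B.G l j.succ s * B.G s 0 l
      - (∑ i : Fin 3, B.G 0 j.succ i.succ * (rho * X.d0 i)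
      + rho ^ 3 * ∑ i, ∑ k, X.d2 i j k * X.d1 k i)
      = B.G 0 0 j.succ * B.G 0 0 0 + ∑ i : Fin 3, B.G i.succ 0 j.succ * B.G 0 0 i.succ
        + (∑ i : Fin 3, xc i * B.γ 0 i.succ) * (∑ k : Fin 3, xc k * B.γ j.succ k.succ)
        + ∑ k : Fin 3, B.γ j.succ k.succ * ∑ i : Fin 3, xc i * B.δ k 0 i.succ
        + rho ^ 2 * ∑ i : Fin 3, B.γ 0 i.succ * ∑ k, X.d2 i j k * xc k := by
    have h1 := B.x_G_zero_succ j
    have hG : ∀ i k : Fin 3, B.G i.succ j.succ k.succ = xc i * B.γ j.succ k.succ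
      + rho ^ 2 * X.d2 i j k := fun i k => by rw [G_succ_eq, X.δ_succ_succ]
    have hG0 : ∀ i : Fin 3, B.G i.succ 0 0 = xc i * B.γ 0 0 + rho * X.d0 i := fun i => by
      rw [G_succ_eq, X.δ_zero_zero]
    have hG1 : ∀ i k : Fin 3, B.G k.succ 0 i.succ = xc k * B.γ 0 i.succ + rho * X.d1 k i :=
      fun i k => by rw [G_succ_eq, X.δ_zero_succ]
    simp only [Fin.sum_univ_succ (n := 3), B.G_symm _ j.succ 0, hG, hG0, hG1 _ 0, hG1 _ 1, hG1 _ 2,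
      X.δ_zero_succ, Fin.sum_univ_three] at *
    linear_combination B.γ 0 0 * h1
  rw [e]
  refine dvd_add (dvd_add (dvd_add (dvd_add ?_ (Finset.dvd_sum fun i _ => ?_)) ?_)
    (Finset.dvd_sum fun k _ => ?_)) ?_
  · rw [X.G_zero_zero_succ_eq, X.G_zero_zero_zero_eq]
    exact ⟨rho * (B.Ui * (dT j X.u2 - dR (B.w j)))
      * (B.Ui * (2 * dU X.u2 - (X.φ1 + rho * dR X.φ1))), by ring⟩
  · rw [show rho ^ 4 = rho * rho ^ 3 by ring, X.G_zero_zero_succ_eq]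
    exact mul_dvd_mul (X.dvd_G_succ_zero i j) (Dvd.intro _ rfl)
  · rw [show rho ^ 4 = rho ^ 2 * rho ^ 2 by ring]
    exact mul_dvd_mul X.x_γ (X.x_γ_angular j)
  · rw [show rho ^ 4 = rho * rho ^ 3 by ring, x_δ_zero]
    refine mul_dvd_mul (X.rho_dvd_γ_angular j k) (Finset.dvd_sum fun s _ => Dvd.dvd.mul_left
      (dvd_add ?_ (X.dvd_dC_U s)) _)
    rw [show rho ^ 3 = rho * rho ^ 2 by ring]
    exact mul_dvd_mul_left _ (sq_dvd_Dr _)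
  · rw [show rho ^ 4 = rho ^ 2 * rho ^ 2 by ring]
    exact mul_dvd_mul_left _ (Finset.dvd_sum fun i _ => (X.sq_dvd_γ i).mul_right _)

variable {A : Fin 3 → Fin 3 → ℝ}

/-- Lowering the index of `d0` with h turns h k into the tangential projection, which a rotation
field absorbs. This is the only quadratic term that contributes at leading order, so it is evaluated
exactly. -/
theorem rot_d0 (hA : ∀ i j, A i j = -A j i) :
    ∑ j, rot A j * ∑ i : Fin 3, B.G 0 j.succ i.succ * (rho * X.d0 i)
    = rho ^ 2 * (B.Ui * (4 * ∑ j, rot A j * dU (B.w j) - 2 * rho * ∑ j, rot A j * dT j X.φ1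
      - 2 * B.G 0 0 0 * ∑ j, rot A j * B.w j
      - rho * ∑ j, rot A j * ∑ i, dR (B.h j i) * X.d0 i)) := by
  have hY := rot_x hA
  set β : Fin 3 → ScriRing := fun s => 2 * dU (B.w s)
    - rho * (2 * dU X.u2 * xc s + dT s X.φ1 - xc s * (X.φ1 + rho * dR X.φ1)) with hβ
  have hd : ∀ i, X.d0 i = -(B.W i * B.G 0 0 0) + ∑ s, B.k i s * β s := fun _ => rfl
  have h1 : ∀ j, ∑ i, B.h j i * X.d0 i = -(B.w j * B.G 0 0 0) + ∑ s, Pr j s * β s := fun j => by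
    have hk : ∀ s, ∑ i, B.h j i * B.k i s = Pr j s := fun s => by
      have := B.k_mul_h s j
      rw [Pr_symm, Pr, ← this]
      exact Finset.sum_congr rfl fun i _ => by rw [B.h_symm, B.k_symm, mul_comm]
    have hk0 := hk 0
    have hk1 := hk 1
    have hk2 := hk 2
    simp only [hd, w, Fin.sum_univ_three] at *
    linear_combination β 0 * hk0 + β 1 * hk1 + β 2 * hk2
  have h2 : ∀ s, ∑ j, rot A j * Pr j s = rot A s := fun s => by
    have := Pr_mul (rot A) (by
      rw [← hY]; exact Finset.sum_congr rfl fun j _ => mul_comm _ _) s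
    rw [← this]
    exact Finset.sum_congr rfl fun j _ => by rw [Pr_symm, mul_comm]
  have a0 := h1 0
  have a1 := h1 1
  have a2 := h1 2
  have b0 := h2 0
  have b1 := h2 1
  have b2 := h2 2
  have hβs : ∑ s, rot A s * β s = 2 * ∑ j, rot A j * dU (B.w j) - rho * ∑ j, rot A j * dT j X.φ1 := by
    simp only [hβ, Fin.sum_univ_three] at *
    linear_combination -rho * (2 * dU X.u2 - (X.φ1 + rho * dR X.φ1)) * hY
  simp only [G_zero_angular, Fin.sum_univ_three] at *
  linear_combination 2 * rho ^ 2 * B.Ui * (rot A 0 * a0 + rot A 1 * a1 + rot A 2 * a2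
    + β 0 * b0 + β 1 * b1 + β 2 * b2 + hβs)

/-- The antisymmetric part of `G^i_{0j}` at second order. -/
def asym (A : Fin 3 → Fin 3 → ℝ) : ScriRing :=
  ∑ j, ∑ i, algebraMap ℝ ScriRing (A j i) * (-(rho ^ 2 * (B.W i * (B.Ui * (dT j X.u2 - dR (B.w j)))))
    + ∑ s, (X.k1 i s * dU (X.c s j) + B.k i s * ((X.dw j s - X.dw s j)
      + rho * (xc j * X.aU s - xc s * X.aU j))))

/-- The leading part ∂_u c of `d1` is symmetric while A is antisymmetric, so the contraction gains a
factor ρ. -/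
theorem asym_d1 (hA : ∀ i j, A i j = -A j i) :
    ∑ j, ∑ i, algebraMap ℝ ScriRing (A j i) * X.d1 i j = rho * X.asym A := by
  have h0 : ∀ i j, ∑ s, Pr i s * dU (X.c s j) = dU (X.c i j) := fun i j => by
    have h := congrArg dU (X.c_x j)
    simp only [map_sum, Derivation.leibniz, dU_xc, map_zero, smul_eq_mul, mul_zero, zero_add] at h
    exact Pr_mul (fun s => dU (X.c s j)) (by
      rw [← h]; exact Finset.sum_congr rfl fun l _ => by rw [X.c_symm]) i
  have h1 : ∀ i j, X.d1 i j = dU (X.c i j)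
      + rho * (-(rho ^ 2 * (B.W i * (B.Ui * (dT j X.u2 - dR (B.w j)))))
    + ∑ s, (X.k1 i s * dU (X.c s j) + B.k i s * ((X.dw j s - X.dw s j)
      + rho * (xc j * X.aU s - xc s * X.aU j)))) := fun i j => by
    have := h0 i j
    rw [d1, X.G_zero_zero_succ_eq]
    simp only [Fin.sum_univ_three] at *
    linear_combination this + X.hk i 0 * dU (X.c 0 j) + X.hk i 1 * dU (X.c 1 j)
      + X.hk i 2 * dU (X.c 2 j)
  have h2 : ∑ j, ∑ i, algebraMap ℝ ScriRing (A j i) * dU (X.c i j) = 0 := by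
    have h00 : A 0 0 = 0 := by linarith [hA 0 0]
    have h11 : A 1 1 = 0 := by linarith [hA 1 1]
    have h22 : A 2 2 = 0 := by linarith [hA 2 2]
    simp only [Fin.sum_univ_three, h00, h11, h22, hA 1 0, hA 2 0, hA 2 1, map_zero, map_neg,
      X.c_symm 1 0, X.c_symm 2 0, X.c_symm 2 1]
    ring
  rw [asym, Finset.mul_sum, ← zero_add (∑ _, _ * _), ← h2, ← Finset.sum_add_distrib]
  refine Finset.sum_congr rfl fun j _ => ?_
  rw [Finset.mul_sum, ← Finset.sum_add_distrib]
  refine Finset.sum_congr rfl fun i _ => ?_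
  rw [h1]
  ring

/-- Moving the rotation inside the divergence costs only the contraction of `d1` with A, which is of
higher order by `asym_d1`. The divergence itself will integrate to zero. -/
theorem rot_div (hA : ∀ i j, A i j = -A j i) :
    ∑ j, rot A j * ∑ i : Fin 3, dC i.succ (B.δ i 0 j.succ)
    = rho ^ 2 * (∑ i, dT i (∑ j, rot A j * X.d1 i j) - rho * X.asym A) := by
  have hx : ∀ j, ∑ i, xc i * (X.d1 i j + rho * dR (X.d1 i j)) = 0 := fun j => by
    have h1 := X.x_d1 j
    have h2 := congrArg dR h1
    simp only [map_sum, Derivation.leibniz, dR_xc, map_zero, smul_eq_mul, mul_zero, add_zero] at h2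
    simp only [Fin.sum_univ_three] at *
    linear_combination h1 + rho * h2
  have hP : ∀ j l, ∑ i, Pr i l * X.d1 i j = X.d1 l j := fun j l => by
    rw [← Pr_mul (fun i => X.d1 i j) (X.x_d1 j) l]
    exact Finset.sum_congr rfl fun i _ => by rw [Pr_symm]
  have hdT : ∀ i j, dT i (rot A j) = ∑ l, algebraMap ℝ ScriRing (A j l) * Pr i l := fun i j => by
    refine rho_mul_cancel ?_
    rw [← dC_rot, dC_succ, dR_rot]
    ring
  rw [← X.asym_d1 hA]
  have e1 : ∀ j, ∑ i : Fin 3, dC i.succ (B.δ i 0 j.succ) = rho ^ 2 * ∑ i, dT i (X.d1 i j) := fun j => by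
    simp only [X.δ_zero_succ, dC_rho_mul]
    rw [← Finset.mul_sum, Finset.sum_sub_distrib, hx, sub_zero]
  have e2 : ∑ i, dT i (∑ j, rot A j * X.d1 i j) = ∑ j, rot A j * ∑ i, dT i (X.d1 i j)
      + ∑ j, ∑ i, algebraMap ℝ ScriRing (A j i) * X.d1 i j := by
    have e3 : ∀ j, ∑ i, X.d1 i j * dT i (rot A j) = ∑ i, algebraMap ℝ ScriRing (A j i) * X.d1 i j :=
      fun j => by
        have p0 := hP j 0
        have p1 := hP j 1
        have p2 := hP j 2
        simp only [hdT, Fin.sum_univ_three] at *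
        linear_combination algebraMap ℝ ScriRing (A j 0) * p0 + algebraMap ℝ ScriRing (A j 1) * p1
          + algebraMap ℝ ScriRing (A j 2) * p2
    rw [← Finset.sum_congr rfl fun j _ => e3 j]
    simp only [map_sum, Derivation.leibniz, smul_eq_mul, Finset.sum_add_distrib, Finset.mul_sum]
    rw [Finset.sum_comm, Finset.sum_comm (f := fun i j => X.d1 i j * dT i (rot A j))]
  rw [e2]
  simp only [e1]
  rw [Finset.sum_congr rfl fun j _ => mul_left_comm (rot A j) (rho ^ 2) _, ← Finset.mul_sum]
  ring

end Exp
end Fields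

end

/-! ### Evolution of the angular momentum aspect along a rotation. -/

section

theorem dR_dT (i : Fin 3) (a : ScriRing) : dR (dT i a) = dT i (dR a) := dR_tanDer _ a
theorem dR_dU (a : ScriRing) : dR (dU a) = dU (dR a) := dR_tanDer _ a
theorem dU_dT (i : Fin 3) (a : ScriRing) : dU (dT i a) = dT i (dU a) := dU_tanDer _ a

theorem roundMetric_symm (x : E3) (i j : Fin 3) : roundMetric x i j = roundMetric x j i := by
  simp only [roundMetric, mul_comm, eq_comm]

theorem roundMetric_mul {x : E3} {v : Fin 3 → ℝ} (hv : ∑ j, x j * v j = 0)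
    (i : Fin 3) : ∑ j, roundMetric x i j * v j = v i := by
  rw [Fin.sum_univ_three] at hv ⊢
  fin_cases i <;> simp [roundMetric]
  · linear_combination -x 0 * hv
  · linear_combination -x 1 * hv
  · linear_combination -x 2 * hv

theorem roundMetric_x {x : E3} (hx : ‖x‖ = 1) (i : Fin 3) : ∑ j, roundMetric x i j * x j = 0 := by
  have h := sum_x_sq hx
  rw [Fin.sum_univ_three]
  fin_cases i <;> simp [roundMetric]
  · linear_combination -x 0 * h
  · linear_combination -x 1 * h
  · linear_combination -x 2 * h

theorem rotVec_x {A : Fin 3 → Fin 3 → ℝ} (hA : ∀ i j, A i j = -A j i) (x : E3) :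
    ∑ j, rotVec A x j * x j = 0 := by
  have h00 : A 0 0 = 0 := by linarith [hA 0 0]
  have h11 : A 1 1 = 0 := by linarith [hA 1 1]
  have h22 : A 2 2 = 0 := by linarith [hA 2 2]
  simp only [rotVec, Fin.sum_univ_three, h00, h11, h22, hA 1 0, hA 2 0, hA 2 1]
  ring

theorem sum_proj_mul {P N E : Fin 3 → Fin 3 → ℝ} (hP : ∀ i j, P i j = P j i)
    (hN : ∀ i j, N i j = N j i) (hPN : ∀ i k, ∑ s, P i s * N s k = N i k) :
    ∑ i, ∑ k, (∑ s, P i s * E s k) * N k i = ∑ s, ∑ k, E s k * N k s := by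
  have h : ∀ s k, ∑ i, P i s * N k i = N k s := fun s k => by
    rw [hN k s, ← hPN s k]
    exact Finset.sum_congr rfl fun i _ => by rw [hP, hN]
  have h00 := h 0 0
  have h01 := h 0 1
  have h02 := h 0 2
  have h10 := h 1 0
  have h11 := h 1 1
  have h12 := h 1 2
  have h20 := h 2 0
  have h21 := h 2 1
  have h22 := h 2 2
  clear h
  simp only [Fin.sum_univ_three] at *
  linear_combination E 0 0 * h00 + E 0 1 * h01 + E 0 2 * h02 + E 1 0 * h10 + E 1 1 * h11
    + E 1 2 * h12 + E 2 0 * h20 + E 2 1 * h21 + E 2 2 * h22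

namespace Fields
variable {B : Fields} {m : ℝ → E3 → ℝ} {C : ℝ → E3 → Fin 3 → Fin 3 → ℝ}
  {W2 W3 : ℝ → E3 → Fin 3 → ℝ}

namespace Exp
variable (X : B.Exp m C W2 W3) {A : Fin 3 → Fin 3 → ℝ}
include X

/-- The leading part of the angular Einstein equation contracted with a rotation. -/
def lead (A : Fin 3 → Fin 3 → ℝ) : ScriRing :=
  2 * ∑ i, dT i (∑ j, rot A j * X.d1 i j) - 4 * B.Ui * ∑ j, rot A j * dU (B.w j)

/-- The subleading part of the angular Einstein equation contracted with a rotation. -/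
def sub (A : Fin 3 → Fin 3 → ℝ) : ScriRing :=
  2 * dU (B.Ui * ∑ j, rot A j * (dT j X.u2 - dR (B.w j))) - 2 * X.asym A
    - 2 * ∑ j, rot A j * dT j (2 * B.Ui * dU X.u2)
    + B.Ui * (2 * ∑ j, rot A j * dT j X.φ1 + ∑ j, rot A j * ∑ i, dR (B.h j i) * X.d0 i)
    - ∑ j, rot A j * ∑ i, ∑ k, X.d2 i j k * X.d1 k i

/-- The uA equation contracted with a rotation and divided by ρ². Contraction with Y discards every
term proportional to x_j. Two orders are kept because the r⁻³ coefficient of the shift appears only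
at the second. -/
theorem lead_add_sub (hR : ∀ μ ν, B.ric μ ν = 0) (hA : ∀ i j, A i j = -A j i) :
    rho ^ 2 ∣ X.lead A + rho * X.sub A := by
  have hY := rot_x hA
  have h : ∀ j : Fin 3, 2 * ∑ l, dC l (B.G l 0 j.succ) - 2 * dC j.succ (B.t 0)
      + ∑ s, B.t s * B.G s 0 j.succ - ∑ l, ∑ s, B.G l j.succ s * B.G s 0 l = 0 := fun j => by
    rw [← ric_eq, hR]
  have hsum : ∑ j : Fin 3, rot A j * (2 * ∑ l, dC l (B.G l 0 j.succ) - 2 * dC j.succ (B.t 0)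
      + ∑ s, B.t s * B.G s 0 j.succ - ∑ l, ∑ s, B.G l j.succ s * B.G s 0 l) = 0 :=
    Finset.sum_eq_zero fun j _ => by rw [h, mul_zero]
  -- time derivative
  have e1 : ∑ j : Fin 3, rot A j * dU (B.G 0 0 j.succ)
      = rho ^ 3 * dU (B.Ui * ∑ j, rot A j * (dT j X.u2 - dR (B.w j))) := by
    rw [← dU_rho_pow_mul, Finset.mul_sum, Finset.mul_sum, map_sum]
    refine Finset.sum_congr rfl fun j _ => ?_
    rw [X.G_zero_zero_succ_eq, show rho ^ 3 * (B.Ui * (rot A j * (dT j X.u2 - dR (B.w j))))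
      = rot A j * (rho ^ 3 * (B.Ui * (dT j X.u2 - dR (B.w j)))) by ring, Derivation.leibniz (D := dU)
      (rot A j), dU_rot]
    simp
  -- radial part of the divergence
  have hdvd : rho ^ 2 ∣ ∑ j : Fin 3, rot A j * B.γ 0 j.succ :=
    Finset.dvd_sum fun j _ => (X.sq_dvd_γ j).mul_left _
  obtain ⟨g, hg⟩ := hdvd
  have e2 : ∑ j : Fin 3, rot A j * ∑ i : Fin 3, dC i.succ (xc i * B.γ 0 j.succ)
      = -(rho ^ 4 * dR g) := by
    have h1 : Dr (∑ j : Fin 3, rot A j * B.γ 0 j.succ) = ∑ j : Fin 3, rot A j * Dr (B.γ 0 j.succ) := by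
      simp only [Dr, map_sum, Derivation.leibniz, dR_rot, smul_eq_mul, mul_zero, add_zero]
      rw [Finset.mul_sum, ← Finset.sum_neg_distrib]
      exact Finset.sum_congr rfl fun j _ => by ring
    have h2 : Dr (rho ^ 2 * g) = -(2 * rho ^ 3 * g) - rho ^ 4 * dR g := by
      simp [Dr, Derivation.leibniz]; ring
    rw [hg, h2] at h1
    simp only [sum_dC_xc_mul]
    simp only [Fin.sum_univ_three] at hg h1 ⊢
    linear_combination 2 * rho * hg - h1
  have e3 := X.rot_div hA
  have e4 : ∑ j : Fin 3, rot A j * dC j.succ (B.t 0)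
      = rho ^ 3 * ∑ j, rot A j * dT j (2 * B.Ui * dU X.u2) := by
    have ht : B.t 0 = rho ^ 2 * (2 * B.Ui * dU X.u2) := by rw [t, dC_zero, X.dU_U]; ring
    rw [ht]
    simp only [dC_succ_rho_pow_mul, Fin.sum_univ_three] at *
    push_cast
    linear_combination -(rho ^ 3 * (2 * (2 * B.Ui * dU X.u2) + rho * dR (2 * B.Ui * dU X.u2))) * hY
  have e5 : rho ^ 4 ∣ ∑ j : Fin 3, rot A j * ∑ s, B.t s * B.G s 0 j.succ := by
    refine Finset.dvd_sum fun j _ => Dvd.dvd.mul_left (Finset.dvd_sum fun s _ => ?_) _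
    refine Fin.cases ?_ (fun i => ?_) s
    · rw [X.G_zero_zero_succ_eq, t, dC_zero, X.dU_U]
      exact ⟨2 * rho * B.Ui * dU X.u2 * (B.Ui * (dT j X.u2 - dR (B.w j))), by ring⟩
    · rw [show rho ^ 4 = rho ^ 3 * rho by ring]
      exact mul_dvd_mul ((X.dvd_dC_U i).mul_left _) (X.dvd_G_succ_zero i j)
  choose r hr using X.quadratic_terms
  have e6 : ∑ j : Fin 3, rot A j * ∑ l, ∑ s, B.G l j.succ s * B.G s 0 l
      = ∑ j, rot A j * ∑ i : Fin 3, B.G 0 j.succ i.succ * (rho * X.d0 i)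
      + rho ^ 3 * ∑ j, rot A j * ∑ i, ∑ k, X.d2 i j k * X.d1 k i + rho ^ 4 * ∑ j, rot A j * r j := by
    rw [Finset.mul_sum, Finset.mul_sum, ← Finset.sum_add_distrib, ← Finset.sum_add_distrib]
    exact Finset.sum_congr rfl fun j _ => by linear_combination rot A j * hr j
  rw [X.rot_d0 hA] at e6
  obtain ⟨r', hr'⟩ := e5
  have e7 : ∑ j : Fin 3, rot A j * ∑ l, dC l (B.G l 0 j.succ)
      = ∑ j : Fin 3, rot A j * dU (B.G 0 0 j.succ)
        + ∑ j : Fin 3, rot A j * ∑ i : Fin 3, dC i.succ (xc i * B.γ 0 j.succ)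
        + ∑ j, rot A j * ∑ i : Fin 3, dC i.succ (B.δ i 0 j.succ) := by
    rw [← Finset.sum_add_distrib, ← Finset.sum_add_distrib]
    refine Finset.sum_congr rfl fun j _ => ?_
    rw [Fin.sum_univ_succ (n := 3)]
    simp only [G_succ_eq, map_add, Finset.sum_add_distrib, dC_zero]
    ring
  rw [e1, e2, e3] at e7
  have e8 : 2 * ∑ j : Fin 3, rot A j * ∑ l, dC l (B.G l 0 j.succ)
      - 2 * ∑ j : Fin 3, rot A j * dC j.succ (B.t 0)
      + ∑ j : Fin 3, rot A j * ∑ s, B.t s * B.G s 0 j.succ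
      - ∑ j : Fin 3, rot A j * ∑ l, ∑ s, B.G l j.succ s * B.G s 0 l = 0 := by
    rw [← hsum, Finset.mul_sum, Finset.mul_sum, ← Finset.sum_sub_distrib, ← Finset.sum_add_distrib,
      ← Finset.sum_sub_distrib]
    exact Finset.sum_congr rfl fun j _ => by ring
  rw [e7, e4, hr', e6, X.G_zero_zero_zero_eq] at e8
  refine ⟨2 * dR g - r' + ∑ j, rot A j * r j - 2 * B.Ui * (B.Ui * (2 * dU X.u2
    - (X.φ1 + rho * dR X.φ1))) * ∑ j, rot A j * B.w j, rho_pow_mul_cancel 2 ?_⟩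
  rw [lead, sub]
  linear_combination e8

theorem val_asym : Val (X.asym A) fun u x => ∑ j, ∑ i, A j i *
    (∑ s, (-(C u x i s * deriv (fun v => C v x s j) u) + roundMetric x i s *
      ((tderiv j (fun z => W2 u z s) x - x j * W2 u x s)
        - (tderiv s (fun z => W2 u z j) x - x s * W2 u x j)))) := fun u x hx => by
  simp only [asym, dw, map_sum, map_mul, map_add, map_sub, map_neg, ev_algebraMap, ev_rho, zero_mul,
    add_zero, map_pow, X.val_k1 _ _ u x hx, X.val_k _ _ u x hx, (X.val_c _ _).dU u x hx, ev_xc,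
    (X.val_w _).dT _ u x hx, X.val_w _ u x hx, ne_eq, OfNat.ofNat_ne_zero, not_false_eq_true,
    zero_pow, neg_zero, zero_add, neg_mul]

/-- The evolution of the angular momentum aspect, contracted with a rotation. -/
theorem rotation_evolution (hR : ∀ μ ν, B.ric μ ν = 0) (hA : ∀ i j, A i j = -A j i) :
    ∃ η : Fin 3 → ℝ → E3 → ℝ, (∀ i, ScriFun (η i)) ∧
      (∀ u (x : E3), ‖x‖ = 1 → ∑ i, x i * η i u x = 0) ∧ ∀ u (x : E3), ‖x‖ = 1 →
      6 * ∑ j, rotVec A x j * deriv (fun v => W3 v x j + ∑ l, C v x j l * W2 v x l) u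
      = 2 * ∑ i, tderiv i (η i u) x
        + ∑ j, rotVec A x j * tderiv j (fun z => 4 * m u z
          - 2 * deriv (fun v => -(1 / 16) * ∑ a, ∑ b, C v z a b * C v z a b) u) x
        + 2 * ∑ j, rotVec A x j * ∑ i, C u x j i * deriv (fun v => W2 v x i) u
        + 2 * ∑ j, rotVec A x j * ∑ i, W2 u x i * deriv (fun v => C v x i j) u
        - ∑ j, rotVec A x j * ∑ i, ∑ k, tderiv j (fun z => C u z i k) x
          * deriv (fun v => C v x k i) u
        - 2 * (∑ j, ∑ i, A j i * (tderiv j (fun z => W2 u z i) x - tderiv i (fun z => W2 u z j) x)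
          + 2 * ∑ j, rotVec A x j * W2 u x j
          - ∑ j, ∑ i, A j i * ∑ s, C u x i s * deriv (fun v => C v x s j) u) := by
  -- The field η is the ρ-derivative of Y^j `d1`_ij at null infinity. It is never computed: it
  -- enters only as the divergence of a tangential field, whose integral vanishes.
  obtain ⟨V, hV⟩ : ∃ V : Fin 3 → ScriRing, ∀ i, V i = ∑ j, rot A j * X.d1 i j := ⟨_, fun _ => rfl⟩
  choose η hη using fun i => exists_val (dR (V i))
  refine ⟨η, fun i => (hη i).scriFun, fun u x hx => ?_, fun u x hx => ?_⟩
  · have h1 : ∑ i, xc i * V i = 0 := by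
      simp only [hV, Finset.mul_sum]
      rw [Finset.sum_comm]
      refine Finset.sum_eq_zero fun j _ => ?_
      rw [Finset.sum_congr rfl fun i _ => mul_left_comm (xc i) (rot A j) (X.d1 i j),
        ← Finset.mul_sum, X.x_d1, mul_zero]
    have h2 := congrArg dR h1
    simp only [map_sum, Derivation.leibniz, dR_xc, map_zero, smul_eq_mul, mul_zero, add_zero] at h2
    have h3 := congrArg (ev u x hx) h2
    simpa [hη _ u x hx] using h3
  · obtain ⟨r, hr⟩ := X.lead_add_sub hR hA
    -- The relation holds up to ρ², so its ρ-derivative at ρ = 0 is exact: the derivative of `lead`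
    -- plus the value of `sub`.
    have h1 := congrArg (ev u x hx) (congrArg dR hr)
    simp only [map_add, Derivation.leibniz, Derivation.leibniz_pow, dR_rho, smul_eq_mul, mul_one,
      map_mul, map_pow, ev_rho, zero_mul, zero_add] at h1
    have hUi : ev u x hx (dR B.Ui) = 0 := by
      rw [X.hUi]; simp [Derivation.leibniz]
    have hUi' : ev u x hx (dU B.Ui) = 0 := by
      rw [X.hUi]; simp [Derivation.leibniz]
    have d2 : dR (2 : ScriRing) = 0 := by simpa using Derivation.map_natCast dR 2
    have d4 : dR (4 : ScriRing) = 0 := by simpa using Derivation.map_natCast dR 4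
    have hl : ev u x hx (dR (X.lead A)) = 2 * ∑ i, tderiv i (η i u) x
        - 4 * ∑ j, rotVec A x j * deriv (fun v => W3 v x j + ∑ l, C v x j l * W2 v x l) u := by
      simp only [lead, ← hV, map_sub, Derivation.leibniz, smul_eq_mul, map_sum, dR_dT, dR_dU, dR_rot,
        map_add, map_mul, d2, d4, hUi, (hη _).dT _ u x hx, (X.val_dR_w _).dU u x hx, X.val_Ui u x hx,
        ev_rot, map_ofNat, map_zero, mul_zero, add_zero]
      ring
    have hY := rotVec_x hA x
    have hN : ∀ i j, deriv (fun v => C v x i j) u = deriv (fun v => C v x j i) u := fun i j => by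
      congr 1; funext v; exact X.C_symm v hx i j
    have sm : SphereSmooth (m u) := by
      have := X.val_φ1.scriFun.sphereSmooth u
      refine ((sphereSmooth_const (1 / 2)).mul this).congr fun x _ => ?_
      simp
    have sU : SphereSmooth fun z => deriv (fun v => -(1 / 16) * ∑ a, ∑ b, C v z a b * C v z a b) u :=
      X.val_u2.dU.scriFun.sphereSmooth u
    have hq : ∀ j, ev u x hx (dT j (2 * B.Ui * dU X.u2)) = 2 * tderiv j (fun z =>
        deriv (fun v => -(1 / 16) * ∑ a, ∑ b, C v z a b * C v z a b) u) x := fun j => by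
      have : Val (2 * B.Ui * dU X.u2) fun u z =>
          2 * deriv (fun v => -(1 / 16) * ∑ a, ∑ b, C v z a b * C v z a b) u := fun u z hz => by
        simp only [map_mul, map_ofNat, X.val_Ui u z hz, mul_one, X.val_u2.dU u z hz]
      exact (this.dT j u x hx).trans (tderiv_const_mul j 2 sU hx)
    have hφ : ∀ j, ev u x hx (dT j X.φ1) = 2 * tderiv j (m u) x := fun j => by
      exact (X.val_φ1.dT j u x hx).trans (tderiv_const_mul j 2 sm hx)
    have hd : ∀ j, tderiv j (fun z => 4 * m u z
        - 2 * deriv (fun v => -(1 / 16) * ∑ a, ∑ b, C v z a b * C v z a b) u) x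
        = 4 * tderiv j (m u) x - 2 * tderiv j (fun z =>
          deriv (fun v => -(1 / 16) * ∑ a, ∑ b, C v z a b * C v z a b) u) x := fun j => by
      rw [tderiv_sub j (by fun_prop) (by fun_prop) hx, tderiv_const_mul j 4 sm hx,
        tderiv_const_mul j 2 sU hx]
    have hdU : ev u x hx (dU (B.Ui * ∑ j, rot A j * (dT j X.u2 - dR (B.w j))))
        = ∑ j, rotVec A x j * (tderiv j (fun z =>
          deriv (fun v => -(1 / 16) * ∑ a, ∑ b, C v z a b * C v z a b) u) x
          - deriv (fun v => W3 v x j + ∑ l, C v x j l * W2 v x l) u) := by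
      simp only [Derivation.leibniz, smul_eq_mul, map_sum, map_sub, dU_dT, dU_rot, map_add, map_mul,
        hUi', X.val_Ui u x hx, X.val_u2.dU.dT _ u x hx, (X.val_dR_w _).dU u x hx, ev_rot, map_zero,
        mul_zero, add_zero, one_mul]
    have hW := X.W2_x u hx
    have sW : ∀ i, SphereSmooth fun z => W2 u z i := fun i => (X.val_W i).scriFun.sphereSmooth u
    have hdW : ∀ j, ∑ s, x s * tderiv j (fun z => W2 u z s) x = -W2 u x j := fun j => by
      have h2 : tderiv j (fun z : E3 => ∑ s, z s * W2 u z s) x = 0 := by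
        rw [tderiv_congr (ψ := fun _ => 0) (fun z hz => X.W2_x u hz) j hx, tderiv_const]
      rw [tderiv_sum j (fun s => by fun_prop) hx] at h2
      simp only [tderiv_mul j (sphereSmooth_coord _) (sW _) hx, tderiv_coord j _ hx,
        Finset.sum_add_distrib] at h2
      have h3 := X.P_W2 u hx j
      simp only [mul_comm (W2 u x _)] at h2
      linarith
    have hP : ∀ i j, ∑ s, roundMetric x i s * ((tderiv j (fun z => W2 u z s) x - x j * W2 u x s)
        - (tderiv s (fun z => W2 u z j) x - x s * W2 u x j))
        = (tderiv j (fun z => W2 u z i) x - x j * W2 u x i)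
        - (tderiv i (fun z => W2 u z j) x - x i * W2 u x j) := fun i j => by
      refine roundMetric_mul (v := fun s => (tderiv j (fun z => W2 u z s) x - x j * W2 u x s)
        - (tderiv s (fun z => W2 u z j) x - x s * W2 u x j)) ?_ i
      have h2 := hdW j
      have h3 := sum_x_tderiv (sW j) hx
      have h4 := sum_x_sq hx
      simp only [Fin.sum_univ_three] at *
      linear_combination h2 - x j * hW - h3 + W2 u x j * h4
    have hasym : ev u x hx (X.asym A) = ∑ j, ∑ i, A j i *
        (tderiv j (fun z => W2 u z i) x - tderiv i (fun z => W2 u z j) x)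
          + 2 * ∑ j, rotVec A x j * W2 u x j
          - ∑ j, ∑ i, A j i * ∑ s, C u x i s * deriv (fun v => C v x s j) u := by
      rw [X.val_asym u x hx]
      simp only [Finset.sum_add_distrib, hP]
      have h00 : A 0 0 = 0 := by linarith [hA 0 0]
      have h11 : A 1 1 = 0 := by linarith [hA 1 1]
      have h22 : A 2 2 = 0 := by linarith [hA 2 2]
      simp only [rotVec, Fin.sum_univ_three, h00, h11, h22, hA 1 0, hA 2 0, hA 2 1]
      ring
    -- Against the symmetric news, ∇_j C_sk + ∇_k C_sj − ∇_s C_jk reduces to ∇_j C_sk; the other two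
    -- terms cancel, and the remaining radial term is killed by Y.
    have hquad : ∑ j, rotVec A x j * ∑ i, ∑ k, ev u x hx (X.d2 i j k) * ev u x hx (X.d1 k i)
        = ∑ j, rotVec A x j * (∑ i, ∑ k, tderiv j (fun z => C u z i k) x
          * deriv (fun v => C v x k i) u - 2 * ∑ i, W2 u x i * deriv (fun v => C v x i j) u) := by
      have e : ∀ j, ∑ i, ∑ k, ev u x hx (X.d2 i j k) * ev u x hx (X.d1 k i)
          = ∑ i, ∑ k, tderiv j (fun z => C u z i k) x * deriv (fun v => C v x k i) u
            - 2 * ∑ i, W2 u x i * deriv (fun v => C v x i j) u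
            - x j * ∑ i, ∑ k, C u x i k * deriv (fun v => C v x k i) u := by
        intro j
        simp only [X.val_d2 _ _ _ u x hx, X.val_d1 _ _ u x hx, add_mul, Finset.sum_add_distrib,
          neg_mul, Finset.sum_neg_distrib]
        rw [sum_proj_mul (P := roundMetric x) (N := fun i k => deriv (fun v => C v x i k) u)
          (E := fun s k => (tderiv j (fun z => C u z s k) x - x j * C u x s k)
            + (tderiv k (fun z => C u z s j) x - x k * C u x s j)
            - (tderiv s (fun z => C u z j k) x - x s * C u x j k)) (roundMetric_symm x) hN
          (X.P_news u hx)]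
        have hc : ∀ k s, tderiv k (fun z => C u z s j) x = tderiv k (fun z => C u z j s) x :=
          fun k s => tderiv_congr (fun z hz => X.C_symm u hz s j) k hx
        have hPN : ∀ i, ∑ k, roundMetric x j k * deriv (fun v => C v x k i) u
          = deriv (fun v => C v x i j) u := fun i => by rw [X.P_news u hx, hN]
        have hPN0 := hPN 0
        have hPN1 := hPN 1
        have hPN2 := hPN 2
        simp only [hc, X.C_symm u hx _ j, Fin.sum_univ_three, hN 1 0, hN 2 0, hN 2 1]
          at hPN0 hPN1 hPN2 ⊢
        linear_combination -2 * W2 u x 0 * hPN0 - 2 * W2 u x 1 * hPN1 - 2 * W2 u x 2 * hPN2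
      simp only [e]
      generalize ∑ i, ∑ k, C u x i k * deriv (fun v => C v x k i) u = S
      simp only [Fin.sum_univ_three] at hY ⊢
      linear_combination -S * hY
    have hsub : ev u x hx (X.sub A) = 2 * ∑ j, rotVec A x j * (tderiv j (fun z =>
          deriv (fun v => -(1 / 16) * ∑ a, ∑ b, C v z a b * C v z a b) u) x
          - deriv (fun v => W3 v x j + ∑ l, C v x j l * W2 v x l) u)
        - 2 * ev u x hx (X.asym A) - 2 * ∑ j, rotVec A x j * (2 * tderiv j (fun z =>
          deriv (fun v => -(1 / 16) * ∑ a, ∑ b, C v z a b * C v z a b) u) x)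
        + (2 * ∑ j, rotVec A x j * (2 * tderiv j (m u) x)
          + ∑ j, rotVec A x j * ∑ i, C u x j i * (2 * deriv (fun v => W2 v x i) u))
        - ∑ j, rotVec A x j * ∑ i, ∑ k, ev u x hx (X.d2 i j k) * ev u x hx (X.d1 k i) := by
      simp only [sub, map_sub, map_add, map_mul, map_ofNat, hdU, map_sum, ev_rot, hq, hφ,
        X.val_Ui u x hx, one_mul, X.dR_h, ev_rho, zero_mul, add_zero, X.val_c _ _ u x hx,
        X.val_d0 _ u x hx]
    rw [hl, hsub, hasym, hquad] at h1
    have h0 : (0 : ℝ) ^ 2 * ev u x hx (dR r) + ev u x hx r * ev u x hx (2 • rho ^ (2 - 1)) = 0 := by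
      simp
    rw [h0] at h1
    simp only [hd]
    simp only [Fin.sum_univ_three] at h1 ⊢
    linear_combination -h1

end Exp
end Fields

end

/-! ### From the ring to functions of the coordinates: the Ricci tensor of the spacetime metric. -/

section

/-- The function `Φ` of the coordinates `(u, y)` represents `a` near null infinity. -/
def Near (a : ScriRing) (Φ : Pt → ℝ) : Prop := NearFin fun q => rep a q = Φ (ofTriple q)

theorem near_toRing {F : Triple → ℝ} (hF : F ∈ scriSmooth) {Φ : Pt → ℝ}
    (h : NearFin fun q => F q = Φ (ofTriple q)) : Near (toRing F hF) Φ :=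
  ((nearFin_rep hF).and h).mono fun _ _ e => e.1.trans e.2

theorem Near.eq {a b : ScriRing} {Φ Φ' : Pt → ℝ} (h : Near a Φ) (h' : Near b Φ')
    (e : NearFin fun q => Φ (ofTriple q) = Φ' (ofTriple q)) : a = b := by
  rw [← toRing_rep a, ← toRing_rep b, toRing_eq_iff]
  exact ((h.and h').and e).mono fun _ _ e => e.1.1.trans (e.2.trans e.1.2.symm)

theorem Near.congr {a : ScriRing} {Φ Φ' : Pt → ℝ} (h : Near a Φ)
    (e : NearFin fun q => Φ (ofTriple q) = Φ' (ofTriple q)) : Near a Φ' :=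
  (NearFin.and h e).mono fun _ _ e => e.1.trans e.2

theorem Near.eq_zero {a : ScriRing} {Φ : Pt → ℝ} (h : Near a Φ)
    (e : NearFin fun q => Φ (ofTriple q) = 0) : a = 0 := by
  have h0 : (0 : ScriRing) = toRing (fun _ => 0) (const_mem 0) := rfl
  rw [h0]
  exact h.eq (near_toRing (const_mem 0) (Φ := fun _ => 0) (NearFin.of_scri fun _ _ _ => by simp)) e

theorem near_const (c : ℝ) : Near (algebraMap ℝ ScriRing c) fun _ => c := by
  rw [algebraMap_eq]
  exact near_toRing _ (NearFin.of_scri fun _ _ _ => by simp)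

theorem near_one : Near 1 fun _ => 1 := by simpa using near_const 1

theorem near_rho : Near rho fun p => (toTriple p).2.1 :=
  near_toRing _ fun _ _ _ => Eventually.of_forall fun q hq => by
    beta_reduce; rw [toTriple_ofTriple hq]

theorem near_xc (i : Fin 3) : Near (xc i) fun p => (toTriple p).2.2 i :=
  near_toRing _ fun _ _ _ => Eventually.of_forall fun q hq => by
    beta_reduce; rw [toTriple_ofTriple hq]

theorem near_rep (a : ScriRing) : Near a fun p => rep a (toTriple p) := fun _ _ _ =>
  Eventually.of_forall fun q hq => by beta_reduce; rw [toTriple_ofTriple hq]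

theorem Near.add {a b : ScriRing} {Φ Φ' : Pt → ℝ} (h : Near a Φ) (h' : Near b Φ') :
    Near (a + b) fun p => Φ p + Φ' p := by
  have e : a + b = toRing (fun q => rep a q + rep b q) (add_mem' (rep_mem a) (rep_mem b)) := by
    rw [← toRing_add (rep_mem a) (rep_mem b), toRing_rep, toRing_rep]
  rw [e]
  exact near_toRing _ ((NearFin.and h h').mono fun _ _ e => by rw [e.1, e.2])

theorem Near.mul {a b : ScriRing} {Φ Φ' : Pt → ℝ} (h : Near a Φ) (h' : Near b Φ') :
    Near (a * b) fun p => Φ p * Φ' p := by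
  have e : a * b = toRing (fun q => rep a q * rep b q) (mul_mem' (rep_mem a) (rep_mem b)) := by
    rw [← toRing_mul (rep_mem a) (rep_mem b), toRing_rep, toRing_rep]
  rw [e]
  exact near_toRing _ ((NearFin.and h h').mono fun _ _ e => by rw [e.1, e.2])

theorem Near.smul {a : ScriRing} {Φ : Pt → ℝ} (c : ℝ) (h : Near a Φ) :
    Near (c • a) fun p => c * Φ p := by
  rw [Algebra.smul_def]; exact (near_const c).mul h

theorem Near.neg {a : ScriRing} {Φ : Pt → ℝ} (h : Near a Φ) : Near (-a) fun p => -Φ p := by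
  simpa using h.smul (-1)

theorem Near.sub {a b : ScriRing} {Φ Φ' : Pt → ℝ} (h : Near a Φ) (h' : Near b Φ') :
    Near (a - b) fun p => Φ p - Φ' p := by
  simpa [sub_eq_add_neg] using h.add h'.neg

theorem Near.pow {a : ScriRing} {Φ : Pt → ℝ} (h : Near a Φ) (n : ℕ) :
    Near (a ^ n) fun p => Φ p ^ n := by
  induction n with
  | zero => simpa using near_one
  | succ n ih => simpa only [pow_succ] using ih.mul h

theorem Near.sum {ι : Type*} [DecidableEq ι] {s : Finset ι} {a : ι → ScriRing} {Φ : ι → Pt → ℝ}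
    (h : ∀ i, Near (a i) (Φ i)) : Near (∑ i ∈ s, a i) fun p => ∑ i ∈ s, Φ i p := by
  induction s using Finset.induction_on with
  | empty => simpa using near_const 0
  | insert i s hi ih => simpa only [Finset.sum_insert hi] using (h i).add ih

/-- A representative and the function Φ agree on a whole neighbourhood of each nearby finite point
in the coordinates (u, y), so their partial derivatives agree there as well. -/
theorem Near.dC {a : ScriRing} {Φ : Pt → ℝ} (h : Near a Φ) (μ : Fin 4) :
    Near (dC μ a) (pd μ Φ) := by
  have e := dC_toRing μ (rep_mem a)
  rw [toRing_rep] at e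
  rw [e]
  refine near_toRing _ ((NearFin.eventually h).and (nearFin_differentiableAt (rep_mem a)) |>.mono
    fun q hq hh => ?_)
  have hp := spatial_ofTriple_ne hq
  have ht := toTriple_ofTriple hq
  have h0 := pd_comp_toTriple hp (by rw [ht]; exact hh.2) μ
  rw [ht] at h0
  rw [← h0]
  unfold pd
  have h1 : (fun p => rep a (toTriple p)) =ᶠ[𝓝 (ofTriple q)] Φ := by
    have h2 := (continuousAt_toTriple hp).eventually (by rw [ht]; exact hh.1)
    filter_upwards [h2, eventually_spatial_ne hp] with p h3 h4
    rw [h3 (isFinite_toTriple h4), ofTriple_toTriple h4]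
  rw [h1.fderiv_eq]

namespace Fields
variable (B : Fields)

/-- The fields represent the metric `g`. -/
def Repr (g : Pt → Matrix (Fin 4) (Fin 4) ℝ) : Prop := ∀ μ ν, Near (B.g μ ν) fun p => g p μ ν

/-- Checks the closed form of the inverse metric, which is then the matrix inverse that occurs in
the Christoffel symbols. -/
theorem sum_g_gi (μ ν : Fin 4) : ∑ s, B.g μ s * B.gi s ν = if μ = ν then 1 else 0 := by
  have hU := B.U_mul
  have hw := B.x_w
  have hk : ∀ i j, ∑ s, B.h i s * B.k s j = (if i = j then 1 else 0) - xc i * xc j := fun i j => by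
    have h1 := B.k_mul_h j i
    rw [Finset.sum_congr rfl fun s _ => by rw [B.h_symm i s, B.k_symm s j, mul_comm], h1]
    simp only [eq_comm, mul_comm]
  have hwk : ∀ j, ∑ s, B.w s * B.k s j = B.W j := fun j => by
    have h1 : ∑ s, B.w s * B.k s j = ∑ i, B.W i * ∑ s, B.h i s * B.k s j := by
      simp only [w, Finset.sum_mul, Finset.mul_sum]
      rw [Finset.sum_comm]
      exact Finset.sum_congr rfl fun i _ => Finset.sum_congr rfl fun s _ => by
        rw [B.h_symm s i]; ring
    have h2 := B.x_W
    rw [h1]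
    simp only [hk, mul_sub, Finset.sum_sub_distrib, mul_ite, mul_one, mul_zero,
      Finset.sum_ite_eq', Finset.mem_univ, if_true]
    rw [Finset.sum_congr rfl fun i _ => show B.W i * (xc i * xc j) = xc i * B.W i * xc j by ring,
      ← Finset.sum_mul, h2, zero_mul, sub_zero]
  rw [Fin.sum_univ_succ (n := 3)]
  refine Fin.cases ?_ (fun i => ?_) μ <;> refine Fin.cases ?_ (fun j => ?_) ν
  · simp only [gi_zero_zero, g_zero_succ, gi_succ_zero, b, Fin.sum_univ_three, if_true] at hw ⊢
    linear_combination hU + B.U * B.Ui * sum_sq - rho * B.Ui * hw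
  · have h1 := hwk j
    have h2 := B.x_k j
    have h3 : ∑ i, B.W i * B.w i = B.W 0 * B.w 0 + B.W 1 * B.w 1 + B.W 2 * B.w 2 :=
      Fin.sum_univ_three _
    simp only [gi_zero_succ, g_zero_succ, gi_succ_succ, b, φ, h3, Fin.sum_univ_three,
      (Fin.succ_ne_zero j).symm, if_false, g_zero_zero] at hw h1 h2 ⊢
    have h4 := B.x_W
    simp only [Fin.sum_univ_three] at h4
    linear_combination rho * h1 - B.U * h2 - rho * B.W j * hU
      - B.U * B.Ui * (B.V * xc j + rho * B.W j) * sum_sq - rho * B.U * B.Ui * xc j * h4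
      + rho * B.Ui * (B.V * xc j + rho * B.W j) * hw
  · have h1 := B.h_x i
    simp only [gi_zero_zero, g_succ_succ, gi_succ_zero, g_succ_zero, Fin.sum_univ_three,
      Fin.succ_ne_zero i, if_false] at h1 ⊢
    linear_combination -B.Ui * h1
  · have h1 := B.h_x i
    have h2 := hk i j
    have h3 : B.w i = B.h i 0 * B.W 0 + B.h i 1 * B.W 1 + B.h i 2 * B.W 2 := Fin.sum_univ_three _
    simp only [gi_zero_succ, g_succ_succ, gi_succ_succ, g_succ_zero, Fin.sum_univ_three,
      Fin.succ_inj, b] at h1 h2 ⊢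
    linear_combination h2 + xc i * xc j * hU + B.Ui * (B.V * xc j + rho * B.W j) * h1
      - rho * B.Ui * xc j * h3

variable {B} {g : Pt → Matrix (Fin 4) (Fin 4) ℝ}

theorem Repr.inv (h : B.Repr g) (μ ν : Fin 4) : Near (B.gi μ ν) fun p => (g p)⁻¹ μ ν := by
  have h1 : ∀ μ ν, NearFin fun q => ∑ s, g (ofTriple q) μ s * rep (B.gi s ν) q
      = if μ = ν then 1 else 0 := fun μ ν => by
    have h3 := Near.sum (s := Finset.univ) fun s => (h μ s).mul (near_rep (B.gi s ν))
    rw [sum_g_gi] at h3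
    have h4 : Near (if μ = ν then 1 else 0) fun _ => if μ = ν then 1 else 0 := by
      split_ifs
      · exact near_one
      · simpa using near_const 0
    exact (NearFin.and h3 h4).mono fun q hq e => by
      simp only [toTriple_ofTriple hq] at e; rw [← e.1, e.2]
  refine (nearFin_all fun μ => nearFin_all (h1 μ)).mono fun q hq e => ?_
  have hm : g (ofTriple q) * (Matrix.of fun s ν => rep (B.gi s ν) q) = 1 := by
    ext μ ν
    rw [Matrix.mul_apply, Matrix.one_apply, ← e μ ν]; rfl
  beta_reduce
  rw [Matrix.inv_eq_right_inv hm]; rfl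

theorem Repr.christoffel (h : B.Repr g) (l μ ν : Fin 4) :
    Near ((1 / 2 : ℝ) • B.G l μ ν) (christoffel g l μ ν) :=
  (Near.sum fun s => (h.inv l s).mul (((h s ν).dC μ).add ((h s μ).dC ν) |>.sub
    ((h μ ν).dC s))).smul (1 / 2)

theorem Repr.ricci (h : B.Repr g) (μ ν : Fin 4) :
    Near ((1 / 4 : ℝ) • B.ric μ ν) (ricci g μ ν) := by
  have h1 := (Near.sum (s := Finset.univ) fun l => ((h.christoffel l μ ν).dC l).sub
    ((h.christoffel l μ l).dC ν)).add (Near.sum (s := Finset.univ) fun l => Near.sum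
    (s := Finset.univ) fun s => ((h.christoffel l l s).mul (h.christoffel s μ ν)).sub
      ((h.christoffel l ν s).mul (h.christoffel s μ l)))
  have e : (1 / 4 : ℝ) • B.ric μ ν = ∑ l, (BondiSachs.dC l ((1 / 2 : ℝ) • B.G l μ ν)
      - BondiSachs.dC ν ((1 / 2 : ℝ) • B.G l μ l)) + ∑ l, ∑ s, ((1 / 2 : ℝ) • B.G l l s *
      (1 / 2 : ℝ) • B.G s μ ν - (1 / 2 : ℝ) • B.G l ν s * (1 / 2 : ℝ) • B.G s μ l) := by
    have h2 : (2 : ScriRing) = (2 : ℝ) • 1 := by rw [two_smul]; norm_num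
    simp only [ric, smul_add, Finset.smul_sum, Derivation.map_smul, h2,
      smul_mul_assoc, one_mul, smul_smul, smul_sub]
    have h3 : (1 / 2 : ℝ) * (1 / 2) = 1 / 4 := by norm_num
    simp only [mul_smul_comm, smul_smul, h3]
    norm_num
  rw [e]
  exact h1

theorem Repr.ric_eq_zero (h : B.Repr g) (h0 : ∀ μ ν, NearFin fun q => BondiSachs.ricci g μ ν (ofTriple q) = 0)
    (μ ν : Fin 4) : B.ric μ ν = 0 := by
  have h1 := (h.ricci μ ν).eq_zero (h0 μ ν)
  simpa using h1

end Fields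

end

/-! ### The ring-valued fields of a Bondi–Sachs coordinate system. -/

section

theorem iteratedDeriv_slice {F : Triple → ℝ} (hF : F ∈ scriSmooth) (n : ℕ) (u : ℝ) (x : E3)
    (hx : ‖x‖ = 1) :
    iteratedDeriv n (fun ρ => F (u, ρ, x)) 0 = ev u x hx ((⇑dR)^[n] (toRing F hF)) := by
  induction n generalizing F with
  | zero => simp [ev_toRing]
  | succ n ih =>
    have h : deriv (fun ρ => F (u, ρ, x)) =ᶠ[𝓝 0] fun ρ => tanD (0, 1, 0) F (u, ρ, x) := by
      have hc : ContinuousAt (fun ρ : ℝ => ((u, ρ, x) : Triple)) 0 := by fun_prop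
      have h1 : ContDiffAt ℝ 1 F (u, 0, x) := (hF u x hx).of_le (by simp)
      filter_upwards [hc.eventually (h1.eventually (by simp))] with ρ hρ
      have h2 : HasDerivAt (fun ρ : ℝ => ((u, ρ, x) : Triple)) (0, 1, 0) ρ :=
        (hasDerivAt_const _ _).prodMk ((hasDerivAt_id ρ).prodMk (hasDerivAt_const _ _))
      have h3 := (hρ.differentiableAt (by simp)).hasFDerivAt.comp_hasDerivAt ρ h2
      refine h3.deriv.trans ?_
      simp [tanD, tang]
    rw [iteratedDeriv_succ', h.iteratedDeriv_eq, ih (tanD_mem _ hF), Function.iterate_succ_apply,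
      dR, tanDer_toRing]

theorem val_dR_toRing {F : Triple → ℝ} (hF : F ∈ scriSmooth) :
    Val (dR (toRing F hF)) fun u x => deriv (fun ρ => F (u, ρ, x)) 0 := fun u x hx => by
  have := iteratedDeriv_slice hF 1 u x hx
  rw [iteratedDeriv_one] at this
  exact this.symm

theorem scriSmooth_prod {F : Triple → ℝ} {D : Set Triple} (hD : IsOpen D)
    (h : ∀ (u : ℝ) (x : E3), ‖x‖ = 1 → (u, 0, x) ∈ D) (hF : ContDiffOn ℝ ∞ F D) :
    F ∈ scriSmooth := fun u x hx => (hF _ (h u x hx)).contDiffAt (hD.mem_nhds (h u x hx))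

namespace Coords
variable (B : Coords)

theorem nearFin_dom : NearFin fun q => q ∈ B.dom := NearFin.of_scri fun u x hx =>
  B.isOpen_dom.mem_nhds (B.scri_mem u x hx)

theorem U_mem : B.U ∈ scriSmooth := scriSmooth_prod B.isOpen_dom B.scri_mem B.smooth_U
theorem V_mem : B.V ∈ scriSmooth := scriSmooth_prod B.isOpen_dom B.scri_mem B.smooth_V
theorem W_mem (i : Fin 3) : (fun q => B.W q i) ∈ scriSmooth :=
  scriSmooth_prod B.isOpen_dom B.scri_mem (B.smooth_W i)
theorem h_mem (i j : Fin 3) : (fun q => B.h q i j) ∈ scriSmooth :=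
  scriSmooth_prod B.isOpen_dom B.scri_mem (B.smooth_h i j)

theorem Ui_mem : (fun q => (B.U q)⁻¹) ∈ scriSmooth := fun u x hx =>
  (B.U_mem u x hx).inv (by rw [B.U_scri u x hx]; norm_num)

/-- Two divisions by ρ, permitted by the vanishing of W and of its first ρ-derivative at null
infinity. -/
theorem exists_shift (i : Fin 3) : ∃ a, toRing (fun q => B.W q i) (B.W_mem i) = rho ^ 2 * a := by
  obtain ⟨a, ha⟩ := exists_eq_rho_mul (a := toRing (fun q => B.W q i) (B.W_mem i))
    fun u x hx => by rw [ev_toRing]; exact B.W_scri u x hx i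
  obtain ⟨b, rfl⟩ := exists_eq_rho_mul (a := a) fun u x hx => by
    have h := val_dR_toRing (B.W_mem i) u x hx
    rw [ha] at h
    simp only [Derivation.leibniz, dR_rho, smul_eq_mul, map_add, map_mul, ev_rho, zero_mul,
      mul_one, zero_add] at h
    rw [h]; exact B.W_scri' u x hx i
  exact ⟨b, by rw [ha]; ring⟩

/-- The angular shift divided by `ρ²`. -/
def shift (i : Fin 3) : ScriRing := (B.exists_shift i).choose

theorem rho_sq_mul_shift (i : Fin 3) :
    rho ^ 2 * B.shift i = toRing (fun q => B.W q i) (B.W_mem i) := (B.exists_shift i).choose_spec.symm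

theorem near_coeff {F : Triple → ℝ} (hF : F ∈ scriSmooth) :
    Near (toRing F hF) fun p => F (toTriple p) :=
  near_toRing hF fun _ _ _ => Eventually.of_forall fun q hq => by
    beta_reduce; rw [toTriple_ofTriple hq]

theorem near_eq {a b : ScriRing} {F G : Triple → ℝ} (hF : Near a fun p => F (toTriple p))
    (hG : Near b fun p => G (toTriple p)) (h : ∀ q ∈ B.dom, IsFinite q → F q = G q) : a = b :=
  hF.eq hG (B.nearFin_dom.mono fun q hq hd => by
    beta_reduce; rw [toTriple_ofTriple hq]; exact h q hd hq)

theorem coeff_h_symm {q : Triple} (hd : q ∈ B.dom) (hq : IsFinite q) (i j : Fin 3) :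
    B.h q i j = B.h q j i := by
  have h1 := congrFun (congrFun (B.h_posDef q hd hq).isHermitian i) j
  simp only [Matrix.conjTranspose_apply, Matrix.of_apply, star_trivial] at h1
  linarith

/-- The metric coefficients as elements of the ring of functions near null infinity. -/
def fields : Fields where
  U := toRing B.U B.U_mem
  Ui := toRing _ B.Ui_mem
  V := toRing B.V B.V_mem
  W := B.shift
  h i j := toRing _ (B.h_mem i j)
  U_mul := B.near_eq ((near_coeff B.U_mem).mul (near_coeff B.Ui_mem)) (F := fun q => B.U q * (B.U q)⁻¹)
    (G := fun _ => 1) near_one fun q hd hq => mul_inv_cancel₀ (B.U_pos q hd hq).ne'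
  x_W := by
    refine rho_pow_mul_cancel 2 ?_
    rw [Finset.mul_sum, Finset.sum_congr rfl fun i _ => show rho ^ 2 * (xc i * B.shift i)
      = xc i * toRing _ (B.W_mem i) by rw [← rho_sq_mul_shift]; ring, mul_zero]
    exact B.near_eq (F := fun q => ∑ i, q.2.2 i * B.W q i) (G := fun _ => 0)
      (Near.sum fun i => (near_xc i).mul (near_coeff (B.W_mem i))) (by simpa using near_const 0)
      B.W_tangential
  h_symm i j := B.near_eq (F := fun q => B.h q i j) (G := fun q => B.h q j i)
    (near_coeff (B.h_mem i j)) (near_coeff (B.h_mem j i)) fun q hd hq => B.coeff_h_symm hd hq i j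
  h_x i := B.near_eq (F := fun q => ∑ j, B.h q i j * q.2.2 j) (G := fun _ => 0)
      (Near.sum fun j => (near_coeff (B.h_mem i j)).mul (near_xc j)) (by simpa using near_const 0)
      fun q hd hq => B.h_tangential q hd hq i
  h_det := by
    have e : ∀ i j, Near (toRing _ (B.h_mem i j) + xc i * xc j)
        fun p => B.h (toTriple p) i j + (toTriple p).2.2 i * (toTriple p).2.2 j := fun i j =>
      (near_coeff (B.h_mem i j)).add ((near_xc i).mul (near_xc j))
    refine B.near_eq (F := fun q => (Matrix.of fun i j => B.h q i j + q.2.2 i * q.2.2 j).det)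
      (G := fun _ => 1) ?_ near_one B.h_det
    simp only [Matrix.det_fin_three, Matrix.of_apply]
    exact (((((((e 0 0).mul (e 1 1)).mul (e 2 2)).sub (((e 0 0).mul (e 1 2)).mul (e 2 1))).sub
      (((e 0 1).mul (e 1 0)).mul (e 2 2))).add (((e 0 1).mul (e 1 2)).mul (e 2 0))).add
      (((e 0 2).mul (e 1 0)).mul (e 2 1))).sub (((e 0 2).mul (e 1 1)).mul (e 2 0))

theorem repr_metric : B.fields.Repr B.metric := by
  have hW : ∀ i, Near (rho ^ 2 * B.fields.W i) fun p => B.W (toTriple p) i := fun i => by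
    change Near (rho ^ 2 * B.shift i) _
    rw [B.rho_sq_mul_shift i]; exact near_coeff (B.W_mem i)
  have hU : Near B.fields.U fun p => B.U (toTriple p) := near_coeff B.U_mem
  have hV : Near B.fields.V fun p => B.V (toTriple p) := near_coeff B.V_mem
  have hh : ∀ i j, Near (B.fields.h i j) fun p => B.h (toTriple p) i j := fun i j =>
    near_coeff (B.h_mem i j)
  -- pointwise values of the representatives
  have hWp : ∀ i, Near (B.fields.W i) fun p => B.W (toTriple p) i / (toTriple p).2.1 ^ 2 := fun i => by
    have h1 := (near_rho.pow 2).mul (near_rep (B.fields.W i))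
    refine (NearFin.and h1 (hW i)).mono fun q hq e => ?_
    have e1 := e.1.symm.trans e.2
    simp only [toTriple_ofTriple hq] at e1 ⊢
    rw [← e1]
    field_simp [hq.1.ne']
  have hw : ∀ i, Near (B.fields.w i) fun p =>
      ∑ j, B.h (toTriple p) i j * (B.W (toTriple p) j / (toTriple p).2.1 ^ 2) := fun i =>
    Near.sum fun j => (hh i j).mul (hWp j)
  have hb : ∀ i : Fin 3, Near (B.fields.b i) fun p => -(B.U (toTriple p) * (toTriple p).2.2 i)
      + (toTriple p).2.1 * ∑ j, B.h (toTriple p) i j * (B.W (toTriple p) j / (toTriple p).2.1 ^ 2) :=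
    fun i => (hU.mul (near_xc i)).neg.add (near_rho.mul (hw i))
  have hφ : Near B.fields.φ fun p => -(B.U (toTriple p) * B.V (toTriple p)) + (toTriple p).2.1 ^ 2 *
      ∑ i, B.W (toTriple p) i / (toTriple p).2.1 ^ 2 *
        ∑ j, B.h (toTriple p) i j * (B.W (toTriple p) j / (toTriple p).2.1 ^ 2) :=
    (hU.mul hV).neg.add ((near_rho.pow 2).mul (Near.sum fun i => (hWp i).mul (hw i)))
  have hm : ∀ q, B.metric (ofTriple q) = bondiMetric B.U B.V B.W B.h (ofTriple q) := fun _ => rfl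
  -- Since h is tangential, the projections contained in the forms dx^a act on it as the identity.
  have hproj : ∀ {q : Triple}, q ∈ B.dom → IsFinite q → ∀ a i, ∑ b, B.h q a b *
      roundMetric q.2.2 b i = B.h q a i := fun {q} hd hq a i => by
    have h1 := B.h_tangential q hd hq a
    simp only [roundMetric, mul_sub, Finset.sum_sub_distrib, mul_ite, mul_one, mul_zero,
      Finset.sum_ite_eq', Finset.mem_univ, if_true]
    rw [Finset.sum_congr rfl fun b _ => show B.h q a b * (q.2.2 b * q.2.2 i)
      = B.h q a b * q.2.2 b * q.2.2 i by ring, ← Finset.sum_mul, h1, zero_mul, sub_zero]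
  have hproj' : ∀ {q : Triple}, q ∈ B.dom → IsFinite q → ∀ b i, ∑ a, B.h q a b *
      roundMetric q.2.2 a i = B.h q i b := fun {q} hd hq b i => by
    rw [← B.coeff_h_symm hd hq b i, ← hproj hd hq b i]
    exact Finset.sum_congr rfl fun a _ => by rw [B.coeff_h_symm hd hq]
  intro μ ν
  refine Fin.cases ?_ (fun i => ?_) μ <;> refine Fin.cases ?_ (fun j => ?_) ν
  · refine hφ.congr (B.nearFin_dom.mono fun q hq hd => ?_)
    have hr := hq.1.ne'
    simp only [hm, bondiMetric, toTriple_ofTriple hq, duForm, drForm, dxForm, Fin.cons_zero,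
      Fin.sum_univ_three]
    field_simp
    ring
  · refine (hb j).congr (B.nearFin_dom.mono fun q hq hd => ?_)
    have hr := hq.1.ne'
    have h0 := hproj hd hq 0 j
    have h1 := hproj hd hq 1 j
    have h2 := hproj hd hq 2 j
    simp only [hm, bondiMetric, toTriple_ofTriple hq, duForm, drForm, dxForm, Fin.cons_zero,
      Fin.cons_succ, B.coeff_h_symm hd hq j, Fin.sum_univ_three] at h0 h1 h2 ⊢
    rw [← h0, ← h1, ← h2]
    field_simp
    ring
  · refine (hb i).congr (B.nearFin_dom.mono fun q hq hd => ?_)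
    have hr := hq.1.ne'
    have h0 := hproj' hd hq 0 i
    have h1 := hproj' hd hq 1 i
    have h2 := hproj' hd hq 2 i
    simp only [hm, bondiMetric, toTriple_ofTriple hq, duForm, drForm, dxForm, Fin.cons_zero,
      Fin.cons_succ, Fin.sum_univ_three] at h0 h1 h2 ⊢
    rw [← h0, ← h1, ← h2]
    field_simp
    ring
  · refine (hh i j).congr (B.nearFin_dom.mono fun q hq hd => ?_)
    have hr := hq.1.ne'
    have e : ∑ a, ∑ b, B.h q a b * roundMetric q.2.2 a i * roundMetric q.2.2 b j = B.h q i j := by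
      rw [← hproj' hd hq j i]
      refine Finset.sum_congr rfl fun a _ => ?_
      rw [← hproj hd hq a j, Finset.sum_mul]
      exact Finset.sum_congr rfl fun b _ => by ring
    simp only [hm, bondiMetric, toTriple_ofTriple hq, duForm, drForm, dxForm, Fin.cons_succ]
    rw [← e]
    simp only [Fin.sum_univ_three]
    field_simp
    ring

theorem ric_eq_zero (μ ν : Fin 4) : B.fields.ric μ ν = 0 :=
  B.repr_metric.ric_eq_zero (fun μ ν => B.nearFin_dom.mono fun q hq hd => B.vacuum q hd hq μ ν) μ ν

/-- The coefficient of `r⁻²` in the angular shift. -/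
def shift₂ (u : ℝ) (x : E3) (i : Fin 3) : ℝ := (exists_val (B.shift i)).choose u x

/-- The coefficient of `r⁻³` in the angular shift. -/
def shift₃ (u : ℝ) (x : E3) (i : Fin 3) : ℝ := 1 / 6 * iteratedDeriv 3 (fun ρ => B.W (u, ρ, x) i) 0

theorem asym : B.fields.Asym B.mass B.shear B.shift₂ B.shift₃ where
  U u x hx := B.U_scri u x hx
  V u x hx := B.V_scri u x hx
  V' u x hx := by
    have h := val_dR_toRing B.V_mem u x hx
    refine h.trans ?_
    simp only [mass]; ring
  h i j u x hx := B.h_scri u x hx i j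
  h' i j := val_dR_toRing (B.h_mem i j)
  W i := (exists_val (B.shift i)).choose_spec
  W' i u x hx := by
    have h := iteratedDeriv_slice (B.W_mem i) 3 u x hx
    rw [← rho_sq_mul_shift] at h
    -- At ρ = 0 the third derivative of ρ² s is 6 ∂_ρ s, which matches the factor 1/6 in the Taylor
    -- coefficient.
    have e : (dR)^[3] (rho ^ 2 * B.shift i) = 6 * dR (B.shift i) + rho * (6 * dR (dR (B.shift i))
        + rho * dR (dR (dR (B.shift i)))) := by
      simp only [Function.iterate_succ_apply, Function.iterate_zero, id, Derivation.leibniz,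
        Derivation.leibniz_pow, dR_rho, smul_eq_mul, map_add, nsmul_eq_mul, mul_one, pow_one,
        Nat.cast_ofNat, Nat.add_one_sub_one]
      have d2 : dR (2 : ScriRing) = 0 := by simpa using Derivation.map_natCast dR 2
      simp only [d2, map_zero]
      ring
    rw [e] at h
    simp only [map_add, map_mul, map_ofNat, ev_rho, zero_mul, add_zero] at h
    change ev u x hx (dR (B.shift i)) = _
    simp only [shift₃, h]
    ring

/-- The expansion of the metric coefficients. -/
def expansion : B.fields.Exp B.mass B.shear B.shift₂ B.shift₃ := (B.asym.exp B.ric_eq_zero).some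

end Coords

end

/-! ### The Hessian on the sphere in Cartesian components. -/

section

variable {φ ψ : E3 → ℝ} {x : E3}

theorem trace_roundMetric (hx : ‖x‖ = 1) : ∑ i, roundMetric x i i = 2 := by
  have h := sum_x_sq hx
  simp only [roundMetric, Fin.sum_univ_three, if_true]
  linarith

theorem sum_x_tderiv_tderiv (h : SphereSmooth φ) (hx : ‖x‖ = 1) (i : Fin 3) :
    ∑ j, x j * tderiv i (tderiv j φ) x = -tderiv i φ x := by
  have h1 : tderiv i (fun z : E3 => ∑ j, z j * tderiv j φ z) x = 0 := by
    rw [tderiv_congr (ψ := fun _ => 0) (fun z hz => sum_x_tderiv h hz) i hx, tderiv_const]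
  rw [tderiv_sum i (fun j => (sphereSmooth_coord j).mul (h.tderiv j)) hx] at h1
  simp only [tderiv_mul i (sphereSmooth_coord _) (h.tderiv _) hx, tderiv_coord i _ hx,
    Finset.sum_add_distrib] at h1
  have h2 := roundMetric_mul (v := fun j => tderiv j φ x) (sum_x_tderiv h hx) i
  have h3 : ∑ j, tderiv j φ x * roundMetric x i j = tderiv i φ x := by
    rw [← h2]; exact Finset.sum_congr rfl fun j _ => mul_comm _ _
  have h4 : ∀ j, (fun z => tderiv j φ z) = tderiv j φ := fun _ => rfl
  simp only [h4] at h1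
  linarith

/-- The projection removes the normal component of ∂_i ∇φ, and differentiating x · ∇φ = 0 identifies
that component as −∂_i φ. -/
theorem hess_eq (h : SphereSmooth φ) (hx : ‖x‖ = 1) (i j : Fin 3) :
    hess φ x i j = tderiv i (tderiv j φ) x + x j * tderiv i φ x := by
  have h1 := sum_x_tderiv_tderiv h hx i
  have h4 : ∀ b, (fun z => grad φ z b) = tderiv b φ := fun _ => rfl
  simp only [hess, covDeriv₁, h4, roundMetric, sub_mul, Finset.sum_sub_distrib, ite_mul, one_mul,
    zero_mul, Finset.sum_ite_eq, Finset.mem_univ, if_true, mul_assoc]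
  rw [← Finset.mul_sum, h1]
  ring

theorem hess_symm (h : SphereSmooth φ) (hx : ‖x‖ = 1) (i j : Fin 3) :
    hess φ x i j = hess φ x j i := by
  rw [hess_eq h hx, hess_eq h hx]
  linarith [tderiv_comm h hx i j]

theorem SphereSmooth.hess (h : SphereSmooth φ) (i j : Fin 3) :
    SphereSmooth fun x => hess φ x i j := by
  refine SphereSmooth.congr (φ := fun x => BondiSachs.tderiv i (BondiSachs.tderiv j φ) x
    + x j * BondiSachs.tderiv i φ x) ?_ fun x hx => hess_eq h hx i j
  have h1 := (h.tderiv j).tderiv i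
  have h2 := h.tderiv i
  have h3 := sphereSmooth_coord j
  exact h1.add (h3.mul h2)

theorem SphereSmooth.lap (h : SphereSmooth φ) : SphereSmooth fun x => lap φ x :=
  SphereSmooth.sum fun i => h.hess i i

end

/-! ### Pull-back of the conformally rescaled metric by a supertranslation. -/

section

/-- A change of coordinates near null infinity that is a supertranslation there. -/
structure ScriMap (f : E3 → ℝ) where
  D : Set Triple
  Ψ : Triple → Triple
  isOpen : IsOpen D
  scri_mem : ∀ (u : ℝ) (x : E3), ‖x‖ = 1 → (u, 0, x) ∈ D
  smooth : ContDiffOn ℝ ∞ Ψ D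
  scri : ∀ (u : ℝ) (x : E3), ‖x‖ = 1 → Ψ (u, 0, x) = (u + f x, 0, x)
  finite : ∀ q ∈ D, IsFinite q → IsFinite (Ψ q)

namespace ScriMap
variable {f : E3 → ℝ} (S : ScriMap f)

theorem contDiffAt {u : ℝ} {x : E3} (hx : ‖x‖ = 1) : ContDiffAt ℝ ∞ S.Ψ (u, 0, x) :=
  (S.smooth _ (S.scri_mem u x hx)).contDiffAt (S.isOpen.mem_nhds (S.scri_mem u x hx))

theorem comp_mem {F : Triple → ℝ} (hF : F ∈ scriSmooth) : (fun q => F (S.Ψ q)) ∈ scriSmooth :=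
  fun u x hx => ContDiffAt.comp (g := F) (f := S.Ψ) _
    (by rw [S.scri u x hx]; exact hF _ x hx) (S.contDiffAt hx)

theorem nearFin_comp {P : Triple → Prop} (h : NearFin P) : NearFin fun q => P (S.Ψ q) :=
  fun u x hx => by
  have h1 := (S.contDiffAt (u := u) hx).continuousAt.eventually
    (by rw [S.scri u x hx]; exact h (u + f x) x hx)
  filter_upwards [h1, S.isOpen.mem_nhds (S.scri_mem u x hx)] with q hq hD hf
  exact hq (S.finite q hD hf)

/-- The pull-back of functions on the spacetime. -/
def pull : ScriRing →+* ScriRing :=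
  Ideal.quotientMap finIdeal
    { toFun := fun F => ⟨fun q => F.1 (S.Ψ q), S.comp_mem F.2⟩
      map_one' := rfl
      map_mul' := fun _ _ => rfl
      map_zero' := rfl
      map_add' := fun _ _ => rfl } fun _ hF => S.nearFin_comp hF

theorem pull_toRing {F : Triple → ℝ} (hF : F ∈ scriSmooth) :
    S.pull (toRing F hF) = toRing (fun q => F (S.Ψ q)) (S.comp_mem hF) := rfl

theorem ev_pull (a : ScriRing) (u : ℝ) (x : E3) (hx : ‖x‖ = 1) :
    ev u x hx (S.pull a) = ev (u + f x) x hx a := by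
  obtain ⟨F, hF, rfl⟩ := toRing_surjective a
  rw [pull_toRing, ev_toRing, ev_toRing, S.scri u x hx]

theorem near_pull {a : ScriRing} {Φ : Pt → ℝ} (h : Near a Φ) :
    Near (S.pull a) fun p => Φ (ofTriple (S.Ψ (toTriple p))) := by
  rw [← toRing_rep a, pull_toRing]
  refine near_toRing _ ((S.nearFin_comp h).mono fun q hq e => ?_)
  rw [toTriple_ofTriple hq]; exact e

/-- Points of finite radius are mapped to points of finite radius, so the pulled-back ρ is positive
where equality in the ring is tested. -/
theorem pull_rho_cancel {a b : ScriRing} (h : S.pull rho * a = S.pull rho * b) : a = b := by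
  have hs := S.near_pull near_rho
  have e := (hs.mul (near_rep a)).congr (Φ' := fun p => rep (S.pull rho * b) (toTriple p))
    (by rw [← h]; exact (NearFin.and (hs.mul (near_rep a)) (near_rep _)).mono
          fun q _ e => e.1.symm.trans e.2)
  refine (near_rep a).eq (near_rep b) ?_
  refine (((NearFin.and (hs.mul (near_rep a)) (hs.mul (near_rep b))).and
    (NearFin.of_scri fun u x hx => S.isOpen.mem_nhds (S.scri_mem u x hx)))).mono fun q hq e => ?_
  have hf := S.finite q e.2 hq
  have e1 := e.1.1.symm.trans ((congrArg (fun c => rep c q) h).trans e.1.2)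
  simp only [toTriple_ofTriple hq, toTriple_ofTriple hf] at e1 ⊢
  exact mul_left_cancel₀ hf.1.ne' e1

theorem sum_pull_xc : ∑ i, S.pull (xc i) * S.pull (xc i) = 1 := by
  rw [← map_one S.pull, ← sum_xc_mul_xc, map_sum]
  exact Finset.sum_congr rfl fun i _ => (map_mul _ _ _).symm

theorem sum_pull_xc_der (d : Derivation ℝ ScriRing ScriRing) :
    ∑ i, S.pull (xc i) * d (S.pull (xc i)) = 0 := by
  have h := congrArg d S.sum_pull_xc
  simp only [map_sum, Derivation.leibniz, smul_eq_mul, Derivation.map_one_eq_zero] at h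
  have h2 : (2 : ℝ) • ∑ i, S.pull (xc i) * d (S.pull (xc i)) = 0 := by
    rw [two_smul, ← h, ← Finset.sum_add_distrib]
  exact (smul_eq_zero_iff_right (two_ne_zero)).1 h2

/-- The pull-back of `s²` times the metric, on a pair of derivations. -/
def form (B : Fields) (d e : Derivation ℝ ScriRing ScriRing) : ScriRing :=
  S.pull rho ^ 2 * S.pull B.φ * (d (S.pull uc) * e (S.pull uc))
    + S.pull B.U * (d (S.pull uc) * e (S.pull rho) + d (S.pull rho) * e (S.pull uc))
    + S.pull rho ^ 2 * ∑ i, S.pull (B.w i) *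
      (d (S.pull uc) * e (S.pull (xc i)) + d (S.pull (xc i)) * e (S.pull uc))
    + ∑ i, ∑ j, S.pull (B.h i j) * (d (S.pull (xc i)) * e (S.pull (xc j)))

variable {S} {B B' : Fields}

theorem form_symm (d e : Derivation ℝ ScriRing ScriRing) : S.form B d e = S.form B e d := by
  have h1 : ∑ i, ∑ j, S.pull (B.h i j) * (d (S.pull (xc i)) * e (S.pull (xc j)))
      = ∑ i, ∑ j, S.pull (B.h i j) * (e (S.pull (xc i)) * d (S.pull (xc j))) := by
    rw [Finset.sum_comm]
    exact Finset.sum_congr rfl fun i _ => Finset.sum_congr rfl fun j _ => by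
      rw [B.h_symm j i]; ring
  rw [form, form, h1]
  simp only [mul_comm, add_comm]

theorem form_sum_right {ι : Type*} [DecidableEq ι] (s : Finset ι) (d : Derivation ℝ ScriRing ScriRing) (c : ι → ScriRing)
    (e : ι → Derivation ℝ ScriRing ScriRing) :
    S.form B d (∑ i ∈ s, c i • e i) = ∑ i ∈ s, c i * S.form B d (e i) := by
  induction s using Finset.induction_on with
  | empty => simp [form]
  | insert i s hi ih =>
    rw [Finset.sum_insert hi, Finset.sum_insert hi, ← ih]
    simp only [form, Derivation.add_apply, Derivation.smul_apply, smul_eq_mul, Fin.sum_univ_three]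
    ring

/-- The transformation law of the metric. -/
def Pulls (S : ScriMap f) (B B' : Fields) : Prop :=
  ∀ μ ν, S.form B (dC μ) (dC ν) = S.pull rho ^ 2 * B'.g μ ν

variable (hS : S.Pulls B B')

/-- Radial and projected combinations of the coordinate derivatives recover ρ² ∂_ρ and ρ times the
tangential derivatives. By bilinearity the Cartesian transformation law becomes one in the frame
adapted to null infinity. -/
theorem sum_xc_smul_dC : ∑ i : Fin 3, xc i • dC i.succ = (-rho ^ 2) • dR := by
  ext a
  have := sum_xc_dC a
  simp only [Dr, Fin.sum_univ_three, Derivation.add_apply, Derivation.smul_apply, smul_eq_mul] at this ⊢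
  rw [this]; ring

theorem sum_Pr_smul_dC (j : Fin 3) : ∑ i : Fin 3, Pr j i • dC i.succ = rho • dT j := by
  ext a
  have h1 := Pr_mul (fun i => dT i a) (sum_xc_dT a) j
  have h2 := Pr_x j
  simp only [Fin.sum_univ_three, Derivation.add_apply, Derivation.smul_apply, smul_eq_mul, dC_succ] at *
  linear_combination rho * h1 - rho ^ 2 * dR a * h2

theorem form_sum_left {ι : Type*} [DecidableEq ι] (s : Finset ι) (d : Derivation ℝ ScriRing ScriRing)
    (c : ι → ScriRing) (e : ι → Derivation ℝ ScriRing ScriRing) :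
    S.form B (∑ i ∈ s, c i • e i) d = ∑ i ∈ s, c i * S.form B (e i) d := by
  rw [form_symm, form_sum_right]
  exact Finset.sum_congr rfl fun i _ => by rw [form_symm]

theorem form_smul_right (d e : Derivation ℝ ScriRing ScriRing) (c : ScriRing) :
    S.form B d (c • e) = c * S.form B d e := by
  simpa using form_sum_right (S := S) (B := B) {()} d (fun _ => c) fun _ => e

theorem form_smul_left (d e : Derivation ℝ ScriRing ScriRing) (c : ScriRing) :
    S.form B (c • d) e = c * S.form B d e := by
  rw [form_symm, form_smul_right, form_symm]

include hS

variable {σ : ScriRing} (hσ : S.pull rho = rho * σ)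
include hσ

theorem form_dU_dU : S.form B dU dU = rho ^ 2 * σ ^ 2 * B'.φ := by
  have h := hS 0 0
  rw [hσ] at h
  refine Eq.trans h ?_
  rw [Fields.g_zero_zero]; ring

theorem form_dU_dR : S.form B dU dR = σ ^ 2 * B'.U := by
  have h : S.form B dU (∑ i : Fin 3, xc i • dC i.succ) = ∑ i : Fin 3, xc i * (S.pull rho ^ 2 * B'.g 0 i.succ) := by
    rw [form_sum_right]; exact Finset.sum_congr rfl fun i _ => by rw [← hS 0 i.succ]; rfl
  rw [sum_xc_smul_dC, form_smul_right, hσ] at h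
  refine rho_pow_mul_cancel 2 ?_
  have hw := B'.x_w
  have hs := sum_sq
  simp only [Fields.g_zero_succ, Fields.b, Fin.sum_univ_three] at h hw
  linear_combination -h - rho ^ 3 * σ ^ 2 * hw + rho ^ 2 * σ ^ 2 * B'.U * hs

/-- In the new Bondi–Sachs system the radial direction is null and orthogonal to the spheres. The
vanishing of this component, and of the mixed radial–angular one, are the gauge conditions that
determine the change of coordinates. -/
theorem form_dR_dR : S.form B dR dR = 0 := by
  have h : S.form B (∑ i : Fin 3, xc i • dC i.succ) (∑ i : Fin 3, xc i • dC i.succ) =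
      ∑ i : Fin 3, xc i * ∑ j : Fin 3, xc j * (S.pull rho ^ 2 * B'.g i.succ j.succ) := by
    rw [form_sum_left]
    refine Finset.sum_congr rfl fun i _ => ?_
    rw [form_sum_right]; exact congrArg _ (Finset.sum_congr rfl fun j _ => by rw [← hS])
  rw [sum_xc_smul_dC, form_smul_right, form_smul_left, hσ] at h
  refine rho_pow_mul_cancel 4 ?_
  have h0 := B'.h_x 0
  have h1 := B'.h_x 1
  have h2 := B'.h_x 2
  simp only [Fields.g_succ_succ, Fin.sum_univ_three] at *
  linear_combination h + rho ^ 2 * σ ^ 2 * (xc 0 * h0 + xc 1 * h1 + xc 2 * h2)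

theorem form_dR_dT (k : Fin 3) : S.form B dR (dT k) = 0 := by
  have h : S.form B (∑ i : Fin 3, xc i • dC i.succ) (∑ i : Fin 3, Pr k i • dC i.succ) =
      ∑ i : Fin 3, xc i * ∑ j : Fin 3, Pr k j * (S.pull rho ^ 2 * B'.g i.succ j.succ) := by
    rw [form_sum_left]
    refine Finset.sum_congr rfl fun i _ => ?_
    rw [form_sum_right]; exact congrArg _ (Finset.sum_congr rfl fun j _ => by rw [← hS])
  rw [sum_xc_smul_dC, sum_Pr_smul_dC, form_smul_right, form_smul_left, hσ] at h
  refine rho_pow_mul_cancel 3 ?_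
  have h0 := B'.x_h 0
  have h1 := B'.x_h 1
  have h2 := B'.x_h 2
  simp only [Fields.g_succ_succ, Fin.sum_univ_three] at *
  linear_combination -h - rho ^ 2 * σ ^ 2 * (Pr k 0 * h0 + Pr k 1 * h1 + Pr k 2 * h2)

theorem form_dT_dT (k l : Fin 3) : S.form B (dT k) (dT l) = σ ^ 2 * B'.h k l := by
  have h : S.form B (∑ i : Fin 3, Pr k i • dC i.succ) (∑ i : Fin 3, Pr l i • dC i.succ) =
      ∑ i : Fin 3, Pr k i * ∑ j : Fin 3, Pr l j * (S.pull rho ^ 2 * B'.g i.succ j.succ) := by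
    rw [form_sum_left]
    refine Finset.sum_congr rfl fun i _ => ?_
    rw [form_sum_right]; exact congrArg _ (Finset.sum_congr rfl fun j _ => by rw [← hS])
  rw [sum_Pr_smul_dC, sum_Pr_smul_dC, form_smul_right, form_smul_left, hσ] at h
  have e1 : ∀ i, ∑ j, Pr l j * B'.h i j = B'.h i l := fun i => by
    have := Pr_mul (fun j => B'.h i j) (by
      rw [← B'.h_x i]; exact Finset.sum_congr rfl fun j _ => mul_comm _ _) l
    exact this
  have e2 := Pr_mul (fun j => B'.h j l) (B'.x_h l) k
  have h0 := e1 0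
  have h1 := e1 1
  have h2 := e1 2
  refine rho_pow_mul_cancel 2 ?_
  simp only [Fields.g_succ_succ, Fin.sum_univ_three] at *
  linear_combination h + rho ^ 2 * σ ^ 2 * e2 + rho ^ 2 * σ ^ 2 * (Pr k 0 * h0 + Pr k 1 * h1 + Pr k 2 * h2)

end ScriMap

end

/-! ### The Jacobian of the change of coordinates. -/

section

namespace ScriMap
variable {f : E3 → ℝ} (S : ScriMap f)

/-- `s²` times the Jacobian of the change of coordinates. -/
def jac (μ : Fin 4) : Fin 4 → ScriRing :=
  Fin.cases (S.pull rho ^ 2 * dC μ (S.pull uc)) fun i =>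
    S.pull rho * dC μ (S.pull (xc i)) - S.pull (xc i) * dC μ (S.pull rho)

/-- For y = x/s one has s² ∂y = s ∂x − x ∂s. The part along x is annihilated by h and w, and
survives only against −U x_j in g_{0j}, where it produces the term U du dρ. -/
theorem sum_jac (B : Fields) (μ ν : Fin 4) :
    ∑ a, ∑ b, S.jac μ a * S.jac ν b * S.pull (B.g a b)
      = S.pull rho ^ 2 * S.form B (dC μ) (dC ν) := by
  have hw := congrArg S.pull B.x_w
  have h0 := congrArg S.pull (B.h_x 0)
  have h1 := congrArg S.pull (B.h_x 1)
  have h2 := congrArg S.pull (B.h_x 2)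
  have k0 := congrArg S.pull (B.x_h 0)
  have k1 := congrArg S.pull (B.x_h 1)
  have k2 := congrArg S.pull (B.x_h 2)
  have hx := S.sum_pull_xc
  have d1 := S.sum_pull_xc_der (dC μ)
  have d2 := S.sum_pull_xc_der (dC ν)
  simp only [map_sum, map_mul, map_zero] at hw h0 h1 h2 k0 k1 k2
  have e : ∀ a, ∑ b, S.jac μ a * S.jac ν b * S.pull (B.g a b)
      = S.jac μ a * S.jac ν 0 * S.pull (B.g a 0)
        + ∑ j : Fin 3, S.jac μ a * S.jac ν j.succ * S.pull (B.g a j.succ) := fun a =>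
    Fin.sum_univ_succ (n := 3) _
  simp only [e]
  rw [Fin.sum_univ_succ (n := 3)]
  simp only [jac, Fin.cases_zero, Fin.cases_succ, Fields.g_zero_zero, Fields.g_zero_succ,
    Fields.g_succ_zero, Fields.g_succ_succ, Fields.b, map_add, map_neg, map_mul]
  have hb : ∀ (a s : ScriRing) (d : Derivation ℝ ScriRing ScriRing),
      ∑ j : Fin 3, s ^ 2 * a * (S.pull rho * d (S.pull (xc j)) - S.pull (xc j) * d (S.pull rho))
        * (-(S.pull B.U * S.pull (xc j)) + S.pull rho * S.pull (B.w j))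
      = s ^ 2 * a * (S.pull B.U * d (S.pull rho)
        + S.pull rho ^ 2 * ∑ j, S.pull (B.w j) * d (S.pull (xc j))) := fun a s d => by
    have d3 := S.sum_pull_xc_der d
    simp only [Fin.sum_univ_three] at hw hx d3 ⊢
    linear_combination s ^ 2 * a * (S.pull B.U * d (S.pull rho) * hx
      - S.pull rho * S.pull B.U * d3 - S.pull rho * d (S.pull rho) * hw)
  have hh : ∑ i : Fin 3, ∑ j : Fin 3,
      (S.pull rho * dC μ (S.pull (xc i)) - S.pull (xc i) * dC μ (S.pull rho)) *
      (S.pull rho * dC ν (S.pull (xc j)) - S.pull (xc j) * dC ν (S.pull rho)) * S.pull (B.h i j)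
      = S.pull rho ^ 2 * ∑ i, ∑ j, S.pull (B.h i j)
        * (dC μ (S.pull (xc i)) * dC ν (S.pull (xc j))) := by
    simp only [Fin.sum_univ_three] at h0 h1 h2 k0 k1 k2 ⊢
    linear_combination -S.pull rho * dC ν (S.pull rho) * (dC μ (S.pull (xc 0)) * h0
      + dC μ (S.pull (xc 1)) * h1 + dC μ (S.pull (xc 2)) * h2)
      - dC μ (S.pull rho) * ((S.pull rho * dC ν (S.pull (xc 0)) - S.pull (xc 0) * dC ν (S.pull rho)) * k0
      + (S.pull rho * dC ν (S.pull (xc 1)) - S.pull (xc 1) * dC ν (S.pull rho)) * k1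
      + (S.pull rho * dC ν (S.pull (xc 2)) - S.pull (xc 2) * dC ν (S.pull rho)) * k2)
  rw [hb]
  have hb' := hb (dC ν (S.pull uc)) (S.pull rho) (dC μ)
  rw [Finset.sum_add_distrib, hh]
  have hc : ∑ x : Fin 3, (S.pull rho * dC μ (S.pull (xc x)) - S.pull (xc x) * dC μ (S.pull rho)) *
      (S.pull rho ^ 2 * dC ν (S.pull uc)) * (-(S.pull B.U * S.pull (xc x)) + S.pull rho * S.pull (B.w x))
      = ∑ j : Fin 3, S.pull rho ^ 2 * dC ν (S.pull uc) *
        (S.pull rho * dC μ (S.pull (xc j)) - S.pull (xc j) * dC μ (S.pull rho))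
        * (-(S.pull B.U * S.pull (xc j)) + S.pull rho * S.pull (B.w j)) :=
    Finset.sum_congr rfl fun j _ => by ring
  rw [hc, hb', form]
  simp only [Fin.sum_univ_three]
  ring

theorem nearFin_mem : NearFin fun q => q ∈ S.D := NearFin.of_scri fun u x hx =>
  S.isOpen.mem_nhds (S.scri_mem u x hx)

theorem near_jac (μ a : Fin 4) : Near (S.jac μ a) fun p => (S.Ψ (toTriple p)).2.1 ^ 2 *
    pd μ (fun p => ofTriple (S.Ψ (toTriple p)) a) p := by
  have hs : Near (S.pull rho) fun p => (S.Ψ (toTriple p)).2.1 :=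
    Coords.near_coeff (S.comp_mem rho_mem)
  have ha : Near (S.pull uc) fun p => (S.Ψ (toTriple p)).1 := Coords.near_coeff (S.comp_mem time_mem)
  have hz : ∀ i, Near (S.pull (xc i)) fun p => (S.Ψ (toTriple p)).2.2 i := fun i =>
    Coords.near_coeff (S.comp_mem (coord_mem i))
  refine Fin.cases ((hs.pow 2).mul (ha.dC μ)) (fun i => ?_) a
  refine ((hs.mul ((hz i).dC μ)).sub ((hz i).mul (hs.dC μ))).congr ?_
  refine ((S.nearFin_mem.and (nearFin_differentiableAt (S.comp_mem rho_mem))).and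
    (nearFin_differentiableAt (S.comp_mem (coord_mem i)))).mono fun q hq h => ?_
  have hf := S.finite q h.1.1 hq
  obtain ⟨L, hL, -⟩ := hasFDerivAt_toTriple (spatial_ofTriple_ne hq)
  have ht := toTriple_ofTriple hq
  have d1 : DifferentiableAt ℝ (fun p => (S.Ψ (toTriple p)).2.1) (ofTriple q) :=
    DifferentiableAt.comp (g := fun q => (S.Ψ q).2.1) (ofTriple q) (by rw [ht]; exact h.1.2)
      hL.differentiableAt
  have d2 : DifferentiableAt ℝ (fun p => (S.Ψ (toTriple p)).2.2 i) (ofTriple q) :=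
    DifferentiableAt.comp (g := fun q => (S.Ψ q).2.2 i) (ofTriple q) (by rw [ht]; exact h.2)
      hL.differentiableAt
  have hne : (S.Ψ (toTriple (ofTriple q))).2.1 ≠ 0 := by rw [ht]; exact hf.1.ne'
  have e : pd μ (fun p => ofTriple (S.Ψ (toTriple p)) i.succ) (ofTriple q)
      = (S.Ψ (toTriple (ofTriple q))).2.1⁻¹ * pd μ (fun p => (S.Ψ (toTriple p)).2.2 i) (ofTriple q)
        - (S.Ψ (toTriple (ofTriple q))).2.2 i * (((S.Ψ (toTriple (ofTriple q))).2.1 ^ 2)⁻¹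
          * pd μ (fun p => (S.Ψ (toTriple p)).2.1) (ofTriple q)) := by
    have h2 := (((hasDerivAt_inv hne).comp_hasFDerivAt (ofTriple q) d1.hasFDerivAt).mul
      d2.hasFDerivAt).fderiv
    have h3 := DFunLike.congr_fun h2 (Pi.single μ 1)
    simp only [ContinuousLinearMap.add_apply, ContinuousLinearMap.smul_apply, smul_eq_mul,
      Function.comp_apply] at h3
    refine Eq.trans h3 ?_
    simp only [pd]
    ring
  simp only [e]
  field_simp

/-- The metrics of supertranslated Bondi–Sachs systems are related by pull-back. -/
theorem pulls {B B' : Coords}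
    (h : ∀ q ∈ S.D, IsFinite q → ∀ μ ν : Fin 4, B'.metric (ofTriple q) μ ν =
      ∑ a, ∑ b, pd μ (fun p => ofTriple (S.Ψ (toTriple p)) a) (ofTriple q) *
          pd ν (fun p => ofTriple (S.Ψ (toTriple p)) b) (ofTriple q) *
          B.metric (ofTriple (S.Ψ q)) a b) : S.Pulls B.fields B'.fields := by
  intro μ ν
  have hs : Near (S.pull rho) fun p => (S.Ψ (toTriple p)).2.1 :=
    Coords.near_coeff (S.comp_mem rho_mem)
  -- The Jacobian has denominators s²; multiplying both sides by s² turns the law into an identity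
  -- between ring elements.
  refine S.pull_rho_cancel (S.pull_rho_cancel ?_)
  have h1 := Near.sum (s := Finset.univ) fun a => Near.sum (s := Finset.univ) fun b =>
    ((S.near_jac μ a).mul (S.near_jac ν b)).mul (S.near_pull (B.repr_metric a b))
  rw [S.sum_jac] at h1
  have h2 := (hs.pow 4).mul (B'.repr_metric μ ν)
  have h3 := h1.eq h2 (S.nearFin_mem.mono fun q hq hD => by
    simp only [toTriple_ofTriple hq, h q hD hq μ ν, Finset.mul_sum]
    exact Finset.sum_congr rfl fun a _ => Finset.sum_congr rfl fun b _ => by ring)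
  linear_combination h3

theorem pull_xc_sub (i : Fin 3) : ∃ z, S.pull (xc i) = xc i + rho * z := by
  obtain ⟨z, hz⟩ := exists_eq_rho_mul (a := S.pull (xc i) - xc i) fun u x hx => by
    rw [map_sub, S.ev_pull, ev_xc, ev_xc, sub_self]
  exact ⟨z, by rw [← hz]; ring⟩

theorem pull_rho : ∃ σ, S.pull rho = rho * σ :=
  exists_eq_rho_mul fun u x hx => by rw [S.ev_pull, ev_rho]

theorem pull_uc_sub {fc : ScriRing} (hf : Val fc fun _ => f) : ∃ a, S.pull uc = uc + fc + rho * a := by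
  obtain ⟨z, hz⟩ := exists_eq_rho_mul (a := S.pull uc - (uc + fc)) fun u x hx => by
    rw [map_sub, S.ev_pull, map_add, ev_uc, ev_uc, hf u x hx, sub_self]
  exact ⟨z, by rw [← hz]; ring⟩

/-- Selects the root σ = 1 of σ² = 1 at null infinity. -/
theorem ev_nonneg {σ : ScriRing} (hσ : S.pull rho = rho * σ) (u : ℝ) (x : E3) (hx : ‖x‖ = 1) :
    0 ≤ ev u x hx σ := by
  have h1 := S.near_pull near_rho
  rw [hσ] at h1
  have h2 := near_rho.mul (near_rep σ)
  have h3 : NearFin fun q => 0 ≤ rep σ q := ((NearFin.and h1 h2).and S.nearFin_mem).mono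
    fun q hq e => by
    have hf := S.finite q e.2 hq
    have e1 := e.1.1.symm.trans e.1.2
    simp only [toTriple_ofTriple hq, toTriple_ofTriple hf] at e1
    have e2 : 0 < q.2.1 * rep σ q := e1 ▸ hf.1
    exact ((mul_pos_iff_of_pos_left hq.1).1 e2).le
  have h4 : Tendsto (fun ρ : ℝ => rep σ (u, ρ, x)) (𝓝[>] 0) (𝓝 (rep σ (u, 0, x))) := by
    have h5 : ContinuousAt (fun ρ : ℝ => rep σ (u, ρ, x)) 0 :=
      ContinuousAt.comp (g := rep σ) (f := fun ρ : ℝ => ((u, ρ, x) : Triple))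
        (rep_mem σ u x hx).continuousAt (by fun_prop)
    exact h5.tendsto.mono_left nhdsWithin_le_nhds
  have h6 : ev u x hx σ = rep σ (u, 0, x) := by
    rw [← ev_toRing (rep_mem σ) u x hx, toRing_rep]
  rw [h6]
  exact ge_of_tendsto h4 (h3.tendsto u x hx)

end ScriMap

theorem exists_val_of_sphereSmooth {f : E3 → ℝ} (hf : SphereSmooth f) :
    ∃ a, Val a (fun _ => f) ∧ dU a = 0 ∧ dR a = 0 := by
  have hm : (fun q : Triple => f (‖q.2.2‖⁻¹ • q.2.2)) ∈ scriSmooth := fun u x hx =>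
    ContDiffAt.comp (g := fun y : E3 => f (‖y‖⁻¹ • y)) (f := fun q : Triple => q.2.2) _
      (hf.contDiffAt (ne_zero_of_unit hx)) (by fun_prop)
  have h0 : (0 : ScriRing) = toRing (fun _ => 0) (const_mem 0) := rfl
  have h : ∀ e : Triple, e.2.2 = 0 → tanDer e (toRing _ hm) = 0 := fun e he => by
    rw [tanDer_toRing, h0, toRing_eq_iff]
    refine NearFin.of_scri fun u x hx => ?_
    have hc : ContinuousAt (fun q : Triple => q.2.2) (u, 0, x) := by fun_prop
    filter_upwards [hc.eventually (isOpen_ne.mem_nhds (ne_zero_of_unit hx))] with q hq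
    have h1 : HasFDerivAt (fun q : Triple => q.2.2) ((ContinuousLinearMap.snd ℝ ℝ E3).comp
        (ContinuousLinearMap.snd ℝ ℝ (ℝ × E3))) q :=
      ((ContinuousLinearMap.snd ℝ ℝ E3).comp (ContinuousLinearMap.snd ℝ ℝ (ℝ × E3))).hasFDerivAt
    have h2 := (HasFDerivAt.comp (g := fun y : E3 => f (‖y‖⁻¹ • y)) q
      (hf.differentiableAt hq).hasFDerivAt h1).fderiv
    have h3 := DFunLike.congr_fun h2 (tang e q)
    refine Eq.trans h3 ?_
    simp [tang, he]
  exact ⟨toRing _ hm, fun u x hx => by rw [ev_toRing]; simp [hx], h _ rfl, h _ rfl⟩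

end

/-! ### The supertranslation to first order in ρ. -/

section

theorem Val.dU_eq_zero {a : ScriRing} (h : Val a fun _ _ => 0) (u : ℝ) (x : E3) (hx : ‖x‖ = 1) :
    ev u x hx (BondiSachs.dU a) = 0 := by
  rw [h.dU u x hx]; exact deriv_const _ _

namespace ScriMap
variable {f : E3 → ℝ} (S : ScriMap f)

/-- Expansion of a supertranslation near null infinity. -/
structure Expansion where
  φ : ScriRing
  val_φ : Val φ fun _ => f
  dU_φ : dU φ = 0
  dR_φ : dR φ = 0
  a : ScriRing
  z : Fin 3 → ScriRing
  s : ScriRing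
  pull_uc : S.pull uc = uc + φ - rho * ((1 / 2 : ℝ) • ∑ i, dT i φ ^ 2) + rho ^ 2 * a
  pull_xc : ∀ i, S.pull (xc i) = xc i - rho * dT i φ + rho ^ 2 * z i
  pull_rho : S.pull rho = rho * (1 + rho * s)

variable {S} {B B' : Fields} {m m' : ℝ → E3 → ℝ} {C C' : ℝ → E3 → Fin 3 → Fin 3 → ℝ}
  {W2 W3 W2' W3' : ℝ → E3 → Fin 3 → ℝ} (X : B.Exp m C W2 W3) (X' : B'.Exp m' C' W2' W3')
  (hS : S.Pulls B B')
include X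

/-- The pulled-back x is still a unit vector, so x · dx = 0 and the round part of h reduces to the
Euclidean inner product; the shear remains as a perturbation of order ρ. -/
theorem form_eq (d e : Derivation ℝ ScriRing ScriRing) : S.form B d e =
    S.pull rho ^ 2 * S.pull B.φ * (d (S.pull uc) * e (S.pull uc))
    + S.pull B.U * (d (S.pull uc) * e (S.pull rho) + d (S.pull rho) * e (S.pull uc))
    + S.pull rho ^ 2 * ∑ i, S.pull (B.w i) *
      (d (S.pull uc) * e (S.pull (xc i)) + d (S.pull (xc i)) * e (S.pull uc))
    + ∑ i, d (S.pull (xc i)) * e (S.pull (xc i))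
    + S.pull rho * ∑ i, ∑ j, S.pull (X.c i j) * (d (S.pull (xc i)) * e (S.pull (xc j))) := by
  have h1 := S.sum_pull_xc_der d
  have h2 := S.sum_pull_xc_der e
  have h3 : ∀ i j, S.pull (B.h i j) = (if i = j then 1 else 0) - S.pull (xc i) * S.pull (xc j)
      + S.pull rho * S.pull (X.c i j) := fun i j => by
    rw [X.hh, Pr]; split_ifs <;> simp
  simp only [form, h3]
  simp only [Fin.sum_univ_three, Fin.isValue, Fin.reduceEq, if_true, if_false] at *
  linear_combination -(S.pull (xc 0) * e (S.pull (xc 0)) + S.pull (xc 1) * e (S.pull (xc 1))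
    + S.pull (xc 2) * e (S.pull (xc 2))) * h1

include hS X'

/-- At null infinity the angular components give σ = 1, the mixed radial–angular ones then give −∇f
for the angular displacement, and the radial one gives −½ |∇f|² for the retardation of time. -/
theorem exists_expansion (hf : SphereSmooth f) : Nonempty S.Expansion := by
  obtain ⟨φ, val_φ, dU_φ, dR_φ⟩ := exists_val_of_sphereSmooth hf
  obtain ⟨a, ha⟩ := S.pull_uc_sub val_φ
  choose z hz using S.pull_xc_sub
  obtain ⟨σ, hσ⟩ := S.pull_rho
  have hφ : ∀ i, Val (dT i φ) fun _ => tderiv i f := fun i => val_φ.dT i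
  have hzT : ∀ u x hx i k, ev u x hx (dT k (S.pull (xc i))) = roundMetric x k i := fun u x hx i k => by
    simp [hz, Derivation.leibniz, roundMetric, apply_ite]
  have hzR : ∀ u x hx i, ev u x hx (dR (S.pull (xc i))) = ev u x hx (z i) := fun u x hx i => by
    simp [hz, Derivation.leibniz]
  have haT : ∀ u x hx k, ev u x hx (dT k (S.pull uc)) = tderiv k f x := fun u x hx k => by
    simp [ha, Derivation.leibniz, hφ k u x hx]
  have haR : ∀ u x hx, ev u x hx (dR (S.pull uc)) = ev u x hx a := fun u x hx => by
    simp [ha, Derivation.leibniz, dR_φ]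
  have hσT : ∀ u x hx k, ev u x hx (dT k (S.pull rho)) = 0 := fun u x hx k => by
    simp [hσ, Derivation.leibniz]
  have hσR : ∀ u x hx, ev u x hx (dR (S.pull rho)) = ev u x hx σ := fun u x hx => by
    simp [hσ, Derivation.leibniz]
  have hU : ∀ u x hx, ev u x hx (S.pull B.U) = 1 := fun u x hx => by rw [ev_pull, X.val_U _ x hx]
  have h0 : ∀ u x hx, ev u x hx (S.pull rho) = 0 := fun u x hx => by rw [ev_pull, ev_rho]
  -- The trace of σ² P = P over the tangent plane gives 2σ² = 2, and the sign comes from σ ≥ 0.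
  have hσ1 : ∀ u x hx, ev u x hx σ = 1 := fun u x hx => by
    have h : ∀ k, ev u x hx σ ^ 2 * roundMetric x k k = roundMetric x k k := fun k => by
      have h1 := congrArg (ev u x hx) (form_dT_dT hS hσ k k)
      rw [form_eq X] at h1
      simp only [map_add, map_mul, map_sum, map_pow, h0, haT, hσT, hzT, X'.val_h _ _ u x hx] at h1
      have h2 : ∑ i, roundMetric x k i * roundMetric x k i = roundMetric x k k :=
        roundMetric_mul (v := fun i => roundMetric x k i) (by
          rw [← roundMetric_x hx k]; exact Finset.sum_congr rfl fun i _ => mul_comm _ _) k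
      rw [h2] at h1
      linarith
    have h2 := h 0
    have h3 := h 1
    have h4 := h 2
    have h5 := sum_x_sq hx
    simp only [roundMetric, if_true] at h2 h3 h4
    have h6 : ev u x hx σ ^ 2 = 1 := by nlinarith
    have h7 := S.ev_nonneg hσ u x hx
    nlinarith
  have hz1 : ∀ u x hx k, ev u x hx (z k) = -tderiv k f x := fun u x hx k => by
    have h1 := congrArg (ev u x hx) (form_dR_dT hS hσ k)
    rw [form_eq X] at h1
    simp only [map_add, map_mul, map_sum, map_pow, h0, haT, haR, hσT, hσR, hzT, hzR, hU, hσ1,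
      map_zero] at h1
    have h2 : ∑ i, x i * ev u x hx (z i) = 0 := by
      have h3 := congrArg (ev u x hx) (S.sum_pull_xc_der dR)
      simpa [hzR, ev_pull] using h3
    have h3 := roundMetric_mul (x := x) (v := fun i => ev u x hx (z i)) h2 k
    have h4 : ∑ i, ev u x hx (z i) * roundMetric x k i = ev u x hx (z k) := by
      rw [← h3]; exact Finset.sum_congr rfl fun i _ => mul_comm _ _
    rw [h4] at h1
    linarith
  have ha1 : ∀ u x hx, ev u x hx a = -(1 / 2) * ∑ i, tderiv i f x ^ 2 := fun u x hx => by
    have h1 := congrArg (ev u x hx) (form_dR_dR hS hσ)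
    rw [form_eq X] at h1
    simp only [map_add, map_mul, map_sum, map_pow, h0, haT, haR, hσT, hσR, hzT, hzR, hU, hσ1, hz1,
      map_zero] at h1
    simp only [Fin.sum_univ_three] at h1 ⊢
    linarith
  have e1 : ∀ k, ∃ z2, z k = -dT k φ + rho * z2 := fun k => by
    obtain ⟨b, hb⟩ := exists_eq_rho_mul (a := z k + dT k φ) fun u x hx => by
      rw [map_add, hz1, hφ k u x hx]; ring
    exact ⟨b, by rw [← hb]; ring⟩
  choose z2 hz2 using e1
  obtain ⟨a2, ha2⟩ := exists_eq_rho_mul (a := a + (1 / 2 : ℝ) • ∑ i, dT i φ ^ 2) fun u x hx => by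
    simp only [map_add, ha1, ev_smul, map_sum, map_pow, hφ _ u x hx]; ring
  obtain ⟨s, hs⟩ := exists_eq_rho_mul (a := σ - 1) fun u x hx => by
    rw [map_sub, hσ1, map_one, sub_self]
  refine ⟨⟨φ, val_φ, dU_φ, dR_φ, a2, z2, s, ?_, fun i => ?_, ?_⟩⟩
  · rw [ha]; linear_combination rho * ha2
  · rw [hz, hz2]; ring
  · rw [hσ]; linear_combination rho * hs

end ScriMap

end

/-! ### Transformation of the shear. -/

section

theorem ev_dR_mul (a b : ScriRing) (u : ℝ) (x : E3) (hx : ‖x‖ = 1) :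
    ev u x hx (dR (a * b)) = ev u x hx a * ev u x hx (dR b) + ev u x hx b * ev u x hx (dR a) := by
  simp [Derivation.leibniz]

theorem ev_dR_sq (a : ScriRing) (u : ℝ) (x : E3) (hx : ‖x‖ = 1) :
    ev u x hx (dR (a ^ 2)) = 2 * (ev u x hx a * ev u x hx (dR a)) := by
  rw [pow_two, ev_dR_mul]; ring

namespace ScriMap
variable {f : E3 → ℝ} {S : ScriMap f}

namespace Expansion
variable (T : S.Expansion)

theorem val_dφ (i : Fin 3) : Val (dT i T.φ) fun _ => tderiv i f := T.val_φ.dT i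

theorem dU_dφ (i : Fin 3) : dU (dT i T.φ) = 0 := by rw [dU_dT, T.dU_φ, map_zero]

theorem dR_dφ (i : Fin 3) : dR (dT i T.φ) = 0 := by rw [dR_dT, T.dR_φ, map_zero]

variable (u : ℝ) (x : E3) (hx : ‖x‖ = 1)
include T

theorem ev_pull_rho : ev u x hx (S.pull rho) = 0 := by rw [ev_pull, ev_rho]

theorem ev_dT_rho (k : Fin 3) : ev u x hx (dT k (S.pull rho)) = 0 := by
  rw [T.pull_rho]; simp [Derivation.leibniz]

theorem ev_dR_dT_rho (k : Fin 3) : ev u x hx (dR (dT k (S.pull rho))) = 0 := by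
  rw [T.pull_rho]; simp [Derivation.leibniz]

theorem ev_dR_rho : ev u x hx (dR (S.pull rho)) = 1 := by
  rw [T.pull_rho]; simp [Derivation.leibniz]

theorem ev_dT_xc (i k : Fin 3) : ev u x hx (dT k (S.pull (xc i))) = roundMetric x k i := by
  rw [T.pull_xc]
  simp [Derivation.leibniz, roundMetric, apply_ite]

theorem ev_dR_dT_xc (i k : Fin 3) :
    ev u x hx (dR (dT k (S.pull (xc i)))) = -tderiv k (tderiv i f) x := by
  have h := (T.val_dφ i).dT k u x hx
  have h1 : dR (if k = i then 1 else 0 : ScriRing) = 0 := by split_ifs <;> simp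
  rw [T.pull_xc]
  simp [Derivation.leibniz, dR_dT, h, h1, dT_xc, T.dR_φ]

end Expansion

variable {B B' : Fields} {m m' : ℝ → E3 → ℝ} {C C' : ℝ → E3 → Fin 3 → Fin 3 → ℝ}
  {W2 W3 W2' W3' : ℝ → E3 → Fin 3 → ℝ}

namespace Expansion
variable (T : S.Expansion) (X : B.Exp m C W2 W3) (X' : B'.Exp m' C' W2' W3') (hS : S.Pulls B B')
  (hf : SphereSmooth f)
include X X' hS hf T

/-- The ρ coefficient of the angular transformation law. The two Hessians come from differentiating
the angular displacement −ρ∇f in either slot; the correction to the radius is still unknown here. -/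
theorem shear_aux (u : ℝ) {x : E3} (hx : ‖x‖ = 1) (k l : Fin 3) :
    C' u x k l + 2 * ev u x hx T.s * roundMetric x k l = C (u + f x) x k l - 2 * hess f x k l := by
  have hσ : S.pull rho = rho * (1 + rho * T.s) := T.pull_rho
  have h := congrArg (fun a => ev u x hx (dR a)) (form_dT_dT hS hσ k l)
  have hP : ∀ i j, Val (S.pull (X.c i j)) fun u x => C (u + f x) x i j := fun i j u x hx => by
    rw [S.ev_pull, X.val_c i j _ x hx]
  rw [form_eq X, X'.hh] at h
  simp only [map_add, map_sum, ev_dR_mul, ev_dR_sq, T.ev_pull_rho u x hx, T.ev_dT_rho u x hx,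
    T.ev_dR_dT_rho u x hx, T.ev_dT_xc u x hx, T.ev_dR_dT_xc u x hx, T.ev_dR_rho u x hx,
    hP _ _ u x hx, X'.val_c _ _ u x hx, dR_Pr, ev_Pr, ev_rho, map_one, map_mul, dR_rho, map_zero,
    Derivation.map_one_eq_zero, map_pow] at h
  have e1 : ∀ i j, ∑ b, roundMetric x i b * tderiv j (tderiv b f) x = hess f x j i :=
    fun i j => rfl
  have e2 : ∑ i, ∑ j, C (u + f x) x i j * (roundMetric x k i * roundMetric x l j)
      = C (u + f x) x k l := by
    have h1 : ∀ i, ∑ j, C (u + f x) x i j * (roundMetric x k i * roundMetric x l j)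
        = roundMetric x k i * C (u + f x) x i l := fun i => by
      rw [← X.C_symm _ hx, ← X.P_C (u + f x) hx l i, Finset.mul_sum]
      exact Finset.sum_congr rfl fun j _ => by rw [X.C_symm _ hx j i]; ring
    simp only [h1]
    exact X.P_C _ hx k l
  have e3 := hess_symm hf hx k l
  have e4 := e1 k l
  have e5 := e1 l k
  rw [← e2, e3]
  rw [e3] at e5
  simp only [Fin.sum_univ_three] at h e4 e5 ⊢
  linear_combination -h - e4 - e5

/-- Both shears are trace-free, so the trace of `shear_aux` determines the correction to the radius.
-/
theorem ev_s (u : ℝ) {x : E3} (hx : ‖x‖ = 1) : ev u x hx T.s = -(1 / 2) * lap f x := by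
  have h : ∀ k, C' u x k k + 2 * ev u x hx T.s * roundMetric x k k
      = C (u + f x) x k k - 2 * hess f x k k := fun k => T.shear_aux X X' hS hf u hx k k
  have h0 := h 0
  have h1 := h 1
  have h2 := h 2
  have h3 := X.C_trace (u + f x) hx
  have h4 := X'.C_trace u hx
  have h5 := trace_roundMetric hx
  have h6 : lap f x = hess f x 0 0 + hess f x 1 1 + hess f x 2 2 := Fin.sum_univ_three _
  rw [Fin.sum_univ_three] at h3 h4 h5
  rw [h6]
  linear_combination 1 / 4 * (h0 + h1 + h2 + h3 - h4) - 1 / 2 * ev u x hx T.s * h5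

/-- The transformation of the shear under a supertranslation. -/
theorem shear_eq (u : ℝ) {x : E3} (hx : ‖x‖ = 1) (k l : Fin 3) :
    C' u x k l = C (u + f x) x k l - 2 * hess f x k l + roundMetric x k l * lap f x := by
  have h := T.shear_aux X X' hS hf u hx k l
  rw [T.ev_s X X' hS hf u hx] at h
  linear_combination h

end Expansion

end ScriMap

end

/-! ### Transformation of the mass aspect. -/

section

theorem ScriFun.differentiableAt {v : ℝ → E3 → ℝ} (h : ScriFun v) {x : E3} (hx : ‖x‖ = 1) {u : ℝ} :
    DifferentiableAt ℝ (fun s => v s x) u := by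
  have h0 : x ≠ 0 := by rintro rfl; simp at hx
  have h1 := ((h u x h0).differentiableAt (by simp)).comp u
    (f := fun s : ℝ => (s, x)) (by fun_prop)
  refine h1.congr_of_eventuallyEq (Eventually.of_forall fun s => ?_)
  simp [hx]

theorem Fields.Exp.trace_news {B : Fields} {m : ℝ → E3 → ℝ} {C : ℝ → E3 → Fin 3 → Fin 3 → ℝ}
    {W2 W3 : ℝ → E3 → Fin 3 → ℝ} (X : B.Exp m C W2 W3) (u : ℝ) {x : E3} (hx : ‖x‖ = 1) :
    ∑ i, deriv (fun v => C v x i i) u = 0 := by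
  rw [← deriv_fun_sum fun i _ => (X.val_c i i).scriFun.differentiableAt hx,
    funext fun v => X.C_trace v hx]
  simp

namespace ScriMap
variable {f : E3 → ℝ} {S : ScriMap f}
variable {B B' : Fields} {m m' : ℝ → E3 → ℝ} {C C' : ℝ → E3 → Fin 3 → Fin 3 → ℝ}
  {W2 W3 W2' W3' : ℝ → E3 → Fin 3 → ℝ}

theorem val_pull {a : ScriRing} {v : ℝ → E3 → ℝ} (h : Val a v) :
    Val (S.pull a) fun u x => v (u + f x) x := fun u x hx => by rw [S.ev_pull, h _ x hx]

namespace Expansion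
variable (T : S.Expansion) (X : B.Exp m C W2 W3) (X' : B'.Exp m' C' W2' W3') (hS : S.Pulls B B')
  (hf : SphereSmooth f)
include X X' hS hf T

/-- The expansion of the radius to second order. -/
theorem exists_second_order : ∃ L s : ScriRing, dU L = 0 ∧ dR L = 0 ∧
    S.pull rho = rho * (1 + rho * (L + rho * s)) := by
  obtain ⟨l, hl, hU, hR⟩ := exists_val_of_sphereSmooth hf.lap
  obtain ⟨s, hs⟩ := exists_eq_rho_mul (a := T.s + (1 / 2 : ℝ) • l) fun u x hx => by
    rw [map_add, ev_smul, T.ev_s X X' hS hf u hx, hl u x hx]; ring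
  refine ⟨-((1 / 2 : ℝ) • l), s, by simp [Derivation.map_smul, hU], by simp [Derivation.map_smul, hR], ?_⟩
  rw [T.pull_rho]
  linear_combination rho ^ 2 * hs

/-- The transformation of the mass aspect under a supertranslation. -/
theorem mass_eq (u : ℝ) {x : E3} (hx : ‖x‖ = 1) :
    m' u x = m (u + f x) x + ∑ i, deriv (fun v => W2 v x i) (u + f x) * tderiv i f x
      + 1 / 4 * ∑ i, ∑ j, deriv (fun v => deriv (fun s => C s x i j) v) (u + f x)
        * (tderiv i f x * tderiv j f x)
      + 1 / 4 * ∑ i, ∑ j, deriv (fun v => C v x i j) (u + f x) * hess f x i j := by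
  obtain ⟨L, s, hLU, hLR, hs⟩ := T.exists_second_order X X' hS hf
  have d2 : dR (2 : ScriRing) = 0 := by simpa using Derivation.map_natCast dR 2
  obtain ⟨q, hq⟩ : ∃ q, q = (1 / 2 : ℝ) • ∑ i, dT i T.φ ^ 2 := ⟨_, rfl⟩
  have hq2 : ∑ i, dT i T.φ ^ 2 = 2 * q := by
    rw [hq, mul_smul_comm, ← smul_mul_assoc,
      show (1 / 2 : ℝ) • (2 : ScriRing) = 1 by
        rw [Algebra.smul_def, ← map_ofNat (algebraMap ℝ ScriRing) 2, ← map_mul]; norm_num, one_mul]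
  have hqU : dU q = 0 := by
    rw [hq, Derivation.map_smul, map_sum, Finset.sum_eq_zero, smul_zero]
    intro i _; rw [Derivation.leibniz_pow, T.dU_dφ]; simp
  have hqR : dR q = 0 := by
    rw [hq, Derivation.map_smul, map_sum, Finset.sum_eq_zero, smul_zero]
    intro i _; rw [Derivation.leibniz_pow, T.dR_dφ]; simp
  have ha := T.pull_uc
  rw [← hq] at ha
  have aU : dU (S.pull uc) = 1 + rho ^ 2 * dU T.a := by
    rw [ha]; simp [Derivation.leibniz, T.dU_φ, hqU]
  have aR : dR (S.pull uc) = -q + 2 * rho * T.a + rho ^ 2 * dR T.a := by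
    rw [ha]; simp [Derivation.leibniz, T.dR_φ, hqR]; ring
  have zU : ∀ i, dU (S.pull (xc i)) = rho ^ 2 * dU (T.z i) := fun i => by
    rw [T.pull_xc]; simp [Derivation.leibniz, T.dU_dφ]
  have zR : ∀ i, dR (S.pull (xc i)) = -dT i T.φ + 2 * rho * T.z i + rho ^ 2 * dR (T.z i) := fun i => by
    rw [T.pull_xc]; simp [Derivation.leibniz, T.dR_dφ]; ring
  have sU : dU (S.pull rho) = rho ^ 3 * dU s := by
    rw [hs]; simp [Derivation.leibniz, hLU]; ring
  have sR : dR (S.pull rho) = 1 + 2 * rho * L + 3 * rho ^ 2 * s + rho ^ 3 * dR s := by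
    rw [hs]; simp [Derivation.leibniz, hLR]; ring
  have hU : S.pull B.U = 1 + S.pull rho ^ 2 * S.pull X.u2 := by rw [X.hU]; simp
  have hφ : S.pull B.φ = -1 + S.pull rho * S.pull X.φ1 := by rw [X.φ_eq]; simp
  obtain ⟨σ, hσ⟩ : ∃ σ, σ = 1 + rho * (L + rho * s) := ⟨_, rfl⟩
  rw [← hσ] at hs
  have hp : ∀ i, Val (dT i T.φ) fun _ => tderiv i f := fun i => T.val_dφ i
  have vc : ∀ i j, Val (S.pull (X.c i j)) fun u x => C (u + f x) x i j := fun i j =>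
    val_pull (X.val_c i j)
  have vw : ∀ i, Val (S.pull (B.w i)) fun u x => W2 (u + f x) x i := fun i => val_pull (X.val_w i)
  have vu := val_pull (S := S) X.val_u2
  -- the radial component determines the second-order change of time
  have h1 : Val (4 * T.a - 4 * q * L - 4 * ∑ i, dT i T.φ * T.z i
      + ∑ i, ∑ j, S.pull (X.c i j) * (dT i T.φ * dT j T.φ)) fun _ _ => 0 := fun u x hx => by
    have h := congrArg (fun a => ev u x hx (dR a)) (form_dR_dR hS hs)
    have v1 : ev u x hx (dR (dR (S.pull uc))) = 2 * ev u x hx T.a := by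
      rw [aR]; simp [Derivation.leibniz, hqR, map_ofNat]; ring
    have v2 : ev u x hx (dR (dR (S.pull rho))) = 2 * ev u x hx L := by
      rw [sR]; simp [Derivation.leibniz, d2, map_ofNat]; ring
    have v3 : ∀ i, ev u x hx (dR (dR (S.pull (xc i)))) = 2 * ev u x hx (T.z i) := fun i => by
      rw [zR]; simp only [map_add, map_neg, T.dR_dφ, ev_dR_mul, ev_dR_sq, map_mul, map_pow, ev_rho, d2, dR_rho, map_one, map_ofNat, map_zero]; ring
    have v4 : ev u x hx (dR (S.pull uc)) = -ev u x hx q := by rw [aR]; simp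
    have v5 : ∀ i, ev u x hx (dR (S.pull (xc i))) = -tderiv i f x := fun i => by
      rw [zR]; simp [hp i u x hx]
    have v6 : ev u x hx (dR (S.pull B.U)) = 0 := by
      rw [hU, hs]; simp [Derivation.leibniz]
    have v7 : ev u x hx (S.pull B.U) = 1 := by rw [ev_pull, X.val_U _ x hx]
    rw [form_eq X] at h
    simp only [map_add, map_sum, ev_dR_mul, ev_dR_sq, T.ev_pull_rho u x hx, T.ev_dR_rho u x hx,
      v1, v2, v3, v4, v5, v6, v7, vc _ _ u x hx, map_zero, map_pow, map_mul] at h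
    simp only [map_add, map_sub, map_mul, map_sum, map_ofNat, hp _ u x hx, vc _ _ u x hx]
    simp only [Fin.sum_univ_three] at h ⊢
    linear_combination h
  -- The ρ² coefficient of the mixed time–radial component; it expresses the ρ³ coefficient s of the
  -- pulled-back radius.
  have h2 : Val (s - L ^ 2 - X'.u2 + S.pull X.u2 + q + dU T.a - ∑ i, S.pull (B.w i) * dT i T.φ
      - ∑ i, dU (T.z i) * dT i T.φ) fun _ _ => 0 := fun u x hx => by
    have h := form_dU_dR hS hs
    rw [form_eq X, hU, hφ, aR, sR, aU, sU, X'.hU, hs] at h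
    simp only [zU] at h
    have h3 : σ ^ 2 * (-1 + rho * σ * S.pull X.φ1) * ((1 + rho ^ 2 * dU T.a)
          * (-q + 2 * rho * T.a + rho ^ 2 * dR T.a))
        + (dU T.a * (1 + 2 * rho * L + 3 * rho ^ 2 * s + rho ^ 3 * dR s) + s + rho * dR s
          - (L + rho * s) ^ 2)
        + σ ^ 2 * S.pull X.u2 * ((1 + rho ^ 2 * dU T.a)
          * (1 + 2 * rho * L + 3 * rho ^ 2 * s + rho ^ 3 * dR s))
        + (1 + (rho * σ) ^ 2 * S.pull X.u2) * (rho * dU s * (-q + 2 * rho * T.a + rho ^ 2 * dR T.a))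
        + σ ^ 2 * ∑ i, S.pull (B.w i) * ((1 + rho ^ 2 * dU T.a) * dR (S.pull (xc i))
          + rho ^ 2 * dU (T.z i) * (-q + 2 * rho * T.a + rho ^ 2 * dR T.a))
        + ∑ i, dU (T.z i) * dR (S.pull (xc i))
        + rho * σ * ∑ i, ∑ j, S.pull (X.c i j) * (dU (T.z i) * dR (S.pull (xc j)))
        - σ ^ 2 * X'.u2 = 0 := by
      refine rho_pow_mul_cancel 2 ?_
      simp only [Fin.sum_univ_three] at h ⊢
      linear_combination h + (σ + 1 + rho * (L + rho * s)) * hσ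
    have h4 := congrArg (ev u x hx) h3
    have v5 : ∀ i, ev u x hx (dR (S.pull (xc i))) = -tderiv i f x := fun i => by
      rw [zR]; simp [hp i u x hx]
    simp only [hσ, map_add, map_sub, map_mul, map_sum, map_neg, map_one, map_pow, map_ofNat, ev_rho,
      hp _ u x hx, v5] at h4 ⊢
    simp only [Fin.sum_univ_three, map_zero] at h4 ⊢
    linear_combination h4
  -- The ρ³ coefficient of the time–time component: the mass changes by ∂_u s, so s is needed only
  -- through its time derivative.
  have h3 : Val (X'.φ1 - S.pull X.φ1 - 2 * dU s) fun _ _ => 0 := fun u x hx => by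
    have h := form_dU_dU hS hs
    rw [form_eq X, hU, hφ, aU, sU, X'.φ_eq, hs] at h
    simp only [zU] at h
    have h4 : -(σ ^ 2 * rho * dU T.a * (2 + rho ^ 2 * dU T.a))
        + σ ^ 3 * S.pull X.φ1 * (1 + rho ^ 2 * dU T.a) ^ 2
        + 2 * (1 + (rho * σ) ^ 2 * S.pull X.u2) * (1 + rho ^ 2 * dU T.a) * dU s
        + rho * σ ^ 2 * ∑ i, S.pull (B.w i) * (2 * (1 + rho ^ 2 * dU T.a) * dU (T.z i))
        + rho * ∑ i, dU (T.z i) * dU (T.z i)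
        + rho ^ 2 * σ * ∑ i, ∑ j, S.pull (X.c i j) * (dU (T.z i) * dU (T.z j))
        - σ ^ 2 * X'.φ1 = 0 := by
      refine rho_pow_mul_cancel 3 ?_
      simp only [Fin.sum_univ_three] at h ⊢
      linear_combination h
    have h5 := congrArg (ev u x hx) h4
    simp only [hσ, map_add, map_sub, map_mul, map_neg, map_one, map_pow, map_ofNat, ev_rho] at h5 ⊢
    rw [map_zero] at h5
    linear_combination -h5
  -- Two time derivatives of `h1` and one of `h2`: the second-order displacements `T.a` and `T.z`
  -- are unknown, but they cancel in the final combination.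
  have e1 := Val.dU_eq_zero (a := dU _) (fun u x hx => Val.dU_eq_zero h1 u x hx) u x hx
  have e2 := Val.dU_eq_zero h2 u x hx
  have e3 := h3 u x hx
  have pU := T.dU_dφ
  have dU4 : dU (4 : ScriRing) = 0 := by simpa using Derivation.map_natCast dU 4
  simp only [map_add, map_sub, map_sum, Derivation.leibniz, Derivation.leibniz_pow, smul_eq_mul, map_mul, pU, hqU, hLU,
    dU4, map_zero, mul_zero, add_zero, zero_add, map_ofNat, hp _ u x hx, (vw _).dU u x hx, vu.dU u x hx,
    ((vc _ _).dU).dU u x hx, X'.val_u2.dU u x hx, X'.val_φ1 u x hx, val_pull X.val_φ1 u x hx,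
    smul_zero, sub_zero] at e1 e2 e3
  have hC : ∀ i j v, HasDerivAt (fun v => C v x i j) (deriv (fun v => C v x i j) v) v := fun i j v =>
    ((X.val_c i j).scriFun.differentiableAt hx).hasDerivAt
  have hC1 : ∀ i j v, HasDerivAt (fun v => C (v + f x) x i j)
      (deriv (fun v => C v x i j) (v + f x)) v := fun i j v => (hC i j (v + f x)).comp_add_const v (f x)
  have hC2 : ∀ i j, deriv (fun s => deriv (fun s => C (s + f x) x i j) s) u
      = deriv (fun v => deriv (fun s => C s x i j) v) (u + f x) := fun i j => by
    rw [funext fun s => (hC1 i j s).deriv]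
    exact deriv_comp_add_const (fun v => deriv (fun s => C s x i j) v) (f x) u
  have hW : ∀ i, deriv (fun s => W2 (s + f x) x i) u = deriv (fun v => W2 v x i) (u + f x) := fun i =>
    deriv_comp_add_const (fun v => W2 v x i) (f x) u
  have hC' : ∀ i j, HasDerivAt (fun v => C' v x i j) (deriv (fun v => C v x i j) (u + f x)) u :=
    fun i j => by
    refine (((hC1 i j u).sub_const (2 * hess f x i j)).add_const (roundMetric x i j * lap f x)).congr_of_eventuallyEq
      (Eventually.of_forall fun v => T.shear_eq X X' hS hf v hx i j)
  have hd : ∀ {D : ℝ → Fin 3 → Fin 3 → ℝ} {N : Fin 3 → Fin 3 → ℝ},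
      (∀ i j, HasDerivAt (fun v => D v i j) (N i j) u) →
      deriv (fun s => -(1 / 16) * ∑ i, ∑ j, D s i j * D s i j) u
        = -(1 / 8) * ∑ i, ∑ j, D u i j * N i j := fun {D N} h => by
    have h1 := (HasDerivAt.fun_sum (u := Finset.univ) fun i _ =>
      HasDerivAt.fun_sum (u := Finset.univ) fun j _ => (h i j).mul (h i j)).const_mul (-(1 / 16) : ℝ)
    refine h1.deriv.trans ?_
    simp only [Fin.sum_univ_three]
    ring
  rw [hd hC', hd fun i j => hC1 i j u] at e2
  simp only [hC2, hW] at e1 e2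
  have hN : ∑ i, ∑ j, roundMetric x i j * deriv (fun v => C v x i j) (u + f x) = 0 := by
    have h0 := X.trace_news (u + f x) hx
    have h1 := X.P_news (u + f x) hx
    have h2 : ∀ i, ∑ j, roundMetric x i j * deriv (fun v => C v x i j) (u + f x)
        = deriv (fun v => C v x i i) (u + f x) := fun i => by
      rw [← h1 i i]
      refine Finset.sum_congr rfl fun j _ => ?_
      congr 2; funext v; exact X.C_symm v hx i j
    simp only [h2, h0]
  have hs' : ∀ i j, C' u x i j = _ := fun i j => T.shear_eq X X' hS hf u hx i j
  simp only [hs'] at e2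
  simp only [Fin.sum_univ_three] at e1 e2 hN ⊢
  linear_combination 1 / 2 * e3 + e2 - 1 / 4 * e1 - 1 / 8 * lap f x * hN

end Expansion

end ScriMap

end

/-! ### Lie derivatives along rotations and their action on closed potentials. -/

section

/-- The derivative of `φ` along the rotation field `A x`. -/
def rotD (A : Fin 3 → Fin 3 → ℝ) (φ : E3 → ℝ) (x : E3) : ℝ := ∑ k, rotVec A x k * tderiv k φ x

/-- The Lie derivative of a tangential two-tensor along the rotation field `A x`. -/
def lieT (A : Fin 3 → Fin 3 → ℝ) (T : E3 → Fin 3 → Fin 3 → ℝ) (x : E3) (i j : Fin 3) : ℝ :=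
  rotD A (fun z => T z i j) x + ∑ k, A k i * T x k j + ∑ k, A k j * T x i k

section
variable {A : Fin 3 → Fin 3 → ℝ} {φ ψ : E3 → ℝ} {x : E3}

@[fun_prop]
theorem sphereSmooth_rotVec (A : Fin 3 → Fin 3 → ℝ) (j : Fin 3) : SphereSmooth fun x => rotVec A x j := by
  unfold rotVec; fun_prop

@[fun_prop]
theorem SphereSmooth.rotD (h : SphereSmooth φ) : SphereSmooth fun x => BondiSachs.rotD A φ x := by
  unfold BondiSachs.rotD; fun_prop

theorem rotD_congr (e : ∀ x : E3, ‖x‖ = 1 → φ x = ψ x) (hx : ‖x‖ = 1) : rotD A φ x = rotD A ψ x := by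
  simp only [rotD, tderiv_congr e _ hx]

theorem rotD_add (h : SphereSmooth φ) (h' : SphereSmooth ψ) (hx : ‖x‖ = 1) :
    rotD A (fun z => φ z + ψ z) x = rotD A φ x + rotD A ψ x := by
  simp only [rotD, tderiv_add _ h h' hx, mul_add, Finset.sum_add_distrib]

theorem rotD_mul (h : SphereSmooth φ) (h' : SphereSmooth ψ) (hx : ‖x‖ = 1) :
    rotD A (fun z => φ z * ψ z) x = φ x * rotD A ψ x + ψ x * rotD A φ x := by
  simp only [rotD, tderiv_mul _ h h' hx, Fin.sum_univ_three]; ring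

theorem rotD_const_mul (a : ℝ) (h : SphereSmooth φ) (hx : ‖x‖ = 1) :
    rotD A (fun z => a * φ z) x = a * rotD A φ x := by
  simp only [rotD, tderiv_const_mul _ a h hx, Fin.sum_univ_three]; ring

theorem rotD_sum {ι : Type*} {s : Finset ι} {φ : ι → E3 → ℝ} (h : ∀ k, SphereSmooth (φ k)) (hx : ‖x‖ = 1) :
    rotD A (fun z => ∑ k ∈ s, φ k z) x = ∑ k ∈ s, rotD A (φ k) x := by
  simp only [rotD, tderiv_sum _ h hx, Fin.sum_univ_three, Finset.mul_sum, Finset.sum_add_distrib]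

theorem tderiv_rotVec (A : Fin 3 → Fin 3 → ℝ) (hx : ‖x‖ = 1) (i k : Fin 3) :
    tderiv i (fun z => rotVec A z k) x = A k i - x i * rotVec A x k := by
  unfold rotVec
  rw [tderiv_sum i (fun l => by fun_prop) hx]
  simp only [tderiv_const_mul i _ (sphereSmooth_coord _) hx, tderiv_coord i _ hx, roundMetric,
    Fin.sum_univ_three]
  fin_cases i <;> simp <;> ring

theorem rotD_coord (hA : ∀ i j, A i j = -A j i) (hx : ‖x‖ = 1) (i : Fin 3) :
    rotD A (fun z => z i) x = rotVec A x i := by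
  have h := rotVec_x hA x
  rw [← roundMetric_mul (x := x) (v := rotVec A x) (by rw [← h]; simp only [mul_comm]) i]
  simp only [rotD, tderiv_coord _ i hx, roundMetric_symm x _ i, mul_comm]

/-- Rotations act linearly on Cartesian components, so the commutator of Y with a tangential
derivative is the constant matrix A. -/
theorem tderiv_rotD (hA : ∀ i j, A i j = -A j i) (h : SphereSmooth φ) (hx : ‖x‖ = 1) (i : Fin 3) :
    tderiv i (rotD A φ) x = rotD A (tderiv i φ) x + ∑ k, A k i * tderiv k φ x := by
  have h1 := rotVec_x hA x
  have h2 : ∀ k, tderiv i (tderiv k φ) x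
      = tderiv k (tderiv i φ) x + (x i * tderiv k φ x - x k * tderiv i φ x) := fun k => by
    linarith [tderiv_comm h hx i k]
  have h3 : tderiv i (rotD A φ) x = _ := tderiv_sum i (s := Finset.univ)
    (φ := fun k z => rotVec A z k * tderiv k φ z) (fun k => by fun_prop) hx
  rw [h3]
  simp only [tderiv_mul i (sphereSmooth_rotVec A _) (h.tderiv _) hx, h2, tderiv_rotVec A hx, rotD,
    Fin.sum_univ_three] at h1 ⊢
  linear_combination -(tderiv i φ x) * h1

/-- Infinitesimal invariance of the area measure: the antisymmetry of A makes Y tangential and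
divergence-free. -/
theorem sphereIntegral_rotD (hA : ∀ i j, A i j = -A j i) (h : SphereSmooth φ) :
    sphereIntegral (fun x => rotD A φ x) = 0 := by
  unfold rotD
  rw [sphereIntegral_sum fun k => by fun_prop]
  simp only [sphereIntegral_mul_tderiv (sphereSmooth_rotVec A _) h]
  rw [Finset.sum_sub_distrib, ← Finset.mul_sum, ← sphereIntegral_sum fun k => by fun_prop,
    ← sphereIntegral_sum fun k => by fun_prop, ← sphereIntegral_const_mul,
    ← sphereIntegral_sub (by fun_prop) (by fun_prop),
    sphereIntegral_congr (ψ := fun _ => 0 * 0) fun x hx => ?_, sphereIntegral_const_mul, zero_mul]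
  have h1 := rotVec_x hA x
  have e : ∀ i, A i i = 0 := fun i => by linarith [hA i i]
  simp only [tderiv_rotVec A hx, e, Fin.sum_univ_three] at h1 ⊢
  linear_combination 3 * φ x * h1

theorem sphereIntegral_mul_rotD (hA : ∀ i j, A i j = -A j i) (h : SphereSmooth φ) (h' : SphereSmooth ψ) :
    sphereIntegral (fun x => φ x * rotD A ψ x) = -sphereIntegral fun x => ψ x * rotD A φ x := by
  have h1 := sphereIntegral_rotD hA (h.mul h')
  rw [sphereIntegral_congr fun x hx => rotD_mul h h' hx,
    sphereIntegral_add (by fun_prop) (by fun_prop)] at h1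
  linarith

/-- The derivative Y can be moved onto the test functions, and it maps the span of the coordinate
functions to itself. -/
theorem HighModes.rotD (hA : ∀ i j, A i j = -A j i) (h : SphereSmooth φ) (h1 : HighModes φ) :
    HighModes (rotD A φ) := by
  refine ⟨sphereIntegral_rotD hA h, fun i => ?_⟩
  rw [sphereIntegral_congr fun x _ => mul_comm _ _,
    sphereIntegral_mul_rotD hA (sphereSmooth_coord i) h,
    sphereIntegral_congr (ψ := fun x => ∑ l, A i l * (φ x * x l)) fun x hx => ?_,
    sphereIntegral_sum fun k => by fun_prop]
  · simp [sphereIntegral_const_mul, h1.2]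
  · rw [rotD_coord hA hx, rotVec, Finset.mul_sum]
    exact Finset.sum_congr rfl fun l _ => by ring

theorem lieT_congr {T T' : E3 → Fin 3 → Fin 3 → ℝ} (e : ∀ x : E3, ‖x‖ = 1 → ∀ i j, T x i j = T' x i j)
    (hx : ‖x‖ = 1) (i j : Fin 3) : lieT A T x i j = lieT A T' x i j := by
  simp only [lieT, e x hx, rotD_congr (fun z hz => e z hz i j) hx]

theorem lieT_add_mul {T T' : E3 → Fin 3 → Fin 3 → ℝ} (h : ∀ i j, SphereSmooth fun x => T x i j)
    (h' : ∀ i j, SphereSmooth fun x => T' x i j) (a : ℝ) (hx : ‖x‖ = 1) (i j : Fin 3) :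
    lieT A (fun x i j => T x i j + a * T' x i j) x i j = lieT A T x i j + a * lieT A T' x i j := by
  simp only [lieT, rotD_add (h i j) ((sphereSmooth_const a).mul (h' i j)) hx,
    rotD_const_mul a (h' i j) hx, Fin.sum_univ_three]
  ring

/-- Rotations are isometries, so Y commutes with the Hessian; the extra terms in `lieT` account for
the rotation of the Cartesian components. -/
theorem lieT_hess (hA : ∀ i j, A i j = -A j i) (h : SphereSmooth φ) (hx : ‖x‖ = 1) (i j : Fin 3) :
    lieT A (hess φ) x i j = hess (rotD A φ) x i j := by
  have e1 : rotD A (fun z => hess φ z i j) x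
      = rotD A (tderiv i (tderiv j φ)) x + (x j * rotD A (tderiv i φ) x + tderiv i φ x * rotVec A x j) := by
    rw [rotD_congr (fun z hz => hess_eq h hz i j) hx, rotD_add (by fun_prop) (by fun_prop) hx,
      rotD_mul (by fun_prop) (by fun_prop) hx, rotD_coord hA hx]
  have e2 : tderiv i (tderiv j (rotD A φ)) x
      = tderiv i (rotD A (tderiv j φ)) x + ∑ k, A k j * tderiv i (tderiv k φ) x := by
    rw [tderiv_congr (fun z hz => tderiv_rotD hA h hz j) i hx,
      tderiv_add i (by fun_prop) (by fun_prop) hx, tderiv_sum i (fun k => by fun_prop) hx]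
    simp only [tderiv_const_mul i _ (h.tderiv _) hx]
  have e3 := tderiv_rotD hA (h.tderiv j) hx i
  have e4 := tderiv_rotD hA h hx i
  have e5 : rotVec A x j = -∑ k, A k j * x k := by
    rw [rotVec, ← Finset.sum_neg_distrib]; exact Finset.sum_congr rfl fun k _ => by rw [hA j k]; ring
  rw [lieT, e1, hess_eq h.rotD hx, e2, e3, e4, e5]
  simp only [hess_eq h hx, Fin.sum_univ_three]
  ring

theorem rotD_lap (hA : ∀ i j, A i j = -A j i) (h : SphereSmooth φ) (hx : ‖x‖ = 1) :
    rotD A (lap φ) x = lap (rotD A φ) x := by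
  simp only [lap, ← lieT_hess hA h hx, lieT]
  have e : ∀ i, A i i = 0 := fun i => by linarith [hA i i]
  refine Eq.trans (rotD_sum (fun i => h.hess i i) hx) ?_
  simp only [Fin.sum_univ_three, e, hA 1 0, hA 2 0, hA 2 1, hess_symm h hx 1 0, hess_symm h hx 2 0,
    hess_symm h hx 2 1]
  ring

theorem lieT_roundMetric_mul (hA : ∀ i j, A i j = -A j i) (h : SphereSmooth φ) (hx : ‖x‖ = 1)
    (i j : Fin 3) :
    lieT A (fun x i j => roundMetric x i j * φ x) x i j = roundMetric x i j * rotD A φ x := by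
  have e5 : ∀ j, rotVec A x j = -∑ k, A k j * x k := fun j => by
    rw [rotVec, ← Finset.sum_neg_distrib]; exact Finset.sum_congr rfl fun k _ => by rw [hA j k]; ring
  have e1 : rotD A (fun z => roundMetric z i j) x = -(x i * rotVec A x j + x j * rotVec A x i) := by
    have : ∀ z, roundMetric z i j = (if i = j then 1 else 0) + -1 * (z i * z j) := fun z => by
      rw [roundMetric]; ring
    rw [funext this, rotD_add (by fun_prop) (by fun_prop) hx, rotD_const_mul _ (by fun_prop) hx,
      rotD_mul (by fun_prop) (by fun_prop) hx, rotD_coord hA hx, rotD_coord hA hx]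
    simp only [rotD, tderiv_const]
    simp
  have e6 := hA i j
  rw [lieT, rotD_mul (by fun_prop) h hx, e1, e5, e5]
  have e7 : ∑ k, A k i * (roundMetric x k j * φ x) = (A j i - (∑ k, A k i * x k) * x j) * φ x := by
    simp only [roundMetric, Fin.sum_univ_three]; fin_cases j <;> simp <;> ring
  have e8 : ∑ k, A k j * (roundMetric x i k * φ x) = (A i j - (∑ k, A k j * x k) * x i) * φ x := by
    simp only [roundMetric, Fin.sum_univ_three]; fin_cases i <;> simp <;> ring
  rw [e7, e8, e6]
  ring

theorem lieT_areaForm (hA : ∀ i j, A i j = -A j i) (hx : ‖x‖ = 1) (i j : Fin 3) :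
    lieT A areaForm x i j = 0 := by
  have e : ∀ i, A i i = 0 := fun i => by linarith [hA i i]
  have e1 : rotD A (fun z => areaForm z i j) x = ∑ k, leviCivita k i j * rotVec A x k := by
    simp only [areaForm]
    rw [rotD_sum (fun k => by fun_prop) hx]
    simp only [rotD_const_mul _ (sphereSmooth_coord _) hx, rotD_coord hA hx]
  rw [lieT, e1]
  simp only [areaForm, rotVec, Fin.sum_univ_three, e, hA 1 0, hA 2 0, hA 2 1]
  fin_cases i <;> fin_cases j <;> simp [leviCivita, e, hA 1 0, hA 2 0, hA 2 1] <;> ring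

@[fun_prop]
theorem sphereSmooth_areaForm (i j : Fin 3) : SphereSmooth fun x => areaForm x i j := by
  unfold areaForm; fun_prop

theorem lieT_areaForm_mul (hA : ∀ i j, A i j = -A j i) {H : E3 → Fin 3 → Fin 3 → ℝ}
    (h : ∀ i j, SphereSmooth fun x => H x i j) (hx : ‖x‖ = 1) (i j : Fin 3) :
    lieT A (fun x i j => ∑ e, areaForm x i e * H x e j) x i j
      = ∑ e, areaForm x i e * lieT A H x e j := by
  have e0 : ∀ i, A i i = 0 := fun i => by linarith [hA i i]
  have e1 : ∀ e, rotD A (fun z => areaForm z i e) x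
      = -(∑ k, A k i * areaForm x k e + ∑ k, A k e * areaForm x i k) := fun e => by
    have h1 := lieT_areaForm hA hx i e
    rw [lieT] at h1
    linarith
  rw [lieT, rotD_sum (fun k => by fun_prop) hx]
  simp only [rotD_mul (sphereSmooth_areaForm _ _) (h _ _) hx, e1, lieT]
  simp only [Fin.sum_univ_three, e0, hA 1 0, hA 2 0, hA 2 1]
  ring

theorem lieT_swap {T : E3 → Fin 3 → Fin 3 → ℝ} (x : E3) (i j : Fin 3) :
    lieT A (fun x i j => T x j i) x i j = lieT A T x j i := by
  simp only [lieT]; ring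

theorem hess_add_mul (h : SphereSmooth φ) (h' : SphereSmooth ψ) (a : ℝ) (hx : ‖x‖ = 1) (i j : Fin 3) :
    hess (fun z => φ z + a * ψ z) x i j = hess φ x i j + a * hess ψ x i j := by
  have e : ∀ j {z : E3}, ‖z‖ = 1 → tderiv j (fun z => φ z + a * ψ z) z = tderiv j φ z + a * tderiv j ψ z :=
    fun j z hz => by rw [tderiv_add j h (by fun_prop) hz, tderiv_const_mul j a h' hz]
  rw [hess_eq (by fun_prop) hx, hess_eq h hx, hess_eq h' hx, tderiv_congr (fun z hz => e j hz) i hx,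
    tderiv_add i (by fun_prop) (by fun_prop) hx, tderiv_const_mul i a (by fun_prop) hx, e i hx]
  ring

theorem lap_add_mul (h : SphereSmooth φ) (h' : SphereSmooth ψ) (a : ℝ) (hx : ‖x‖ = 1) :
    lap (fun z => φ z + a * ψ z) x = lap φ x + a * lap ψ x := by
  simp only [lap, hess_add_mul h h' a hx, Finset.sum_add_distrib, Finset.mul_sum]

theorem HighModes.add_mul (h : SphereSmooth φ) (h' : SphereSmooth ψ) (h1 : HighModes φ)
    (h2 : HighModes ψ) (a : ℝ) : HighModes fun x => φ x + a * ψ x := by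
  refine ⟨?_, fun i => ?_⟩
  · rw [sphereIntegral_add h (by fun_prop), sphereIntegral_const_mul, h1.1, h2.1]; simp
  · simp only [_root_.add_mul, mul_assoc]
    rw [sphereIntegral_add (by fun_prop) (by fun_prop), sphereIntegral_const_mul, h1.2, h2.2]; simp

end

variable {A : Fin 3 → Fin 3 → ℝ} {φ : E3 → ℝ} {x : E3} {T T' : E3 → Fin 3 → Fin 3 → ℝ} {c c' : E3 → ℝ}

namespace IsClosedPotential

theorem add_mul (h : IsClosedPotential T c) (h' : IsClosedPotential T' c') (a : ℝ) :
    IsClosedPotential (fun x i j => T x i j + a * T' x i j) fun x => c x + a * c' x := by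
  obtain ⟨h1, h2, d, h3, h4, h5⟩ := h
  obtain ⟨h1', h2', d', h3', h4', h5'⟩ := h'
  refine ⟨by fun_prop, h2.add_mul h1 h1' h2' a, fun x => d x + a * d' x, by fun_prop,
    h4.add_mul h3 h3' h4' a, fun x hx i j => ?_⟩
  simp only [h5 x hx, h5' x hx, hess_add_mul h1 h1' a hx, lap_add_mul h1 h1' a hx,
    hess_add_mul h3 h3' a hx, Fin.sum_univ_three]
  ring

theorem congr (h : IsClosedPotential T c) (e : ∀ x : E3, ‖x‖ = 1 → ∀ i j, T' x i j = T x i j) :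
    IsClosedPotential T' c := by
  obtain ⟨h1, h2, d, h3, h4, h5⟩ := h
  exact ⟨h1, h2, d, h3, h4, fun x hx i j => (e x hx i j).trans (h5 x hx i j)⟩

theorem of_scalar (h : SphereSmooth φ) (h' : HighModes φ) :
    IsClosedPotential (fun x i j => hess φ x i j - 1 / 2 * roundMetric x i j * lap φ x) φ := by
  have h0 : sphereIntegral (fun _ => 0) = 0 := by simpa using sphereIntegral_const_mul 0 fun _ => 0
  refine ⟨h, h', fun _ => 0, by fun_prop, ⟨h0, fun i => by simpa using h0⟩, fun x hx i j => ?_⟩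
  have : ∀ i j, hess (fun _ => 0) x i j = 0 := fun i j => by
    simp [hess_eq (sphereSmooth_const 0) hx, tderiv, show ∀ j, tderiv j (fun _ => 0) = fun _ => (0:ℝ) from
      fun j => funext fun z => tderiv_const j 0]
  simp [this]

/-- The round metric, the area form, the Hessian and the Laplacian are invariant under rotations, so
the decomposition of T is carried to that of L_Y T. Bounds on Y(c) then need no estimate of
derivatives of potentials. -/
theorem lieT (hA : ∀ i j, A i j = -A j i) (h : IsClosedPotential T c) :
    IsClosedPotential (lieT A T) (rotD A c) := by
  obtain ⟨h1, h2, d, h3, h4, h5⟩ := h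
  refine ⟨h1.rotD, h2.rotD hA h1, rotD A d, h3.rotD, h4.rotD hA h3, fun x hx i j => ?_⟩
  have hm : ∀ i j, SphereSmooth fun x => ∑ e, areaForm x i e * hess d x e j := fun i j =>
    SphereSmooth.sum fun e => (sphereSmooth_areaForm i e).mul (h3.hess e j)
  have hs1 : ∀ i j, SphereSmooth fun x => roundMetric x i j * lap c x := fun i j =>
    (sphereSmooth_roundMetric i j).mul h1.lap
  have e := lieT_congr (A := A) (T := T) (T' := fun x i j => (hess c x i j
    + -(1 / 2) * (roundMetric x i j * lap c x))
    + 1 / 2 * (∑ e, areaForm x i e * hess d x e j + 1 * ∑ e, areaForm x j e * hess d x e i))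
    (fun x hx i j => by rw [h5 x hx i j]; ring) hx i j
  rw [e, lieT_add_mul (fun i j => by have := h1.hess i j; have := hs1 i j; fun_prop)
    (fun i j => by have := hm i j; have := hm j i; fun_prop) _ hx,
    lieT_add_mul (fun i j => h1.hess i j) hs1 _ hx,
    lieT_add_mul hm (fun i j => hm j i) _ hx, lieT_hess hA h1 hx, lieT_roundMetric_mul hA h1.lap hx,
    rotD_lap hA h1 hx, lieT_areaForm_mul hA (fun i j => h3.hess i j) hx,
    lieT_swap (T := fun x i j => ∑ e, areaForm x i e * hess d x e j),
    lieT_areaForm_mul hA (fun i j => h3.hess i j) hx]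
  simp only [lieT_hess hA h3 hx]
  ring

end IsClosedPotential

end

/-! ### Integration against the Hessian and the sup-norm bound for closed potentials. -/

section

section
variable {φ ψ : E3 → ℝ}

theorem SphereSmooth.exists_bound (h : SphereSmooth φ) : ∃ M, ∀ x : E3, ‖x‖ = 1 → |φ x| ≤ M := by
  obtain ⟨M, hM⟩ := isCompact_univ.exists_bound_of_continuousOn h.continuous_coe.continuousOn
  exact ⟨M, fun x hx => hM ⟨x, by simpa using hx⟩ trivial⟩

theorem sphereIntegral_mono (h : SphereSmooth φ) (h' : SphereSmooth ψ)
    (e : ∀ x : E3, ‖x‖ = 1 → φ x ≤ ψ x) : sphereIntegral φ ≤ sphereIntegral ψ :=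
  integral_mono h.integrable h'.integrable fun x => e x (by simp)

theorem abs_sphereIntegral_le {M : ℝ} (e : ∀ x : E3, ‖x‖ = 1 → |φ x| ≤ M) :
    |sphereIntegral φ| ≤ M * sphereIntegral fun _ => 1 := by
  have h := norm_integral_le_of_norm_le_const (μ := (volume : Measure E3).toSphere)
    (f := fun x : Metric.sphere (0 : E3) 1 => φ x) (C := M) (Eventually.of_forall fun x => e x (by simp))
  simpa [sphereIntegral] using h

theorem sphereIntegral_coord (i : Fin 3) : sphereIntegral (fun x => x i) = 0 := by
  have h := sphereIntegral_tderiv (sphereSmooth_const 1) i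
  have h0 : sphereIntegral (fun _ => 0) = 0 := by simpa using sphereIntegral_const_mul 0 fun _ => 0
  simp only [tderiv_const, h0, mul_one] at h
  linarith

/-- Two integrations by parts. Tangentiality of S in both slots, and of its divergence D, removes
the normal terms 2 x_i φ that the ambient form of the divergence theorem produces. -/
theorem sphereIntegral_mul_hess {S : E3 → Fin 3 → Fin 3 → ℝ} {D : Fin 3 → E3 → ℝ}
    (hS : ∀ i j, SphereSmooth fun x => S x i j) (hD : ∀ j, SphereSmooth (D j))
    (h1 : ∀ x : E3, ‖x‖ = 1 → ∀ j, ∑ i, x i * S x i j = 0)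
    (h2 : ∀ x : E3, ‖x‖ = 1 → ∀ i, ∑ j, S x i j * x j = 0)
    (h3 : ∀ x : E3, ‖x‖ = 1 → ∀ j, ∑ i, tderiv i (fun z => S z i j) x = D j x)
    (h4 : ∀ x : E3, ‖x‖ = 1 → ∑ j, x j * D j x = 0) (h : SphereSmooth φ) :
    sphereIntegral (fun x => ∑ i, ∑ j, S x i j * hess φ x i j)
      = sphereIntegral fun x => φ x * ∑ j, tderiv j (D j) x := by
  have e1 : sphereIntegral (fun x => ∑ i, ∑ j, S x i j * hess φ x i j)
      = ∑ i, ∑ j, sphereIntegral fun x => S x i j * tderiv i (tderiv j φ) x := by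
    have := fun j => h.tderiv j
    simp only [← sphereIntegral_sum fun j => (hS _ j).mul ((h.tderiv j).tderiv _)]
    rw [← sphereIntegral_sum fun i => by fun_prop]
    refine sphereIntegral_congr fun x hx => Finset.sum_congr rfl fun i _ => ?_
    have := h2 x hx i
    simp only [hess_eq h hx, Fin.sum_univ_three] at this ⊢
    linear_combination tderiv i φ x * this
  have e2 : sphereIntegral (fun x => ∑ j, D j x * tderiv j φ x)
      = -sphereIntegral fun x => φ x * ∑ j, tderiv j (D j) x := by
    rw [sphereIntegral_sum fun j => by fun_prop]
    simp only [sphereIntegral_mul_tderiv (hD _) h, Finset.mul_sum]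
    rw [Finset.sum_sub_distrib, ← Finset.mul_sum, ← sphereIntegral_sum fun j => by fun_prop,
      ← sphereIntegral_sum fun j => by fun_prop, sphereIntegral_congr (ψ := fun _ => 0 * 0) fun x hx => ?_,
      sphereIntegral_const_mul]
    · simp
    · have := h4 x hx
      simp only [Fin.sum_univ_three] at this ⊢
      linear_combination φ x * this
  have e3 : ∑ i, ∑ j, sphereIntegral (fun x => x i * (S x i j * tderiv j φ x)) = 0 := by
    have := fun j => h.tderiv j
    rw [Finset.sum_comm]
    refine Finset.sum_eq_zero fun j _ => ?_
    rw [← sphereIntegral_sum fun i => by fun_prop, sphereIntegral_congr (ψ := fun _ => 0 * 0) fun x hx => ?_,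
      sphereIntegral_const_mul, zero_mul]
    have := h1 x hx j
    simp only [Fin.sum_univ_three] at this ⊢
    linear_combination tderiv j φ x * this
  have e4 : ∑ i, ∑ j, sphereIntegral (fun x => tderiv j φ x * tderiv i (fun z => S z i j) x)
      = sphereIntegral fun x => ∑ j, D j x * tderiv j φ x := by
    rw [Finset.sum_comm, sphereIntegral_sum fun j => by fun_prop]
    refine Finset.sum_congr rfl fun j _ => ?_
    rw [← sphereIntegral_sum fun i => by fun_prop]
    refine sphereIntegral_congr fun x hx => ?_
    rw [← h3 x hx j, Finset.sum_mul]
    exact Finset.sum_congr rfl fun i _ => mul_comm _ _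
  rw [e1]
  simp only [sphereIntegral_mul_tderiv (hS _ _) (h.tderiv _), Finset.sum_sub_distrib, ← Finset.mul_sum]
  rw [e3, e4, e2]; ring

end

/-! ### The kernel that recovers the closed potential at a point -/

section
variable {e : E3} {τ : ℝ} {r : E3 → ℝ} {x : E3}

/-- The tangential part of `e` at `x`. -/
def tanPart (e x : E3) (i : Fin 3) : ℝ := e i - (∑ k, e k * x k) * x i

@[fun_prop]
theorem sphereSmooth_tanPart (e : E3) (i : Fin 3) : SphereSmooth fun x => tanPart e x i := by
  unfold tanPart; fun_prop

theorem tderiv_height (e : E3) (hx : ‖x‖ = 1) (i : Fin 3) :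
    tderiv i (fun z => ∑ k, e k * z k) x = tanPart e x i := by
  rw [tderiv_sum i (fun k => by fun_prop) hx]
  simp only [tderiv_const_mul i _ (sphereSmooth_coord _) hx, tderiv_coord i _ hx, roundMetric,
    tanPart, Fin.sum_univ_three]
  fin_cases i <;> simp <;> ring

theorem tderiv_tanPart (e : E3) (hx : ‖x‖ = 1) (i j : Fin 3) :
    tderiv i (fun z => tanPart e z j) x
      = -(tanPart e x i * x j) - (∑ k, e k * x k) * roundMetric x i j := by
  unfold tanPart
  rw [tderiv_sub i (by fun_prop) (by fun_prop) hx, tderiv_const, tderiv_mul i (by fun_prop) (by fun_prop) hx,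
    tderiv_height e hx, tderiv_coord i j hx, tanPart]
  ring

theorem x_tanPart (e : E3) (hx : ‖x‖ = 1) : ∑ i, x i * tanPart e x i = 0 := by
  have h := sum_x_sq hx
  simp only [tanPart, Fin.sum_univ_three] at h ⊢
  linear_combination -(e 0 * x 0 + e 1 * x 1 + e 2 * x 2) * h

theorem tanPart_sq (he : ‖e‖ = 1) (hx : ‖x‖ = 1) :
    ∑ i, tanPart e x i ^ 2 = 1 - (∑ k, e k * x k) ^ 2 := by
  have h := sum_x_sq hx
  have h' := sum_x_sq he
  simp only [tanPart, Fin.sum_univ_three] at h h' ⊢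
  linear_combination (e 0 * x 0 + e 1 * x 1 + e 2 * x 2) ^ 2 * h + h'

/-- The test tensor. -/
def kerT (e : E3) (r : E3 → ℝ) (x : E3) (i j : Fin 3) : ℝ :=
  r x * (tanPart e x i * tanPart e x j - 1 / 2 * (1 - (∑ k, e k * x k) ^ 2) * roundMetric x i j)

/-- The divergence of the test tensor. -/
def kerD (e : E3) (r : E3 → ℝ) (x : E3) : ℝ :=
  1 / 2 * (1 - (∑ k, e k * x k) ^ 2) * r x ^ 2 - 2 * (∑ k, e k * x k) * r x

theorem sphereSmooth_kerT (hr : SphereSmooth r) (i j : Fin 3) : SphereSmooth fun x => kerT e r x i j := by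
  unfold kerT; fun_prop

theorem sphereSmooth_kerD (hr : SphereSmooth r) : SphereSmooth (kerD e r) := by
  unfold kerD; fun_prop

variable (hr : SphereSmooth r) (h : ∀ x : E3, ‖x‖ = 1 → r x * (τ - ∑ k, e k * x k) = 1)
include hr h

/-- Here r = 1/(τ − e · x), given through its defining relation, so that all derivatives follow by
implicit differentiation. -/
theorem tderiv_ker (hx : ‖x‖ = 1) (i : Fin 3) : tderiv i r x = r x ^ 2 * tanPart e x i := by
  have h1 : tderiv i (fun x => r x * (τ - ∑ k, e k * x k)) x = 0 := by
    rw [tderiv_congr h i hx, tderiv_const]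
  rw [tderiv_mul i hr (by fun_prop) hx, tderiv_sub i (by fun_prop) (by fun_prop) hx, tderiv_const,
    tderiv_height e hx] at h1
  linear_combination r x * h1 - tderiv i r x * h x hx

theorem tderiv_kerD (hx : ‖x‖ = 1) (i : Fin 3) : tderiv i (kerD e r) x
    = (-(∑ k, e k * x k) * r x ^ 2 + (1 - (∑ k, e k * x k) ^ 2) * r x ^ 3 - 2 * r x
      - 2 * (∑ k, e k * x k) * r x ^ 2) * tanPart e x i := by
  have e1 : ∀ x, kerD e r x = 1 / 2 * (r x * r x) - 1 / 2 * (((∑ k, e k * x k) * r x) * ((∑ k, e k * x k) * r x))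
      - 2 * ((∑ k, e k * x k) * r x) := fun x => by rw [kerD]; ring
  have h1 := tderiv_ker hr h hx i
  rw [show kerD e r = _ from funext e1, tderiv_sub i (by fun_prop) (by fun_prop) hx, tderiv_sub i (by fun_prop) (by fun_prop) hx]
  simp only [tderiv_const_mul i _ (show SphereSmooth fun x => r x * r x by fun_prop) hx,
    tderiv_const_mul i _ (show SphereSmooth fun x => (∑ k, e k * x k) * r x by fun_prop) hx,
    tderiv_const_mul i _ (show SphereSmooth fun x => ((∑ k, e k * x k) * r x) * ((∑ k, e k * x k) * r x)
      by fun_prop) hx]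
  rw [tderiv_mul i hr hr hx, tderiv_mul i (by fun_prop) (by fun_prop) hx,
    tderiv_mul i (by fun_prop) hr hx, tderiv_height e hx, h1]
  ring

theorem div_kerT (he : ‖e‖ = 1) (hx : ‖x‖ = 1) (j : Fin 3) :
    ∑ i, tderiv i (fun z => kerT e r z i j) x = kerD e r x * tanPart e x j := by
  have e1 : ∀ i, tderiv i (fun z => kerT e r z i j) x
      = r x * ((tanPart e x i * (-(tanPart e x i * x j) - (∑ k, e k * x k) * roundMetric x i j)
          + tanPart e x j * (-(tanPart e x i * x i) - (∑ k, e k * x k) * roundMetric x i i))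
        - (1 / 2 * (1 - (∑ k, e k * x k) ^ 2) * -(roundMetric x i i * x j + x i * roundMetric x i j)
          - roundMetric x i j * ((∑ k, e k * x k) * tanPart e x i)))
        + (tanPart e x i * tanPart e x j - 1 / 2 * (1 - (∑ k, e k * x k) ^ 2) * roundMetric x i j)
          * (r x ^ 2 * tanPart e x i) := fun i => by
    unfold kerT
    have e2 : tderiv i (fun z => roundMetric z i j) x = -(roundMetric x i i * x j + x i * roundMetric x i j) := by
      unfold roundMetric
      rw [tderiv_sub i (by fun_prop) (by fun_prop) hx, tderiv_const, tderiv_mul i (by fun_prop) (by fun_prop) hx,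
        tderiv_coord i _ hx, tderiv_coord i _ hx]
      simp only [roundMetric]; ring
    have e3 : tderiv i (fun z : E3 => 1 / 2 * (1 - (∑ k, e k * z k) ^ 2)) x
        = -((∑ k, e k * x k) * tanPart e x i) := by
      simp only [pow_two]
      rw [tderiv_const_mul i _ (by fun_prop) hx, tderiv_sub i (by fun_prop) (by fun_prop) hx, tderiv_const,
        tderiv_mul i (by fun_prop) (by fun_prop) hx, tderiv_height e hx]
      ring
    rw [tderiv_mul i hr (by fun_prop) hx, tderiv_ker hr h hx, tderiv_sub i (by fun_prop) (by fun_prop) hx,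
      tderiv_mul i (by fun_prop) (by fun_prop) hx, tderiv_mul i (by fun_prop) (by fun_prop) hx,
      tderiv_tanPart e hx, tderiv_tanPart e hx, e2, e3]
    ring
  have p1 := tanPart_sq he hx
  have p2 := x_tanPart e hx
  have p3 := trace_roundMetric hx
  have p4 := roundMetric_mul p2 j
  have p5 := roundMetric_x hx j
  simp only [e1, roundMetric_symm x _ j]
  obtain ⟨t, ht⟩ : ∃ t, t = ∑ k, e k * x k := ⟨_, rfl⟩
  rw [kerD]
  rw [← ht] at p1 ⊢
  simp only [Fin.sum_univ_three] at p1 p2 p3 p4 p5 ⊢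
  linear_combination (r x ^ 2 * tanPart e x j - r x * x j) * p1 - r x * tanPart e x j * p2
    + (-r x * t * tanPart e x j + 1 / 2 * (1 - t ^ 2) * r x * x j) * p3
    - (1 / 2 * (1 - t ^ 2) * r x ^ 2) * p4 + 1 / 2 * (1 - t ^ 2) * r x * p5

/-- The double divergence of the test tensor is (τ² − 1)² r³ up to modes ℓ ≤ 1, which do not pair
with c. As τ ↓ 1 the main term concentrates at e. -/
theorem div_kerD (he : ‖e‖ = 1) (hx : ‖x‖ = 1) :
    ∑ j, tderiv j (fun z => kerD e r z * tanPart e z j) x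
      = (τ ^ 2 - 1) ^ 2 * r x ^ 3 - τ - 3 * ∑ k, e k * x k := by
  simp only [tderiv_mul _ (sphereSmooth_kerD hr) (sphereSmooth_tanPart e _) hx, tderiv_kerD hr h hx,
    tderiv_tanPart e hx]
  have p1 := tanPart_sq he hx
  have p2 := x_tanPart e hx
  have p3 := trace_roundMetric hx
  have p4 := h x hx
  rw [kerD]
  obtain ⟨t, ht⟩ : ∃ t, t = ∑ k, e k * x k := ⟨_, rfl⟩
  rw [← ht] at p1 p4 ⊢
  obtain ⟨s, hs⟩ : ∃ s, s = τ - t := ⟨_, rfl⟩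
  obtain rfl : t = τ - s := by linarith
  rw [← hs] at p4
  simp only [Fin.sum_univ_three] at p1 p2 p3 ⊢
  linear_combination (-(τ - s) * r x ^ 2 + (1 - (τ - s) ^ 2) * r x ^ 3 - 2 * r x
      - 2 * (τ - s) * r x ^ 2) * p1
    - (1 / 2 * (1 - (τ - s) ^ 2) * r x ^ 2 - 2 * (τ - s) * r x) * (p2 + (τ - s) * p3)
    + (-2 * (τ ^ 2 - 1) * r x ^ 2 * (2 * τ - s) + (2 * τ - s) ^ 2 * r x * (r x * s + 1)
      - 4 * (τ - s) * (2 * τ - s) * r x - 2 * (2 * τ - s) - 2 * (τ ^ 2 - 1) * r x + s) * p4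

/-- The test tensor reproduces the closed potential. -/
theorem sphereIntegral_kerT {T : E3 → Fin 3 → Fin 3 → ℝ} {c : E3 → ℝ} (he : ‖e‖ = 1)
    (hc : IsClosedPotential T c) :
    sphereIntegral (fun x => ∑ i, ∑ j, kerT e r x i j * T x i j)
      = (τ ^ 2 - 1) ^ 2 * sphereIntegral fun x => c x * r x ^ 3 := by
  obtain ⟨h1, h2, d, h3, h4, h5⟩ := hc
  have hS : ∀ i j, SphereSmooth fun x => kerT e r x i j := sphereSmooth_kerT hr
  have hD : SphereSmooth (kerD e r) := sphereSmooth_kerD hr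
  have hx2 : ∀ x : E3, ‖x‖ = 1 → ∀ i, ∑ j, kerT e r x i j * x j = 0 := fun x hx i => by
    have p2 := x_tanPart e hx
    have p5 := roundMetric_x hx i
    simp only [kerT, Fin.sum_univ_three] at p2 p5 ⊢
    linear_combination r x * tanPart e x i * p2
      - r x * (1 / 2 * (1 - (e 0 * x 0 + e 1 * x 1 + e 2 * x 2) ^ 2)) * p5
  have hsymm : ∀ x i j, kerT e r x i j = kerT e r x j i := fun x i j => by
    rw [kerT, kerT, roundMetric_symm x i j]; ring
  have hx1 : ∀ x : E3, ‖x‖ = 1 → ∀ j, ∑ i, x i * kerT e r x i j = 0 := fun x hx j => by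
    rw [← hx2 x hx j]; exact Finset.sum_congr rfl fun i _ => by rw [hsymm, mul_comm]
  have hε : ∀ x : E3, ∀ i, ∑ k, areaForm x i k * x k = 0 := fun x i => by
    simp only [areaForm, Fin.sum_univ_three]
    fin_cases i <;> simp [leviCivita] <;> ring
  have hε' : ∀ x : E3, ∀ i k, areaForm x i k = -areaForm x k i := fun x i k => by
    simp only [areaForm, Fin.sum_univ_three]
    fin_cases i <;> fin_cases k <;> simp [leviCivita] <;> ring
  have hdε : ∀ x : E3, ‖x‖ = 1 → ∀ j i k, tderiv j (fun z => areaForm z i k) x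
      = ∑ l, leviCivita l i k * roundMetric x j l := fun x hx j i k => by
    unfold areaForm
    rw [tderiv_sum j (fun l => by fun_prop) hx]
    simp only [tderiv_const_mul j _ (sphereSmooth_coord _) hx, tderiv_coord j _ hx]
  have e1 := sphereIntegral_mul_hess (D := fun j x => kerD e r x * tanPart e x j) hS
    (fun j => by fun_prop) hx1 hx2
    (fun x hx j => div_kerT hr h he hx j) (fun x hx => by
      have p2 := x_tanPart e hx
      simp only [Fin.sum_univ_three] at p2 ⊢
      linear_combination kerD e r x * p2) h1
  -- The divergence of the test tensor is a function of the height e · x times the gradient of the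
  -- height. Its rotation by the area form is therefore divergence-free, and the second potential
  -- does not contribute.
  have ha : ∀ x : E3, ‖x‖ = 1 → ∑ k, tderiv k (fun z => kerD e r z * ∑ i, areaForm z i k * tanPart e z i) x
      = 0 := fun x hx => by
    have e0 : ∀ k, tderiv k (fun z => kerD e r z * ∑ i, areaForm z i k * tanPart e z i) x = _ := fun k =>
      tderiv_mul k hD (by fun_prop) hx
    have e1 : ∀ k, tderiv k (fun z => ∑ i, areaForm z i k * tanPart e z i) x
        = ∑ i, (areaForm x i k * (-(tanPart e x k * x i) - (∑ k, e k * x k) * roundMetric x k i)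
          + tanPart e x i * ∑ l, leviCivita l i k * roundMetric x k l) := fun k => by
      rw [tderiv_sum k (fun i => by fun_prop) hx]
      refine Finset.sum_congr rfl fun i _ => ?_
      rw [tderiv_mul k (by fun_prop) (by fun_prop) hx, tderiv_tanPart e hx, hdε x hx]
    simp only [e0]
    simp only [e1, tderiv_kerD hr h hx]
    simp only [areaForm, roundMetric, Fin.sum_univ_three]
    simp [leviCivita]
    ring
  have hS' : ∀ j k, SphereSmooth fun x => ∑ i, areaForm x i k * kerT e r x i j := fun j k =>
    SphereSmooth.sum fun i => (sphereSmooth_areaForm i k).mul (hS i j)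
  have e2 := sphereIntegral_mul_hess (S := fun x j k => ∑ i, areaForm x i k * kerT e r x i j)
    (D := fun k x => kerD e r x * ∑ i, areaForm x i k * tanPart e x i)
    (φ := d) hS' (fun j => by fun_prop)
    (fun x hx k => by
      have p := hx2 x hx
      simp only [Fin.sum_univ_three] at p ⊢
      linear_combination areaForm x 0 k * p 0 + areaForm x 1 k * p 1 + areaForm x 2 k * p 2)
    (fun x hx j => by
      have p := hε x
      simp only [Fin.sum_univ_three] at p ⊢
      linear_combination kerT e r x 0 j * p 0 + kerT e r x 1 j * p 1 + kerT e r x 2 j * p 2)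
    (fun x hx k => by
      simp only [tderiv_sum _ (fun i => (sphereSmooth_areaForm i k).mul (hS i _)) hx,
        tderiv_mul _ (sphereSmooth_areaForm _ _) (hS _ _) hx, hdε x hx]
      have p := fun i => div_kerT hr h he hx i
      have q := fun i => roundMetric_mul (v := kerT e r x i) (by
        rw [← hx2 x hx i]; exact Finset.sum_congr rfl fun j _ => mul_comm _ _)
      simp only [Fin.sum_univ_three] at p q ⊢
      have s : ∀ i j, tderiv i (fun z => kerT e r z j i) x = tderiv i (fun z => kerT e r z i j) x :=
        fun i j => by rw [funext fun z => hsymm z j i]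
      have p0 := p 0
      have p1 := p 1
      have p2 := p 2
      have q01 := q 0 1
      have q02 := q 0 2
      have q10 := q 1 0
      have q12 := q 1 2
      have q20 := q 2 0
      have q21 := q 2 1
      have l : ∀ i l, leviCivita l i k = -leviCivita i l k := fun i l => by
        simp only [leviCivita]; ring
      have l0 : ∀ i, leviCivita i i k = 0 := fun i => by simp [leviCivita]
      simp only [roundMetric_symm x 1 0, roundMetric_symm x 2 0, roundMetric_symm x 2 1, l 0 1, l 0 2,
        l 1 2, l0, hsymm x 1 0, hsymm x 2 0, hsymm x 2 1, s 0 1, s 0 2, s 1 2, s 1 0,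
        s 2 0, s 2 1]
        at p0 p1 p2 q01 q02 q10 q12 q20 q21 ⊢
      linear_combination areaForm x 0 k * p0 + areaForm x 1 k * p1 + areaForm x 2 k * p2
        + leviCivita 0 1 k * (q10 - q01) + leviCivita 0 2 k * (q20 - q02)
        + leviCivita 1 2 k * (q21 - q12))
    (fun x hx => by
      have p := hε x
      simp only [Fin.sum_univ_three] at p ⊢
      linear_combination kerD e r x * (tanPart e x 0 * p 0 + tanPart e x 1 * p 1 + tanPart e x 2 * p 2)) h3
  have hH := fun i j => h1.hess i j
  have hH' := fun i j => h3.hess i j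
  rw [sphereIntegral_congr (ψ := fun x => ∑ i, ∑ j, kerT e r x i j * hess c x i j
      + ∑ j, ∑ k, (∑ i, areaForm x i k * kerT e r x i j) * hess d x j k) fun x hx => ?_,
    sphereIntegral_add (by fun_prop) (by fun_prop), e1, e2,
    sphereIntegral_congr (φ := fun x => d x * _) (ψ := fun x => 0 * 0) fun x hx => by rw [ha x hx]; ring,
    sphereIntegral_congr (φ := fun x => c x * _) (ψ := fun x => (τ ^ 2 - 1) ^ 2 * (c x * r x ^ 3)
      - (τ * c x + 3 * ∑ k, e k * (c x * x k))) fun x hx => by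
        rw [div_kerD hr h he hx]; simp only [Fin.sum_univ_three]; ring,
    sphereIntegral_sub (by fun_prop) (by fun_prop), sphereIntegral_add (by fun_prop) (by fun_prop),
    sphereIntegral_const_mul, sphereIntegral_const_mul, sphereIntegral_const_mul,
    sphereIntegral_const_mul, sphereIntegral_sum fun k => by fun_prop]
  · simp only [sphereIntegral_const_mul, h2.1, h2.2]; simp
  · have q := fun i => roundMetric_mul (v := kerT e r x i) (by
      rw [← hx2 x hx i]; exact Finset.sum_congr rfl fun j _ => mul_comm _ _) i
    have p1 := tanPart_sq he hx
    have p3 := trace_roundMetric hx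
    have q0 : ∑ i, kerT e r x i i = 0 := by
      simp only [kerT, Fin.sum_univ_three] at p1 p3 ⊢
      linear_combination r x * p1 - r x * (1 / 2 * (1 - (e 0 * x 0 + e 1 * x 1 + e 2 * x 2) ^ 2)) * p3
    have q1 := q 0
    have q2 := q 1
    have q3 := q 2
    simp only [h5 x hx, hsymm x 1 0, hsymm x 2 0, hsymm x 2 1, hess_symm h3 hx 1 0, hess_symm h3 hx 2 0,
      hess_symm h3 hx 2 1, roundMetric_symm x 1 0, roundMetric_symm x 2 0, roundMetric_symm x 2 1,
      Fin.sum_univ_three] at q0 q1 q2 q3 ⊢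
    linear_combination -(1 / 2 * lap c x) * (q1 + q2 + q3 + q0)

/-- Integrating `div_kerD`: a tangential divergence and the coordinate functions integrate to zero,
which leaves the total mass of the kernel. -/
theorem sphereIntegral_ker (he : ‖e‖ = 1) :
    (τ ^ 2 - 1) ^ 2 * sphereIntegral (fun x => r x ^ 3) = τ * sphereIntegral fun _ => 1 := by
  have hD : SphereSmooth (kerD e r) := sphereSmooth_kerD hr
  have h0 : sphereIntegral (fun x => ∑ j, tderiv j (fun z => kerD e r z * tanPart e z j) x) = 0 := by
    rw [sphereIntegral_sum fun j => by fun_prop]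
    simp only [fun j => sphereIntegral_tderiv (hD.mul (sphereSmooth_tanPart e j)) j]
    rw [← Finset.mul_sum, ← sphereIntegral_sum fun j => by fun_prop,
      sphereIntegral_congr (ψ := fun x => 0 * 0) fun x hx => ?_, sphereIntegral_const_mul]
    · simp
    · have p2 := x_tanPart e hx
      simp only [Fin.sum_univ_three] at p2 ⊢
      linear_combination kerD e r x * p2
  rw [sphereIntegral_congr (ψ := fun x => (τ ^ 2 - 1) ^ 2 * r x ^ 3 - (τ * 1 + 3 * ∑ k, e k * x k))
      fun x hx => by rw [div_kerD hr h he hx]; ring,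
    sphereIntegral_sub (by fun_prop) (by fun_prop), sphereIntegral_add (by fun_prop) (by fun_prop),
    sphereIntegral_const_mul, sphereIntegral_const_mul, sphereIntegral_const_mul,
    sphereIntegral_sum fun k => by fun_prop] at h0
  simp only [sphereIntegral_const_mul, sphereIntegral_coord] at h0
  simp at h0
  linarith

/-- The factor 1 − t², with t = e · x, compensates the singularity of the kernel, because r (1 − t)
≤ 1 for every τ > 1. The bound is uniform in τ, as the limit requires. -/
theorem abs_kerT_le (he : ‖e‖ = 1) (hx : ‖x‖ = 1) (hτ : 1 < τ) (i j : Fin 3) : |kerT e r x i j| ≤ 4 := by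
  have p1 := tanPart_sq he hx
  have p := h x hx
  rw [kerT]
  obtain ⟨t, ht⟩ : ∃ t, t = ∑ k, e k * x k := ⟨_, rfl⟩
  rw [← ht] at p1 p ⊢
  have ha : ∀ i, tanPart e x i ^ 2 ≤ 1 - t ^ 2 := fun i => by
    rw [← p1]
    exact Finset.single_le_sum (f := fun i => tanPart e x i ^ 2) (fun i _ => sq_nonneg _) (Finset.mem_univ i)
  have hx1 : ∀ i, x i ^ 2 ≤ 1 := fun i => by
    have h1 := sum_x_sq hx
    have h2 := Finset.single_le_sum (f := fun i => x i ^ 2) (fun i _ => sq_nonneg _) (Finset.mem_univ i)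
    rw [Fin.sum_univ_three] at h2
    linarith
  have h2 : t ^ 2 ≤ 1 := by nlinarith [ha 0, sq_nonneg (tanPart e x 0)]
  have t1 : t ≤ 1 := by nlinarith
  have t2 : -1 ≤ t := by nlinarith
  have hr0 : 0 < r x := by
    by_contra hn
    nlinarith [mul_nonneg (neg_nonneg.2 (not_lt.1 hn)) (show 0 ≤ τ - t by linarith)]
  have hrt : r x * (1 - t) ≤ 1 := by nlinarith
  have b1 : |tanPart e x i * tanPart e x j| ≤ 1 - t ^ 2 := by
    rw [abs_le]; constructor <;> nlinarith [ha i, ha j, sq_nonneg (tanPart e x i + tanPart e x j),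
      sq_nonneg (tanPart e x i - tanPart e x j)]
  have b2 : |roundMetric x i j| ≤ 2 := by
    have : |x i * x j| ≤ 1 := by
      rw [abs_le]; constructor <;> nlinarith [hx1 i, hx1 j, sq_nonneg (x i + x j), sq_nonneg (x i - x j)]
    rw [roundMetric]
    refine (abs_sub _ _).trans ?_
    split_ifs
    · rw [abs_one]; linarith
    · rw [abs_zero]; linarith
  rw [abs_mul, abs_of_pos hr0]
  have b3 : |tanPart e x i * tanPart e x j - 1 / 2 * (1 - t ^ 2) * roundMetric x i j| ≤ 2 * (1 - t ^ 2) := by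
    refine (abs_sub _ _).trans ?_
    rw [abs_mul (1 / 2 * (1 - t ^ 2)), abs_of_nonneg (show 0 ≤ 1 / 2 * (1 - t ^ 2) by linarith)]
    linarith [mul_le_mul_of_nonneg_left b2 (show 0 ≤ 1 / 2 * (1 - t ^ 2) by linarith)]
  calc _ ≤ r x * (2 * (1 - t ^ 2)) := mul_le_mul_of_nonneg_left b3 hr0.le
    _ = r x * (1 - t) * (2 * (1 + t)) := by ring
    _ ≤ 1 * (2 * (1 + t)) := mul_le_mul_of_nonneg_right hrt (by linarith)
    _ ≤ 4 := by linarith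

end

/-- A closed potential is bounded by its tensor. -/
theorem IsClosedPotential.abs_le {T : E3 → Fin 3 → Fin 3 → ℝ} {c : E3 → ℝ} (hc : IsClosedPotential T c)
    {M : ℝ} (hM : ∀ x : E3, ‖x‖ = 1 → ∀ i j, |T x i j| ≤ M) {e : E3} (he : ‖e‖ = 1) : |c e| ≤ 36 * M := by
  obtain ⟨V, hV⟩ : ∃ V, V = sphereIntegral fun _ => 1 := ⟨_, rfl⟩
  have hV0 : 0 < V := hV ▸ sphereIntegral_one_pos
  have h1 := hc.1
  obtain ⟨N, hN⟩ := h1.exists_bound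
  have hN0 : 0 ≤ N := (abs_nonneg _).trans (hN e he)
  refine le_of_forall_pos_le_add fun η hη => ?_
  obtain ⟨d, hd, hd'⟩ := Metric.continuous_iff.1 h1.continuous_coe ⟨e, by simpa using he⟩ η hη
  -- At distance at least d from e one has τ − e · x ≥ d²/2, since |x − e|² = 2 − 2 e · x; hence r ≤
  -- 2/d².
  obtain ⟨K, hK⟩ : ∃ K, K = 2 * N * (2 / d ^ 2) ^ 3 := ⟨_, rfl⟩
  have hK0 : 0 ≤ K := by rw [hK]; positivity
  have hdist : ∀ x : E3, ‖x‖ = 1 → dist x e ^ 2 = 2 - 2 * ∑ k, e k * x k := fun x hx => by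
    rw [dist_eq_norm, norm_sub_sq_real, hx, he, PiLp.inner_apply]
    simp; ring
  -- The estimate by the approximate identity at fixed τ. Continuity of c gives η near e, the
  -- prefactor (τ² − 1)² damps the far part, and 36 is nine components times the bound 4. Letting τ
  -- ↓ 1 finishes the proof.
  have key : ∀ τ : ℝ, 1 < τ → |c e| * τ ≤ 36 * M + η * τ + (τ ^ 2 - 1) ^ 2 * K := fun τ hτ => by
    have ht : ∀ x : E3, ‖x‖ = 1 → ∑ k, e k * x k ≤ 1 := fun x hx => by
      linarith [hdist x hx, sq_nonneg (dist x e)]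
    have hp : ∀ x : E3, ‖x‖ = 1 → 0 < τ - ∑ k, e k * x k := fun x hx => by linarith [ht x hx]
    have hr0 : SphereSmooth fun x => 1 / (τ - ∑ k, e k * x k) :=
      SphereSmooth.div (by fun_prop) (by fun_prop) fun x hx => (hp x hx).ne'
    obtain ⟨r, hr⟩ : ∃ r, r = fun x : E3 => 1 / (τ - ∑ k, e k * x k) := ⟨_, rfl⟩
    rw [← hr] at hr0
    have h : ∀ x : E3, ‖x‖ = 1 → r x * (τ - ∑ k, e k * x k) = 1 := fun x hx => by
      rw [hr]; exact one_div_mul_cancel (hp x hx).ne'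
    have a1 := sphereIntegral_kerT hr0 h he hc
    have a2 := sphereIntegral_ker hr0 h he
    have a3 : |sphereIntegral (fun x => ∑ i, ∑ j, kerT e r x i j * T x i j)| ≤ 36 * M * V := by
      rw [hV]
      refine abs_sphereIntegral_le fun x hx => ?_
      refine (Finset.abs_sum_le_sum_abs _ _).trans ((Finset.sum_le_sum (g := fun _ => 12 * M)
        fun i _ => (Finset.abs_sum_le_sum_abs _ _).trans ((Finset.sum_le_sum (g := fun _ => 4 * M)
        fun j _ => ?_).trans ?_)).trans ?_)
      · rw [abs_mul]
        exact mul_le_mul (abs_kerT_le hr0 h he hx hτ i j) (hM x hx i j) (abs_nonneg _) (by norm_num)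
      · simp; linarith
      · simp; linarith
    have a4 : ∀ x : E3, ‖x‖ = 1 → |(c e - c x) * r x ^ 3| ≤ η * r x ^ 3 + K := fun x hx => by
      have hp : 0 < r x := by rw [hr]; exact one_div_pos.2 (hp x hx)
      rw [abs_mul, abs_of_pos (pow_pos hp 3)]
      by_cases hxd : dist x e < d
      · have := hd' ⟨x, by simpa using hx⟩ hxd
        rw [dist_comm, Real.dist_eq] at this
        nlinarith [pow_pos hp 3]
      · have b1 : r x ≤ 2 / d ^ 2 := by
          rw [hr]
          have : d ^ 2 ≤ dist x e ^ 2 := pow_le_pow_left₀ hd.le (not_lt.1 hxd) 2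
          rw [hdist x hx] at this
          exact (one_div_le_one_div_of_le (show 0 < d ^ 2 / 2 by positivity) (by linarith)).trans_eq
            (by rw [one_div_div])
        have b2 : r x ^ 3 ≤ (2 / d ^ 2) ^ 3 := pow_le_pow_left₀ hp.le b1 3
        have b3 : |c e - c x| ≤ 2 * N := (abs_sub _ _).trans (by linarith [hN e he, hN x hx])
        have b4 : |c e - c x| * r x ^ 3 ≤ K := by
          rw [hK]; exact mul_le_mul b3 b2 (pow_pos hp 3).le (by positivity)
        have := pow_pos hp 3
        nlinarith
    have a5 := sphereIntegral_mono (φ := fun x => (c e - c x) * r x ^ 3)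
      (ψ := fun x => η * r x ^ 3 + K * 1) (by fun_prop) (by fun_prop)
      fun x hx => (le_abs_self _).trans ((a4 x hx).trans (by simp))
    have a6 := sphereIntegral_mono (ψ := fun x => (c e - c x) * r x ^ 3)
      (φ := fun x => -1 * (η * r x ^ 3 + K * 1)) (by fun_prop) (by fun_prop)
      fun x hx => by linarith [neg_le_of_abs_le (a4 x hx)]
    rw [sphereIntegral_const_mul] at a6
    rw [sphereIntegral_congr (φ := fun x => (c e - c x) * r x ^ 3)
        (ψ := fun x => c e * r x ^ 3 - c x * r x ^ 3) fun x _ => by ring,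
      sphereIntegral_sub (by fun_prop) (by fun_prop), sphereIntegral_const_mul,
      sphereIntegral_add (by fun_prop) (by fun_prop), sphereIntegral_const_mul,
      sphereIntegral_const_mul] at a5 a6
    rw [← hV] at a2 a5 a6
    obtain ⟨b, hb⟩ : ∃ b, b = (τ ^ 2 - 1) ^ 2 := ⟨_, rfl⟩
    have hb0 : 0 ≤ b := hb ▸ sq_nonneg _
    rw [← hb] at a1 a2 ⊢
    rw [a1, _root_.abs_le] at a3
    have a7 := mul_le_mul_of_nonneg_left a5 hb0
    have a8 := mul_le_mul_of_nonneg_left a6 hb0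
    have a9 : |c e * τ| ≤ 36 * M + η * τ + b * K := by
      rw [_root_.abs_le]
      constructor
      · refine le_of_mul_le_mul_right ?_ hV0
        linear_combination a3.1 + a8 + (c e + η) * a2
      · refine le_of_mul_le_mul_right ?_ hV0
        linear_combination a3.2 + a7 + (η - c e) * a2
    rwa [abs_mul, abs_of_pos (show 0 < τ by linarith)] at a9
  have hcont : Continuous fun τ : ℝ => 36 * M + η * τ + (τ ^ 2 - 1) ^ 2 * K - |c e| * τ := by fun_prop
  have hlim := ge_of_tendsto (b := (0 : ℝ)) ((hcont.tendsto 1).mono_left nhdsWithin_le_nhds : Tendsto _ (𝓝[>] (1 : ℝ)) _)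
    (eventually_nhdsWithin_of_forall fun τ hτ => by linarith [key τ (Set.mem_Ioi.1 hτ)])
  simp at hlim
  linarith

end

/-! ### Smooth functions on null infinity: time derivatives, integrals and shifts. -/

section

section
variable {v w : ℝ → E3 → ℝ}

/-- Every smooth function on null infinity is the value of a ring element, so smoothness of
derivatives and commutation of ∂_u with tangential derivatives can be imported from the ring. -/
theorem ScriFun.exists_val (h : ScriFun v) : ∃ a, Val a v := by
  have hm : (fun q : Triple => v q.1 (‖q.2.2‖⁻¹ • q.2.2)) ∈ scriSmooth := fun u x hx =>
    ContDiffAt.comp (g := fun p : ℝ × E3 => v p.1 (‖p.2‖⁻¹ • p.2)) (f := fun q : Triple => (q.1, q.2.2)) _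
      (h u x (ne_zero_of_unit hx)) (by fun_prop)
  exact ⟨toRing _ hm, fun u x hx => by rw [ev_toRing]; simp [hx]⟩

namespace ScriFun

theorem add (h : ScriFun v) (h' : ScriFun w) : ScriFun fun u x => v u x + w u x :=
  fun u y hy => (h u y hy).add (h' u y hy)

theorem sub (h : ScriFun v) (h' : ScriFun w) : ScriFun fun u x => v u x - w u x :=
  fun u y hy => (h u y hy).sub (h' u y hy)

theorem mul (h : ScriFun v) (h' : ScriFun w) : ScriFun fun u x => v u x * w u x :=
  fun u y hy => (h u y hy).mul (h' u y hy)

theorem const_mul (a : ℝ) (h : ScriFun v) : ScriFun fun u x => a * v u x :=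
  fun u y hy => contDiffAt_const.mul (h u y hy)

theorem sum {ι : Type*} {s : Finset ι} {v : ι → ℝ → E3 → ℝ} (h : ∀ i, ScriFun (v i)) :
    ScriFun fun u x => ∑ i ∈ s, v i u x := fun u y hy => ContDiffAt.sum fun i _ => h i u y hy

theorem congr (h : ScriFun v) (e : ∀ u (x : E3), ‖x‖ = 1 → w u x = v u x) : ScriFun w := by
  obtain ⟨a, ha⟩ := h.exists_val
  exact Val.scriFun (a := a) fun u x hx => (ha u x hx).trans (e u x hx).symm

theorem deriv (h : ScriFun v) : ScriFun fun u x => deriv (fun s => v s x) u := by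
  obtain ⟨a, ha⟩ := h.exists_val
  exact ha.dU.scriFun

theorem tderiv (h : ScriFun v) (i : Fin 3) : ScriFun fun u x => BondiSachs.tderiv i (v u) x := by
  obtain ⟨a, ha⟩ := h.exists_val
  exact (ha.dT i).scriFun

theorem deriv_tderiv (h : ScriFun v) (i : Fin 3) (u : ℝ) {x : E3} (hx : ‖x‖ = 1) :
    _root_.deriv (fun s => BondiSachs.tderiv i (v s) x) u
      = BondiSachs.tderiv i (fun z => _root_.deriv (fun s => v s z) u) x := by
  obtain ⟨a, ha⟩ := h.exists_val
  have e := (ha.dT i).dU u x hx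
  rw [dU_dT, ha.dU.dT i u x hx] at e
  exact e.symm

theorem hasDerivAt (h : ScriFun v) {x : E3} (hx : ‖x‖ = 1) (u : ℝ) :
    HasDerivAt (fun s => v s x) (_root_.deriv (fun s => v s x) u) u :=
  (h.differentiableAt hx).hasDerivAt

theorem of_sphereSmooth {φ : E3 → ℝ} (h : SphereSmooth φ) : ScriFun fun _ => φ := by
  obtain ⟨a, ha, -⟩ := exists_val_of_sphereSmooth h
  exact ha.scriFun

theorem continuous (h : ScriFun v) : Continuous fun p : ℝ × Metric.sphere (0 : E3) 1 => v p.1 p.2 := by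
  rw [continuous_iff_continuousAt]
  intro p
  have hp : ‖(p.2 : E3)‖ = 1 := by simp
  have h1 := (h p.1 p.2 (ne_zero_of_unit hp)).continuousAt
  have h2 : ContinuousAt (fun p : ℝ × Metric.sphere (0 : E3) 1 => (p.1, (p.2 : E3))) p := by fun_prop
  refine (ContinuousAt.comp (g := fun p : ℝ × E3 => v p.1 (‖p.2‖⁻¹ • p.2))
    (f := fun p : ℝ × Metric.sphere (0 : E3) 1 => (p.1, (p.2 : E3))) h1 h2).congr
    (Eventually.of_forall fun q => ?_)
  simp

theorem exists_bound (h : ScriFun v) (a b : ℝ) :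
    ∃ M, ∀ u ∈ Set.Icc a b, ∀ x : E3, ‖x‖ = 1 → |v u x| ≤ M := by
  obtain ⟨M, hM⟩ := (isCompact_Icc (a := a) (b := b) |>.prod isCompact_univ).exists_bound_of_continuousOn
    h.continuous.continuousOn
  exact ⟨M, fun u hu x hx => hM (u, ⟨x, by simpa using hx⟩) ⟨hu, trivial⟩⟩

theorem hasDerivAt_sphereIntegral (h : ScriFun v) (u : ℝ) :
    HasDerivAt (fun s => sphereIntegral (v s)) (sphereIntegral fun x => _root_.deriv (fun s => v s x) u) u := by
  obtain ⟨M, hM⟩ := h.deriv.exists_bound (u - 1) (u + 1)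
  refine (hasDerivAt_integral_of_dominated_loc_of_deriv_le (bound := fun _ => M)
    (Icc_mem_nhds (by linarith) (by linarith) : Set.Icc (u - 1) (u + 1) ∈ 𝓝 u)
    (Eventually.of_forall fun s => (h.sphereSmooth s).integrable.aestronglyMeasurable)
    (h.sphereSmooth u).integrable (h.deriv.sphereSmooth u).integrable.aestronglyMeasurable
    (Eventually.of_forall fun x s hs => hM s hs x (by simp)) (integrable_const M)
    (Eventually.of_forall fun x s _ => h.hasDerivAt (by simp) s)).2

variable {f : E3 → ℝ}

theorem shift (h : ScriFun v) (hf : SphereSmooth f) : ScriFun fun u x => v (u + f x) x :=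
  fun u y hy => by
    refine ContDiffAt.comp (g := fun p : ℝ × E3 => v p.1 (‖p.2‖⁻¹ • p.2))
      (f := fun p : ℝ × E3 => (p.1 + f (‖p.2‖⁻¹ • p.2), p.2)) (u, y) (h _ y hy) ?_
    have := ContDiffAt.comp (g := fun y : E3 => f (‖y‖⁻¹ • y)) (f := fun p : ℝ × E3 => p.2) (u, y)
      (hf.contDiffAt hy) contDiffAt_snd
    exact (contDiffAt_fst.add this).prodMk contDiffAt_snd

theorem deriv_shift (u : ℝ) (x : E3) :
    _root_.deriv (fun s => v (s + f x) x) u = _root_.deriv (fun s => v s x) (u + f x) :=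
  deriv_comp_add_const (fun s => v s x) (f x) u

theorem tderiv_shift (h : ScriFun v) (hf : SphereSmooth f) (i : Fin 3) (u : ℝ) {x : E3} (hx : ‖x‖ = 1) :
    BondiSachs.tderiv i (fun z => v (u + f z) z) x
      = BondiSachs.tderiv i (v (u + f x)) x
        + _root_.deriv (fun s => v s x) (u + f x) * BondiSachs.tderiv i f x := by
  have hx0 := ne_zero_of_unit hx
  set e : E3 := EuclideanSpace.single i 1
  have hg := ((h (u + f x) x hx0).differentiableAt (by simp)).hasFDerivAt
  have hf' := (hf.differentiableAt hx0).hasFDerivAt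
  have hfx : f (‖x‖⁻¹ • x) = f x := by simp [hx]
  obtain ⟨L, hL⟩ : ∃ L, L = fderiv ℝ (fun p : ℝ × E3 => v p.1 (‖p.2‖⁻¹ • p.2)) (u + f x, x) := ⟨_, rfl⟩
  rw [← hL] at hg
  have h1 : HasFDerivAt (fun y : E3 => v (u + f (‖y‖⁻¹ • y)) (‖y‖⁻¹ • y)) _ x :=
    HasFDerivAt.comp (g := fun p : ℝ × E3 => v p.1 (‖p.2‖⁻¹ • p.2))
      (f := fun y : E3 => (u + f (‖y‖⁻¹ • y), y)) x (by rw [hfx]; exact hg)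
      ((hf'.const_add u).prodMk (hasFDerivAt_id x))
  have h2 : HasFDerivAt (fun y : E3 => v (u + f x) (‖y‖⁻¹ • y)) _ x :=
    HasFDerivAt.comp (g := fun p : ℝ × E3 => v p.1 (‖p.2‖⁻¹ • p.2)) (f := fun y : E3 => (u + f x, y)) x hg
      ((hasFDerivAt_const (u + f x) x).prodMk (hasFDerivAt_id x))
  have h3 : HasDerivAt (fun s => v s x) (L (1, 0)) (u + f x) := by
    have := HasFDerivAt.comp_hasDerivAt (l := fun p : ℝ × E3 => v p.1 (‖p.2‖⁻¹ • p.2))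
      (f := fun s : ℝ => (s, x)) (u + f x) hg ((hasDerivAt_id _).prodMk (hasDerivAt_const _ x))
    refine this.congr_of_eventuallyEq (Eventually.of_forall fun s => ?_)
    simp [hx]
  rw [h3.deriv]
  unfold BondiSachs.tderiv
  rw [h1.fderiv, h2.fderiv]
  have e1 : ((fderiv ℝ (fun y : E3 => f (‖y‖⁻¹ • y)) x) e, e)
      = (0, e) + (fderiv ℝ (fun y : E3 => f (‖y‖⁻¹ • y)) x) e • ((1, 0) : ℝ × E3) := by simp
  simp only [ContinuousLinearMap.comp_apply, ContinuousLinearMap.prod_apply, ContinuousLinearMap.id_apply,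
    zero_apply]
  rw [e1, map_add, map_smul, smul_eq_mul, mul_comm]

end ScriFun

end

end

/-! ### The evolution laws as equations on null infinity, and the flux of the uncorrected charge. -/

section

/-- The properties of the mass aspect and the shear on which the flux formulas depend. -/
structure ScriData (m : ℝ → E3 → ℝ) (C : ℝ → E3 → Fin 3 → Fin 3 → ℝ) : Prop where
  mass_fun : ScriFun m
  shear_fun : ∀ i j, ScriFun fun u x => C u x i j
  symm : ∀ u (x : E3), ‖x‖ = 1 → ∀ i j, C u x i j = C u x j i
  shear_x : ∀ u (x : E3), ‖x‖ = 1 → ∀ i, ∑ j, C u x i j * x j = 0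
  trace : ∀ u (x : E3), ‖x‖ = 1 → ∑ i, C u x i i = 0
  mass_evolution : ∀ u (x : E3), ‖x‖ = 1 → deriv (fun v => m v x) u
    = -(1 / 8) * ∑ i, ∑ j, deriv (fun v => C v x i j) u * deriv (fun v => C v x i j) u
      + 1 / 4 * ∑ i, ∑ k, tderiv i (fun z => tderiv k (fun y => deriv (fun v => C v y k i) u) z) x

namespace Fields.Exp
variable {B : Fields} {m : ℝ → E3 → ℝ} {C : ℝ → E3 → Fin 3 → Fin 3 → ℝ}
  {W2 W3 : ℝ → E3 → Fin 3 → ℝ} {A : Fin 3 → Fin 3 → ℝ} (X : B.Exp m C W2 W3)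
include X

theorem deriv_W2 (hR : ∀ μ ν, B.ric μ ν = 0) (u : ℝ) {x : E3} (hx : ‖x‖ = 1) (i : Fin 3) :
    deriv (fun v => W2 v x i) u = 1 / 2 * ∑ k, tderiv k (fun y => deriv (fun v => C v y k i) u) x := by
  rw [funext fun v => X.W2_eq hR v hx i]
  have h : ∀ k, ScriFun fun u x => C u x k i := fun k => (X.val_c k i).scriFun
  have h1 := (HasDerivAt.fun_sum (u := Finset.univ) fun k _ =>
    ((h k).tderiv k).hasDerivAt hx u).const_mul (1 / 2 : ℝ)
  refine h1.deriv.trans ?_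
  simp only [fun k => (h k).deriv_tderiv k u hx]

theorem scriData (hR : ∀ μ ν, B.ric μ ν = 0) : ScriData m C where
  mass_fun := by
    have h := (X.val_v1.smul (-1 / 2)).scriFun
    exact h.congr fun u x _ => by ring
  shear_fun i j := (X.val_c i j).scriFun
  symm u _ hx := X.C_symm u hx
  shear_x u _ hx := X.C_x u hx
  trace u _ hx := X.C_trace u hx
  mass_evolution u x hx := by
    rw [X.mass_evolution hR u hx]
    have h : ∀ i k, SphereSmooth fun x => tderiv k (fun y => deriv (fun v => C v y k i) u) x := fun i k =>
      (((X.val_c k i).scriFun.deriv).tderiv k).sphereSmooth u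
    have e : ∀ i, tderiv i (fun z => deriv (fun v => W2 v z i) u) x
        = 1 / 2 * ∑ k, tderiv i (fun z => tderiv k (fun y => deriv (fun v => C v y k i) u) z) x := fun i => by
      rw [tderiv_congr (fun z hz => X.deriv_W2 hR u hz i) i hx,
        tderiv_const_mul i _ (SphereSmooth.sum (h i)) hx, tderiv_sum i (h i) hx]
    simp only [e, ← Finset.mul_sum]
    ring

/-- The ambient divergence equals twice the leading shift by `W2_eq`. That shift is already
tangential, so the projection in the covariant derivative changes nothing. -/
theorem divT_eq (hR : ∀ μ ν, B.ric μ ν = 0) (u : ℝ) {x : E3} (hx : ‖x‖ = 1) (b : Fin 3) :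
    divT (C u) x b = 2 * W2 u x b := by
  have h : ∀ a c, ∑ k, roundMetric x a k * tderiv k (fun z => C u z a c) x = tderiv a (fun z => C u z a c) x :=
    fun a c => roundMetric_mul (v := fun k => tderiv k (fun z => C u z a c) x)
      (sum_x_tderiv ((X.val_c a c).scriFun.sphereSmooth u) hx) a
  have s := roundMetric_symm x
  have h2 : divT (C u) x b = ∑ c, roundMetric x b c * ∑ a, ∑ k, roundMetric x a k
      * tderiv k (fun z => C u z a c) x := by
    simp only [divT, covDeriv₂, Fin.sum_univ_three, s 1 0, s 2 0, s 2 1]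
    ring
  have h1 := X.P_W2 u hx b
  rw [h2]
  simp only [h]
  simp only [X.W2_eq hR u hx, Fin.sum_univ_three] at h1 ⊢
  linear_combination 2 * h1

/-- The flux of the angular momentum without its supertranslation correction. -/
theorem hasDerivAt_charge (hR : ∀ μ ν, B.ric μ ν = 0) (hA : ∀ i j, A i j = -A j i) (u : ℝ) :
    HasDerivAt (fun u => sphereIntegral fun x => 3 / 2 * ∑ j, rotVec A x j * (W3 u x j + ∑ l, C u x j l * W2 u x l)
        - 1 / 2 * ∑ j, rotVec A x j * ∑ l, C u x j l * W2 u x l)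
      (-(1 / 4) * sphereIntegral fun x => ∑ i, ∑ j, deriv (fun v => C v x i j) u * lieT A (C u) x i j) u := by
  have hC : ∀ i j, ScriFun fun u x => C u x i j := fun i j => (X.val_c i j).scriFun
  have hW : ∀ i, ScriFun fun u x => W2 u x i := fun i => (X.val_W i).scriFun
  have hW3 : ∀ i, ScriFun fun u x => W3 u x i := fun i => (X.val_W' i).scriFun
  have hY : ∀ j, ScriFun fun _ x => rotVec A x j := fun j => .of_sphereSmooth (by fun_prop)
  have hCW : ∀ j, ScriFun fun u x => ∑ l, C u x j l * W2 u x l := fun j => .sum fun l => (hC j l).mul (hW l)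
  have hw : ∀ j, ScriFun fun u x => W3 u x j + ∑ l, C u x j l * W2 u x l := fun j => (hW3 j).add (hCW j)
  have hκ : ScriFun fun u x => 3 / 2 * ∑ j, rotVec A x j * (W3 u x j + ∑ l, C u x j l * W2 u x l)
      - 1 / 2 * ∑ j, rotVec A x j * ∑ l, C u x j l * W2 u x l :=
    (ScriFun.const_mul _ (.sum fun j => (hY j).mul (hw j))).sub
      (ScriFun.const_mul _ (.sum fun j => (hY j).mul (hCW j)))
  obtain ⟨η, hη, hηx, h⟩ := X.rotation_evolution hR hA
  convert hκ.hasDerivAt_sphereIntegral u using 1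
  have sη : ∀ i, SphereSmooth (η i u) := fun i => (hη i).sphereSmooth u
  have sC : ∀ i j, SphereSmooth fun x => C u x i j := fun i j => (hC i j).sphereSmooth u
  have sW : ∀ i, SphereSmooth fun x => W2 u x i := fun i => (hW i).sphereSmooth u
  have sN : ∀ i j, SphereSmooth fun x => deriv (fun v => C v x i j) u := fun i j => (hC i j).deriv.sphereSmooth u
  have sL : ∀ i j, SphereSmooth fun x => lieT A (C u) x i j := fun i j => by unfold lieT; fun_prop
  have hg0 : ScriFun fun u z => -(1 / 16) * ∑ a, ∑ b, C u z a b * C u z a b :=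
    ScriFun.const_mul _ (.sum fun a => .sum fun b => (hC a b).mul (hC a b))
  obtain ⟨g, hg⟩ : ∃ g : E3 → ℝ, g = fun z => 4 * m u z
      - 2 * deriv (fun v => -(1 / 16) * ∑ a, ∑ b, C v z a b * C v z a b) u := ⟨_, rfl⟩
  have sg : SphereSmooth g := by
    have h1 := (X.scriData hR).mass_fun.sphereSmooth u
    have h2 := hg0.deriv.sphereSmooth u
    rw [hg]; fun_prop
  -- Pointwise, the rate of change is −¼ N · L_Y C up to a divergence, a derivative along Y, and
  -- terms in the leading shift; all three integrate to zero.
  have e1 : ∀ x : E3, ‖x‖ = 1 → deriv (fun u => 3 / 2 * ∑ j, rotVec A x j * (W3 u x j + ∑ l, C u x j l * W2 u x l)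
      - 1 / 2 * ∑ j, rotVec A x j * ∑ l, C u x j l * W2 u x l) u
      = -(1 / 4) * ∑ i, ∑ j, deriv (fun v => C v x i j) u * lieT A (C u) x i j
        + 1 / 2 * ∑ i, tderiv i (η i u) x + 1 / 4 * rotD A g x
        - (1 / 2 * ∑ j, ∑ i, A j i * (tderiv j (fun z => W2 u z i) x - tderiv i (fun z => W2 u z j) x)
          + ∑ j, rotVec A x j * W2 u x j) := fun x hx => by
    have d1 : ∀ j, HasDerivAt (fun u => ∑ l, C u x j l * W2 u x l) _ u := fun j =>
      HasDerivAt.fun_sum (u := Finset.univ) fun l _ => ((hC j l).hasDerivAt hx u).mul ((hW l).hasDerivAt hx u)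
    have d2 : HasDerivAt (fun u => 3 / 2 * ∑ j, rotVec A x j * (W3 u x j + ∑ l, C u x j l * W2 u x l)
      - 1 / 2 * ∑ j, rotVec A x j * ∑ l, C u x j l * W2 u x l) _ u :=
      ((HasDerivAt.fun_sum (u := Finset.univ) fun j _ =>
        ((hw j).hasDerivAt hx u).const_mul (rotVec A x j)).const_mul (3 / 2 : ℝ)).sub
      ((HasDerivAt.fun_sum (u := Finset.univ) fun j _ => (d1 j).const_mul (rotVec A x j)).const_mul (1 / 2 : ℝ))
    rw [d2.deriv]
    have h1 := h u x hx
    rw [← hg] at h1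
    have s : ∀ i j, deriv (fun v => C v x i j) u = deriv (fun v => C v x j i) u := fun i j => by
      congr 1; funext v; exact X.C_symm v hx i j
    have t : ∀ k i j, tderiv k (fun z => C u z i j) x = tderiv k (fun z => C u z j i) x := fun k i j =>
      tderiv_congr (fun z hz => X.C_symm u hz i j) k hx
    have s' := X.C_symm u hx
    have e : ∀ i, A i i = 0 := fun i => by linarith [hA i i]
    simp only [lieT, rotD, Fin.sum_univ_three, e, hA 1 0, hA 2 0, hA 2 1, s 1 0, s 2 0, s 2 1, s' 1 0, s' 2 0,
      s' 2 1, t _ 1 0, t _ 2 0, t _ 2 1] at h1 ⊢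
    linear_combination 1 / 4 * h1
  have i1 : sphereIntegral (fun x => ∑ i, tderiv i (η i u) x) = 0 := by
    rw [sphereIntegral_sum fun i => by fun_prop]
    simp only [fun i => sphereIntegral_tderiv (sη i) i]
    rw [← Finset.mul_sum, ← sphereIntegral_sum fun i => by fun_prop,
      sphereIntegral_congr (ψ := fun x => 0 * 0) fun x hx => by rw [hηx u x hx, zero_mul],
      sphereIntegral_const_mul]
    simp
  -- Killing's equation: after integration by parts, Y · div C pairs the antisymmetric matrix A with
  -- the symmetric C.
  have i2 : sphereIntegral (fun x => ∑ j, rotVec A x j * W2 u x j) = 0 := by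
    have a1 : ∀ j k, sphereIntegral (fun x => rotVec A x j * tderiv k (fun z => C u z k j) x) = _ :=
      fun j k => sphereIntegral_mul_tderiv (sphereSmooth_rotVec A j) (sC k j) k
    rw [sphereIntegral_congr (ψ := fun x => 1 / 2 * ∑ j, ∑ k, rotVec A x j * tderiv k (fun z => C u z k j) x)
        fun x hx => by simp only [X.W2_eq hR u hx, Fin.sum_univ_three]; ring,
      sphereIntegral_const_mul, sphereIntegral_sum fun j => by fun_prop]
    simp only [fun j => sphereIntegral_sum (s := Finset.univ)
      (fun k => (sphereSmooth_rotVec A j).mul ((sC k j).tderiv k)), a1, Finset.sum_sub_distrib]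
    simp only [← Finset.mul_sum]
    simp only [← fun j => sphereIntegral_sum (s := Finset.univ)
        (fun k => (sphereSmooth_coord k).mul ((sphereSmooth_rotVec A j).mul (sC k j))),
      ← fun j => sphereIntegral_sum (s := Finset.univ)
        (fun k => (sC k j).mul ((sphereSmooth_rotVec A j).tderiv k))]
    rw [← sphereIntegral_sum fun i => by fun_prop, ← sphereIntegral_sum fun i => by fun_prop,
      ← sphereIntegral_const_mul, ← sphereIntegral_sub (by fun_prop) (by fun_prop),
      sphereIntegral_congr (ψ := fun x => 0 * 0) fun x hx => ?_, sphereIntegral_const_mul]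
    · simp
    · have s' := X.C_symm u hx
      have e : ∀ i, A i i = 0 := fun i => by linarith [hA i i]
      have c0 := X.C_x u hx 0
      have c1 := X.C_x u hx 1
      have c2 := X.C_x u hx 2
      simp only [tderiv_rotVec A hx, Fin.sum_univ_three, e, hA 1 0, hA 2 0, hA 2 1, s' 1 0, s' 2 0, s' 2 1]
        at c0 c1 c2 ⊢
      linear_combination 3 * (rotVec A x 0 * c0 + rotVec A x 1 * c1 + rotVec A x 2 * c2)
  -- The divergence theorem replaces each ∂_i by 2 x_i, and A x = Y reduces the integral to the one
  -- in `i2`.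
  have i3 : sphereIntegral (fun x => ∑ j, ∑ i, A j i * (tderiv j (fun z => W2 u z i) x
      - tderiv i (fun z => W2 u z j) x)) = 0 := by
    rw [sphereIntegral_sum fun j => by fun_prop]
    have a1 : ∀ i j, sphereIntegral (fun x => tderiv i (fun z => W2 u z j) x) = _ :=
      fun i j => sphereIntegral_tderiv (sW j) i
    simp only [fun j => sphereIntegral_sum (s := Finset.univ)
      (fun i => (sphereSmooth_const (A j i)).mul (((sW i).tderiv j).sub ((sW j).tderiv i))),
      sphereIntegral_const_mul, fun i j => sphereIntegral_sub ((sW i).tderiv j) ((sW j).tderiv i), a1]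
    have a2 : sphereIntegral (fun x => ∑ j, ∑ i, A j i * (x i * W2 u x j)) = 0 := by
      rw [← i2]
      refine sphereIntegral_congr fun x _ => Finset.sum_congr rfl fun j _ => ?_
      rw [rotVec, Finset.sum_mul]
      exact Finset.sum_congr rfl fun i _ => by ring
    rw [sphereIntegral_sum fun j => by fun_prop] at a2
    simp only [fun j => sphereIntegral_sum (s := Finset.univ)
      (fun i => (sphereSmooth_const (A j i)).mul ((sphereSmooth_coord i).mul (sW j))),
      sphereIntegral_const_mul] at a2
    have e : ∀ i, A i i = 0 := fun i => by linarith [hA i i]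
    simp only [Fin.sum_univ_three, e, hA 1 0, hA 2 0, hA 2 1] at a2 ⊢
    linear_combination -4 * a2
  rw [sphereIntegral_congr e1, sphereIntegral_sub (by fun_prop) (by fun_prop),
    sphereIntegral_add (by fun_prop) (by fun_prop), sphereIntegral_add (by fun_prop) (by fun_prop),
    sphereIntegral_add (by fun_prop) (by fun_prop), sphereIntegral_const_mul, sphereIntegral_const_mul,
    sphereIntegral_const_mul, sphereIntegral_const_mul, i1, i2, i3, sphereIntegral_rotD hA sg]
  ring

end Fields.Exp

end

/-! ### Decay in time, and convergence at both ends of null infinity. -/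

section

/-- `v` is `O((1 + |u|)^{-r})`, uniformly on the sphere. -/
def Decays (r : ℝ) (v : ℝ → E3 → ℝ) : Prop :=
  ∃ M, 0 ≤ M ∧ ∀ u (x : E3), ‖x‖ = 1 → |v u x| ≤ M * (1 + |u|) ^ (-r)

/-- `v` is uniformly bounded. -/
def Bdd (v : ℝ → E3 → ℝ) : Prop := ∃ M, 0 ≤ M ∧ ∀ u (x : E3), ‖x‖ = 1 → |v u x| ≤ M

/-- The variation of `v` in `u` is controlled, uniformly on the sphere, by a bounded monotone function. -/
def Settles (v : ℝ → E3 → ℝ) : Prop := ∃ G : ℝ → ℝ, Monotone G ∧ (∃ M, ∀ u, |G u| ≤ M) ∧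
  ∀ u u' (x : E3), ‖x‖ = 1 → |v u x - v u' x| ≤ |G u - G u'|

section
variable {r : ℝ} {v w : ℝ → E3 → ℝ} {f : E3 → ℝ}

theorem SphereSmooth.bdd (hf : SphereSmooth f) : Bdd fun _ => f := by
  obtain ⟨M, hM⟩ := hf.exists_bound
  exact ⟨|M|, abs_nonneg _, fun _ x hx => (hM x hx).trans (le_abs_self _)⟩

theorem one_add_abs_rpow_pos (r u : ℝ) : 0 < (1 + |u|) ^ (-r) := by positivity

namespace Bdd

theorem add (h : Bdd v) (h' : Bdd w) : Bdd fun u x => v u x + w u x := by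
  obtain ⟨M, hM, h⟩ := h
  obtain ⟨N, hN, h'⟩ := h'
  exact ⟨M + N, by positivity, fun u x hx => (abs_add_le _ _).trans (add_le_add (h u x hx) (h' u x hx))⟩

end Bdd

namespace Decays

theorem congr (h : Decays r v) (e : ∀ u (x : E3), ‖x‖ = 1 → w u x = v u x) : Decays r w := by
  obtain ⟨M, hM, h⟩ := h
  exact ⟨M, hM, fun u x hx => by rw [e u x hx]; exact h u x hx⟩

theorem add (h : Decays r v) (h' : Decays r w) : Decays r fun u x => v u x + w u x := by
  obtain ⟨M, hM, h⟩ := h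
  obtain ⟨N, hN, h'⟩ := h'
  exact ⟨M + N, by positivity, fun u x hx => by
    rw [add_mul]; exact (abs_add_le _ _).trans (add_le_add (h u x hx) (h' u x hx))⟩

theorem mul_bdd (h : Decays r v) (h' : Bdd w) : Decays r fun u x => v u x * w u x := by
  obtain ⟨M, hM, h⟩ := h
  obtain ⟨N, hN, h'⟩ := h'
  refine ⟨M * N, by positivity, fun u x hx => ?_⟩
  rw [abs_mul, mul_right_comm]
  exact mul_le_mul (h u x hx) (h' u x hx) (abs_nonneg _) (mul_nonneg hM (one_add_abs_rpow_pos r u).le)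

theorem const_mul (a : ℝ) (h : Decays r v) : Decays r fun u x => a * v u x :=
  (h.mul_bdd (sphereSmooth_const a).bdd).congr fun u x _ => mul_comm _ _

theorem sub (h : Decays r v) (h' : Decays r w) : Decays r fun u x => v u x - w u x :=
  (h.add (h'.const_mul (-1))).congr fun u x _ => by ring

theorem sum {ι : Type*} {s : Finset ι} {v : ι → ℝ → E3 → ℝ} (h : ∀ i, Decays r (v i)) :
    Decays r fun u x => ∑ i ∈ s, v i u x := by
  choose M hM h using h
  exact ⟨∑ i ∈ s, M i, Finset.sum_nonneg fun i _ => hM i, fun u x hx => by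
    rw [Finset.sum_mul]
    exact (Finset.abs_sum_le_sum_abs _ _).trans (Finset.sum_le_sum fun i _ => h i u x hx)⟩

theorem exists_common {ι : Type*} [Fintype ι] {v : ι → ℝ → E3 → ℝ} (h : ∀ i, Decays r (v i)) :
    ∃ M, 0 ≤ M ∧ ∀ i u (x : E3), ‖x‖ = 1 → |v i u x| ≤ M * (1 + |u|) ^ (-r) := by
  choose M hM h using h
  exact ⟨∑ i, M i, Finset.sum_nonneg fun i _ => hM i, fun i u x hx => (h i u x hx).trans
    (mul_le_mul_of_nonneg_right (Finset.single_le_sum (fun i _ => hM i) (Finset.mem_univ i))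
      (one_add_abs_rpow_pos r u).le)⟩

theorem bdd (hr : 0 ≤ r) (h : Decays r v) : Bdd v := by
  obtain ⟨M, hM, h⟩ := h
  exact ⟨M, hM, fun u x hx => (h u x hx).trans (mul_le_of_le_one_right hM
    (Real.rpow_le_one_of_one_le_of_nonpos (by linarith [abs_nonneg u]) (by linarith)))⟩

/-- A Peetre-type inequality: a bounded shift of u costs only a constant factor, so uniform decay is
stable under supertranslations. -/
theorem rpow_shift_le (hr : 0 ≤ r) {F s u : ℝ} (hs : |s| ≤ F) :
    (1 + |u + s|) ^ (-r) ≤ (1 + F) ^ r * (1 + |u|) ^ (-r) := by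
  have hF : 0 ≤ F := (abs_nonneg s).trans hs
  have h1 : (1 + |u|) / (1 + F) ≤ 1 + |u + s| := by
    rw [div_le_iff₀ (by positivity)]
    have : |u| ≤ |u + s| + |s| := by simpa using abs_sub (u + s) s
    nlinarith [mul_nonneg (abs_nonneg (u + s)) hF]
  refine (Real.rpow_le_rpow_of_nonpos (by positivity) h1 (by linarith)).trans_eq ?_
  rw [Real.div_rpow (by positivity) (by positivity), Real.rpow_neg (by positivity) r, Real.rpow_neg (by positivity) r]
  field_simp

theorem shift (hr : 0 ≤ r) (h : Decays r v) (hf : SphereSmooth f) : Decays r fun u x => v (u + f x) x := by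
  obtain ⟨M, hM, h⟩ := h
  obtain ⟨F, hF, hf⟩ := hf.bdd
  refine ⟨M * (1 + F) ^ r, by positivity, fun u x hx => ?_⟩
  rw [mul_assoc]
  exact (h _ x hx).trans (mul_le_mul_of_nonneg_left (rpow_shift_le hr (hf 0 x hx)) hM)

theorem shift_sub (hr : 0 ≤ r) (hv : ScriFun v) (h : Decays r fun u x => deriv (fun s => v s x) u)
    (hf : SphereSmooth f) : Decays r fun u x => v (u + f x) x - v u x := by
  obtain ⟨M, hM, h⟩ := h
  obtain ⟨F, hF, hf⟩ := hf.bdd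
  refine ⟨M * (1 + F) ^ r * F, by positivity, fun u x hx => ?_⟩
  have h1 := Convex.norm_image_sub_le_of_norm_deriv_le (f := fun s => v s x) (s := Metric.closedBall u F)
    (C := M * ((1 + F) ^ r * (1 + |u|) ^ (-r))) (x := u) (y := u + f x)
    (fun s _ => hv.differentiableAt hx) (fun s hs => ?_) (convex_closedBall u F)
    (Metric.mem_closedBall_self hF) (by simpa [dist_eq_norm] using hf 0 x hx)
  · refine h1.trans ?_
    rw [show M * (1 + F) ^ r * F * (1 + |u|) ^ (-r) = M * ((1 + F) ^ r * (1 + |u|) ^ (-r)) * F by ring]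
    refine mul_le_mul_of_nonneg_left ?_ (by positivity)
    simpa using hf 0 x hx
  · refine (h s x hx).trans (mul_le_mul_of_nonneg_left ?_ hM)
    have := rpow_shift_le (u := u) hr (s := s - u) (by simpa [dist_eq_norm] using hs)
    rwa [add_sub_cancel] at this

theorem continuous_rpow (r : ℝ) : Continuous fun u : ℝ => (1 + |u|) ^ (-r) :=
  (by fun_prop : Continuous fun u : ℝ => 1 + |u|).rpow_const fun u => Or.inl (by positivity)

theorem integrable_rpow (hr : 1 < r) : Integrable fun u : ℝ => (1 + |u|) ^ (-r) := by
  simpa using integrable_one_add_norm (E := ℝ) (μ := volume) (r := r) (by simpa using hr)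

/-- The controlling function is a primitive of the integrable bound on ∂_u v; it is increasing, and
bounded because r > 1. -/
theorem settles (hr : 1 < r) (hv : ScriFun v) (h : Decays r fun u x => deriv (fun s => v s x) u) :
    Settles v := by
  obtain ⟨M, hM, h⟩ := h
  have hc : Continuous fun u : ℝ => M * (1 + |u|) ^ (-r) := (continuous_rpow r).const_mul M
  have hi : Integrable fun u : ℝ => M * (1 + |u|) ^ (-r) := (integrable_rpow hr).const_mul M
  have hpos : ∀ u : ℝ, 0 ≤ M * (1 + |u|) ^ (-r) := fun u => by positivity
  obtain ⟨G, hG⟩ : ∃ G : ℝ → ℝ, G = fun u => ∫ t in (0 : ℝ)..u, M * (1 + |t|) ^ (-r) := ⟨_, rfl⟩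
  have hd : ∀ u, HasDerivAt G (M * (1 + |u|) ^ (-r)) u := fun u => by
    rw [hG]; exact (hc.integral_hasStrictDerivAt 0 u).hasDerivAt
  have hGm : Monotone G := monotone_of_deriv_nonneg (fun u => (hd u).differentiableAt) fun u => by
    rw [(hd u).deriv]; exact hpos u
  refine ⟨G, hGm, ⟨∫ t : ℝ, M * (1 + |t|) ^ (-r), fun u => ?_⟩, fun u u' x hx => ?_⟩
  · rw [hG, ← Real.norm_eq_abs]
    refine intervalIntegral.norm_integral_le_integral_norm_uIoc.trans ?_
    simp only [Real.norm_of_nonneg (hpos _)]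
    exact setIntegral_le_integral hi (Eventually.of_forall hpos)
  · have m1 : Monotone fun u => G u - v u x := monotone_of_deriv_nonneg
      (fun u => (hd u).differentiableAt.sub (hv.differentiableAt hx)) fun u => by
        rw [((hd u).fun_sub (hv.hasDerivAt hx u)).deriv]; linarith [le_of_abs_le (h u x hx)]
    have m2 : Monotone fun u => G u + v u x := monotone_of_deriv_nonneg
      (fun u => (hd u).differentiableAt.add (hv.differentiableAt hx)) fun u => by
        rw [((hd u).fun_add (hv.hasDerivAt hx u)).deriv]; linarith [neg_le_of_abs_le (h u x hx)]
    rcases le_total u u' with hu | hu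
    · rw [abs_sub_comm (G u), abs_of_nonneg (sub_nonneg.2 (hGm hu)), abs_le]
      constructor <;> linarith [m1 hu, m2 hu]
    · rw [abs_of_nonneg (sub_nonneg.2 (hGm hu)), abs_le]
      constructor <;> linarith [m1 hu, m2 hu]

end Decays

namespace Settles

theorem const (φ : E3 → ℝ) : Settles fun _ => φ :=
  ⟨fun _ => 0, monotone_const, ⟨0, by simp⟩, fun u u' x _ => by simp⟩

theorem bdd_of_sphereSmooth (h : Settles v) (hv : SphereSmooth (v 0)) : Bdd v := by
  obtain ⟨G, -, ⟨M, hM⟩, h⟩ := h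
  obtain ⟨N, hN, h'⟩ := hv.bdd
  have hM0 : 0 ≤ M := (abs_nonneg _).trans (hM 0)
  refine ⟨N + 2 * M, by positivity, fun u x hx => ?_⟩
  have h1 := h u 0 x hx
  have h2 := abs_sub (G u) (G 0)
  have h3 := abs_add_le (v u x - v 0 x) (v 0 x)
  rw [sub_add_cancel] at h3
  linarith [hM u, hM 0, h' 0 x hx]

theorem bdd (h : Settles v) (hv : ScriFun v) : Bdd v := h.bdd_of_sphereSmooth (hv.sphereSmooth 0)

/-- Increments of two monotone functions have the same sign. This is why `Settles` asks for a
monotone control: the controls of two functions add up to a control of their sum or product. -/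
theorem abs_add_eq {G H : ℝ → ℝ} (hG : Monotone G) (hH : Monotone H) (u u' : ℝ) :
    |G u + H u - (G u' + H u')| = |G u - G u'| + |H u - H u'| := by
  rcases le_total u u' with h | h
  · have h1 := hG h
    have h2 := hH h
    rw [abs_of_nonpos (by linarith), abs_of_nonpos (by linarith), abs_of_nonpos (by linarith)]; ring
  · have h1 := hG h
    have h2 := hH h
    rw [abs_of_nonneg (by linarith), abs_of_nonneg (by linarith), abs_of_nonneg (by linarith)]; ring

theorem add (h : Settles v) (h' : Settles w) : Settles fun u x => v u x + w u x := by
  obtain ⟨G, hG, ⟨M, hM⟩, h⟩ := h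
  obtain ⟨H, hH, ⟨N, hN⟩, h'⟩ := h'
  refine ⟨fun u => G u + H u, hG.add hH, ⟨M + N, fun u => (abs_add_le _ _).trans (add_le_add (hM u) (hN u))⟩,
    fun u u' x hx => ?_⟩
  rw [abs_add_eq hG hH, add_sub_add_comm]
  exact (abs_add_le _ _).trans (add_le_add (h u u' x hx) (h' u u' x hx))

theorem mul (h : Settles v) (h' : Settles w) (b : Bdd v) (b' : Bdd w) :
    Settles fun u x => v u x * w u x := by
  obtain ⟨G, hG, ⟨M, hM⟩, h⟩ := h
  obtain ⟨H, hH, ⟨N, hN⟩, h'⟩ := h'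
  obtain ⟨P, hP, b⟩ := b
  obtain ⟨Q, hQ, b'⟩ := b'
  refine ⟨fun u => Q * G u + P * H u, (hG.const_mul hQ).add (hH.const_mul hP), ⟨Q * M + P * N, fun u => ?_⟩,
    fun u u' x hx => ?_⟩
  · refine (abs_add_le _ _).trans ?_
    rw [abs_mul, abs_mul, abs_of_nonneg hQ, abs_of_nonneg hP]
    exact add_le_add (mul_le_mul_of_nonneg_left (hM u) hQ) (mul_le_mul_of_nonneg_left (hN u) hP)
  · rw [abs_add_eq (hG.const_mul hQ) (hH.const_mul hP), ← mul_sub, ← mul_sub, abs_mul, abs_mul,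
      abs_of_nonneg hQ, abs_of_nonneg hP,
      show v u x * w u x - v u' x * w u' x = w u x * (v u x - v u' x) + v u' x * (w u x - w u' x) by ring]
    refine (abs_add_le _ _).trans ?_
    rw [abs_mul, abs_mul]
    exact add_le_add (mul_le_mul (b' u x hx) (h u u' x hx) (abs_nonneg _) hQ)
      (mul_le_mul (b u' x hx) (h' u u' x hx) (abs_nonneg _) hP)

theorem sum {ι : Type*} {s : Finset ι} {v : ι → ℝ → E3 → ℝ} (h : ∀ i, Settles (v i)) :
    Settles fun u x => ∑ i ∈ s, v i u x := by
  classical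
  induction s using Finset.induction_on with
  | empty => simpa using const fun _ => 0
  | insert i s hi ih => simpa only [Finset.sum_insert hi] using (h i).add ih

theorem exists_common {ι : Type*} [Fintype ι] {v : ι → ℝ → E3 → ℝ} (h : ∀ i, Settles (v i)) :
    ∃ G : ℝ → ℝ, Monotone G ∧ (∃ M, ∀ u, |G u| ≤ M) ∧
      ∀ i u u' (x : E3), ‖x‖ = 1 → |v i u x - v i u' x| ≤ |G u - G u'| := by
  choose G hG hM h using h
  choose M hM using hM
  refine ⟨fun u => ∑ i, G i u, fun u u' hu => Finset.sum_le_sum fun i _ => hG i hu,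
    ⟨∑ i, M i, fun u => (Finset.abs_sum_le_sum_abs _ _).trans (Finset.sum_le_sum fun i _ => hM i u)⟩,
    fun i u u' x hx => (h i u u' x hx).trans ?_⟩
  rw [← Finset.sum_sub_distrib]
  rcases le_total u u' with hu | hu
  · rw [abs_of_nonpos (sub_nonpos.2 (hG i hu)), abs_of_nonpos (Finset.sum_nonpos fun i _ => sub_nonpos.2 (hG i hu)),
      neg_le_neg_iff]
    have := Finset.single_le_sum (f := fun i => G i u' - G i u) (fun i _ => sub_nonneg.2 (hG i hu)) (Finset.mem_univ i)
    have h2 : ∑ i, (G i u - G i u') = -∑ i, (G i u' - G i u) := by rw [← Finset.sum_neg_distrib]; simp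
    linarith
  · rw [abs_of_nonneg (sub_nonneg.2 (hG i hu)), abs_of_nonneg (Finset.sum_nonneg fun i _ => sub_nonneg.2 (hG i hu))]
    exact Finset.single_le_sum (f := fun i => G i u - G i u') (fun i _ => sub_nonneg.2 (hG i hu)) (Finset.mem_univ i)

end Settles

end

/-! ### Total fluxes -/

section
variable {r : ℝ} {v : ℝ → E3 → ℝ} {f : E3 → ℝ} {F H : ℝ → ℝ} {d e : ℝ}

theorem HasTotalFlux.unique (h : HasTotalFlux F d) (h' : HasTotalFlux F e) : d = e := by
  obtain ⟨a, b, ha, hb, rfl⟩ := h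
  obtain ⟨a', b', ha', hb', rfl⟩ := h'
  rw [tendsto_nhds_unique ha ha', tendsto_nhds_unique hb hb']

theorem HasTotalFlux.add (h : HasTotalFlux F d) (h' : HasTotalFlux H e) :
    HasTotalFlux (fun u => F u + H u) (d + e) := by
  obtain ⟨a, b, ha, hb, rfl⟩ := h
  obtain ⟨a', b', ha', hb', rfl⟩ := h'
  exact ⟨a + a', b + b', ha.add ha', hb.add hb', by ring⟩

theorem HasTotalFlux.const_mul (c : ℝ) (h : HasTotalFlux F d) : HasTotalFlux (fun u => c * F u) (c * d) := by
  obtain ⟨a, b, ha, hb, rfl⟩ := h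
  exact ⟨c * a, c * b, ha.const_mul c, hb.const_mul c, by ring⟩

theorem HasTotalFlux.sum {ι : Type*} {s : Finset ι} {F : ι → ℝ → ℝ} {d : ι → ℝ}
    (h : ∀ i, HasTotalFlux (F i) (d i)) : HasTotalFlux (fun u => ∑ i ∈ s, F i u) (∑ i ∈ s, d i) := by
  choose a b ha hb h using h
  exact ⟨_, _, tendsto_finsetSum _ fun i _ => ha i, tendsto_finsetSum _ fun i _ => hb i, by simp [h]⟩

theorem hasTotalFlux_of_hasDerivAt (h : ∀ u, HasDerivAt F (H u) u) (hi : Integrable H) :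
    HasTotalFlux F (∫ u, H u) := by
  have h1 := tendsto_limUnder_of_hasDerivAt_of_integrableOn_Iic (a := 0) (fun u _ => h u) hi.integrableOn
  have h2 := tendsto_limUnder_of_hasDerivAt_of_integrableOn_Ioi (a := 0) (fun u _ => h u) hi.integrableOn
  exact ⟨_, _, h1, h2, integral_of_hasDerivAt_of_tendsto h hi h1 h2⟩

/-- The Cauchy property passes from G to F; no differentiability of F in u is needed, which matters
for terms that contain the potential. -/
theorem exists_tendsto_of_abs_sub_le {l : Filter ℝ} [l.NeBot] {G : ℝ → ℝ} {a V : ℝ} (hG : Tendsto G l (𝓝 a))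
    (h : ∀ u u', |F u - F u'| ≤ V * |G u - G u'|) : ∃ b, Tendsto F l (𝓝 b) := by
  rw [← cauchy_map_iff_exists_tendsto, cauchy_map_iff]
  refine ⟨inferInstance, ?_⟩
  have h1 := (cauchy_map_iff.1 hG.cauchy_map).2
  rw [tendsto_uniformity_iff_dist_tendsto_zero] at h1 ⊢
  have h2 := h1.const_mul V
  rw [mul_zero] at h2
  exact squeeze_zero (fun _ => dist_nonneg) (fun p => h p.1 p.2) h2

theorem Settles.hasTotalFlux (h : Settles v) (hv : ∀ u, SphereSmooth (v u)) :
    ∃ d, HasTotalFlux (fun u => sphereIntegral (v u)) d := by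
  obtain ⟨G, hG, ⟨M, hM⟩, h⟩ := h
  have h1 : ∀ u u', |sphereIntegral (v u) - sphereIntegral (v u')|
      ≤ (sphereIntegral fun _ => 1) * |G u - G u'| := fun u u' => by
    rw [← sphereIntegral_sub (hv u) (hv u'), mul_comm]
    exact abs_sphereIntegral_le fun x hx => h u u' x hx
  have ht := tendsto_atTop_ciSup hG ⟨M, by rintro _ ⟨u, rfl⟩; exact (le_abs_self _).trans (hM u)⟩
  have hb := tendsto_atBot_ciInf hG ⟨-M, by rintro _ ⟨u, rfl⟩; exact neg_le_of_abs_le (hM u)⟩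
  obtain ⟨a, ha⟩ := exists_tendsto_of_abs_sub_le hb h1
  obtain ⟨b, hb⟩ := exists_tendsto_of_abs_sub_le ht h1
  exact ⟨_, a, b, ha, hb, rfl⟩

theorem Decays.hasTotalFlux (hr : 0 < r) (h : Decays r v) :
    HasTotalFlux (fun u => sphereIntegral (v u)) 0 := by
  obtain ⟨M, hM, h⟩ := h
  have h1 : ∀ u, ‖sphereIntegral (v u)‖ ≤ (M * sphereIntegral fun _ => 1) * (1 + |u|) ^ (-r) := fun u =>
    (abs_sphereIntegral_le fun x hx => h u x hx).trans_eq (by ring)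
  have h2 : ∀ l : Filter ℝ, Tendsto (fun u : ℝ => |u|) l atTop →
      Tendsto (fun u => sphereIntegral (v u)) l (𝓝 0) := fun l hl => by
    refine squeeze_zero_norm h1 ?_
    have := ((tendsto_rpow_neg_atTop hr).comp (tendsto_atTop_add_const_left l 1 hl)).const_mul
      (M * sphereIntegral fun _ => 1)
    rwa [mul_zero] at this
  exact ⟨0, 0, h2 _ tendsto_abs_atBot_atTop, h2 _ tendsto_abs_atTop_atTop, by simp⟩

theorem Decays.integrable_prod (hr : 1 < r) (hv : ScriFun v) (h : Decays r v) :
    Integrable (Function.uncurry fun (u : ℝ) (x : Metric.sphere (0 : E3) 1) => v u x)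
      (volume.prod (volume : Measure E3).toSphere) := by
  obtain ⟨M, hM, h⟩ := h
  exact (((integrable_rpow hr).const_mul M).comp_fst _).mono' hv.continuous.aestronglyMeasurable
    (Eventually.of_forall fun p => h p.1 p.2 (by simp))

theorem Decays.integrable_sphereIntegral (hr : 1 < r) (hv : ScriFun v) (h : Decays r v) :
    Integrable fun u => sphereIntegral (v u) := (h.integrable_prod hr hv).integral_prod_left

/-- The integral over null infinity does not change under a supertranslation. -/
theorem Decays.integral_shift (hr : 1 < r) (hv : ScriFun v) (h : Decays r v) (hf : SphereSmooth f) :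
    ∫ u, sphereIntegral (fun x => v (u + f x) x) = ∫ u, sphereIntegral (v u) := by
  have h1 := integral_integral_swap (h.integrable_prod hr hv)
  have h2 := integral_integral_swap ((h.shift (by linarith) hf).integrable_prod hr (hv.shift hf))
  refine h2.trans (Eq.trans ?_ h1.symm)
  exact integral_congr_ae (Eventually.of_forall fun x => integral_add_right_eq_self (fun u => v u x) (f x))

end

end

/-! ### The flux of the uncorrected charge under a supertranslation. -/

section

/-- Decay of the news and of its first and second derivatives along the sphere. -/
structure NewsDecays (r : ℝ) (C : ℝ → E3 → Fin 3 → Fin 3 → ℝ) : Prop where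
  news : ∀ i j, Decays r fun u x => deriv (fun v => C v x i j) u
  tderiv_news : ∀ k i j, Decays r fun u x => tderiv k (fun z => deriv (fun v => C v z i j) u) x
  tderiv_tderiv_news : ∀ k l i j, Decays r fun u x =>
    tderiv k (tderiv l fun z => deriv (fun v => C v z i j) u) x

/-- The rate of change of the angular momentum without its supertranslation correction. -/
def chargeFlux (A : Fin 3 → Fin 3 → ℝ) (C : ℝ → E3 → Fin 3 → Fin 3 → ℝ) (u : ℝ) : ℝ :=
  -(1 / 4) * sphereIntegral fun x => ∑ i, ∑ j, deriv (fun v => C v x i j) u * lieT A (C u) x i j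

theorem sum_roundMetric_mul {x : E3} {N : Fin 3 → Fin 3 → ℝ} (h1 : ∀ i, ∑ j, N i j * x j = 0)
    (h2 : ∑ i, N i i = 0) : ∑ i, ∑ j, N i j * roundMetric x i j = 0 := by
  have e : ∀ i, ∑ j, N i j * roundMetric x i j = N i i := fun i => by
    have := roundMetric_mul (x := x) (v := N i) (by rw [← h1 i]; simp only [mul_comm]) i
    simpa only [mul_comm] using this
  simp only [e, h2]

namespace ScriData
variable {m m' : ℝ → E3 → ℝ} {C C' : ℝ → E3 → Fin 3 → Fin 3 → ℝ} {A : Fin 3 → Fin 3 → ℝ} {r : ℝ}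
  {f φ : E3 → ℝ}

section
variable (S : ScriData m C)
include S

theorem news_fun (i j : Fin 3) : ScriFun fun u x => deriv (fun v => C v x i j) u := (S.shear_fun i j).deriv

theorem news_symm (u : ℝ) {x : E3} (hx : ‖x‖ = 1) (i j : Fin 3) :
    deriv (fun v => C v x i j) u = deriv (fun v => C v x j i) u := by
  congr 1; funext v; exact S.symm v x hx i j

theorem news_x (u : ℝ) {x : E3} (hx : ‖x‖ = 1) (i : Fin 3) : ∑ j, deriv (fun v => C v x i j) u * x j = 0 := by
  have h := (HasDerivAt.fun_sum (u := Finset.univ) fun j _ =>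
    ((S.shear_fun i j).hasDerivAt hx u).mul_const (x j)).deriv
  rw [← h, funext fun v => S.shear_x v x hx i]
  simp

theorem news_trace (u : ℝ) {x : E3} (hx : ‖x‖ = 1) : ∑ i, deriv (fun v => C v x i i) u = 0 := by
  have h := (HasDerivAt.fun_sum (u := Finset.univ) fun i _ => (S.shear_fun i i).hasDerivAt hx u).deriv
  rw [← h, funext fun v => S.trace v x hx]
  simp

/-- The flux of the mass aspect through the sphere, tested with a function. -/
theorem sphereIntegral_news (hφ : SphereSmooth φ) (u : ℝ) :
    sphereIntegral (fun x => φ x * ∑ i, ∑ j, deriv (fun v => C v x i j) u * deriv (fun v => C v x i j) u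
        - 2 * ∑ i, ∑ j, deriv (fun v => C v x i j) u * hess φ x i j)
      = -8 * sphereIntegral fun x => φ x * deriv (fun v => m v x) u := by
  have sN : ∀ i j, SphereSmooth fun x => deriv (fun v => C v x i j) u := fun i j => (S.news_fun i j).sphereSmooth u
  have sH := fun i j => hφ.hess i j
  have h := sphereIntegral_mul_hess (S := fun x i j => deriv (fun v => C v x i j) u)
    (D := fun j x => ∑ i, tderiv i (fun z => deriv (fun v => C v z i j) u) x) sN (fun j => by fun_prop)
    (fun x hx j => by
      rw [← S.news_x u hx j]
      exact Finset.sum_congr rfl fun i _ => by rw [S.news_symm u hx i j, mul_comm])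
    (fun x hx i => S.news_x u hx i) (fun x _ j => rfl)
    (fun x hx => by
      have h1 : ∀ i, ∑ j, (deriv (fun v => C v x i j) u * roundMetric x i j
          + x j * tderiv i (fun z => deriv (fun v => C v z i j) u) x) = 0 := fun i => by
        have h0 : tderiv i (fun z => ∑ j, deriv (fun v => C v z i j) u * z j) x = 0 := by
          rw [tderiv_congr (fun z hz => S.news_x u hz i) i hx, tderiv_const]
        rw [tderiv_sum i (fun j => by fun_prop) hx] at h0
        rw [← h0]
        refine Finset.sum_congr rfl fun j _ => ?_
        rw [tderiv_mul i (sN i j) (sphereSmooth_coord j) hx, tderiv_coord i j hx]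
      have h2 := sum_roundMetric_mul (S.news_x u hx) (S.news_trace u hx)
      have h3 := Finset.sum_eq_zero fun i (_ : i ∈ Finset.univ) => h1 i
      simp only [Fin.sum_univ_three] at h2 h3 ⊢
      linear_combination h3 - h2) hφ
  have sD := S.mass_fun.deriv.sphereSmooth u
  rw [sphereIntegral_sub (by fun_prop) (by fun_prop), sphereIntegral_const_mul, h, ← sphereIntegral_const_mul,
    ← sphereIntegral_sub (by fun_prop) (by fun_prop), ← sphereIntegral_const_mul]
  refine sphereIntegral_congr fun x hx => ?_
  rw [S.mass_evolution u x hx]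
  simp only [fun j => tderiv_sum j (s := Finset.univ) (fun i => (sN i j).tderiv i) hx]
  ring

theorem lieT_fun (A : Fin 3 → Fin 3 → ℝ) (i j : Fin 3) : ScriFun fun u x => lieT A (C u) x i j :=
  ((ScriFun.sum fun k => (ScriFun.of_sphereSmooth (sphereSmooth_rotVec A k)).mul
    ((S.shear_fun i j).tderiv k)).add (.sum fun k => (S.shear_fun k j).const_mul (A k i))).add
    (.sum fun k => (S.shear_fun i k).const_mul (A k j))

theorem flux_fun (A : Fin 3 → Fin 3 → ℝ) :
    ScriFun fun u x => ∑ i, ∑ j, deriv (fun v => C v x i j) u * lieT A (C u) x i j :=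
  .sum fun i => .sum fun j => (S.news_fun i j).mul (S.lieT_fun A i j)

variable (hr : 1 < r) (hN : NewsDecays r C)
include hr hN

theorem shear_settles (i j : Fin 3) : Settles fun u x => C u x i j := (hN.news i j).settles hr (S.shear_fun i j)

theorem lieT_settles (A : Fin 3 → Fin 3 → ℝ) (i j : Fin 3) : Settles fun u x => lieT A (C u) x i j := by
  have h1 : ∀ k, Settles fun u x => tderiv k (fun z => C u z i j) x := fun k =>
    Decays.settles hr ((S.shear_fun i j).tderiv k) ((hN.tderiv_news k i j).congr fun u x hx =>
      (S.shear_fun i j).deriv_tderiv k u hx)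
  have hc : ∀ a : ℝ, Bdd fun _ _ => a := fun a => (sphereSmooth_const a).bdd
  exact ((Settles.sum fun k => (Settles.const _).mul (h1 k) (sphereSmooth_rotVec A k).bdd
      ((h1 k).bdd ((S.shear_fun i j).tderiv k))).add
    (.sum fun k => (Settles.const _).mul (S.shear_settles hr hN k j) (hc (A k i))
      ((S.shear_settles hr hN k j).bdd (S.shear_fun k j)))).add
    (.sum fun k => (Settles.const _).mul (S.shear_settles hr hN i k) (hc (A k j))
      ((S.shear_settles hr hN i k).bdd (S.shear_fun i k)))

theorem lieT_bdd (A : Fin 3 → Fin 3 → ℝ) (i j : Fin 3) : Bdd fun u x => lieT A (C u) x i j :=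
  (S.lieT_settles hr hN A i j).bdd (S.lieT_fun A i j)

theorem flux_decays (A : Fin 3 → Fin 3 → ℝ) :
    Decays r fun u x => ∑ i, ∑ j, deriv (fun v => C v x i j) u * lieT A (C u) x i j :=
  .sum fun i => .sum fun j => (hN.news i j).mul_bdd (S.lieT_bdd hr hN A i j)

theorem deriv_mass_decays : Decays r fun u x => deriv (fun v => m v x) u := by
  have h0 : 0 ≤ r := by linarith
  have h1 : Decays r fun u x => ∑ i, ∑ j, deriv (fun v => C v x i j) u * deriv (fun v => C v x i j) u :=
    .sum fun i => .sum fun j => (hN.news i j).mul_bdd ((hN.news i j).bdd h0)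
  have h2 : Decays r fun u x => ∑ i, ∑ k, tderiv i (fun z => tderiv k (fun y => deriv (fun v => C v y k i) u) z) x :=
    .sum fun i => .sum fun k => hN.tderiv_tderiv_news i k k i
  exact ((h1.const_mul (-(1 / 8))).add (h2.const_mul (1 / 4))).congr fun u x hx => S.mass_evolution u x hx

theorem mass_settles : Settles m := (S.deriv_mass_decays hr hN).settles hr S.mass_fun

theorem mass_bdd : Bdd m := (S.mass_settles hr hN).bdd S.mass_fun

/-- The total flux of the mass aspect tested with a function. -/
theorem hasTotalFlux_mass (hφ : SphereSmooth φ) : HasTotalFlux (fun u => sphereIntegral fun x => φ x * m u x)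
    (∫ u, sphereIntegral fun x => φ x * deriv (fun v => m v x) u) := by
  have h1 : ScriFun fun u x => φ x * m u x := (ScriFun.of_sphereSmooth hφ).mul S.mass_fun
  have h2 : ∀ u, HasDerivAt (fun u => sphereIntegral fun x => φ x * m u x)
      (sphereIntegral fun x => φ x * deriv (fun v => m v x) u) u := fun u => by
    convert h1.hasDerivAt_sphereIntegral u using 1
    exact sphereIntegral_congr fun x hx => (((S.mass_fun.hasDerivAt hx u).const_mul (φ x)).deriv).symm
  refine hasTotalFlux_of_hasDerivAt h2 (Decays.integrable_sphereIntegral hr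
    ((ScriFun.of_sphereSmooth hφ).mul S.mass_fun.deriv) (v := fun u x => φ x * deriv (fun v => m v x) u) ?_)
  exact ((S.deriv_mass_decays hr hN).mul_bdd hφ.bdd).congr fun u x _ => mul_comm _ _

theorem integrable_chargeFlux (A : Fin 3 → Fin 3 → ℝ) : Integrable (chargeFlux A C) :=
  ((S.flux_decays hr hN A).integrable_sphereIntegral hr (S.flux_fun A)).const_mul _

variable (hf : SphereSmooth f) (hA : ∀ i j, A i j = -A j i)
  (hC' : ∀ u (x : E3), ‖x‖ = 1 → ∀ i j,
    C' u x i j = C (u + f x) x i j - 2 * hess f x i j + roundMetric x i j * lap f x)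
include hf

omit hr hN in
-- The chain rule: the shift depends on the point of the sphere, so Y also differentiates the time
-- argument and produces Y(f) N.
theorem lieT_shift (u : ℝ) {x : E3} (hx : ‖x‖ = 1) (i j : Fin 3) :
    lieT A (fun z => C (u + f z) z) x i j
      = lieT A (C (u + f x)) x i j + rotD A f x * deriv (fun v => C v x i j) (u + f x) := by
  have h := fun k => (S.shear_fun i j).tderiv_shift hf k u hx
  simp only [lieT, rotD, h, Fin.sum_univ_three]
  ring

include hA hC'

omit hr hN in
/-- The integrand of the flux in the supertranslated system. -/
theorem flux_shift (u : ℝ) {x : E3} (hx : ‖x‖ = 1) :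
    ∑ i, ∑ j, deriv (fun v => C' v x i j) u * lieT A (C' u) x i j
      = ∑ i, ∑ j, deriv (fun v => C v x i j) (u + f x) * lieT A (C (u + f x)) x i j
        + (rotD A f x * ∑ i, ∑ j, deriv (fun v => C v x i j) (u + f x) * deriv (fun v => C v x i j) (u + f x)
          - 2 * ∑ i, ∑ j, deriv (fun v => C v x i j) (u + f x) * hess (rotD A f) x i j) := by
  have sC : ∀ i j, SphereSmooth fun z => C (u + f z) z i j := fun i j =>
    ((S.shear_fun i j).shift hf).sphereSmooth u
  have sH := fun i j => hf.hess i j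
  have sL := hf.lap
  have e1 : ∀ i j, deriv (fun v => C' v x i j) u = deriv (fun v => C v x i j) (u + f x) := fun i j => by
    rw [funext fun v => hC' v x hx i j, deriv_add_const, deriv_sub_const]
    exact ScriFun.deriv_shift (v := fun u x => C u x i j) u x
  have e2 : ∀ i j, lieT A (C' u) x i j = lieT A (C (u + f x)) x i j
      + rotD A f x * deriv (fun v => C v x i j) (u + f x) - 2 * hess (rotD A f) x i j
      + roundMetric x i j * rotD A (lap f) x := fun i j => by
    rw [lieT_congr (T' := fun z i j => (C (u + f z) z i j + -2 * hess f z i j)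
        + 1 * (roundMetric z i j * lap f z)) (fun z hz i j => by rw [hC' u z hz]; ring) hx,
      lieT_add_mul (fun i j => (sC i j).add ((sphereSmooth_const _).mul (sH i j)))
        (fun i j => (sphereSmooth_roundMetric i j).mul sL) _ hx,
      lieT_add_mul sC sH _ hx, lieT_hess hA hf hx, lieT_roundMetric_mul hA sL hx, S.lieT_shift hf u hx]
    ring
  -- The Laplacian term of the new shear is pure trace and does not pair with the trace-free news.
  have h := sum_roundMetric_mul (S.news_x (u + f x) hx) (S.news_trace (u + f x) hx)
  simp only [e1, e2]
  simp only [Fin.sum_univ_three] at h ⊢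
  linear_combination rotD A (lap f) x * h

/-- The effect of a supertranslation on the total flux of the uncorrected angular momentum. -/
theorem integral_chargeFlux : Integrable (chargeFlux A C') ∧
    ∫ u, chargeFlux A C' u = (∫ u, chargeFlux A C u)
      + 2 * ∫ u, sphereIntegral fun x => rotD A f x * deriv (fun v => m v x) u := by
  have h0 : 0 ≤ r := by linarith
  have hφ : SphereSmooth (rotD A f) := hf.rotD
  have sφ := ScriFun.of_sphereSmooth hφ
  -- R is the excess integrand at the shifted time. Translation of each generator removes the shift,
  -- and then R integrates to −8 ∫ Y(f) ∂_u m at each u; the prefactor −¼ makes this 2.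
  obtain ⟨R, hR⟩ : ∃ R : ℝ → E3 → ℝ, R = fun u x => rotD A f x * ∑ i, ∑ j, deriv (fun v => C v x i j) u
      * deriv (fun v => C v x i j) u - 2 * ∑ i, ∑ j, deriv (fun v => C v x i j) u * hess (rotD A f) x i j :=
    ⟨_, rfl⟩
  have R1 : ScriFun R := by
    rw [hR]
    exact (sφ.mul (.sum fun i => .sum fun j => (S.news_fun i j).mul (S.news_fun i j))).sub
      (ScriFun.const_mul _ (.sum fun i => .sum fun j => (S.news_fun i j).mul
        (ScriFun.of_sphereSmooth (hφ.hess i j))))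
  have R2 : Decays r R := by
    have d1 : Decays r fun u x => ∑ i, ∑ j, deriv (fun v => C v x i j) u * deriv (fun v => C v x i j) u :=
      .sum fun i => .sum fun j => (hN.news i j).mul_bdd ((hN.news i j).bdd h0)
    have d2 : Decays r fun u x => ∑ i, ∑ j, deriv (fun v => C v x i j) u * hess (rotD A f) x i j :=
      .sum fun i => .sum fun j => (hN.news i j).mul_bdd (hφ.hess i j).bdd
    exact ((d1.mul_bdd hφ.bdd).sub (d2.const_mul 2)).congr fun u x _ => by rw [hR]; ring
  have Q1 := S.flux_fun A
  have Q2 := S.flux_decays hr hN A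
  have T1 := Q1.add R1
  have T2 := Q2.add R2
  have e1 : chargeFlux A C' = fun u => -(1 / 4) * sphereIntegral fun x =>
      (fun u x => ∑ i, ∑ j, deriv (fun v => C v x i j) u * lieT A (C u) x i j + R u x) (u + f x) x :=
    funext fun u => congrArg (-(1 / 4 : ℝ) * ·) (sphereIntegral_congr fun x hx => by
      rw [S.flux_shift hf hA hC' u hx, hR])
  refine ⟨by rw [e1]; exact ((T2.shift h0 hf).integrable_sphereIntegral hr (T1.shift hf)).const_mul _, ?_⟩
  have e2 := T2.integral_shift hr T1 hf
  have e3 : ∀ u, sphereIntegral (fun x => ∑ i, ∑ j, deriv (fun v => C v x i j) u * lieT A (C u) x i j + R u x)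
      = sphereIntegral (fun x => ∑ i, ∑ j, deriv (fun v => C v x i j) u * lieT A (C u) x i j)
        + -8 * sphereIntegral fun x => rotD A f x * deriv (fun v => m v x) u := fun u => by
    rw [sphereIntegral_add (Q1.sphereSmooth u) (R1.sphereSmooth u), ← S.sphereIntegral_news hφ u, hR]
  have i1 := Q2.integrable_sphereIntegral hr Q1
  have i2 : Integrable fun u => sphereIntegral fun x => rotD A f x * deriv (fun v => m v x) u :=
    Decays.integrable_sphereIntegral hr (v := fun u x => rotD A f x * deriv (fun v => m v x) u)
      (sφ.mul S.mass_fun.deriv)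
      (((S.deriv_mass_decays hr hN).mul_bdd hφ.bdd).congr fun u x _ => mul_comm _ _)
  rw [e1, integral_const_mul, e2]
  simp only [e3]
  rw [integral_add i1 (i2.const_mul _), integral_const_mul]
  unfold chargeFlux
  rw [integral_const_mul]
  ring

end

end ScriData

end

/-! ### The supertranslation correction and the total flux of angular momentum. -/

section

/-- Translations do not change the shear. -/
theorem isClosedPotential_of_decomp {f f₂ : E3 → ℝ} {α₀ : ℝ} {α : Fin 3 → ℝ} (hf : SphereSmooth f)
    (hf₂ : HighModes f₂) (hd : ∀ x : E3, ‖x‖ = 1 → f x = α₀ + ∑ i, α i * x i + f₂ x) : SphereSmooth f₂ ∧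
    IsClosedPotential (fun x i j => hess f x i j - 1 / 2 * roundMetric x i j * lap f x) f₂ := by
  have h2 : SphereSmooth f₂ := SphereSmooth.congr (φ := fun x => f x - (α₀ + ∑ i, α i * x i))
    (by fun_prop) fun x hx => by rw [hd x hx]; ring
  refine ⟨h2, (IsClosedPotential.of_scalar h2 hf₂).congr fun x hx i j => ?_⟩
  -- As a vector, α makes ∑ α_i x_i a height function, whose Hessian is minus itself times the round
  -- metric and hence pure trace.
  obtain ⟨e, he⟩ : ∃ e : E3, ∀ i, e i = α i := ⟨WithLp.toLp 2 α, fun _ => rfl⟩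
  have e1 : ∀ j {z : E3}, ‖z‖ = 1 → tderiv j f z = tanPart e z j + tderiv j f₂ z := fun j z hz => by
    rw [tderiv_congr (ψ := fun x => (α₀ + ∑ i, e i * x i) + f₂ x)
        (fun y hy => by rw [hd y hy]; simp only [he]) j hz,
      tderiv_add j (by fun_prop) h2 hz, tderiv_add j (by fun_prop) (by fun_prop) hz, tderiv_const,
      tderiv_height e hz, zero_add]
  have e2 : ∀ i j, hess f x i j = hess f₂ x i j - (∑ k, e k * x k) * roundMetric x i j := fun i j => by
    rw [hess_eq hf hx, hess_eq h2 hx, tderiv_congr (fun z hz => e1 j hz) i hx,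
      tderiv_add i (by fun_prop) (by fun_prop) hx, e1 i hx, tderiv_tanPart e hx]
    ring
  have e3 : lap f x = lap f₂ x - 2 * ∑ k, e k * x k := by
    have := trace_roundMetric hx
    simp only [lap, e2]
    rw [Finset.sum_sub_distrib, ← Finset.mul_sum, this]; ring
  rw [e2, e3]; ring

namespace ScriData
variable {m m' : ℝ → E3 → ℝ} {C C' : ℝ → E3 → Fin 3 → Fin 3 → ℝ} {A : Fin 3 → Fin 3 → ℝ} {r : ℝ}
  {f f₂ : E3 → ℝ} {c c' : ℝ → E3 → ℝ} {α₀ : ℝ} {α δP : Fin 3 → ℝ} {K K' : ℝ → ℝ}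

section
variable (S : ScriData m C) (hr : 1 < r) (hN : NewsDecays r C) (hA : ∀ i j, A i j = -A j i)
  (hc : ∀ u, IsClosedPotential (C u) (c u))
include S hr hN hA hc

/-- The difference of the potentials at two times is the potential of the difference of the shears;
hence the sup-norm bound carries the control of L_Y C over to Y(c) although c has no assumed
regularity in u. -/
theorem rotD_potential_settles : Settles fun u x => rotD A (c u) x := by
  obtain ⟨G, hG, ⟨M, hM⟩, h⟩ := Settles.exists_common (v := fun (p : Fin 3 × Fin 3) u x => lieT A (C u) x p.1 p.2)
    fun p => S.lieT_settles hr hN A p.1 p.2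
  refine ⟨fun u => 36 * G u, hG.const_mul (by norm_num), ⟨36 * M, fun u => ?_⟩, fun u u' x hx => ?_⟩
  · rw [abs_mul, abs_of_pos (by norm_num : (0 : ℝ) < 36)]; linarith [hM u]
  · have h1 := (((hc u).lieT hA).add_mul ((hc u').lieT hA) (-1)).abs_le (M := |G u - G u'|)
      (fun z hz i j => by have := h (i, j) u u' z hz; simpa [sub_eq_add_neg] using this) hx
    rw [← mul_sub, abs_mul, abs_of_pos (by norm_num : (0 : ℝ) < 36)]
    simpa [sub_eq_add_neg] using h1

theorem rotD_potential_bdd : Bdd fun u x => rotD A (c u) x :=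
  (S.rotD_potential_settles hr hN hA hc).bdd_of_sphereSmooth (hc 0).1.rotD

variable (hf : SphereSmooth f)
  (hC' : ∀ u (x : E3), ‖x‖ = 1 → ∀ i j,
    C' u x i j = C (u + f x) x i j - 2 * hess f x i j + roundMetric x i j * lap f x)
  (hc' : ∀ u, IsClosedPotential (C' u) (c' u))
  (hf₂ : HighModes f₂) (hd : ∀ x : E3, ‖x‖ = 1 → f x = α₀ + ∑ i, α i * x i + f₂ x)
include hf hC' hc' hf₂ hd

/-- By linearity c' − c + 2 f₂ is the closed potential of C(u + f) − C(u), since the trace-free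
Hessian of f has potential f₂. The Lie derivative of this difference decays with the news and its
first derivatives. -/
theorem rotD_potential_decays :
    Decays r fun u x => rotD A (c' u) x - rotD A (c u) x + 2 * rotD A f₂ x := by
  have h0 : 0 ≤ r := by linarith
  obtain ⟨s2, p2⟩ := isClosedPotential_of_decomp hf hf₂ hd
  have hb : ∀ a : ℝ, Bdd fun _ _ => a := fun a => (sphereSmooth_const a).bdd
  have d0 : ∀ i j, Decays r fun u x => C (u + f x) x i j - C u x i j := fun i j =>
    Decays.shift_sub h0 (S.shear_fun i j) (hN.news i j) hf
  have d1 : ∀ k i j, Decays r fun u x =>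
      tderiv k (fun z => C (u + f x) z i j) x - tderiv k (fun z => C u z i j) x := fun k i j =>
    Decays.shift_sub h0 ((S.shear_fun i j).tderiv k) ((hN.tderiv_news k i j).congr fun u x hx =>
      (S.shear_fun i j).deriv_tderiv k u hx) hf
  have d2 : ∀ i j, Decays r fun u x => lieT A (fun z i j => C (u + f z) z i j + -1 * C u z i j) x i j :=
    fun i j => by
    refine ((((Decays.sum (s := Finset.univ) fun k => (d1 k i j).mul_bdd (sphereSmooth_rotVec A k).bdd).add
      (Decays.sum (s := Finset.univ) fun k => (d0 k j).const_mul (A k i))).add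
      (Decays.sum (s := Finset.univ) fun k => (d0 i k).const_mul (A k j))).add
      (((hN.news i j).shift h0 hf).mul_bdd hf.rotD.bdd (w := fun _ => rotD A f))).congr fun u x hx => ?_
    rw [lieT_add_mul (T := fun z => C (u + f z) z) (fun i j => ((S.shear_fun i j).shift hf).sphereSmooth u)
      (fun i j => (S.shear_fun i j).sphereSmooth u) _ hx, S.lieT_shift hf u hx]
    simp only [lieT, rotD, Fin.sum_univ_three]
    ring
  obtain ⟨M, hM, h⟩ := Decays.exists_common (v := fun (p : Fin 3 × Fin 3) u x =>
    lieT A (fun z i j => C (u + f z) z i j + -1 * C u z i j) x p.1 p.2) fun p => d2 p.1 p.2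
  refine ⟨36 * M, by positivity, fun u x hx => ?_⟩
  have p := (((hc' u).add_mul (hc u) (-1)).add_mul p2 2).congr
    (T' := fun z i j => C (u + f z) z i j + -1 * C u z i j)
    fun z hz i j => by rw [hC' u z hz]; ring
  have h1 := (p.lieT hA).abs_le (fun z hz i j => h (i, j) u z hz) hx
  have sc := (hc u).1
  have sc' := (hc' u).1
  rw [rotD_add (by fun_prop) (by fun_prop) hx, rotD_add sc' (by fun_prop) hx, rotD_const_mul _ sc hx,
    rotD_const_mul _ s2 hx] at h1
  beta_reduce
  rw [mul_assoc, show rotD A (c' u) x - rotD A (c u) x + 2 * rotD A f₂ x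
    = rotD A (c' u) x + -1 * rotD A (c u) x + 2 * rotD A f₂ x by ring]
  exact h1

/-- The transformation of the total flux of angular momentum under a supertranslation. -/
theorem angularMomentum_flux (S' : ScriData m' C') (hm : Decays r fun u x => m' u x - m u x)
    (hK : ∀ u, HasDerivAt K (chargeFlux A C u) u) (hK' : ∀ u, HasDerivAt K' (chargeFlux A C' u) u)
    (hP : ∀ j, HasTotalFlux (fun u => sphereIntegral fun x => 2 * m u x * x j) (δP j)) :
    ∃ δJ δJ' : ℝ, HasTotalFlux (fun u => K u + sphereIntegral fun x => m u x * rotD A (c u) x) δJ ∧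
      HasTotalFlux (fun u => K' u + sphereIntegral fun x => m' u x * rotD A (c' u) x) δJ' ∧
      δJ' = δJ + ∑ i, ∑ j, α i * A i j * δP j := by
  have h0 : 0 < r := by linarith
  obtain ⟨s2, -⟩ := isClosedPotential_of_decomp hf hf₂ hd
  have sφ : SphereSmooth (rotD A f) := hf.rotD
  have sφ₂ : SphereSmooth (rotD A f₂) := s2.rotD
  have sm := fun u => S.mass_fun.sphereSmooth u
  have sm' := fun u => S'.mass_fun.sphereSmooth u
  have sc : ∀ u, SphereSmooth (rotD A (c u)) := fun u => (hc u).1.rotD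
  have sc' : ∀ u, SphereSmooth (rotD A (c' u)) := fun u => (hc' u).1.rotD
  obtain ⟨i1, i2⟩ := S.integral_chargeFlux hr hN hf hA hC'
  have b1 := S.rotD_potential_bdd hr hN hA hc
  have d1 := S.rotD_potential_decays hr hN hA hc hf hC' hc' hf₂ hd
  have b2 : Bdd fun u x => rotD A (c' u) x := by
    obtain ⟨M, hM, h⟩ := ((d1.bdd h0.le).add b1).add ((sφ₂.mul (sphereSmooth_const (-2))).bdd)
    exact ⟨M, hM, fun u x hx => by have := h u x hx; ring_nf at this ⊢; exact this⟩
  have F1 := hasTotalFlux_of_hasDerivAt hK (S.integrable_chargeFlux hr hN A)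
  have F2 := hasTotalFlux_of_hasDerivAt hK' i1
  obtain ⟨e, F3⟩ := ((S.mass_settles hr hN).mul (S.rotD_potential_settles hr hN hA hc) (S.mass_bdd hr hN)
    b1).hasTotalFlux fun u => (sm u).mul (sc u)
  have F4 := S.hasTotalFlux_mass hr hN sφ
  have F5 := S.hasTotalFlux_mass hr hN sφ₂
  -- This is m' Y(c') − m Y(c) + 2 m Y(f₂). As it decays, the flux of the correction term changes by
  -- −2 ∫ Y(f₂) δm.
  have d2 : Decays r fun u x => (m' u x - m u x) * rotD A (c' u) x
      + (rotD A (c' u) x - rotD A (c u) x + 2 * rotD A f₂ x) * m u x :=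
    (hm.mul_bdd b2).add (d1.mul_bdd (S.mass_bdd hr hN))
  have F6 := d2.hasTotalFlux h0
  refine ⟨_, (∫ u, chargeFlux A C' u) + ((e + 0) + -2 * ∫ u, sphereIntegral fun x =>
    rotD A f₂ x * deriv (fun v => m v x) u), F1.add F3, ?_, ?_⟩
  · have F7 := F2.add ((F3.add F6).add (F5.const_mul (-2)))
    convert F7 using 2 with u
    congr 1
    rw [← sphereIntegral_const_mul, ← sphereIntegral_add
        (by have := sm u; have := sc u; have := sc' u; fun_prop)
        (by have := sm u; have := sm' u; have := sc u; have := sc' u; fun_prop),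
      ← sphereIntegral_add (by have := sm u; have := sm' u; have := sc u; have := sc' u; fun_prop)
        (by have := sm u; fun_prop)]
    exact sphereIntegral_congr fun x _ => by ring
  · have F8 := (F4.const_mul 2).add (F5.const_mul (-2))
    have F9 : HasTotalFlux _ (∑ i, ∑ j, α i * A i j * δP j) :=
      HasTotalFlux.sum (s := Finset.univ) fun i => HasTotalFlux.sum (s := Finset.univ) fun j =>
        (hP j).const_mul (α i * A i j)
    -- In Y(f) − Y(f₂) the modes ℓ ≥ 2 cancel, and 2 ∑ α_i A_ij x_j tested against m gives the
    -- momenta. Uniqueness of the total flux then identifies the two integrals over null infinity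
    -- with the momentum fluxes.
    have e1 := F9.unique (e := _) (F := _) (by
      convert F8 using 2 with u
      have sP : ∀ j, SphereSmooth fun x => 2 * m u x * x j := fun j => by have := sm u; fun_prop
      simp only [← sphereIntegral_const_mul]
      simp only [← fun i => sphereIntegral_sum (s := Finset.univ)
        (fun j => (sphereSmooth_const (α i * A i j)).mul (sP j))]
      rw [← sphereIntegral_sum fun i => by fun_prop, ← sphereIntegral_add
        (by have := sm u; fun_prop) (by have := sm u; fun_prop)]
      refine sphereIntegral_congr fun x hx => ?_
      have e2 : rotD A f x = ∑ i, α i * rotVec A x i + rotD A f₂ x := by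
        rw [rotD_congr hd hx, rotD_add (by fun_prop) s2 hx, rotD_add (by fun_prop) (by fun_prop) hx,
          rotD_sum (fun i => by fun_prop) hx]
        simp only [rotD_const_mul _ (sphereSmooth_coord _) hx, rotD_coord hA hx]
        simp [rotD, tderiv_const]
      rw [e2]
      simp only [rotVec, Fin.sum_univ_three]
      ring)
    rw [e1, i2]
    ring

end

end ScriData

end

/-! ### Rotation Killing fields, and the passage from coordinate systems to the flux formula. -/

section

/-- The decay hypothesis concerns only large |u|; on the remaining compact interval smoothness
supplies a bound, and replacing |u| by 1 + |u| costs a constant. -/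
theorem ScriFun.decays {v : ℝ → E3 → ℝ} (hv : ScriFun v) {ε K R : ℝ} (hε : 0 < ε)
    (h : ∀ u, R ≤ |u| → ∀ x : E3, ‖x‖ = 1 → |v u x| ≤ K * |u| ^ (-1 - ε)) : Decays (1 + ε) v := by
  obtain ⟨M, hM⟩ := hv.exists_bound (-max R 1) (max R 1)
  have hR : 1 ≤ max R 1 := le_max_right _ _
  refine ⟨|M| * (1 + max R 1) ^ (1 + ε) + |K| * 2 ^ (1 + ε), by positivity, fun u x hx => ?_⟩
  have hu : (0 : ℝ) < 1 + |u| := by positivity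
  rcases le_total |u| (max R 1) with h1 | h1
  · refine le_trans ?_ (mul_le_mul_of_nonneg_right (le_add_of_nonneg_right (by positivity))
      (one_add_abs_rpow_pos (1 + ε) u).le)
    have h2 : 1 ≤ (1 + max R 1) ^ (1 + ε) * (1 + |u|) ^ (-(1 + ε)) := by
      rw [Real.rpow_neg hu.le, ← div_eq_mul_inv, one_le_div (by positivity)]
      exact Real.rpow_le_rpow hu.le (by linarith) (by linarith)
    rw [mul_assoc]
    exact (hM u (abs_le.1 h1) x hx).trans ((le_abs_self M).trans (le_mul_of_one_le_right (abs_nonneg M) h2))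
  · refine le_trans ?_ (mul_le_mul_of_nonneg_right (le_add_of_nonneg_left (by positivity))
      (one_add_abs_rpow_pos (1 + ε) u).le)
    have hu1 : 1 ≤ |u| := hR.trans h1
    have h2 : |u| ^ (-1 - ε) ≤ 2 ^ (1 + ε) * (1 + |u|) ^ (-(1 + ε)) := by
      rw [show -1 - ε = -(1 + ε) by ring]
      refine (Real.rpow_le_rpow_of_nonpos (show 0 < (1 + |u|) / 2 by positivity) (by linarith)
        (by linarith)).trans_eq ?_
      rw [Real.div_rpow hu.le (by norm_num), Real.rpow_neg hu.le, Real.rpow_neg (by norm_num : (0 : ℝ) ≤ 2)]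
      field_simp
    rw [mul_assoc]
    exact (h u ((le_max_left _ _).trans h1) x hx).trans ((mul_le_mul_of_nonneg_right (le_abs_self K)
      (by positivity)).trans (mul_le_mul_of_nonneg_left h2 (abs_nonneg K)))

theorem SphereSmooth.eq_of_tderiv_eq_zero {φ : E3 → ℝ} (h : SphereSmooth φ)
    (h0 : ∀ x : E3, ‖x‖ = 1 → ∀ i, BondiSachs.tderiv i φ x = 0) {x y : E3} (hx : ‖x‖ = 1) (hy : ‖y‖ = 1) :
    φ x = φ y := by
  have hc : IsPreconnected ({0}ᶜ : Set E3) :=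
    (isConnected_compl_singleton_of_one_lt_rank (by
      rw [← Module.finrank_eq_rank]; simp) 0).isPreconnected
  have h1 := isOpen_compl_singleton.is_const_of_fderiv_eq_zero (𝕜 := ℝ) (s := ({0}ᶜ : Set E3))
    (f := fun y : E3 => φ (‖y‖⁻¹ • y)) hc
    (fun z hz => (h.differentiableAt hz).differentiableWithinAt) (fun z hz => by
      have hz0 : ‖z‖ ≠ 0 := norm_ne_zero_iff.2 hz
      have h2 : ∀ i, fderiv ℝ (fun y : E3 => φ (‖y‖⁻¹ • y)) z (EuclideanSpace.single i 1) = 0 := fun i => by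
        have := tderiv_normalize i φ hz
        rw [h0 _ (norm_normalize hz)] at this
        exact (mul_eq_zero.1 this.symm).resolve_left hz0
      refine ContinuousLinearMap.coe_injective ((EuclideanSpace.basisFun (Fin 3) ℝ).toBasis.ext fun i => ?_)
      simpa using h2 i)
    (show x ∈ ({0}ᶜ : Set E3) from ne_zero_of_unit hx) (show y ∈ ({0}ᶜ : Set E3) from ne_zero_of_unit hy)
  simpa [hx, hy] using h1

/-- Every rotation Killing field is an infinitesimal rotation. -/
theorem IsRotationKilling.exists_rotVec {Y : E3 → Fin 3 → ℝ} (h : IsRotationKilling Y) :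
    ∃ A : Fin 3 → Fin 3 → ℝ, (∀ i j, A i j = -A j i) ∧ ∀ x : E3, ‖x‖ = 1 → ∀ i, Y x i = rotVec A x i := by
  obtain ⟨hs, hk⟩ := h
  -- These are the ambient derivatives, on the sphere, of the extension of Y that is homogeneous of
  -- degree one; for Y = A x they are the entries of A.
  obtain ⟨w, hw⟩ : ∃ w : Fin 3 → Fin 3 → E3 → ℝ, ∀ i j, w j i = fun x => tderiv i (fun z => Y z j) x + x i * Y x j :=
    ⟨fun j i x => tderiv i (fun z => Y z j) x + x i * Y x j, fun _ _ => rfl⟩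
  have sw : ∀ i j, SphereSmooth (w j i) := fun i j => by have := hs j; rw [hw]; fun_prop
  have hx : ∀ x : E3, ‖x‖ = 1 → ∀ i, ∑ b, x b * tderiv i (fun z => Y z b) x = -Y x i := fun x hx i => by
    have h0 : tderiv i (fun z => ∑ b, z b * Y z b) x = 0 := by
      rw [tderiv_congr (fun z hz => (hk z hz).1) i hx, tderiv_const]
    rw [tderiv_sum i (fun b => by have := hs b; fun_prop) hx] at h0
    simp only [tderiv_mul i (sphereSmooth_coord _) (hs _) hx, tderiv_coord i _ hx, Finset.sum_add_distrib] at h0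
    have h1 := roundMetric_mul (hk x hx).1 i
    simp only [mul_comm (Y x _)] at h0
    linarith
  have anti : ∀ x : E3, ‖x‖ = 1 → ∀ i j, w i j x = -w j i x := fun x hx' i j => by
    have e : ∀ i j, covDeriv₁ Y x i j = tderiv i (fun z => Y z j) x + x j * Y x i := fun i j => by
      have h1 := hx x hx' i
      simp only [covDeriv₁, roundMetric, Fin.sum_univ_three] at h1 ⊢
      fin_cases j <;> simp <;> linear_combination (-x _) * h1
    have h2 := (hk x hx').2 i j
    rw [e, e] at h2
    simp only [hw]
    linarith
  have symm : ∀ x : E3, ‖x‖ = 1 → ∀ i j k, tderiv k (w j i) x = tderiv i (w j k) x := fun x hx' i j k => by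
    have h1 := tderiv_comm (hs j) hx' k i
    rw [hw, hw, tderiv_add k ((hs j).tderiv i) (by have := hs j; fun_prop) hx',
      tderiv_add i ((hs j).tderiv k) (by have := hs j; fun_prop) hx',
      tderiv_mul k (sphereSmooth_coord i) (hs j) hx', tderiv_mul i (sphereSmooth_coord k) (hs j) hx',
      tderiv_coord k i hx', tderiv_coord i k hx', roundMetric_symm x k i]
    linear_combination h1
  -- The derivative of w is antisymmetric in one pair of indices and symmetric in another, so cyclic
  -- permutation makes it vanish.
  have zero : ∀ x : E3, ‖x‖ = 1 → ∀ i j k, tderiv k (w j i) x = 0 := fun x hx' i j k => by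
    have a : ∀ i j k, tderiv k (w j i) x = -tderiv k (w i j) x := fun i j k => by
      rw [tderiv_congr (fun z hz => anti z hz j i) k hx']; exact tderiv_neg k
    linarith [symm x hx' i j k, symm x hx' j k i, symm x hx' k i j, a i j k, a j k i, a k i j]
  obtain ⟨e, he⟩ : ∃ e : E3, ‖e‖ = 1 := ⟨EuclideanSpace.single 0 1, by simp⟩
  refine ⟨fun i j => w i j e, anti e he, fun x hx' i => ?_⟩
  have h1 : ∀ j, w i j e = w i j x := fun j =>
    (sw j i).eq_of_tderiv_eq_zero (fun z hz k => zero z hz j i k) he hx'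
  simp only [rotVec, h1, hw]
  have h2 := sum_x_tderiv (hs i) hx'
  have h3 := sum_x_sq hx'
  simp only [Fin.sum_univ_three] at h2 ⊢
  linear_combination -h2 - Y x i * h3

/-- This matrix has entries ε_ikj, which is the index order of the final formula. -/
theorem rotationField_eq (k : Fin 3) {x : E3} (hx : ‖x‖ = 1) (i : Fin 3) :
    rotationField k x i = rotVec (fun i j => leviCivita i k j) x i := by
  simp only [rotationField, grad, tderiv_coord _ k hx, rotVec, areaForm, roundMetric, Fin.sum_univ_three]
  fin_cases i <;> fin_cases k <;> simp [leviCivita] <;> ring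

namespace Coords
variable (B B' : Coords)

theorem scriData : ScriData B.mass B.shear := B.expansion.scriData B.ric_eq_zero

theorem newsDecays {ε K R : ℝ} (hε : 0 < ε) (h : ∀ u : ℝ, R ≤ |u| → ∀ x : E3, ‖x‖ = 1 → ∀ i j : Fin 3,
    |B.news u x i j| ≤ K * |u| ^ (-1 - ε) ∧
    |deriv (fun s => B.news s x i j) u| ≤ K * |u| ^ (-1 - ε) ∧
    (∀ k, |tderiv k (fun z => B.news u z i j) x| ≤ K * |u| ^ (-1 - ε)) ∧
    ∀ k l, |tderiv k (tderiv l fun z => B.news u z i j) x| ≤ K * |u| ^ (-1 - ε)) :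
    NewsDecays (1 + ε) B.shear ∧ ∀ i j, Decays (1 + ε) fun u x => deriv (fun s => B.news s x i j) u := by
  have hN := B.scriData.news_fun
  exact ⟨⟨fun i j => (hN i j).decays hε fun u hu x hx => (h u hu x hx i j).1,
    fun k i j => ((hN i j).tderiv k).decays hε fun u hu x hx => (h u hu x hx i j).2.2.1 k,
    fun k l i j => (((hN i j).tderiv l).tderiv k).decays hε fun u hu x hx => (h u hu x hx i j).2.2.2 k l⟩,
    fun i j => (hN i j).deriv.decays hε fun u hu x hx => (h u hu x hx i j).2.1⟩

/-- The angular momentum without its supertranslation correction. -/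
def charge (A : Fin 3 → Fin 3 → ℝ) (u : ℝ) : ℝ :=
  sphereIntegral fun x => 3 / 2 * ∑ j, rotVec A x j * (B.shift₃ u x j + ∑ l, B.shear u x j l * B.shift₂ u x l)
    - 1 / 2 * ∑ j, rotVec A x j * ∑ l, B.shear u x j l * B.shift₂ u x l

theorem hasDerivAt_charge {A : Fin 3 → Fin 3 → ℝ} (hA : ∀ i j, A i j = -A j i) (u : ℝ) :
    HasDerivAt (B.charge A) (chargeFlux A B.shear u) u :=
  B.expansion.hasDerivAt_charge B.ric_eq_zero hA u

/-- The gradient of |C|² in the angular momentum aspect integrates to zero against Y, and −c Y(m) is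
integrated by parts to m Y(c). -/
theorem angularMomentum_eq {A : Fin 3 → Fin 3 → ℝ} (hA : ∀ i j, A i j = -A j i) {Y : E3 → Fin 3 → ℝ}
    (hY : ∀ x : E3, ‖x‖ = 1 → ∀ i, Y x i = rotVec A x i) {c : ℝ → E3 → ℝ}
    (hc : ∀ u, SphereSmooth (c u)) (u : ℝ) :
    B.angularMomentum c Y u = B.charge A u + sphereIntegral fun x => B.mass u x * rotD A (c u) x := by
  have sC : ∀ i j, SphereSmooth fun x => B.shear u x i j := fun i j => (B.scriData.shear_fun i j).sphereSmooth u
  have sm : SphereSmooth (B.mass u) := B.scriData.mass_fun.sphereSmooth u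
  have sc : SphereSmooth (c u) := hc u
  have sW : ∀ i, SphereSmooth fun x => B.shift₂ u x i := fun i => (B.expansion.val_W i).scriFun.sphereSmooth u
  have sW' : ∀ i, SphereSmooth fun x => B.shift₃ u x i := fun i => (B.expansion.val_W' i).scriFun.sphereSmooth u
  have sg : SphereSmooth fun z => ∑ d, ∑ e, B.shear u z d e * B.shear u z d e := by fun_prop
  have h1 := sphereIntegral_mul_rotD hA sc sm
  rw [charge, ← neg_eq_iff_eq_neg.2 h1, angularMomentum,
    sphereIntegral_congr (ψ := fun x => (3 / 2 * ∑ j, rotVec A x j * (B.shift₃ u x j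
      + ∑ l, B.shear u x j l * B.shift₂ u x l) - 1 / 2 * ∑ j, rotVec A x j * ∑ l, B.shear u x j l * B.shift₂ u x l)
      + 3 / 32 * rotD A (fun z => ∑ d, ∑ e, B.shear u z d e * B.shear u z d e) x - c u x * rotD A (B.mass u) x)
      fun x hx => ?_,
    sphereIntegral_sub (by fun_prop) (by fun_prop), sphereIntegral_add (by fun_prop) (by fun_prop),
    sphereIntegral_const_mul, sphereIntegral_rotD hA sg]
  · ring
  · have e := B.expansion.divT_eq B.ric_eq_zero u hx
    simp only [hY x hx, angularAspect, e, shift₃, rotD, grad, Fin.sum_univ_three]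
    ring

end Coords

/-- The effect of a supertranslation on the shear and the mass aspect. -/
theorem SupertranslationRelated.shear_eq {B B' : Coords} {f : E3 → ℝ} (h : SupertranslationRelated B B' f)
    (hf : SphereSmooth f) :
    (∀ u (x : E3), ‖x‖ = 1 → ∀ i j, B'.shear u x i j
      = B.shear (u + f x) x i j - 2 * hess f x i j + roundMetric x i j * lap f x) ∧
    ∀ u (x : E3), ‖x‖ = 1 → B'.mass u x = B.mass (u + f x) x
      + ∑ i, deriv (fun v => B.shift₂ v x i) (u + f x) * tderiv i f x
      + 1 / 4 * ∑ i, ∑ j, deriv (fun v => B.news v x i j) (u + f x) * (tderiv i f x * tderiv j f x)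
      + 1 / 4 * ∑ i, ∑ j, B.news (u + f x) x i j * hess f x i j := by
  obtain ⟨D, Ψ, h1, h2, h3, h4, h5⟩ := h
  obtain ⟨S, rfl, rfl⟩ : ∃ S : ScriMap f, S.D = D ∧ S.Ψ = Ψ :=
    ⟨⟨D, Ψ, h1, h2, h3, h4, fun q hq hq' => (h5 q hq hq').2.2.1⟩, rfl, rfl⟩
  have hS : S.Pulls B.fields B'.fields := S.pulls fun q hq hq' => (h5 q hq hq').2.2.2
  obtain ⟨T⟩ := S.exists_expansion B.expansion B'.expansion hS hf
  exact ⟨fun u x hx => T.shear_eq B.expansion B'.expansion hS hf u hx,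
    fun u x hx => T.mass_eq B.expansion B'.expansion hS hf u hx⟩

/-- The difference m(u + f) − m(u) is controlled by ∂_u m, and each other term of the transformation
law has the news, its divergence or its time derivative as a factor. The decay of ∂_u N is used
here. -/
theorem SupertranslationRelated.mass_decays {B B' : Coords} {f : E3 → ℝ} (h : SupertranslationRelated B B' f)
    (hf : SphereSmooth f) {r : ℝ} (hr : 1 < r) (hN : NewsDecays r B.shear)
    (hN' : ∀ i j, Decays r fun u x => deriv (fun s => B.news s x i j) u) :
    Decays r fun u x => B'.mass u x - B.mass u x := by
  have h0 : 0 ≤ r := by linarith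
  have S := B.scriData
  have d1 := (S.deriv_mass_decays hr hN).shift_sub h0 S.mass_fun hf
  have d2 : ∀ i, Decays r fun u x => deriv (fun v => B.shift₂ v x i) u := fun i =>
    ((Decays.sum (s := Finset.univ) fun k => hN.tderiv_news k k i).const_mul (1 / 2)).congr fun u x hx =>
      B.expansion.deriv_W2 B.ric_eq_zero u hx i
  have d3 := Decays.sum (s := Finset.univ) fun i => ((d2 i).shift h0 hf).mul_bdd (hf.tderiv i).bdd
  have d4 := (Decays.sum (s := Finset.univ) fun i => Decays.sum (s := Finset.univ) fun j =>
    ((hN' i j).shift h0 hf).mul_bdd ((hf.tderiv i).mul (hf.tderiv j)).bdd).const_mul (1 / 4)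
  have d5 := (Decays.sum (s := Finset.univ) fun i => Decays.sum (s := Finset.univ) fun j =>
    ((hN.news i j).shift h0 hf).mul_bdd (hf.hess i j).bdd).const_mul (1 / 4)
  exact (((d1.add d3).add d4).add d5).congr fun u x hx => by
    rw [(h.shear_eq hf).2 u x hx]; simp only [Coords.news]; ring

end

end BondiSachs

end

theorem mainTheorem2
    (B B' : BondiSachs.Coords)
    (hdecay : B.NewsDecay)
    (f : BondiSachs.E3 → ℝ) (hf : BondiSachs.SphereSmooth f)
    (hrel : BondiSachs.SupertranslationRelated B B' f)
    (α₀ : ℝ) (α : Fin 3 → ℝ) (f₂ : BondiSachs.E3 → ℝ) (hf₂ : BondiSachs.HighModes f₂)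
    (hdecomp : ∀ x : BondiSachs.E3, ‖x‖ = 1 → f x = α₀ + ∑ i, α i * x i + f₂ x)
    (c c' : ℝ → BondiSachs.E3 → ℝ)
    (hc : ∀ u, BondiSachs.IsClosedPotential (B.shear u) (c u))
    (hc' : ∀ u, BondiSachs.IsClosedPotential (B'.shear u) (c' u)) :
    ∃ δP : Fin 3 → ℝ, (∀ j, BondiSachs.HasTotalFlux (B.momentum j) (δP j)) ∧
      (∀ k : Fin 3, ∃ δJ δJ' : ℝ,
        BondiSachs.HasTotalFlux (B.angularMomentum c (BondiSachs.rotationField k)) δJ ∧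
        BondiSachs.HasTotalFlux (B'.angularMomentum c' (BondiSachs.rotationField k)) δJ' ∧
        δJ' = δJ + ∑ i, ∑ j, α i * BondiSachs.leviCivita i k j * δP j) ∧
      (∀ Y : BondiSachs.E3 → Fin 3 → ℝ, BondiSachs.IsRotationKilling Y → ∃ δJ δJ' : ℝ,
        BondiSachs.HasTotalFlux (B.angularMomentum c Y) δJ ∧
        BondiSachs.HasTotalFlux (B'.angularMomentum c' Y) δJ' ∧
        (α = 0 → δJ' = δJ)) := by
  obtain ⟨ε, hε, K, R, hK⟩ := hdecay
  obtain ⟨hN, hN'⟩ := B.newsDecays hε hK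
  have hr : 1 < 1 + ε := by linarith
  have S := B.scriData
  have hP : ∀ j, ∃ d, BondiSachs.HasTotalFlux (B.momentum j) d := fun j => by
    have h := (S.hasTotalFlux_mass hr hN (BondiSachs.sphereSmooth_coord j)).const_mul 2
    refine ⟨_, cast (congrArg (BondiSachs.HasTotalFlux · _) (funext fun u => ?_)) h⟩
    rw [← BondiSachs.sphereIntegral_const_mul]
    exact BondiSachs.sphereIntegral_congr fun x _ => by ring
  choose δP hP using hP
  -- Both families of rotation fields are of the form A x on the sphere, so a single formula in A
  -- serves the explicit generators and the general Killing fields.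
  have key : ∀ (A : Fin 3 → Fin 3 → ℝ) (Y : BondiSachs.E3 → Fin 3 → ℝ), (∀ i j, A i j = -A j i) →
      (∀ x : BondiSachs.E3, ‖x‖ = 1 → ∀ i, Y x i = BondiSachs.rotVec A x i) → ∃ δJ δJ' : ℝ,
        BondiSachs.HasTotalFlux (B.angularMomentum c Y) δJ ∧
        BondiSachs.HasTotalFlux (B'.angularMomentum c' Y) δJ' ∧
        δJ' = δJ + ∑ i, ∑ j, α i * A i j * δP j := fun A Y hA hY => by
    rw [funext (B.angularMomentum_eq hA hY fun u => (hc u).1),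
      funext (B'.angularMomentum_eq hA hY fun u => (hc' u).1)]
    exact S.angularMomentum_flux hr hN hA hc hf (hrel.shear_eq hf).1 hc' hf₂ hdecomp B'.scriData
      (hrel.mass_decays hf hr hN hN') (B.hasDerivAt_charge hA) (B'.hasDerivAt_charge hA) hP
  refine ⟨δP, hP, fun k => ?_, fun Y hY => ?_⟩
  · exact key _ _ (fun i j => by simp only [BondiSachs.leviCivita]; ring)
      fun x hx i => BondiSachs.rotationField_eq k hx i
  · obtain ⟨A, hA, hYA⟩ := hY.exists_rotVec
    obtain ⟨δJ, δJ', h1, h2, h3⟩ := key A Y hA hYA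
    exact ⟨δJ, δJ', h1, h2, fun h => by simpa [h] using h3⟩
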